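/- **Conventions.** Everything is $C^\infty$. An exterior differential system (EDS) $\mathcal I$ on a manifold is a differentially closed ideal of differential forms whose homogeneous components are the sections of constant rank bundles $I^p$. It is *hyperbolic of class $s$* if locally there is a coframe $\theta^1,\dots,\theta^s,\hat\sigma^1,\hat\sigma^2,\check\sigma^1,\check\sigma^2$ with $\mathcal I=\langle\theta^1,\dots,\theta^s,\hat\sigma^1\wedge\hat\sigma^2,\check\sigma^1\wedge\check\sigma^2\rangle_{\rm alg}$; its singular Pfaffian systems are $\hat V=\mathrm{span}\{\theta^i,\hat\sigma^a\}$ and $\check V=\mathrm{span}\{\theta^i,\check\sigma^a\}$ (unique up to interchange). For $V\subset T^*M$, $V^\infty_x$ is the span of the $df_x$, where $f$ is a smooth function near $x$ whose differential is a section of $V$. $\mathcal I$ is *Darboux integrable* if $\hat V^\infty$, $\check V^\infty$ have constant rank, $\hat V+\check V^\infty=\check V+\hat V^\infty=T^*M$ and $\hat V^\infty\cap\check V^\infty=0$. An EDS $\mathcal E$ on $N$ is an *integrable extension* of $\mathcal I$ on $M$ by a submersion $\mathbf p:N\to M$ if $\mathcal E=\langle \mathcal S(J)\cup\mathbf p^*\mathcal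 I\rangle_{\rm alg}$ for some subbundle $J\subset T^*N$ such that $\mathrm{ann}(J)$ is a complement of $\ker\mathbf p_*$. An integrable extension of a Darboux integrable hyperbolic system (singular systems $\hat V,\check V$) by a Darboux integrable hyperbolic system with singular systems $\hat Z=J\oplus\mathbf p^*\hat V$, $\check Z=J\oplus\mathbf p^*\check V$ is *maximally compatible* if [i] $\ker\mathbf p_*\cap\mathrm{ann}(\hat Z^\infty)=0$ and $\ker\mathbf p_*\cap\mathrm{ann}(\check Z^\infty)=0$; [ii] $\mathrm{rank}\,\hat Z^\infty=\mathrm{rank}\ker\mathbf p_*+\mathrm{rank}\,\hat V^\infty$ and $\mathrm{rank}\,\check Z^\infty=\mathrm{rank}\ker\mathbf p_*+\mathrm{rank}\,\check V^\infty$. The *prolongation* of a hyperbolic system of class $s$ on $M$ is the Pfaffian system on the $(s+6)$-manifold of its 2-dimensional integral elements $(x,P)$, $P\subset T_xM$, that is generated by the pullbacks of the covectors at $x$ vanishing on $P$. An integrable extension $\mathbf p$ induces $\mathbf p^{[1]}:(x,P)\mapsto(\mathbf p(x),\mathbf p_*P)$. **Setting.** Let $\mathcal I_1=\langle du-u_x\,dx-u_y\,dy,\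 du_x\wedge dx,\ du_y\wedge dy\rangle_{\rm alg}$ be the Monge–Ampère system of the wave equation $u_{xy}=0$ on $N_1=J^1(\mathbb R^2,\mathbb R)=\mathbb R^5$. Let $\mathcal I_2$ be a hyperbolic Monge–Ampère system on a 5-manifold $N_2$ (class $1$, with $\theta^1$ a contact form) with singular systems $\hat V_2,\check V_2$. Let $\mathcal B$ be an EDS on a 6-manifold $N$ that is an integrable extension of both $\mathcal I_1$ and $\mathcal I_2$, by submersions $\mathbf p_1:N\to N_1$ and $\mathbf p_2:N\to N_2$ (a Bäcklund transformation with 1-dimensional fibres). Let $\mathcal I_1^{[1]}$, $\mathcal I_2^{[1]}$, $\mathcal B^{[1]}$ be the prolongations. Let $N_2^{[1]}$ and $N^{[1]}$ be open sets of 2-dimensional integral elements of $\mathcal I_2$ and of $\mathcal B$ (the regular ones) with $\mathbf p_2^{[1]}(N^{[1]})\subset N_2^{[1]}$. Suppose that $\mathcal I_2^{[1]}$ is Darboux integrable on $N_2^{[1]}$, with singular systems $\hat V_{2,[1]},\check V_{2,[1]}$, and that $$\mathrm{rank}\,\hat V_2^\infty=\mathrm{rank}\,\check V_2^\infty=1,\qquad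 \mathrm{rank}\,\hat V_{2,[1]}^\infty=\mathrm{rank}\,\check V_{2,[1]}^\infty=2 .$$ **Theorem.** $\mathcal B$ is hyperbolic of class $2$, and $\mathbf p_2^{[1]}:(\mathcal B^{[1]},N^{[1]})\to(\mathcal I_2^{[1]},N_2^{[1]})$ is an integrable extension of Darboux integrable systems, where $\mathcal B^{[1]}$ has singular systems $\hat W_{[1]}=J\oplus\mathbf p_2^{[1]*}\hat V_{2,[1]}$ and $\check W_{[1]}=J\oplus\mathbf p_2^{[1]*}\check V_{2,[1]}$. Let $\widetilde N\subset N^{[1]}$ be the set of points at which the spaces of $\mathbf p_2^{[1]}$-semibasic covectors in $\hat W_{[1]}^\infty$ and in $\check W_{[1]}^\infty$ both have dimension $2$. Then $\widetilde N$ is open and dense in $N^{[1]}$, and the integrable extension $\mathbf p_2^{[1]}:(\mathcal B^{[1]},\widetilde N)\to(\mathcal I_2^{[1]},\mathbf p_2^{[1]}(\widetilde N))$ satisfies [i] and [ii] and is therefore maximally compatible. On the other hand $\mathbf p_1^{[1]}:\mathcal B^{[1]}\to\mathcal I_1^{[1]}$ is also an integrable extension of Darboux integrable systems (over $N^{[1]}$),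 but its restriction to any non-empty open subset of $N^{[1]}$ is not maximally compatible. -/

import Mathlib

open scoped Manifold ContDiff Topology
open Set Module

namespace Darboux

noncomputable section

/-! ### Forms and exterior differential systems on a manifold

`M` is a manifold modelled on the vector space `E`.  As everywhere in Mathlib, the tangent space at
a point is (a copy of) `E`, so that `E [⋀^Fin p]→L[ℝ] ℝ` is the space of `p`-covectors at a point
and `E →L[ℝ] ℝ` is the cotangent space. -/

section Basic

variable {E : Type*} [NormedAddCommGroup E] [NormedSpace ℝ E]
  {E' : Type*} [NormedAddCommGroup E'] [NormedSpace ℝ E']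
  {F : Type*} [NormedAddCommGroup F] [NormedSpace ℝ F]
  {M : Type*} [TopologicalSpace M] [ChartedSpace E M]
  {M' : Type*} [TopologicalSpace M'] [ChartedSpace E' M']

/-- The tangent map `f_*` at `x`. -/
def tmap (f : M → M') (x : M) : E →L[ℝ] E' := mfderiv 𝓘(ℝ, E) 𝓘(ℝ, E') f x

/-- A covector, seen as an alternating form of degree one. -/
def ofOne (α : E →L[ℝ] ℝ) : E [⋀^Fin 1]→L[ℝ] ℝ :=
  ContinuousAlternatingMap.ofSubsingleton ℝ E ℝ 0 α

/-- The exterior product `α ∧ η` of a covector and a `p`-covector. -/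
def wedge {p : ℕ} (α : E →L[ℝ] ℝ) (η : E [⋀^Fin p]→L[ℝ] ℝ) : E [⋀^Fin (p + 1)]→L[ℝ] ℝ :=
  ContinuousAlternatingMap.alternatizeUncurryFin (α.smulRight η)

/-- The expression of a `p`-form in the chart `e`: its pullback by `e⁻¹`. -/
def chartForm {p : ℕ} (e : OpenPartialHomeomorph M E) (η : M → E [⋀^Fin p]→L[ℝ] ℝ) :
    E → E [⋀^Fin p]→L[ℝ] ℝ :=
  fun y => (η (e.symm y)).compContinuousLinearMap (tmap e.symm y)

/-- The `p`-form `η` is smooth on `U`. -/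
def SmoothForm {p : ℕ} (η : M → E [⋀^Fin p]→L[ℝ] ℝ) (U : Set M) : Prop :=
  ∀ e ∈ atlas E M, ContDiffOn ℝ ∞ (chartForm e η) (e.target ∩ e.symm ⁻¹' U)

/-- The exterior derivative of a `p`-form, computed in the preferred chart at each point. -/
def extD {p : ℕ} (η : M → E [⋀^Fin p]→L[ℝ] ℝ) : M → E [⋀^Fin (p + 1)]→L[ℝ] ℝ :=
  fun x => (extDeriv (chartForm (chartAt E x) η) (chartAt E x x)).compContinuousLinearMap
    (tmap (chartAt E x) x)

/-- The expression of a (vector-valued) field of covectors in the chart `e`. -/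
def chartCov (e : OpenPartialHomeomorph M E) (α : M → E →L[ℝ] F) : E → E →L[ℝ] F :=
  fun y => (α (e.symm y)).comp (tmap e.symm y)

/-- The field of covectors `α` is smooth on `U`. -/
def SmoothCov (α : M → E →L[ℝ] F) (U : Set M) : Prop :=
  ∀ e ∈ atlas E M, ContDiffOn ℝ ∞ (chartCov e α) (e.target ∩ e.symm ⁻¹' U)

/-- `W ⊆ T*M` is, over `U`, a smooth subbundle of constant rank. -/
def IsSubbundleOn (W : M → Submodule ℝ (E →L[ℝ] ℝ)) (U : Set M) : Prop :=
  ∃ r : ℕ, ∀ x ∈ U, ∃ U' : Set M, IsOpen U' ∧ x ∈ U' ∧ U' ⊆ U ∧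
    ∃ α : Fin r → M → E →L[ℝ] ℝ, (∀ i, SmoothCov (α i) U') ∧
      ∀ y ∈ U', LinearIndependent ℝ (fun i => α i y) ∧
        W y = Submodule.span ℝ (range fun i => α i y)

/-- The vectors annihilated by all covectors of `J`. -/
def annih (J : Submodule ℝ (E →L[ℝ] ℝ)) : Submodule ℝ E where
  carrier := {v | ∀ α ∈ J, α v = 0}
  add_mem' := by
    intro v w hv hw α hα
    rw [map_add, hv α hα, hw α hα, add_zero]
  zero_mem' := fun α _ => map_zero α
  smul_mem' := by
    intro c v hv α hα
    rw [map_smul, hv α hα, smul_zero]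

/-- The homogeneous generators of degree one given by a set of covectors. -/
def oneForms (A : Set (E →L[ℝ] ℝ)) : ∀ p : ℕ, Set (E [⋀^Fin p]→L[ℝ] ℝ)
  | 1 => ofOne '' A
  | _ => ∅

/-- The homogeneous generators of degree two given by a set of 2-covectors. -/
def twoForms (T : Set (E [⋀^Fin 2]→L[ℝ] ℝ)) : ∀ p : ℕ, Set (E [⋀^Fin p]→L[ℝ] ℝ)
  | 2 => T
  | _ => ∅

/-- The component of degree `p` of the ideal of the exterior algebra of `E*` that is generated by
the homogeneous elements `S`: the smallest graded subspace that contains `S` and is closed under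
exterior multiplication. -/
def algIdeal (S : ∀ p : ℕ, Set (E [⋀^Fin p]→L[ℝ] ℝ)) (p : ℕ) :
    Submodule ℝ (E [⋀^Fin p]→L[ℝ] ℝ) :=
  sInf {L | ∃ K : ∀ q : ℕ, Submodule ℝ (E [⋀^Fin q]→L[ℝ] ℝ),
    (∀ (q : ℕ) (α : E →L[ℝ] ℝ), ∀ η ∈ K q, wedge α η ∈ K (q + 1)) ∧
    (∀ q, S q ⊆ K q) ∧ L = K p}

end Basic

/-- A family of subspaces `I^p_x` of the `p`-covectors at the points `x` of `M`, for all `p`. -/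
abbrev FormFamily (E : Type*) [NormedAddCommGroup E] [NormedSpace ℝ E] (M : Type*) :=
  ∀ p : ℕ, M → Submodule ℝ (E [⋀^Fin p]→L[ℝ] ℝ)

section Systems

variable {E : Type*} [NormedAddCommGroup E] [NormedSpace ℝ E]
  {E' : Type*} [NormedAddCommGroup E'] [NormedSpace ℝ E']
  {M : Type*} [TopologicalSpace M] [ChartedSpace E M]
  {M' : Type*} [TopologicalSpace M'] [ChartedSpace E' M']

/-- `I` is, over the open set `U`, an exterior differential system of constant rank: each `I^p` is a
smooth subbundle of constant rank of the bundle of `p`-covectors, and the sections form an ideal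
that is closed under exterior differentiation. -/
structure IsEDSOn (I : FormFamily E M) (U : Set M) : Prop where
  subbundle : ∀ p : ℕ, ∃ r : ℕ, ∀ x ∈ U, ∃ U' : Set M, IsOpen U' ∧ x ∈ U' ∧ U' ⊆ U ∧
    ∃ η : Fin r → M → E [⋀^Fin p]→L[ℝ] ℝ, (∀ i, SmoothForm (η i) U') ∧
      ∀ y ∈ U', LinearIndependent ℝ (fun i => η i y) ∧
        I p y = Submodule.span ℝ (range fun i => η i y)
  ideal : ∀ x ∈ U, ∀ (p : ℕ) (α : E →L[ℝ] ℝ), ∀ η ∈ I p x, wedge α η ∈ I (p + 1) x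
  closed : ∀ (p : ℕ) (U' : Set M), IsOpen U' → U' ⊆ U →
    ∀ η : M → E [⋀^Fin p]→L[ℝ] ℝ, SmoothForm η U' → (∀ y ∈ U', η y ∈ I p y) →
      ∀ y ∈ U', extD η y ∈ I (p + 1) y

/-- A smooth coframe `θ^1, …, θ^s, σ̂^1, σ̂^2, σ̌^1, σ̌^2` over `U` (the latter pairs are called `h`
and `c`) for which `I = ⟨θ^1, …, θ^s, σ̂^1 ∧ σ̂^2, σ̌^1 ∧ σ̌^2⟩_alg` over `U`. -/
structure AdaptedCoframe (s : ℕ) (I : FormFamily E M) (U : Set M) where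
  θ : Fin s → M → E →L[ℝ] ℝ
  h : Fin 2 → M → E →L[ℝ] ℝ
  c : Fin 2 → M → E →L[ℝ] ℝ
  smooth_θ : ∀ i, SmoothCov (θ i) U
  smooth_h : ∀ i, SmoothCov (h i) U
  smooth_c : ∀ i, SmoothCov (c i) U
  coframe : ∀ x ∈ U, Function.Bijective fun v : E =>
    ((fun i => θ i x v, fun i => h i x v, fun i => c i x v) :
      (Fin s → ℝ) × (Fin 2 → ℝ) × (Fin 2 → ℝ))
  generate : ∀ x ∈ U, ∀ p, I p x = algIdeal (fun q =>
    oneForms (range fun i => θ i x) q ∪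
      twoForms {wedge (h 0 x) (ofOne (h 1 x)), wedge (c 0 x) (ofOne (c 1 x))} q) p

/-- `I` is, over `U`, a hyperbolic system of class `s`. -/
def IsHyperbolicOn (s : ℕ) (I : FormFamily E M) (U : Set M) : Prop :=
  ∀ x ∈ U, ∃ U' : Set M, IsOpen U' ∧ x ∈ U' ∧ Nonempty (AdaptedCoframe s I U')

/-- `I` is, over `U`, hyperbolic of class `s`, with singular Pfaffian systems
`Vh = span {θ^i, σ̂^a}` and `Vc = span {θ^i, σ̌^a}`. -/
def IsSingularPairOn (s : ℕ) (I : FormFamily E M) (Vh Vc : M → Submodule ℝ (E →L[ℝ] ℝ))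
    (U : Set M) : Prop :=
  ∀ x ∈ U, ∃ U' : Set M, IsOpen U' ∧ x ∈ U' ∧ ∃ κ : AdaptedCoframe s I U', ∀ y ∈ U',
    Vh y = Submodule.span ℝ ((range fun i => κ.θ i y) ∪ (range fun i => κ.h i y)) ∧
    Vc y = Submodule.span ℝ ((range fun i => κ.θ i y) ∪ (range fun i => κ.c i y))

/-- The fibre `V^∞_x`, spanned by the differentials at `x` of the local first integrals of `V`. -/
def firstIntegrals (V : M → Submodule ℝ (E →L[ℝ] ℝ)) (x : M) : Submodule ℝ (E →L[ℝ] ℝ) :=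
  Submodule.span ℝ {α | ∃ (f : M → ℝ) (U : Set M), IsOpen U ∧ x ∈ U ∧
    ContMDiffOn 𝓘(ℝ, E) 𝓘(ℝ, ℝ) ∞ f U ∧ (∀ y ∈ U, tmap f y ∈ V y) ∧ α = tmap f x}

/-- The (hyperbolic) differential system `I` with singular Pfaffian systems `Vh`, `Vc` is Darboux
integrable over `U`.  As part of the notion, the bundles of first integrals have constant rank. -/
structure DarbouxIntegrableOn (s : ℕ) (I : FormFamily E M)
    (Vh Vc : M → Submodule ℝ (E →L[ℝ] ℝ)) (U : Set M) : Prop where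
  eds : IsEDSOn I U
  singular : IsSingularPairOn s I Vh Vc U
  rank_h : ∃ r : ℕ, ∀ x ∈ U, finrank ℝ (firstIntegrals Vh x) = r
  rank_c : ∃ r : ℕ, ∀ x ∈ U, finrank ℝ (firstIntegrals Vc x) = r
  sup_h : ∀ x ∈ U, Vh x ⊔ firstIntegrals Vc x = ⊤
  sup_c : ∀ x ∈ U, Vc x ⊔ firstIntegrals Vh x = ⊤
  inf : ∀ x ∈ U, firstIntegrals Vh x ⊓ firstIntegrals Vc x = ⊥

/-- A hyperbolic Monge-Ampère system: an exterior differential system that is hyperbolic of class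
one (so on a 5-manifold) and whose 1-forms are multiples of a contact form `θ`, i.e. `dθ` is
nondegenerate on the kernel of `θ`. -/
structure IsHyperbolicMongeAmpere (I : FormFamily E M) : Prop where
  eds : IsEDSOn I univ
  hyperbolic : IsHyperbolicOn 1 I univ
  contact : ∀ (U : Set M) (θ : M → E →L[ℝ] ℝ), IsOpen U → SmoothCov θ U →
    (∀ y ∈ U, ofOne (θ y) ∈ I 1 y) → ∀ x ∈ U, θ x ≠ 0 →
      ∀ v : E, θ x v = 0 →
        (∀ w : E, θ x w = 0 → extD (fun y => ofOne (θ y)) x ![v, w] = 0) → v = 0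

/-- The vertical vectors of `p` at `x`. -/
def vertical (E' : Type*) [NormedAddCommGroup E'] [NormedSpace ℝ E'] {M' : Type*}
    [TopologicalSpace M'] [ChartedSpace E' M'] (p : M → M') (x : M) : Submodule ℝ E :=
  LinearMap.ker (tmap p x : E →L[ℝ] E').toLinearMap

/-- `J` is an admissible subbundle, over `U`, for the submersion `p` and the systems `B` upstairs and
`I` downstairs: `ann J` is a complement of the vertical bundle of `p`, and
`B = ⟨J ∪ p^* I⟩_alg`. -/
structure IsAdmissibleOn (p : M → M') (B : FormFamily E M) (I : FormFamily E' M')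
    (J : M → Submodule ℝ (E →L[ℝ] ℝ)) (U : Set M) : Prop where
  subbundle : IsSubbundleOn J U
  transverse : ∀ x ∈ U, IsCompl (annih (J x)) (vertical E' p x)
  generate : ∀ x ∈ U, ∀ q, B q x = algIdeal (fun k => oneForms (J x : Set (E →L[ℝ] ℝ)) k ∪
    (fun η : E' [⋀^Fin k]→L[ℝ] ℝ => η.compContinuousLinearMap (tmap p x)) '' (I k (p x))) q

/-- `p : (B, U) → (I, p(U))` is an integrable extension of exterior differential systems. -/
structure IsIntegrableExtensionOn (p : M → M') (B : FormFamily E M) (I : FormFamily E' M')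
    (U : Set M) : Prop where
  eds_top : IsEDSOn B U
  eds_base : IsEDSOn I (p '' U)
  smooth : ContMDiffOn 𝓘(ℝ, E) 𝓘(ℝ, E') ∞ p U
  submersion : ∀ x ∈ U, Function.Surjective (tmap p x : E →L[ℝ] E')
  admissible : ∃ J : M → Submodule ℝ (E →L[ℝ] ℝ), IsAdmissibleOn p B I J U

/-- The pullback by `p` of a space of covectors at `p x`. -/
def pullCov (p : M → M') (x : M) (V : Submodule ℝ (E' →L[ℝ] ℝ)) : Submodule ℝ (E →L[ℝ] ℝ) :=
  Submodule.span ℝ ((fun α : E' →L[ℝ] ℝ => α.comp (tmap p x : E →L[ℝ] E')) '' (V : Set (E' →L[ℝ] ℝ)))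

/-- The `p`-semibasic covectors at `x`: those that vanish on the vertical vectors of `p`. -/
def semibasic (E' : Type*) [NormedAddCommGroup E'] [NormedSpace ℝ E'] {M' : Type*}
    [TopologicalSpace M'] [ChartedSpace E' M'] (p : M → M') (x : M) : Submodule ℝ (E →L[ℝ] ℝ) where
  carrier := {α | ∀ v : E, (tmap p x : E →L[ℝ] E') v = 0 → α v = 0}
  add_mem' := by
    intro α β hα hβ v hv
    rw [add_apply, hα v hv, hβ v hv, add_zero]
  zero_mem' := fun _ _ => rfl
  smul_mem' := by
    intro c α hα v hv
    rw [smul_apply, hα v hv, smul_zero]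

/-- `p : (B, U) → (I, p(U))` is an integrable extension of Darboux integrable hyperbolic systems (of
class `sB` and `sI`), with singular Pfaffian systems `Zh = J ⊕ p^* Vh` and `Zc = J ⊕ p^* Vc` for an
admissible subbundle `J`. -/
structure IsDarbouxExtensionOn (sB sI : ℕ) (p : M → M') (B : FormFamily E M)
    (I : FormFamily E' M') (Zh Zc : M → Submodule ℝ (E →L[ℝ] ℝ))
    (Vh Vc : M' → Submodule ℝ (E' →L[ℝ] ℝ)) (U : Set M) : Prop where
  extension : IsIntegrableExtensionOn p B I U
  darboux_top : DarbouxIntegrableOn sB B Zh Zc U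
  darboux_base : DarbouxIntegrableOn sI I Vh Vc (p '' U)
  singular : ∃ J : M → Submodule ℝ (E →L[ℝ] ℝ), IsAdmissibleOn p B I J U ∧ ∀ x ∈ U,
    Disjoint (J x) (pullCov p x (Vh (p x))) ∧ Zh x = J x ⊔ pullCov p x (Vh (p x)) ∧
    Disjoint (J x) (pullCov p x (Vc (p x))) ∧ Zc x = J x ⊔ pullCov p x (Vc (p x))

/-- Maximal compatibility of the integrable extension `p : (B, U) → (I, p(U))` of Darboux integrable
systems. -/
structure MaximallyCompatibleOn (sB sI : ℕ) (p : M → M') (B : FormFamily E M)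
    (I : FormFamily E' M') (Zh Zc : M → Submodule ℝ (E →L[ℝ] ℝ))
    (Vh Vc : M' → Submodule ℝ (E' →L[ℝ] ℝ)) (U : Set M) : Prop where
  darboux : IsDarbouxExtensionOn sB sI p B I Zh Zc Vh Vc U
  transverse_h : ∀ x ∈ U,
    (vertical E' p x : Submodule ℝ E) ⊓ annih (firstIntegrals Zh x) = ⊥
  transverse_c : ∀ x ∈ U,
    (vertical E' p x : Submodule ℝ E) ⊓ annih (firstIntegrals Zc x) = ⊥
  rank_h : ∀ x ∈ U, finrank ℝ (firstIntegrals Zh x) =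
    finrank ℝ (vertical E' p x : Submodule ℝ E) + finrank ℝ (firstIntegrals Vh (p x))
  rank_c : ∀ x ∈ U, finrank ℝ (firstIntegrals Zc x) =
    finrank ℝ (vertical E' p x : Submodule ℝ E) + finrank ℝ (firstIntegrals Vc (p x))

/-- The Pfaffian system `⟨S(W)⟩_diff` of a family `W` of spaces of covectors: at each point the ideal
generated by `W` and by the values of `dα`, for the local smooth sections `α` of `W`. -/
def pfaffian (W : M → Submodule ℝ (E →L[ℝ] ℝ)) : FormFamily E M := fun p x =>
  algIdeal (fun q => oneForms (W x : Set (E →L[ℝ] ℝ)) q ∪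
    twoForms {η | ∃ (α : M → E →L[ℝ] ℝ) (U : Set M), IsOpen U ∧ x ∈ U ∧ SmoothCov α U ∧
      (∀ y ∈ U, α y ∈ W y) ∧ η = extD (fun y => ofOne (α y)) x} q) p

end Systems

/-! ### The space of 2-dimensional integral elements -/

/-- A 2-dimensional integral element of the system `I`: a plane in a tangent space of `M` on which
all forms of `I` vanish, at a point around which `I` is hyperbolic of class `s` (for a hyperbolic
system this is no restriction on the point; all these integral elements are regular). -/
@[ext]
structure IntegralElement {E : Type*} [NormedAddCommGroup E] [NormedSpace ℝ E] {M : Type*}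
    [TopologicalSpace M] [ChartedSpace E M] (s : ℕ) (I : FormFamily E M) where
  pt : M
  plane : Submodule ℝ E
  finrank_plane : finrank ℝ plane = 2
  integral : ∀ (p : ℕ), ∀ η ∈ I p pt, ∀ v : Fin p → E, (∀ i, v i ∈ plane) → η v = 0
  hyperbolic_at : ∃ U : Set M, IsOpen U ∧ pt ∈ U ∧ Nonempty (AdaptedCoframe s I U)

section Algebra

variable {E : Type*} [NormedAddCommGroup E] [NormedSpace ℝ E]

theorem subset_algIdeal (S : ∀ p : ℕ, Set (E [⋀^Fin p]→L[ℝ] ℝ)) (p : ℕ) :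
    S p ⊆ algIdeal S p := by
  intro η hη
  refine Submodule.mem_sInf.2 ?_
  rintro L ⟨K, -, hK, rfl⟩
  exact hK p hη

theorem algIdeal_induction {S : ∀ p : ℕ, Set (E [⋀^Fin p]→L[ℝ] ℝ)}
    (K : ∀ q : ℕ, Submodule ℝ (E [⋀^Fin q]→L[ℝ] ℝ))
    (h1 : ∀ (q : ℕ) (α : E →L[ℝ] ℝ), ∀ η ∈ K q, wedge α η ∈ K (q + 1))
    (h2 : ∀ q, S q ⊆ K q) {p : ℕ} {η : E [⋀^Fin p]→L[ℝ] ℝ} (h : η ∈ algIdeal S p) : η ∈ K p :=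
  Submodule.mem_sInf.1 h _ ⟨K, h1, h2, rfl⟩

theorem wedge_mem_algIdeal {S : ∀ p : ℕ, Set (E [⋀^Fin p]→L[ℝ] ℝ)} (p : ℕ) (α : E →L[ℝ] ℝ)
    (η : E [⋀^Fin p]→L[ℝ] ℝ) (h : η ∈ algIdeal S p) : wedge α η ∈ algIdeal S (p + 1) := by
  refine Submodule.mem_sInf.2 ?_
  rintro L ⟨K, h1, h2, rfl⟩
  exact h1 p α η (algIdeal_induction K h1 h2 h)

theorem ofOne_apply (α : E →L[ℝ] ℝ) (v : Fin 1 → E) : ofOne α v = α (v 0) := rfl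

theorem wedge_apply {p : ℕ} (α : E →L[ℝ] ℝ) (η : E [⋀^Fin p]→L[ℝ] ℝ) (v : Fin (p + 1) → E) :
    wedge α η v = ∑ i : Fin (p + 1), (-1 : ℝ) ^ (i : ℕ) * (α (v i) * η (i.removeNth v)) := by
  simp [wedge, ContinuousAlternatingMap.alternatizeUncurryFin_apply]

theorem wedge_ofOne_apply (α β : E →L[ℝ] ℝ) (v : Fin 2 → E) :
    wedge α (ofOne β) v = α (v 0) * β (v 1) - α (v 1) * β (v 0) := by
  rw [wedge_apply, Fin.sum_univ_two]
  simp [ofOne_apply, Fin.removeNth, Fin.tail]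
  ring

/-- The forms that vanish on a subspace. -/
def vanishOn (P : Submodule ℝ E) (q : ℕ) : Submodule ℝ (E [⋀^Fin q]→L[ℝ] ℝ) where
  carrier := {η | ∀ v : Fin q → E, (∀ i, v i ∈ P) → η v = 0}
  add_mem' := by
    intro α β hα hβ v hv
    rw [ContinuousAlternatingMap.add_apply, hα v hv, hβ v hv, add_zero]
  zero_mem' := fun _ _ => rfl
  smul_mem' := by
    intro c α hα v hv
    rw [ContinuousAlternatingMap.smul_apply, hα v hv, smul_zero]

theorem wedge_mem_vanishOn (P : Submodule ℝ E) (q : ℕ) (α : E →L[ℝ] ℝ) (η : E [⋀^Fin q]→L[ℝ] ℝ)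
    (h : η ∈ vanishOn P q) : wedge α η ∈ vanishOn P (q + 1) := by
  intro v hv
  rw [wedge_apply]
  refine Finset.sum_eq_zero fun i _ => ?_
  rw [h (i.removeNth v) (fun j => hv _), mul_zero, mul_zero]

end Algebra

section Prolongation

variable {E : Type*} [NormedAddCommGroup E] [NormedSpace ℝ E]
  {M : Type*} [TopologicalSpace M] [ChartedSpace E M] {s : ℕ} {I : FormFamily E M}

/-- The common value of `β v / α v` for the `v ∈ P` with `α v ≠ 0`. -/
def slope (α β : E →L[ℝ] ℝ) (P : Submodule ℝ E) : ℝ :=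
  open Classical in if h : ∃ v ∈ P, α v ≠ 0 then β h.choose / α h.choose else 0

theorem slope_eq {α β : E →L[ℝ] ℝ} {P : Submodule ℝ E}
    (hP : ∀ v ∈ P, ∀ w ∈ P, α v * β w = α w * β v) {v : E} (hv : v ∈ P) (h : α v ≠ 0) :
    slope α β P = β v / α v := by
  have hex : ∃ v ∈ P, α v ≠ 0 := ⟨v, hv, h⟩
  rw [slope, dif_pos hex, div_eq_div_iff hex.choose_spec.2 h]
  have := hP _ hex.choose_spec.1 _ hv
  linarith

theorem fin2_cases (i k : Fin 2) : k = i ∨ k = i + 1 := by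
  revert i k; decide

namespace AdaptedCoframe

variable {U : Set M} (κ : AdaptedCoframe s I U)

/-- The coframe as a field of linear maps to `ℝ^s × ℝ^2 × ℝ^2`. -/
def cof (x : M) : E →L[ℝ] (Fin s → ℝ) × (Fin 2 → ℝ) × (Fin 2 → ℝ) :=
  (ContinuousLinearMap.pi fun i => κ.θ i x).prod
    ((ContinuousLinearMap.pi fun i => κ.h i x).prod (ContinuousLinearMap.pi fun i => κ.c i x))

theorem cof_bijective {x : M} (hx : x ∈ U) : Function.Bijective (κ.cof x) := κ.coframe x hx

/-- The plane in `T_xM` on which `θ = 0`, `σ^{i+1} = a σ^i` for the first pair and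
`σ^{j+1} = b σ^j` for the second pair. -/
def plane (x : M) (i j : Fin 2) (a b : ℝ) : Submodule ℝ E where
  carrier := {v | (∀ k, κ.θ k x v = 0) ∧ κ.h (i + 1) x v = a * κ.h i x v ∧
    κ.c (j + 1) x v = b * κ.c j x v}
  add_mem' := by
    rintro v w ⟨h1, h2, h3⟩ ⟨k1, k2, k3⟩
    refine ⟨fun k => ?_, ?_, ?_⟩
    · rw [map_add, h1, k1, add_zero]
    · rw [map_add, map_add, h2, k2, mul_add]
    · rw [map_add, map_add, h3, k3, mul_add]
  zero_mem' := by simp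
  smul_mem' := by
    rintro r v ⟨h1, h2, h3⟩
    refine ⟨fun k => ?_, ?_, ?_⟩
    · rw [map_smul, h1, smul_zero]
    · rw [map_smul, map_smul, h2, smul_eq_mul, smul_eq_mul]; ring
    · rw [map_smul, map_smul, h3, smul_eq_mul, smul_eq_mul]; ring

/-- The coordinates of the vector spanning the first line of `plane`. -/
def wh (s : ℕ) (i : Fin 2) (a : ℝ) : (Fin s → ℝ) × (Fin 2 → ℝ) × (Fin 2 → ℝ) :=
  (0, Pi.single i 1 + a • Pi.single (i + 1) 1, 0)

/-- The coordinates of the vector spanning the second line of `plane`. -/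
def wc (s : ℕ) (j : Fin 2) (b : ℝ) : (Fin s → ℝ) × (Fin 2 → ℝ) × (Fin 2 → ℝ) :=
  (0, 0, Pi.single j 1 + b • Pi.single (j + 1) 1)

theorem fin2_ne (i : Fin 2) : i + 1 ≠ i := by revert i; decide

theorem cof_eq_iff (x : M) (v : E) (w : (Fin s → ℝ) × (Fin 2 → ℝ) × (Fin 2 → ℝ)) (i j : Fin 2) :
    κ.cof x v = w ↔ (∀ k, κ.θ k x v = w.1 k) ∧ (κ.h i x v = w.2.1 i ∧
      κ.h (i + 1) x v = w.2.1 (i + 1)) ∧ (κ.c j x v = w.2.2 j ∧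
      κ.c (j + 1) x v = w.2.2 (j + 1)) := by
  constructor
  · rintro rfl
    exact ⟨fun k => rfl, ⟨rfl, rfl⟩, rfl, rfl⟩
  · rintro ⟨h1, ⟨h2, h3⟩, h4, h5⟩
    refine Prod.ext (funext h1) (Prod.ext (funext fun k => ?_) (funext fun k => ?_))
    · rcases fin2_cases i k with rfl | rfl
      exacts [h2, h3]
    · rcases fin2_cases j k with rfl | rfl
      exacts [h4, h5]

theorem cof_comb_iff (x : M) (v : E) (i j : Fin 2) (a b r t : ℝ) :
    κ.cof x v = r • wh s i a + t • wc s j b ↔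
      v ∈ κ.plane x i j a b ∧ κ.h i x v = r ∧ κ.c j x v = t := by
  rw [κ.cof_eq_iff x v _ i j]
  simp only [wh, wc, plane, Submodule.mem_mk, AddSubmonoid.mem_mk, AddSubsemigroup.mem_mk,
    mem_ofPred_eq]
  simp
  constructor
  · rintro ⟨h1, ⟨h2, h3⟩, h4, h5⟩
    refine ⟨⟨h1, ?_, ?_⟩, h2, h4⟩
    · rw [h3, h2, mul_comm]
    · rw [h5, h4, mul_comm]
  · rintro ⟨⟨h1, h2, h3⟩, h4, h5⟩
    refine ⟨h1, ⟨h4, ?_⟩, h5, ?_⟩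
    · rw [h2, h4, mul_comm]
    · rw [h3, h5, mul_comm]

theorem finrank_plane {x : M} (hx : x ∈ U) (i j : Fin 2) (a b : ℝ) :
    finrank ℝ (κ.plane x i j a b) = 2 := by
  let f : κ.plane x i j a b →ₗ[ℝ] ℝ × ℝ :=
    ((κ.h i x).toLinearMap.prod (κ.c j x).toLinearMap).comp (κ.plane x i j a b).subtype
  have hf : ∀ v, f v = (κ.h i x v, κ.c j x v) := fun v => rfl
  have hbij : Function.Bijective f := by
    constructor
    · intro v w hvw
      rw [hf, hf, Prod.mk.injEq] at hvw
      refine Subtype.ext ((κ.cof_bijective hx).1 ?_)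
      rw [(κ.cof_comb_iff x v i j a b _ _).2 ⟨v.2, rfl, rfl⟩,
        (κ.cof_comb_iff x w i j a b _ _).2 ⟨w.2, rfl, rfl⟩, hvw.1, hvw.2]
    · rintro ⟨r, t⟩
      obtain ⟨v, hv⟩ := (κ.cof_bijective hx).2 (r • wh s i a + t • wc s j b)
      obtain ⟨h1, h2, h3⟩ := (κ.cof_comb_iff x v i j a b r t).1 hv
      exact ⟨⟨v, h1⟩, by rw [hf]; exact Prod.ext h2 h3⟩
  rw [(LinearEquiv.ofBijective f hbij).finrank_eq]
  simp

theorem mem_theta {x : M} (hx : x ∈ U) (k : Fin s) : ofOne (κ.θ k x) ∈ I 1 x := by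
  rw [κ.generate x hx]
  exact subset_algIdeal _ _ (Or.inl ⟨_, ⟨k, rfl⟩, rfl⟩)

theorem mem_h {x : M} (hx : x ∈ U) : wedge (κ.h 0 x) (ofOne (κ.h 1 x)) ∈ I 2 x := by
  rw [κ.generate x hx]
  exact subset_algIdeal _ _ (Or.inr (Or.inl rfl))

theorem mem_c {x : M} (hx : x ∈ U) : wedge (κ.c 0 x) (ofOne (κ.c 1 x)) ∈ I 2 x := by
  rw [κ.generate x hx]
  exact subset_algIdeal _ _ (Or.inr (Or.inr rfl))

theorem integral_plane {x : M} (hx : x ∈ U) (i j : Fin 2) (a b : ℝ) (p : ℕ) :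
    ∀ η ∈ I p x, ∀ v : Fin p → E, (∀ k, v k ∈ κ.plane x i j a b) → η v = 0 := by
  intro η hη
  rw [κ.generate x hx] at hη
  refine algIdeal_induction (fun q => vanishOn (κ.plane x i j a b) q)
    (fun q α η h => wedge_mem_vanishOn _ _ _ _ h) ?_ hη
  rintro q η (hη | hη)
  · match q, η, hη with
    | 1, _, ⟨_, ⟨k, rfl⟩, rfl⟩ => exact fun v hv => (hv 0).1 k
  · match q, η, hη with
    | 2, _, Or.inl rfl =>
      intro v hv
      rw [wedge_ofOne_apply]
      have h0 := (hv 0).2.1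
      have h1 := (hv 1).2.1
      fin_cases i
      · change κ.h 1 x (v 0) = a * κ.h 0 x (v 0) at h0
        change κ.h 1 x (v 1) = a * κ.h 0 x (v 1) at h1
        rw [h0, h1]; ring
      · change κ.h 0 x (v 0) = a * κ.h 1 x (v 0) at h0
        change κ.h 0 x (v 1) = a * κ.h 1 x (v 1) at h1
        rw [h0, h1]; ring
    | 2, _, Or.inr rfl =>
      intro v hv
      rw [wedge_ofOne_apply]
      have h0 := (hv 0).2.2
      have h1 := (hv 1).2.2
      fin_cases j
      · change κ.c 1 x (v 0) = b * κ.c 0 x (v 0) at h0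
        change κ.c 1 x (v 1) = b * κ.c 0 x (v 1) at h1
        rw [h0, h1]; ring
      · change κ.c 0 x (v 0) = b * κ.c 1 x (v 0) at h0
        change κ.c 0 x (v 1) = b * κ.c 1 x (v 1) at h1
        rw [h0, h1]; ring

/-- The integral element with given slopes. -/
def elem (hU : IsOpen U) {x : M} (hx : x ∈ U) (i j : Fin 2) (a b : ℝ) : IntegralElement s I where
  pt := x
  plane := κ.plane x i j a b
  finrank_plane := κ.finrank_plane hx i j a b
  integral := κ.integral_plane hx i j a b
  hyperbolic_at := ⟨U, hU, hx, ⟨κ⟩⟩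

variable {z : IntegralElement s I}

theorem theta_eq_zero (hz : z.pt ∈ U) {v : E} (hv : v ∈ z.plane) (k : Fin s) :
    κ.θ k z.pt v = 0 :=
  z.integral 1 _ (κ.mem_theta hz k) (fun _ => v) (fun _ => hv)

theorem h_symm (hz : z.pt ∈ U) (i : Fin 2) : ∀ v ∈ z.plane, ∀ w ∈ z.plane,
    κ.h i z.pt v * κ.h (i + 1) z.pt w = κ.h i z.pt w * κ.h (i + 1) z.pt v := by
  intro v hv w hw
  have := z.integral 2 _ (κ.mem_h hz) ![v, w] (by intro k; fin_cases k; exacts [hv, hw])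
  rw [wedge_ofOne_apply] at this
  simp only [Matrix.cons_val_zero, Matrix.cons_val_one] at this
  fin_cases i
  · change κ.h 0 z.pt v * κ.h 1 z.pt w = κ.h 0 z.pt w * κ.h 1 z.pt v
    linarith
  · change κ.h 1 z.pt v * κ.h 0 z.pt w = κ.h 1 z.pt w * κ.h 0 z.pt v
    linarith

theorem c_symm (hz : z.pt ∈ U) (j : Fin 2) : ∀ v ∈ z.plane, ∀ w ∈ z.plane,
    κ.c j z.pt v * κ.c (j + 1) z.pt w = κ.c j z.pt w * κ.c (j + 1) z.pt v := by
  intro v hv w hw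
  have := z.integral 2 _ (κ.mem_c hz) ![v, w] (by intro k; fin_cases k; exacts [hv, hw])
  rw [wedge_ofOne_apply] at this
  simp only [Matrix.cons_val_zero, Matrix.cons_val_one] at this
  fin_cases j
  · change κ.c 0 z.pt v * κ.c 1 z.pt w = κ.c 0 z.pt w * κ.c 1 z.pt v
    linarith
  · change κ.c 1 z.pt v * κ.c 0 z.pt w = κ.c 1 z.pt w * κ.c 0 z.pt v
    linarith

theorem exists_h_ne (hz : z.pt ∈ U) : ∃ i : Fin 2, ∃ v ∈ z.plane, κ.h i z.pt v ≠ 0 := by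
  by_contra! hcon
  have : FiniteDimensional ℝ z.plane := FiniteDimensional.of_finrank_eq_succ z.finrank_plane
  let f : z.plane →ₗ[ℝ] (Fin 2 → ℝ) :=
    (LinearMap.pi fun i => (κ.c i z.pt).toLinearMap).comp z.plane.subtype
  have hf : ∀ v i, f v i = κ.c i z.pt v := fun v i => rfl
  have hinj : Function.Injective f := by
    rw [injective_iff_map_eq_zero]
    intro v hv
    have h0 : κ.cof z.pt v = 0 := by
      rw [κ.cof_eq_iff z.pt v 0 0 0]
      exact ⟨fun k => κ.theta_eq_zero hz v.2 k, ⟨hcon _ _ v.2, hcon _ _ v.2⟩,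
          by rw [← hf, hv]; rfl, by rw [← hf, hv]; rfl⟩
    exact Subtype.ext ((κ.cof_bijective hz).1 (by rw [h0]; simp))
  have hsurj : Function.Surjective f :=
    (LinearMap.injective_iff_surjective_of_finrank_eq_finrank
      (by rw [z.finrank_plane]; simp)).1 hinj
  obtain ⟨v, hv⟩ := hsurj ![1, 0]
  obtain ⟨w, hw⟩ := hsurj ![0, 1]
  have := κ.c_symm hz 0 v v.2 w w.2
  rw [← hf, ← hf, ← hf, ← hf, hv, hw] at this
  simp at this

theorem exists_c_ne (hz : z.pt ∈ U) : ∃ j : Fin 2, ∃ v ∈ z.plane, κ.c j z.pt v ≠ 0 := by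
  by_contra! hcon
  have : FiniteDimensional ℝ z.plane := FiniteDimensional.of_finrank_eq_succ z.finrank_plane
  let f : z.plane →ₗ[ℝ] (Fin 2 → ℝ) :=
    (LinearMap.pi fun i => (κ.h i z.pt).toLinearMap).comp z.plane.subtype
  have hf : ∀ v i, f v i = κ.h i z.pt v := fun v i => rfl
  have hinj : Function.Injective f := by
    rw [injective_iff_map_eq_zero]
    intro v hv
    have h0 : κ.cof z.pt v = 0 := by
      rw [κ.cof_eq_iff z.pt v 0 0 0]
      exact ⟨fun k => κ.theta_eq_zero hz v.2 k, ⟨by rw [← hf, hv]; rfl, by rw [← hf, hv]; rfl⟩,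
          hcon _ _ v.2, hcon _ _ v.2⟩
    exact Subtype.ext ((κ.cof_bijective hz).1 (by rw [h0]; simp))
  have hsurj : Function.Surjective f :=
    (LinearMap.injective_iff_surjective_of_finrank_eq_finrank
      (by rw [z.finrank_plane]; simp)).1 hinj
  obtain ⟨v, hv⟩ := hsurj ![1, 0]
  obtain ⟨w, hw⟩ := hsurj ![0, 1]
  have := κ.h_symm hz 0 v v.2 w w.2
  rw [← hf, ← hf, ← hf, ← hf, hv, hw] at this
  simp at this

/-- An integral element on which `σ^i` and `σ^j` do not vanish is determined by its slopes. -/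
theorem plane_eq (hz : z.pt ∈ U) {i j : Fin 2} (hi : ∃ v ∈ z.plane, κ.h i z.pt v ≠ 0)
    (hj : ∃ v ∈ z.plane, κ.c j z.pt v ≠ 0) :
    κ.plane z.pt i j (slope (κ.h i z.pt) (κ.h (i + 1) z.pt) z.plane)
      (slope (κ.c j z.pt) (κ.c (j + 1) z.pt) z.plane) = z.plane := by
  obtain ⟨v, hv, hv'⟩ := hi
  obtain ⟨w, hw, hw'⟩ := hj
  symm
  have hle : z.plane ≤ κ.plane z.pt i j (slope (κ.h i z.pt) (κ.h (i + 1) z.pt) z.plane)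
      (slope (κ.c j z.pt) (κ.c (j + 1) z.pt) z.plane) := by
    intro u hu
    refine ⟨fun k => κ.theta_eq_zero hz hu k, ?_, ?_⟩
    · rw [slope_eq (κ.h_symm hz i) hv hv', div_mul_eq_mul_div, eq_div_iff hv']
      have := κ.h_symm hz i v hv u hu
      linarith
    · rw [slope_eq (κ.c_symm hz j) hw hw', div_mul_eq_mul_div, eq_div_iff hw']
      have := κ.c_symm hz j w hw u hu
      linarith
  have : FiniteDimensional ℝ (κ.plane z.pt i j
      (slope (κ.h i z.pt) (κ.h (i + 1) z.pt) z.plane)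
      (slope (κ.c j z.pt) (κ.c (j + 1) z.pt) z.plane)) :=
    FiniteDimensional.of_finrank_eq_succ (κ.finrank_plane hz i j _ _)
  exact Submodule.eq_of_le_of_finrank_eq hle
    (by rw [z.finrank_plane, κ.finrank_plane hz])

/-- The vector of `plane` with prescribed coordinates. -/
theorem exists_vec {x : M} (hx : x ∈ U) (i j : Fin 2) (a b r t : ℝ) :
    ∃ v ∈ κ.plane x i j a b, κ.h i x v = r ∧ κ.c j x v = t := by
  obtain ⟨v, hv⟩ := (κ.cof_bijective hx).2 (r • wh s i a + t • wc s j b)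
  obtain ⟨h1, h2, h3⟩ := (κ.cof_comb_iff x v i j a b r t).1 hv
  exact ⟨v, h1, h2, h3⟩

/-- The chart of the space of integral elements given by a chart `φ` of `M`, an adapted coframe and
the choice of a form in each pair: the coordinates of an integral element are those of its point and
its two slopes. -/
def chart (hU : IsOpen U) (z₀ : IntegralElement s I) (φ : OpenPartialHomeomorph M E)
    (i j : Fin 2) : PartialEquiv (IntegralElement s I) (E × ℝ × ℝ) where
  toFun z := (φ z.pt, slope (κ.h i z.pt) (κ.h (i + 1) z.pt) z.plane,
    slope (κ.c j z.pt) (κ.c (j + 1) z.pt) z.plane)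
  invFun q := open Classical in
    if hq : φ.symm q.1 ∈ U then κ.elem hU hq i j q.2.1 q.2.2 else z₀
  source := {z | z.pt ∈ φ.source ∧ z.pt ∈ U ∧ (∃ v ∈ z.plane, κ.h i z.pt v ≠ 0) ∧
    ∃ v ∈ z.plane, κ.c j z.pt v ≠ 0}
  target := {q | q.1 ∈ φ.target ∧ φ.symm q.1 ∈ U}
  map_source' := by
    rintro z ⟨h1, h2, -, -⟩
    refine ⟨φ.map_source h1, ?_⟩
    simpa [φ.left_inv h1] using h2
  map_target' := by
    rintro ⟨y, a, b⟩ ⟨h1, h2⟩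
    simp only at h1 h2
    simp only [dif_pos h2]
    refine ⟨φ.map_target h1, h2, ?_, ?_⟩
    · obtain ⟨v, hv, hv', -⟩ := κ.exists_vec h2 i j a b 1 0
      exact ⟨v, hv, hv'.trans_ne one_ne_zero⟩
    · obtain ⟨v, hv, -, hv'⟩ := κ.exists_vec h2 i j a b 0 1
      exact ⟨v, hv, hv'.trans_ne one_ne_zero⟩
  left_inv' := by
    rintro z ⟨h1, h2, h3, h4⟩
    have e : φ.symm (φ z.pt) = z.pt := φ.left_inv h1
    have h5 : φ.symm (φ z.pt) ∈ U := by rw [e]; exact h2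
    simp only [dif_pos h5]
    refine IntegralElement.ext e ?_
    change κ.plane (φ.symm (φ z.pt)) i j _ _ = z.plane
    rw [e]
    exact κ.plane_eq h2 h3 h4
  right_inv' := by
    rintro ⟨y, a, b⟩ ⟨h1, h2⟩
    simp only at h1 h2
    simp only [dif_pos h2]
    have hpt : (κ.elem hU h2 i j a b).pt = φ.symm y := rfl
    have hU' : (κ.elem hU h2 i j a b).pt ∈ U := h2
    refine Prod.ext (φ.right_inv h1) (Prod.ext ?_ ?_)
    · obtain ⟨v, hv, hv', -⟩ := κ.exists_vec h2 i j a b 1 0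
      have hne : κ.h i (κ.elem hU h2 i j a b).pt v ≠ 0 :=
        hv'.trans_ne one_ne_zero
      simp only
      rw [slope_eq (κ.h_symm hU' i) hv hne, hpt, hv.2.1, hv', mul_one, div_one]
    · obtain ⟨v, hv, -, hv'⟩ := κ.exists_vec h2 i j a b 0 1
      have hne : κ.c j (κ.elem hU h2 i j a b).pt v ≠ 0 :=
        hv'.trans_ne one_ne_zero
      simp only
      rw [slope_eq (κ.c_symm hU' j) hv hne, hpt, hv.2.2, hv', mul_one, div_one]

end AdaptedCoframe

namespace AdaptedCoframe

variable {U : Set M} (κ : AdaptedCoframe s I U)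
  {U' : Set M} (κ' : AdaptedCoframe s I U')

theorem smooth_cof [FiniteDimensional ℝ E] : SmoothCov κ.cof U := by
  intro e he
  rw [contDiffOn_clm_apply]
  intro v
  have aux : ∀ {α : M → E →L[ℝ] ℝ}, SmoothCov α U →
      ContDiffOn ℝ ∞ (fun y => α (e.symm y) (tmap e.symm y v)) (e.target ∩ e.symm ⁻¹' U) :=
    fun h => contDiffOn_clm_apply.1 (h e he) v
  exact (contDiffOn_pi.2 fun i => aux (κ.smooth_θ i)).prodMk
    ((contDiffOn_pi.2 fun i => aux (κ.smooth_h i)).prodMk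
      (contDiffOn_pi.2 fun i => aux (κ.smooth_c i)))

theorem tmap_symm_bijective [IsManifold 𝓘(ℝ, E) ∞ M] {φ : OpenPartialHomeomorph M E}
    (hφ : φ ∈ atlas E M) {y : E} (hy : y ∈ φ.target) :
    Function.Bijective (tmap φ.symm y : E →L[ℝ] E) := by
  have : IsManifold 𝓘(ℝ, E) 1 M := IsManifold.of_le (n := ∞) (by norm_cast)
  exact (mdifferentiable_of_mem_atlas (I := 𝓘(ℝ, E)) hφ).symm.mfderiv_bijective hy

theorem chart_cof_isInvertible [FiniteDimensional ℝ E] [IsManifold 𝓘(ℝ, E) ∞ M]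
    {φ : OpenPartialHomeomorph M E}
    (hφ : φ ∈ atlas E M) {y : E} (hy : y ∈ φ.target) (hyU : φ.symm y ∈ U) :
    ∃ L : E ≃L[ℝ] ((Fin s → ℝ) × (Fin 2 → ℝ) × (Fin 2 → ℝ)), (L : E →L[ℝ] _) =
      chartCov φ κ.cof y := by
  have hb : Function.Bijective (chartCov φ κ.cof y) :=
    (κ.cof_bijective hyU).comp (tmap_symm_bijective hφ hy)
  exact ⟨(LinearEquiv.ofBijective (chartCov φ κ.cof y).toLinearMap hb).toContinuousLinearEquiv,
    by ext v <;> rfl⟩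

/-- The vector with coordinates `w` in the coframe, expressed in the chart `φ`. -/
def vec (φ : OpenPartialHomeomorph M E) (y : E) (w : (Fin s → ℝ) × (Fin 2 → ℝ) × (Fin 2 → ℝ)) : E :=
  ContinuousLinearMap.inverse (chartCov φ κ.cof y) w

theorem cof_vec [FiniteDimensional ℝ E] [IsManifold 𝓘(ℝ, E) ∞ M] {φ : OpenPartialHomeomorph M E}
    (hφ : φ ∈ atlas E M) {y : E} (hy : y ∈ φ.target) (hyU : φ.symm y ∈ U)
    (w : (Fin s → ℝ) × (Fin 2 → ℝ) × (Fin 2 → ℝ)) :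
    κ.cof (φ.symm y) (tmap φ.symm y (κ.vec φ y w)) = w := by
  obtain ⟨L, hL⟩ := κ.chart_cof_isInvertible hφ hy hyU
  change chartCov φ κ.cof y (κ.vec φ y w) = w
  rw [vec, ← hL, ContinuousLinearMap.inverse_equiv]
  exact L.apply_symm_apply w

theorem vec_smooth [FiniteDimensional ℝ E] [IsManifold 𝓘(ℝ, E) ∞ M]
    {φ : OpenPartialHomeomorph M E} (hφ : φ ∈ atlas E M) :
    ContDiffOn ℝ ∞ (fun y => ContinuousLinearMap.inverse (chartCov φ κ.cof y))
      (φ.target ∩ φ.symm ⁻¹' U) := by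
  have : CompleteSpace E := FiniteDimensional.complete ℝ E
  intro y hy
  obtain ⟨L, hL⟩ := κ.chart_cof_isInvertible hφ hy.1 hy.2
  have h := contDiffAt_map_inverse (𝕜 := ℝ) (n := ∞) L
  rw [hL] at h
  exact h.comp_contDiffWithinAt y (κ.smooth_cof φ hφ y hy)

/-- The value of the covector field `α` on the vector of `plane` with coordinates `r`, `t`, as a
function of the coordinates of the integral element. -/
def val (φ : OpenPartialHomeomorph M E) (i j : Fin 2) (α : M → E →L[ℝ] ℝ) (r t : ℝ)
    (q : E × ℝ × ℝ) : ℝ :=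
  α (φ.symm q.1) (tmap φ.symm q.1 (κ.vec φ q.1 (r • wh s i q.2.1 + t • wc s j q.2.2)))

theorem wh_smooth (i : Fin 2) : ContDiff ℝ ∞ (wh s i) := by
  refine contDiff_const.prodMk (ContDiff.prodMk ?_ contDiff_const)
  exact contDiff_const.add (contDiff_id.smul contDiff_const)

theorem wc_smooth (i : Fin 2) : ContDiff ℝ ∞ (wc s i) := by
  refine contDiff_const.prodMk (ContDiff.prodMk contDiff_const ?_)
  exact contDiff_const.add (contDiff_id.smul contDiff_const)

theorem val_smooth [FiniteDimensional ℝ E] [IsManifold 𝓘(ℝ, E) ∞ M]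
    {φ : OpenPartialHomeomorph M E} (hφ : φ ∈ atlas E M) (i j : Fin 2) {α : M → E →L[ℝ] ℝ}
    (hα : SmoothCov α U') (r t : ℝ) :
    ContDiffOn ℝ ∞ (κ.val φ i j α r t) {q | q.1 ∈ φ.target ∧ φ.symm q.1 ∈ U ∧ φ.symm q.1 ∈ U'} := by
  have h1 : ContDiffOn ℝ ∞ (fun q : E × ℝ × ℝ => chartCov φ α q.1)
      {q | q.1 ∈ φ.target ∧ φ.symm q.1 ∈ U ∧ φ.symm q.1 ∈ U'} :=
    (hα φ hφ).comp contDiff_fst.contDiffOn fun q hq => ⟨hq.1, hq.2.2⟩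
  have h2 : ContDiffOn ℝ ∞
      (fun q : E × ℝ × ℝ => ContinuousLinearMap.inverse (chartCov φ κ.cof q.1))
      {q | q.1 ∈ φ.target ∧ φ.symm q.1 ∈ U ∧ φ.symm q.1 ∈ U'} :=
    (κ.vec_smooth hφ).comp contDiff_fst.contDiffOn fun q hq => ⟨hq.1, hq.2.1⟩
  have h3 : ContDiff ℝ ∞ (fun q : E × ℝ × ℝ => r • wh s i q.2.1 + t • wc s j q.2.2) :=
    (((wh_smooth i).comp (contDiff_fst.comp contDiff_snd)).const_smul r).add
      (((wc_smooth j).comp (contDiff_snd.comp contDiff_snd)).const_smul t)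
  exact h1.clm_apply (h2.clm_apply h3.contDiffOn)

theorem vec_mem [FiniteDimensional ℝ E] [IsManifold 𝓘(ℝ, E) ∞ M] {φ : OpenPartialHomeomorph M E}
    (hφ : φ ∈ atlas E M) {y : E} (hy : y ∈ φ.target) (hyU : φ.symm y ∈ U) (i j : Fin 2)
    (a b r t : ℝ) :
    tmap φ.symm y (κ.vec φ y (r • wh s i a + t • wc s j b)) ∈ κ.plane (φ.symm y) i j a b :=
  ((κ.cof_comb_iff _ _ i j a b r t).1 (κ.cof_vec hφ hy hyU _)).1

/-- A covector field does not vanish on an integral element iff it does not vanish on one of the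
two spanning vectors. -/
theorem exists_ne_iff [FiniteDimensional ℝ E] [IsManifold 𝓘(ℝ, E) ∞ M]
    {φ : OpenPartialHomeomorph M E} (hφ : φ ∈ atlas E M) (i j : Fin 2) (α : M → E →L[ℝ] ℝ)
    {q : E × ℝ × ℝ} (hq : q.1 ∈ φ.target) (hqU : φ.symm q.1 ∈ U) :
    (∃ v ∈ κ.plane (φ.symm q.1) i j q.2.1 q.2.2, α (φ.symm q.1) v ≠ 0) ↔
      κ.val φ i j α 1 0 q ≠ 0 ∨ κ.val φ i j α 0 1 q ≠ 0 := by
  constructor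
  · rintro ⟨v, hv, hne⟩
    by_contra! hcon
    apply hne
    have e : v = tmap φ.symm q.1 (κ.vec φ q.1
        (κ.h i (φ.symm q.1) v • wh s i q.2.1 + κ.c j (φ.symm q.1) v • wc s j q.2.2)) := by
      refine (κ.cof_bijective hqU).1 ?_
      rw [κ.cof_vec hφ hq hqU]
      exact (κ.cof_comb_iff _ _ i j _ _ _ _).2 ⟨hv, rfl, rfl⟩
    have h10 := hcon.1
    have h01 := hcon.2
    simp only [val, vec, one_smul, zero_smul, add_zero, zero_add] at h10 h01
    rw [e]
    simp only [vec, map_add, map_smul, h10, h01, smul_zero, add_zero]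
  · rintro (h | h)
    exacts [⟨_, κ.vec_mem hφ hq hqU i j _ _ 1 0, h⟩, ⟨_, κ.vec_mem hφ hq hqU i j _ _ 0 1, h⟩]

theorem isOpen_base {E M : Type*} [TopologicalSpace E] [TopologicalSpace M] {U U' : Set M} (hU : IsOpen U) (hU' : IsOpen U') (φ : OpenPartialHomeomorph M E) :
    IsOpen {q : E × ℝ × ℝ | q.1 ∈ φ.target ∧ φ.symm q.1 ∈ U ∧ φ.symm q.1 ∈ U'} :=
  (φ.isOpen_inter_preimage_symm (hU.inter hU')).preimage continuous_fst

variable [FiniteDimensional ℝ E] [IsManifold 𝓘(ℝ, E) ∞ M]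

theorem trans_source (hU : IsOpen U) (hU' : IsOpen U') (z₀ z₀' : IntegralElement s I)
    {φ φ' : OpenPartialHomeomorph M E} (hφ : φ ∈ atlas E M) (i j i' j' : Fin 2) :
    ((κ.chart hU z₀ φ i j).symm.trans (κ'.chart hU' z₀' φ' i' j')).source =
      {q | q.1 ∈ φ.target ∧ φ.symm q.1 ∈ U ∧ φ.symm q.1 ∈ U' ∧ φ.symm q.1 ∈ φ'.source ∧
        (κ.val φ i j (κ'.h i') 1 0 q ≠ 0 ∨ κ.val φ i j (κ'.h i') 0 1 q ≠ 0) ∧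
        (κ.val φ i j (κ'.c j') 1 0 q ≠ 0 ∨ κ.val φ i j (κ'.c j') 0 1 q ≠ 0)} := by
  ext q
  have key : ∀ (h1 : q.1 ∈ φ.target) (h2 : φ.symm q.1 ∈ U),
      (κ.chart hU z₀ φ i j).symm q = κ.elem hU h2 i j q.2.1 q.2.2 := fun h1 h2 => dif_pos h2
  constructor
  · rintro ⟨⟨h1, h2⟩, h3⟩
    change (κ.chart hU z₀ φ i j).symm q ∈ (κ'.chart hU' z₀' φ' i' j').source at h3
    rw [key h1 h2] at h3
    obtain ⟨h3, h4, h5, h6⟩ := h3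
    exact ⟨h1, h2, h4, h3, (κ.exists_ne_iff hφ i j (κ'.h i') h1 h2).1 h5,
      (κ.exists_ne_iff hφ i j (κ'.c j') h1 h2).1 h6⟩
  · rintro ⟨h1, h2, h4, h3, h5, h6⟩
    refine ⟨⟨h1, h2⟩, ?_⟩
    change (κ.chart hU z₀ φ i j).symm q ∈ (κ'.chart hU' z₀' φ' i' j').source
    rw [key h1 h2]
    exact ⟨h3, h4, (κ.exists_ne_iff hφ i j (κ'.h i') h1 h2).2 h5,
      (κ.exists_ne_iff hφ i j (κ'.c j') h1 h2).2 h6⟩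

theorem isOpen_ne (hU : IsOpen U) (hU' : IsOpen U') {φ : OpenPartialHomeomorph M E}
    (hφ : φ ∈ atlas E M) (i j : Fin 2) {α : M → E →L[ℝ] ℝ} (hα : SmoothCov α U') (r t : ℝ) :
    IsOpen {q : E × ℝ × ℝ | (q.1 ∈ φ.target ∧ φ.symm q.1 ∈ U ∧ φ.symm q.1 ∈ U') ∧
      κ.val φ i j α r t q ≠ 0} :=
  (κ.val_smooth hφ i j hα r t).continuousOn.isOpen_inter_preimage (isOpen_base hU hU' φ)
    _root_.isOpen_ne

theorem isOpen_trans_source (hU : IsOpen U) (hU' : IsOpen U') (z₀ z₀' : IntegralElement s I)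
    {φ φ' : OpenPartialHomeomorph M E} (hφ : φ ∈ atlas E M) (i j i' j' : Fin 2) :
    IsOpen ((κ.chart hU z₀ φ i j).symm.trans (κ'.chart hU' z₀' φ' i' j')).source := by
  rw [κ.trans_source κ' hU hU' z₀ z₀' hφ]
  have o1 := (isOpen_base hU φ'.open_source φ)
  have o2 := (κ.isOpen_ne hU hU' hφ i j (κ'.smooth_h i') 1 0).union
    (κ.isOpen_ne hU hU' hφ i j (κ'.smooth_h i') 0 1)
  have o3 := (κ.isOpen_ne hU hU' hφ i j (κ'.smooth_c j') 1 0).union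
    (κ.isOpen_ne hU hU' hφ i j (κ'.smooth_c j') 0 1)
  convert (o1.inter o2).inter o3 using 1
  ext q
  simp only [mem_inter_iff, mem_union, mem_ofPred_eq]
  tauto

/-- The slope, with respect to another coframe, is a smooth function of the coordinates. -/
theorem slope_smooth (hU : IsOpen U) (hU' : IsOpen U') {φ : OpenPartialHomeomorph M E}
    (hφ : φ ∈ atlas E M) (i j : Fin 2) {α β : M → E →L[ℝ] ℝ} (hα : SmoothCov α U')
    (hβ : SmoothCov β U') {T : Set (E × ℝ × ℝ)}
    (hT : ∀ q ∈ T, q.1 ∈ φ.target ∧ φ.symm q.1 ∈ U ∧ φ.symm q.1 ∈ U')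
    (hne : ∀ q ∈ T, κ.val φ i j α 1 0 q ≠ 0 ∨ κ.val φ i j α 0 1 q ≠ 0)
    (hsymm : ∀ q ∈ T, ∀ v ∈ κ.plane (φ.symm q.1) i j q.2.1 q.2.2,
      ∀ w ∈ κ.plane (φ.symm q.1) i j q.2.1 q.2.2,
        α (φ.symm q.1) v * β (φ.symm q.1) w = α (φ.symm q.1) w * β (φ.symm q.1) v) :
    ContDiffOn ℝ ∞ (fun q => slope (α (φ.symm q.1)) (β (φ.symm q.1))
      (κ.plane (φ.symm q.1) i j q.2.1 q.2.2)) T := by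
  have aux : ∀ r t : ℝ, ∀ q ∈ T, κ.val φ i j α r t q ≠ 0 →
      ContDiffWithinAt ℝ ∞ (fun q => slope (α (φ.symm q.1)) (β (φ.symm q.1))
        (κ.plane (φ.symm q.1) i j q.2.1 q.2.2)) T q := by
    intro r t q hq hne
    have hO := κ.isOpen_ne hU hU' hφ i j hα r t
    have hqO : q ∈ {q : E × ℝ × ℝ | (q.1 ∈ φ.target ∧ φ.symm q.1 ∈ U ∧ φ.symm q.1 ∈ U') ∧
      κ.val φ i j α r t q ≠ 0} := ⟨hT q hq, hne⟩
    have hd : ContDiffAt ℝ ∞ (fun q => κ.val φ i j β r t q / κ.val φ i j α r t q) q :=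
      (((κ.val_smooth hφ i j hβ r t).mono fun _ h => h.1).div
        ((κ.val_smooth hφ i j hα r t).mono fun _ h => h.1) fun _ h => h.2).contDiffAt
        (hO.mem_nhds hqO)
    have heq : ∀ q ∈ T, κ.val φ i j α r t q ≠ 0 →
        slope (α (φ.symm q.1)) (β (φ.symm q.1)) (κ.plane (φ.symm q.1) i j q.2.1 q.2.2) =
          κ.val φ i j β r t q / κ.val φ i j α r t q := fun q hq hne =>
      slope_eq (hsymm q hq) (κ.vec_mem hφ (hT q hq).1 (hT q hq).2.1 i j _ _ r t) hne
    refine hd.contDiffWithinAt.congr_of_eventuallyEq ?_ (heq q hq hne)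
    filter_upwards [self_mem_nhdsWithin, mem_nhdsWithin_of_mem_nhds (hO.mem_nhds hqO)] with p hp hp'
    exact heq p hp hp'.2
  intro q hq
  rcases hne q hq with h | h
  exacts [aux _ _ q hq h, aux _ _ q hq h]

theorem contDiffOn_trans (hU : IsOpen U) (hU' : IsOpen U') (z₀ z₀' : IntegralElement s I)
    {φ φ' : OpenPartialHomeomorph M E} (hφ : φ ∈ atlas E M) (hφ' : φ' ∈ atlas E M)
    (i j i' j' : Fin 2) :
    ContDiffOn ℝ ∞ ((κ.chart hU z₀ φ i j).symm.trans (κ'.chart hU' z₀' φ' i' j'))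
      ((κ.chart hU z₀ φ i j).symm.trans (κ'.chart hU' z₀' φ' i' j')).source := by
  rw [κ.trans_source κ' hU hU' z₀ z₀' hφ]
  set T := {q : E × ℝ × ℝ | q.1 ∈ φ.target ∧ φ.symm q.1 ∈ U ∧ φ.symm q.1 ∈ U' ∧
        φ.symm q.1 ∈ φ'.source ∧
        (κ.val φ i j (κ'.h i') 1 0 q ≠ 0 ∨ κ.val φ i j (κ'.h i') 0 1 q ≠ 0) ∧
        (κ.val φ i j (κ'.c j') 1 0 q ≠ 0 ∨ κ.val φ i j (κ'.c j') 0 1 q ≠ 0)} with hT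
  have heq : ∀ q ∈ T, ((κ.chart hU z₀ φ i j).symm.trans (κ'.chart hU' z₀' φ' i' j')) q =
      (φ' (φ.symm q.1),
        slope (κ'.h i' (φ.symm q.1)) (κ'.h (i' + 1) (φ.symm q.1))
          (κ.plane (φ.symm q.1) i j q.2.1 q.2.2),
        slope (κ'.c j' (φ.symm q.1)) (κ'.c (j' + 1) (φ.symm q.1))
          (κ.plane (φ.symm q.1) i j q.2.1 q.2.2)) := by
    rintro q ⟨h1, h2, -⟩
    have key : (κ.chart hU z₀ φ i j).symm q = κ.elem hU h2 i j q.2.1 q.2.2 := dif_pos h2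
    rw [PartialEquiv.coe_trans, Function.comp_apply, key]
    rfl
  refine ContDiffOn.congr ?_ heq
  refine ContDiffOn.prodMk ?_ (ContDiffOn.prodMk ?_ ?_)
  · have h := (contDiffGroupoid ∞ 𝓘(ℝ, E)).compatible hφ hφ'
    rw [contDiffGroupoid, mem_groupoid_of_pregroupoid] at h
    have h1 : ContDiffOn ℝ ∞ (φ' ∘ φ.symm) (φ.symm.trans φ').source := by
      have := h.1
      simpa [contDiffPregroupoid] using this
    exact h1.comp contDiff_fst.contDiffOn fun q hq => by
      rw [OpenPartialHomeomorph.trans_source]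
      exact ⟨hq.1, hq.2.2.2.1⟩
  · refine κ.slope_smooth hU hU' hφ i j (κ'.smooth_h i') (κ'.smooth_h (i' + 1))
      (fun q hq => ⟨hq.1, hq.2.1, hq.2.2.1⟩) (fun q hq => hq.2.2.2.2.1) fun q hq => ?_
    exact κ'.h_symm (z := κ.elem hU hq.2.1 i j q.2.1 q.2.2) hq.2.2.1 i'
  · refine κ.slope_smooth hU hU' hφ i j (κ'.smooth_c j') (κ'.smooth_c (j' + 1))
      (fun q hq => ⟨hq.1, hq.2.1, hq.2.2.1⟩) (fun q hq => hq.2.2.2.2.2) fun q hq => ?_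
    exact κ'.c_symm (z := κ.elem hU hq.2.1 i j q.2.1 q.2.2) hq.2.2.1 j'

end AdaptedCoframe

namespace IntegralElement

/-- Around every integral element there is a chart of the space of integral elements. -/
theorem exists_chart (z : IntegralElement s I) : ∃ e : PartialEquiv (IntegralElement s I) (E × ℝ × ℝ),
    z ∈ e.source ∧ ∃ (U : Set M) (hU : IsOpen U) (κ : AdaptedCoframe s I U)
      (z₀ : IntegralElement s I) (φ : OpenPartialHomeomorph M E) (_ : φ ∈ atlas E M) (i j : Fin 2),
      e = κ.chart hU z₀ φ i j := by
  obtain ⟨U, hU, hz, ⟨κ⟩⟩ := z.hyperbolic_at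
  obtain ⟨i, hi⟩ := κ.exists_h_ne hz
  obtain ⟨j, hj⟩ := κ.exists_c_ne hz
  exact ⟨κ.chart hU z (chartAt E z.pt) i j, ⟨mem_chart_source E z.pt, hz, hi, hj⟩,
    U, hU, κ, z, chartAt E z.pt, chart_mem_atlas E z.pt, i, j, rfl⟩

variable [FiniteDimensional ℝ E] [IsManifold 𝓘(ℝ, E) ∞ M]

/-- The smooth atlas of the space of integral elements, given by the charts
`AdaptedCoframe.chart`. -/
def core (s : ℕ) (I : FormFamily E M) : ChartedSpaceCore (E × ℝ × ℝ) (IntegralElement s I) where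
  atlas := {e | ∃ (U : Set M) (hU : IsOpen U) (κ : AdaptedCoframe s I U)
      (z₀ : IntegralElement s I) (φ : OpenPartialHomeomorph M E) (_ : φ ∈ atlas E M) (i j : Fin 2),
      e = κ.chart hU z₀ φ i j}
  chartAt z := z.exists_chart.choose
  mem_chart_source z := z.exists_chart.choose_spec.1
  chart_mem_atlas z := z.exists_chart.choose_spec.2
  open_source := by
    rintro _ _ ⟨U, hU, κ, z₀, φ, hφ, i, j, rfl⟩ ⟨U', hU', κ', z₀', φ', hφ', i', j', rfl⟩
    exact κ.isOpen_trans_source κ' hU hU' z₀ z₀' hφ i j i' j'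
  continuousOn_toFun := by
    rintro _ _ ⟨U, hU, κ, z₀, φ, hφ, i, j, rfl⟩ ⟨U', hU', κ', z₀', φ', hφ', i', j', rfl⟩
    exact (κ.contDiffOn_trans κ' hU hU' z₀ z₀' hφ hφ' i j i' j').continuousOn

instance : TopologicalSpace (IntegralElement s I) := (core s I).toTopologicalSpace

instance : ChartedSpace (E × ℝ × ℝ) (IntegralElement s I) := (core s I).toChartedSpace

instance : IsManifold 𝓘(ℝ, E × ℝ × ℝ) ∞ (IntegralElement s I) := by
  refine isManifold_of_contDiffOn _ _ _ ?_
  intro e e' he he'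
  obtain ⟨f, hf, hef⟩ : ∃ f, ∃ hf : f ∈ (core s I).atlas,
      e = (core s I).openPartialHomeomorph f hf := by
    simpa only [mem_iUnion, mem_singleton_iff] using (show e ∈ ⋃ (f : _) (hf : f ∈ (core s I).atlas),
      {(core s I).openPartialHomeomorph f hf} from he)
  obtain ⟨f', hf', hef'⟩ : ∃ f, ∃ hf : f ∈ (core s I).atlas,
      e' = (core s I).openPartialHomeomorph f hf := by
    simpa only [mem_iUnion, mem_singleton_iff] using (show e' ∈ ⋃ (f : _) (hf : f ∈ (core s I).atlas),
      {(core s I).openPartialHomeomorph f hf} from he')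
  obtain ⟨U, hU, κ, z₀, φ, hφ, i, j, rfl⟩ := hf
  obtain ⟨U', hU', κ', z₀', φ', hφ', i', j', rfl⟩ := hf'
  have h := κ.contDiffOn_trans κ' hU hU' z₀ z₀' hφ hφ' i j i' j'
  rw [hef, hef']
  simpa only [OpenPartialHomeomorph.coe_trans, modelWithCornersSelf_coe, modelWithCornersSelf_coe_symm,
    Function.id_comp, Function.comp_id, range_id, inter_univ, preimage_id] using! h

end IntegralElement

end Prolongation

section ProlongedSystem

variable {E : Type*} [NormedAddCommGroup E] [NormedSpace ℝ E] [FiniteDimensional ℝ E]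
  {M : Type*} [TopologicalSpace M] [ChartedSpace E M] [IsManifold 𝓘(ℝ, E) ∞ M]

/-- The canonical (contact) system on the space of integral elements: at `z` it is spanned by the
pullbacks of the covectors that vanish on the plane `z`. -/
def contactSystem (s : ℕ) (I : FormFamily E M) (z : IntegralElement s I) :
    Submodule ℝ ((E × ℝ × ℝ) →L[ℝ] ℝ) :=
  Submodule.span ℝ ((fun α : E →L[ℝ] ℝ =>
    α.comp (tmap (fun z : IntegralElement s I => z.pt) z : (E × ℝ × ℝ) →L[ℝ] E)) ''
      {α | ∀ v ∈ z.plane, α v = 0})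

/-- The prolongation `I^[1]` of `I`, an exterior differential system on the space of 2-dimensional
integral elements. -/
def prolong (s : ℕ) (I : FormFamily E M) : FormFamily (E × ℝ × ℝ) (IntegralElement s I) :=
  pfaffian (contactSystem s I)

end ProlongedSystem

section ProlongedMap

variable {E : Type*} [NormedAddCommGroup E] [NormedSpace ℝ E]
  {M : Type*} [TopologicalSpace M] [ChartedSpace E M]
  {E' : Type*} [NormedAddCommGroup E'] [NormedSpace ℝ E']
  {M' : Type*} [TopologicalSpace M'] [ChartedSpace E' M']

/-- The map `p^[1]` induced by an integrable extension `p : (B, N) → (I, M)` between the spaces of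
integral elements: it sends a plane `P` at `x` to the plane `p_*(P)` at `p x`. -/
def prolongMap {sB sI : ℕ} {p : M → M'} {B : FormFamily E M} {I : FormFamily E' M'}
    (hI : IsHyperbolicOn sI I univ) (hp : IsIntegrableExtensionOn p B I univ)
    (z : IntegralElement sB B) : IntegralElement sI I where
  pt := p z.pt
  plane := z.plane.map (tmap p z.pt : E →L[ℝ] E').toLinearMap
  finrank_plane := by
    obtain ⟨J, hJ⟩ := hp.admissible
    have hx : z.pt ∈ univ := mem_univ _
    rw [← z.finrank_plane]
    let f : z.plane →ₗ[ℝ] E' := (tmap p z.pt : E →L[ℝ] E').toLinearMap.domRestrict z.plane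
    have hf : Function.Injective f := by
      rw [injective_iff_map_eq_zero]
      intro v hv
      have h1 : (v : E) ∈ annih (J z.pt) := by
        intro α hα
        refine z.integral 1 (ofOne α) ?_ (fun _ => v) fun _ => v.2
        rw [hJ.generate z.pt hx]
        exact subset_algIdeal _ _ (Or.inl ⟨α, hα, rfl⟩)
      have h2 : (v : E) ∈ (vertical E' p z.pt : Submodule ℝ E) := hv
      exact Subtype.ext ((hJ.transverse z.pt hx).disjoint.le_bot ⟨h1, h2⟩)
    rw [← LinearMap.range_domRestrict]
    exact (LinearEquiv.ofInjective f hf).finrank_eq.symm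
  integral := by
    obtain ⟨J, hJ⟩ := hp.admissible
    intro q η hη v hv
    choose w hw hwv using hv
    have h : η.compContinuousLinearMap (tmap p z.pt) ∈ B q z.pt := by
      rw [hJ.generate z.pt (mem_univ _)]
      exact subset_algIdeal _ _ (Or.inr ⟨η, hη, rfl⟩)
    have := z.integral q _ h w hw
    rw [← this, ContinuousAlternatingMap.compContinuousLinearMap_apply]
    congr 1
    exact (funext hwv).symm
  hyperbolic_at := by
    obtain ⟨U, hU, hx, hκ⟩ := hI (p z.pt) (mem_univ _)
    exact ⟨U, hU, hx, hκ⟩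

end ProlongedMap

/-! ### The wave equation -/

/-- The space `J^1(ℝ^2, ℝ)`, with coordinates `(x, y, u, u_x, u_y)` numbered from `0` to `4`. -/
abbrev J1 := EuclideanSpace ℝ (Fin 5)

/-- The coordinate differentials on `J1`. -/
def dc (i : Fin 5) : J1 →L[ℝ] ℝ := EuclideanSpace.proj i

/-- The contact form `du - u_x dx - u_y dy`. -/
def waveContact (m : J1) : J1 →L[ℝ] ℝ := dc 2 - m 3 • dc 0 - m 4 • dc 1

/-- The standard Monge-Ampère system of the wave equation `u_xy = 0`:
`⟨du - u_x dx - u_y dy, du_x ∧ dx, du_y ∧ dy⟩_alg`. -/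
def wave : FormFamily J1 J1 := fun p m => algIdeal (fun q => oneForms {waveContact m} q ∪
  twoForms {wedge (dc 3) (ofOne (dc 0)), wedge (dc 4) (ofOne (dc 1))} q) p

theorem chartCov_self {F : Type*} [NormedAddCommGroup F] [NormedSpace ℝ F] (α : J1 → J1 →L[ℝ] F) :
    chartCov (OpenPartialHomeomorph.refl J1) α = α := by
  funext y
  have : (tmap (OpenPartialHomeomorph.refl J1).symm y : J1 →L[ℝ] J1) =
      ContinuousLinearMap.id ℝ J1 := mfderiv_id
  rw [chartCov, this]
  rfl

theorem smoothCov_self {F : Type*} [NormedAddCommGroup F] [NormedSpace ℝ F] {α : J1 → J1 →L[ℝ] F}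
    (h : ContDiff ℝ ∞ α) (U : Set J1) : SmoothCov α U := by
  intro e he
  obtain rfl := chartedSpaceSelf_atlas.1 he
  rw [chartCov_self]
  exact h.contDiffOn

/-- The adapted coframe `θ, du_x, dx, du_y, dy`. -/
def waveCoframe : AdaptedCoframe 1 wave univ where
  θ := fun _ m => waveContact m
  h := fun i _ => dc (![3, 0] i)
  c := fun i _ => dc (![4, 1] i)
  smooth_θ := by
    intro i
    refine smoothCov_self ?_ _
    have hc : ∀ k : Fin 5, ContDiff ℝ ∞ fun m : J1 => m k := fun k =>
      (EuclideanSpace.proj k : J1 →L[ℝ] ℝ).contDiff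
    exact (contDiff_const.sub ((hc 3).smul contDiff_const)).sub ((hc 4).smul contDiff_const)
  smooth_h := fun i => smoothCov_self contDiff_const _
  smooth_c := fun i => smoothCov_self contDiff_const _
  coframe := by
    intro m _
    have hθ : ∀ v : J1, waveContact m v = v 2 - m 3 * v 0 - m 4 * v 1 := fun v => rfl
    have hd : ∀ (k : Fin 5) (v : J1), dc k v = v k := fun k v => rfl
    constructor
    · intro v w hvw
      simp only [Prod.mk.injEq, funext_iff, Fin.forall_fin_two, hθ, hd] at hvw
      obtain ⟨h1, ⟨h2, h3⟩, h4, h5⟩ := hvw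
      have h1 := h1 0
      simp at h2 h3 h4 h5
      rw [h3, h5] at h1
      ext k
      fin_cases k
      · exact h3
      · exact h5
      · simpa using h1
      · exact h2
      · exact h4
    · rintro ⟨r, f, g⟩
      refine ⟨!₂[f 1, g 1, r 0 + m 3 * f 1 + m 4 * g 1, f 0, g 0], ?_⟩
      refine Prod.ext (funext fun k => ?_) (Prod.ext (funext fun k => ?_) (funext fun k => ?_))
      · fin_cases k
        simp [hθ]
        ring
      · fin_cases k <;> simp [hd]
      · fin_cases k <;> simp [hd]
  generate := by
    intro m _ p
    have : (range fun _ : Fin 1 => waveContact m) = {waveContact m} := range_const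
    simp only [this]
    rfl

theorem wave_hyperbolic : IsHyperbolicOn 1 wave univ :=
  fun _ _ => ⟨univ, isOpen_univ, mem_univ _, ⟨waveCoframe⟩⟩

/-- The set `Ñ` of the points of `U` at which the `p`-semibasic elements of `Zh^∞` and of `Zc^∞`
form spaces of dimension two. -/
def semibasicRankTwo {E : Type*} [NormedAddCommGroup E] [NormedSpace ℝ E]
    {M : Type*} [TopologicalSpace M] [ChartedSpace E M]
    (E' : Type*) [NormedAddCommGroup E'] [NormedSpace ℝ E']
    {M' : Type*} [TopologicalSpace M'] [ChartedSpace E' M'] (p : M → M')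
    (Zh Zc : M → Submodule ℝ (E →L[ℝ] ℝ)) (U : Set M) : Set M :=
  {x | x ∈ U ∧
    finrank ℝ (firstIntegrals Zh x ⊓ semibasic E' p x : Submodule ℝ (E →L[ℝ] ℝ)) = 2 ∧
    finrank ℝ (firstIntegrals Zc x ⊓ semibasic E' p x : Submodule ℝ (E →L[ℝ] ℝ)) = 2}

end

end Darboux

open Darboux

/-! Everything rests on counting the first integrals of the singular systems of `B` and of its
prolongation.

Since `B` extends the wave equation, one of its singular systems contains the pullbacks of `dx` and
`du_x`, the other those of `dy` and `du_y`. Since `B` also extends `I₂`, whose singular systems have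
one first integral each, and the fibres are one-dimensional, neither can have more than two
(`not_linearIndependent_firstIntegrals`). Indeed, if a first integral is not constant along the
fibres of `p₂`, its level sets are local sections of `p₂`. The remaining first integrals, restricted
to such a section, are first integrals of the system downstairs, because a semibasic covector in `J
⊕ p^*V` already lies in `p^*V` (`exists_le_finrank`).

On the space of integral elements the new coordinates are the slopes. If the characteristic forms of
a coframe are exact, equal to `dH` and `dC`, the contact form `dH_{i+1} - sh dH_i` has exterior
derivative `dH_i ∧ d(sh)`. Hence the prolongation again has an adapted coframe with exact
characteristic forms, `dH_i, d(sh)` and `dC_j, d(sc)` (`prolongCoframe`). The prolongation of an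
extension is an extension by the pullback of `J` (`prolong_admissible`), so each singular system of
the prolonged `B` has three independent first integrals pulled back by the prolongation of `p₁`: for
the wave equation `x`, `u_x` and the slope of `du_x` against `dx`, and likewise for `y`.

There are no others. A first integral `f` of the first singular system does not depend on the second
slope. With the first slope frozen it becomes a function `F` on `N`. For every second slope in an
interval, `dF` kills the corresponding characteristic line; these lines span the plane on which `θ`
and the first pair vanish, so `F` is a first integral of `B` (`exists_descent`). By the bound, `dF`
is a combination of the two `dH`, and `df` is a combination of three known differentials
(`firstIntegrals_eq`). The ranks are therefore exactly three, and the prolonged `B` is Darboux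
integrable.

All these first integrals are semibasic for the prolongation of `p₁`, so its fibres lie in their
annihilators and condition [i] fails at every point. For the prolongation of `p₂`, `3 = 1 + 2` is
condition [ii], while [i] says that not all first integrals are semibasic (`vertical_inf_annih`),
which is the same as the semibasic ones having dimension two. This is an open condition. It is also
dense: if all three were semibasic on an open set, they would descend to three independent first
integrals of a system that has two (`exists_not_semibasic`). `Ñ` is the intersection of the two open
dense sets so obtained.

Singular systems are determined only up to interchange. `eventually_eq_or_swap` shows that the order
is locally constant, so the argument covers every choice of singular pair. -/

set_option linter.unusedSectionVars false

namespace Darboux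

noncomputable section

/-! ### Smoothness of form-valued maps in finite dimension -/

section Linear

variable {E : Type*} [NormedAddCommGroup E] [NormedSpace ℝ E] [FiniteDimensional ℝ E]
  {E' : Type*} [NormedAddCommGroup E'] [NormedSpace ℝ E']
  {F : Type*} [NormedAddCommGroup F] [NormedSpace ℝ F]

/-- The values of a form on the tuples of basis vectors. -/
def evalBasis (E : Type*) [NormedAddCommGroup E] [NormedSpace ℝ E] [FiniteDimensional ℝ E] (p : ℕ) :
    (E [⋀^Fin p]→L[ℝ] ℝ) →L[ℝ] ((Fin p → Fin (finrank ℝ E)) → ℝ) :=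
  ContinuousLinearMap.pi fun σ =>
    ContinuousAlternatingMap.apply ℝ E ℝ fun k => finBasis ℝ E (σ k)

theorem evalBasis_injective (p : ℕ) : Function.Injective (evalBasis E p) := by
  intro η η' h
  refine ContinuousAlternatingMap.toAlternatingMap_injective
    (Basis.ext_alternating (finBasis ℝ E) fun σ _ => ?_)
  exact congrFun h σ

instance finiteDimensional_forms (p : ℕ) : FiniteDimensional ℝ (E [⋀^Fin p]→L[ℝ] ℝ) :=
  FiniteDimensional.of_injective (evalBasis E p).toLinearMap (evalBasis_injective p)

/-- A linear left inverse of `evalBasis` recovers a form from its finitely many values on tuples of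
basis vectors, so smoothness of these values suffices. -/
theorem contDiffWithinAt_form {p : ℕ} {f : F → E [⋀^Fin p]→L[ℝ] ℝ} {s : Set F} {x : F}
    (h : ∀ v : Fin p → E, ContDiffWithinAt ℝ ∞ (fun y => f y v) s x) :
    ContDiffWithinAt ℝ ∞ f s x := by
  obtain ⟨g, hg⟩ := (evalBasis E p).toLinearMap.exists_leftInverse_of_injective
    (LinearMap.ker_eq_bot.2 (evalBasis_injective p))
  have h1 : ContDiffWithinAt ℝ ∞ (fun y => evalBasis E p (f y)) s x :=
    contDiffWithinAt_pi.2 fun σ => h _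
  have h2 := (LinearMap.toContinuousLinearMap g).contDiff.comp_contDiffWithinAt (x := x) h1
  refine h2.congr_of_eventuallyEq (Filter.Eventually.of_forall fun y => ?_) ?_
  all_goals exact (LinearMap.congr_fun hg _).symm

/-- Multilinear expansion of the arguments in a basis writes the value as a finite sum of products
of smooth functions. -/
theorem contDiffWithinAt_form_apply {p : ℕ} {f : F → E [⋀^Fin p]→L[ℝ] ℝ} {s : Set F} {x : F}
    {v : Fin p → F → E} (hf : ContDiffWithinAt ℝ ∞ f s x)
    (hv : ∀ k, ContDiffWithinAt ℝ ∞ (v k) s x) :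
    ContDiffWithinAt ℝ ∞ (fun y => f y fun k => v k y) s x := by
  classical
  set b := finBasis ℝ E
  have key : ∀ y, f y (fun k => v k y) = ∑ σ : Fin p → Fin (finrank ℝ E),
      (∏ k, b.repr (v k y) (σ k)) * f y fun k => b (σ k) := by
    intro y
    conv_lhs => rw [show (fun k => v k y) = fun k => ∑ i, b.repr (v k y) i • b i from
      funext fun k => (b.sum_repr (v k y)).symm]
    have h1 := (f y).toMultilinearMap.map_sum (fun k i => b.repr (v k y) i • b i)
    refine h1.trans (Finset.sum_congr rfl fun σ _ => ?_)
    exact (f y).toMultilinearMap.map_smul_univ (fun k => b.repr (v k y) (σ k)) fun k => b (σ k)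
  simp only [key]
  refine ContDiffWithinAt.sum fun σ _ => ContDiffWithinAt.mul ?_ ?_
  · refine contDiffWithinAt_prod fun k _ => ?_
    exact (LinearMap.toContinuousLinearMap (b.coord (σ k))).contDiff.comp_contDiffWithinAt
      (x := x) (hv k)
  · exact (ContinuousAlternatingMap.apply ℝ E ℝ fun k => b (σ k)).contDiff.comp_contDiffWithinAt
      (x := x) hf

theorem contDiffWithinAt_comp {p : ℕ} [FiniteDimensional ℝ E'] {f : F → E' [⋀^Fin p]→L[ℝ] ℝ}
    {A : F → E →L[ℝ] E'} {s : Set F} {x : F} (hf : ContDiffWithinAt ℝ ∞ f s x)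
    (hA : ContDiffWithinAt ℝ ∞ A s x) :
    ContDiffWithinAt ℝ ∞ (fun y => (f y).compContinuousLinearMap (A y)) s x :=
  contDiffWithinAt_form fun v => contDiffWithinAt_form_apply (v := fun k y => A y (v k)) hf
    fun _ => hA.clm_apply contDiffWithinAt_const

/-- The exterior product by a covector as a bilinear map. -/
def wedgeL (p : ℕ) :
    (E →L[ℝ] ℝ) →L[ℝ] (E [⋀^Fin p]→L[ℝ] ℝ) →L[ℝ] (E [⋀^Fin (p + 1)]→L[ℝ] ℝ) :=
  (ContinuousLinearMap.compL ℝ _ _ _ (ContinuousAlternatingMap.alternatizeUncurryFinCLM ℝ E ℝ)).comp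
    (ContinuousLinearMap.smulRightL ℝ E (E [⋀^Fin p]→L[ℝ] ℝ))

omit [FiniteDimensional ℝ E] in
theorem wedgeL_apply {p : ℕ} (α : E →L[ℝ] ℝ) (η : E [⋀^Fin p]→L[ℝ] ℝ) :
    wedgeL p α η = wedge α η := rfl

end Linear
-- Leibniz rules for the exterior derivative in a vector space
section ExtDeriv

variable {E : Type*} [NormedAddCommGroup E] [NormedSpace ℝ E]

theorem wedge_smul {p : ℕ} (α : E →L[ℝ] ℝ) (c : ℝ) (η : E [⋀^Fin p]→L[ℝ] ℝ) :
    wedge α (c • η) = c • wedge α η := by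
  simp only [← wedgeL_apply, map_smul]

theorem smul_wedge {p : ℕ} (c : ℝ) (α : E →L[ℝ] ℝ) (η : E [⋀^Fin p]→L[ℝ] ℝ) :
    wedge (c • α) η = c • wedge α η := by
  simp only [← wedgeL_apply, map_smul, smul_apply]

theorem sum_wedge {p : ℕ} {ι : Type*} (t : Finset ι) (α : ι → E →L[ℝ] ℝ)
    (η : E [⋀^Fin p]→L[ℝ] ℝ) : wedge (∑ i ∈ t, α i) η = ∑ i ∈ t, wedge (α i) η := by
  simp only [← wedgeL_apply, map_sum, sum_apply]

theorem extDeriv_mul_smul {p : ℕ} {g : E → ℝ} {η : E → E [⋀^Fin p]→L[ℝ] ℝ} {x : E}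
    (hg : DifferentiableAt ℝ g x) (hη : DifferentiableAt ℝ η x) :
    extDeriv (fun y => g y • η y) x = wedge (fderiv ℝ g x) (η x) + g x • extDeriv η x := by
  rw [extDeriv, fderiv_fun_smul hg hη, ContinuousAlternatingMap.alternatizeUncurryFin_add,
    ContinuousAlternatingMap.alternatizeUncurryFin_smul]
  exact add_comm _ _

theorem minSmoothness_le_infty : minSmoothness ℝ 2 ≤ (∞ : WithTop ℕ∞) := by
  rw [minSmoothness_of_isRCLikeNormedField]
  exact WithTop.coe_le_coe.2 (le_top : (2 : ℕ∞) ≤ ⊤)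

theorem contDiffAt_extDeriv {p : ℕ} {η : E → E [⋀^Fin p]→L[ℝ] ℝ} {x : E}
    (hη : ContDiffAt ℝ ∞ η x) : ContDiffAt ℝ ∞ (extDeriv η) x := by
  have h := hη.fderiv_right (m := ∞) le_rfl
  exact ContDiffAt.comp (g := ContinuousAlternatingMap.alternatizeUncurryFinCLM ℝ E ℝ) x
    (ContinuousLinearMap.contDiff _).contDiffAt h

/-- Apply `d` twice to `g η`: since `d(g η) = dg ∧ η + g dη`, the identity `d ∘ d = 0`, used for `g
η` and for `η`, leaves `d(dg ∧ η) + dg ∧ dη = 0`. -/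
theorem extDeriv_wedge_fderiv {p : ℕ} {g : E → ℝ} {η : E → E [⋀^Fin p]→L[ℝ] ℝ} {x : E}
    (hg : ContDiffAt ℝ ∞ g x) (hη : ContDiffAt ℝ ∞ η x) (hd : ∀ᶠ y in 𝓝 x, DifferentiableAt ℝ g y)
    (hd' : ∀ᶠ y in 𝓝 x, DifferentiableAt ℝ η y) :
    extDeriv (fun y => wedge (fderiv ℝ g y) (η y)) x = - wedge (fderiv ℝ g x) (extDeriv η x) := by
  have hη' := contDiffAt_extDeriv hη
  have hev : (fun y => wedge (fderiv ℝ g y) (η y)) =ᶠ[𝓝 x]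
      fun y => extDeriv (fun y => g y • η y) y + (-1 : ℝ) • (g y • extDeriv η y) := by
    filter_upwards [hd, hd'] with y h h'
    rw [extDeriv_mul_smul h h', neg_smul, one_smul, add_neg_cancel_right]
  have hs : ContDiffAt ℝ ∞ (fun y => g y • η y) x := hg.smul hη
  have hds := contDiffAt_extDeriv hs
  have hgη : ContDiffAt ℝ ∞ (fun y => g y • extDeriv η y) x := hg.smul hη'
  have h1 : (∞ : WithTop ℕ∞) ≠ 0 := by simp
  rw [hev.extDeriv_eq, extDeriv_fun_add (hds.differentiableAt h1)
    ((hgη.const_smul (-1 : ℝ)).differentiableAt h1)]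
  have h2 := extDeriv_fun_smul (x := x) (-1 : ℝ) (fun y => g y • extDeriv η y)
  rw [show extDeriv (fun y => (-1 : ℝ) • (g y • extDeriv η y)) x = _ from h2,
    extDeriv_extDeriv_apply (r := ∞) hs minSmoothness_le_infty,
    extDeriv_mul_smul (hg.differentiableAt h1) (hη'.differentiableAt h1),
    extDeriv_extDeriv_apply (r := ∞) hη minSmoothness_le_infty, smul_zero, add_zero, zero_add, neg_smul, one_smul]

end ExtDeriv

/-! ### Tangent maps and charts -/

section Tangent

variable {E : Type*} [NormedAddCommGroup E] [NormedSpace ℝ E]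
  {E' : Type*} [NormedAddCommGroup E'] [NormedSpace ℝ E']
  {E'' : Type*} [NormedAddCommGroup E''] [NormedSpace ℝ E'']
  {M : Type*} [TopologicalSpace M] [ChartedSpace E M]
  {M' : Type*} [TopologicalSpace M'] [ChartedSpace E' M']
  {M'' : Type*} [TopologicalSpace M''] [ChartedSpace E'' M'']

theorem tmap_comp {g : M' → M''} {f : M → M'} {x : M}
    (hg : MDifferentiableAt 𝓘(ℝ, E') 𝓘(ℝ, E'') g (f x))
    (hf : MDifferentiableAt 𝓘(ℝ, E) 𝓘(ℝ, E') f x) :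
    tmap (fun y => g (f y)) x = (tmap g (f x) : E' →L[ℝ] E'').comp (tmap f x : E →L[ℝ] E') :=
  mfderiv_comp x hg hf

theorem tmap_congr {f g : M → M'} {x : M} (h : f =ᶠ[𝓝 x] g) :
    (tmap f x : E →L[ℝ] E') = tmap g x :=
  h.mfderiv_eq

theorem tmap_id (x : M) : (tmap (fun y : M => y) x : E →L[ℝ] E) = ContinuousLinearMap.id ℝ E :=
  mfderiv_id

theorem tmap_eq_fderiv (f : E → E') (x : E) : (tmap f x : E →L[ℝ] E') = fderiv ℝ f x :=
  mfderiv_eq_fderiv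

theorem _root_.ContMDiffAt.mdiff {f : M → M'} {x : M}
    (h : ContMDiffAt 𝓘(ℝ, E) 𝓘(ℝ, E') ∞ f x) : MDifferentiableAt 𝓘(ℝ, E) 𝓘(ℝ, E') f x :=
  h.mdifferentiableAt (by simp)

variable [IsManifold 𝓘(ℝ, E) ∞ M] [IsManifold 𝓘(ℝ, E') ∞ M']

theorem chart_smoothAt {e : OpenPartialHomeomorph M E} (he : e ∈ atlas E M) {x : M}
    (hx : x ∈ e.source) : ContMDiffAt 𝓘(ℝ, E) 𝓘(ℝ, E) ∞ e x :=
  (contMDiffOn_of_mem_maximalAtlas (IsManifold.subset_maximalAtlas he)).contMDiffAt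
    (e.open_source.mem_nhds hx)

theorem chart_symm_smoothAt {e : OpenPartialHomeomorph M E} (he : e ∈ atlas E M) {y : E}
    (hy : y ∈ e.target) : ContMDiffAt 𝓘(ℝ, E) 𝓘(ℝ, E) ∞ e.symm y :=
  (contMDiffOn_symm_of_mem_maximalAtlas (IsManifold.subset_maximalAtlas he)).contMDiffAt
    (e.open_target.mem_nhds hy)

theorem tmap_symm_comp {e : OpenPartialHomeomorph M E} (he : e ∈ atlas E M) {x : M}
    (hx : x ∈ e.source) :
    (tmap e.symm (e x) : E →L[ℝ] E).comp (tmap e x : E →L[ℝ] E) = ContinuousLinearMap.id ℝ E := by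
  rw [← tmap_comp (chart_symm_smoothAt he (e.map_source hx)).mdiff (chart_smoothAt he hx).mdiff,
    ← tmap_id x]
  refine tmap_congr ?_
  filter_upwards [e.open_source.mem_nhds hx] with y hy using e.left_inv hy

theorem tmap_comp_symm {e : OpenPartialHomeomorph M E} (he : e ∈ atlas E M) {y : E}
    (hy : y ∈ e.target) :
    (tmap e (e.symm y) : E →L[ℝ] E).comp (tmap e.symm y : E →L[ℝ] E) =
      ContinuousLinearMap.id ℝ E := by
  rw [← tmap_comp (chart_smoothAt he (e.map_target hy)).mdiff (chart_symm_smoothAt he hy).mdiff,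
    ← tmap_id y]
  refine tmap_congr ?_
  filter_upwards [e.open_target.mem_nhds hy] with z hz using e.right_inv hz

end Tangent

/-! ### Smooth forms on a manifold and their pullbacks -/

section Forms

variable {E : Type*} [NormedAddCommGroup E] [NormedSpace ℝ E]
  {E' : Type*} [NormedAddCommGroup E'] [NormedSpace ℝ E']
  {M : Type*} [TopologicalSpace M] [ChartedSpace E M]
  {M' : Type*} [TopologicalSpace M'] [ChartedSpace E' M']

theorem SmoothForm.mono {p : ℕ} {η : M → E [⋀^Fin p]→L[ℝ] ℝ} {U U' : Set M}
    (h : SmoothForm η U) (hU : U' ⊆ U) : SmoothForm η U' :=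
  fun e he => (h e he).mono fun _ hy => ⟨hy.1, hU hy.2⟩

theorem SmoothForm.contDiffAt {p : ℕ} {η : M → E [⋀^Fin p]→L[ℝ] ℝ} {U : Set M}
    (h : SmoothForm η U) (hU : IsOpen U) {e : OpenPartialHomeomorph M E} (he : e ∈ atlas E M) {y : E}
    (hy : y ∈ e.target) (hyU : e.symm y ∈ U) : ContDiffAt ℝ ∞ (chartForm e η) y :=
  (h e he).contDiffAt ((e.isOpen_inter_preimage_symm hU).mem_nhds ⟨hy, hyU⟩)

theorem smoothForm_of_contDiffAt {p : ℕ} {η : M → E [⋀^Fin p]→L[ℝ] ℝ} {U : Set M}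
    (h : ∀ e ∈ atlas E M, ∀ y ∈ e.target, e.symm y ∈ U → ContDiffAt ℝ ∞ (chartForm e η) y) :
    SmoothForm η U :=
  fun e he y hy => (h e he y hy.1 hy.2).contDiffWithinAt

theorem ofOne_injective : Function.Injective (ofOne : (E →L[ℝ] ℝ) → _) :=
  (ContinuousAlternatingMap.ofSubsingleton ℝ E ℝ 0).injective

/-- `ofOne` as a linear map. -/
def ofOneL (E : Type*) [NormedAddCommGroup E] [NormedSpace ℝ E] :
    (E →L[ℝ] ℝ) ≃ₗᵢ[ℝ] E [⋀^Fin 1]→L[ℝ] ℝ :=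
  ContinuousAlternatingMap.ofSubsingletonLIE (0 : Fin 1)

theorem ofOne_add (α β : E →L[ℝ] ℝ) : ofOne (α + β) = ofOne α + ofOne β :=
  map_add (ofOneL E) α β

theorem ofOne_smul (c : ℝ) (α : E →L[ℝ] ℝ) : ofOne (c • α) = c • ofOne α :=
  map_smul (ofOneL E) c α

theorem ofOne_sum {ι : Type*} (t : Finset ι) (α : ι → E →L[ℝ] ℝ) :
    ofOne (∑ i ∈ t, α i) = ∑ i ∈ t, ofOne (α i) :=
  map_sum (ofOneL E) α t

theorem ofOne_comp (α : E' →L[ℝ] ℝ) (L : E →L[ℝ] E') :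
    (ofOne α).compContinuousLinearMap L = ofOne (α.comp L) := rfl

theorem wedge_comp {p : ℕ} (α : E' →L[ℝ] ℝ) (η : E' [⋀^Fin p]→L[ℝ] ℝ) (L : E →L[ℝ] E') :
    (wedge α η).compContinuousLinearMap L =
      wedge (α.comp L) (η.compContinuousLinearMap L) := by
  ext v
  rw [ContinuousAlternatingMap.compContinuousLinearMap_apply, wedge_apply, wedge_apply]
  rfl

theorem smoothCov_iff {α : M → E →L[ℝ] ℝ} {U : Set M} :
    SmoothCov α U ↔ SmoothForm (fun y => ofOne (α y)) U := by
  refine forall₂_congr fun e _ => ?_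
  exact ((ofOneL E).toContinuousLinearEquiv.comp_contDiffOn_iff (f := chartCov e α)).symm

theorem chartForm_add {p : ℕ} (e : OpenPartialHomeomorph M E) (η η' : M → E [⋀^Fin p]→L[ℝ] ℝ) :
    chartForm e (fun y => η y + η' y) = fun y => chartForm e η y + chartForm e η' y := rfl

theorem chartForm_smul {p : ℕ} (e : OpenPartialHomeomorph M E) (g : M → ℝ)
    (η : M → E [⋀^Fin p]→L[ℝ] ℝ) :
    chartForm e (fun y => g y • η y) = fun y => g (e.symm y) • chartForm e η y := rfl

theorem chartForm_wedge {p : ℕ} (e : OpenPartialHomeomorph M E) (α : M → E →L[ℝ] ℝ)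
    (η : M → E [⋀^Fin p]→L[ℝ] ℝ) :
    chartForm e (fun y => wedge (α y) (η y)) = fun y => wedge (chartCov e α y) (chartForm e η y) :=
  funext fun _ => wedge_comp _ _ _

theorem SmoothForm.add {p : ℕ} {η η' : M → E [⋀^Fin p]→L[ℝ] ℝ} {U : Set M}
    (h : SmoothForm η U) (h' : SmoothForm η' U) : SmoothForm (fun y => η y + η' y) U :=
  fun e he => (h e he).add (h' e he)

theorem SmoothForm.wedge {p : ℕ} {α : M → E →L[ℝ] ℝ} {η : M → E [⋀^Fin p]→L[ℝ] ℝ} {U : Set M}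
    (h : SmoothCov α U) (h' : SmoothForm η U) : SmoothForm (fun y => wedge (α y) (η y)) U := by
  intro e he
  rw [chartForm_wedge]
  exact ((wedgeL p).contDiff.comp_contDiffOn (h e he)).clm_apply (h' e he)

/-- The pullback of a form by a map. -/
def pullForm {p : ℕ} (f : M → M') (η : M' → E' [⋀^Fin p]→L[ℝ] ℝ) : M → E [⋀^Fin p]→L[ℝ] ℝ :=
  fun y => (η (f y)).compContinuousLinearMap (tmap f y)

/-- The pullback of a field of covectors by a map. -/
def pull (f : M → M') (α : M' → E' →L[ℝ] ℝ) : M → E →L[ℝ] ℝ :=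
  fun y => (α (f y)).comp (tmap f y)

variable [IsManifold 𝓘(ℝ, E) ∞ M] [IsManifold 𝓘(ℝ, E') ∞ M']

theorem smoothAt_symm {f : M → M'} {e : OpenPartialHomeomorph M E} (he : e ∈ atlas E M) {y : E}
    (hy : y ∈ e.target) (hf : ContMDiffAt 𝓘(ℝ, E) 𝓘(ℝ, E') ∞ f (e.symm y)) :
    ContMDiffAt 𝓘(ℝ, E) 𝓘(ℝ, E') ∞ (fun y => f (e.symm y)) y :=
  hf.comp y (chart_symm_smoothAt he hy)

theorem SmoothForm.smul {p : ℕ} {g : M → ℝ} {η : M → E [⋀^Fin p]→L[ℝ] ℝ} {U : Set M} (hU : IsOpen U)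
    (h : ContMDiffOn 𝓘(ℝ, E) 𝓘(ℝ, ℝ) ∞ g U) (h' : SmoothForm η U) :
    SmoothForm (fun y => g y • η y) U := by
  refine smoothForm_of_contDiffAt fun e he y hy hyU => ?_
  exact (smoothAt_symm he hy (h.contMDiffAt (hU.mem_nhds hyU))).contDiffAt.smul
    (h'.contDiffAt hU he hy hyU)

/-- The expression in charts of a map. -/
def rep (e : OpenPartialHomeomorph M E) (e' : OpenPartialHomeomorph M' E') (f : M → M') : E → E' :=
  fun y => e' (f (e.symm y))

theorem rep_smooth {f : M → M'} {e : OpenPartialHomeomorph M E} (he : e ∈ atlas E M)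
    {e' : OpenPartialHomeomorph M' E'} (he' : e' ∈ atlas E' M') {y : E} (hy : y ∈ e.target)
    (hf : ContMDiffAt 𝓘(ℝ, E) 𝓘(ℝ, E') ∞ f (e.symm y)) (hy' : f (e.symm y) ∈ e'.source) :
    ContDiffAt ℝ ∞ (rep e e' f) y :=
  ((chart_smoothAt he' hy').comp (f := fun y => f (e.symm y)) y (smoothAt_symm he hy hf)).contDiffAt

/-- Chain rule applied to `e'.symm ∘ rep e e' f = f ∘ e.symm`, an identity that holds near `y`
because `f (e.symm y)` lies in the open source of `e'`. -/
theorem tmap_symm_fderiv_rep {f : M → M'} {e : OpenPartialHomeomorph M E} (he : e ∈ atlas E M)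
    {e' : OpenPartialHomeomorph M' E'} (he' : e' ∈ atlas E' M') {y : E} (hy : y ∈ e.target)
    (hf : ContMDiffAt 𝓘(ℝ, E) 𝓘(ℝ, E') ∞ f (e.symm y)) (hy' : f (e.symm y) ∈ e'.source) :
    (tmap e'.symm (rep e e' f y) : E' →L[ℝ] E').comp (fderiv ℝ (rep e e' f) y) =
      (tmap f (e.symm y) : E →L[ℝ] E').comp (tmap e.symm y : E →L[ℝ] E) := by
  rw [← tmap_eq_fderiv]
  refine (tmap_comp (f := rep e e' f) (chart_symm_smoothAt he' (e'.map_source hy')).mdiff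
    (rep_smooth he he' hy hf hy').contMDiffAt.mdiff).symm.trans (Eq.trans ?_
      (tmap_comp hf.mdiff (chart_symm_smoothAt he hy).mdiff))
  refine tmap_congr ?_
  have := (smoothAt_symm he hy hf).continuousAt.preimage_mem_nhds (e'.open_source.mem_nhds hy')
  filter_upwards [this] with z hz using e'.left_inv hz

theorem chartForm_pullForm {p : ℕ} {f : M → M'} {e : OpenPartialHomeomorph M E} (he : e ∈ atlas E M)
    {e' : OpenPartialHomeomorph M' E'} (he' : e' ∈ atlas E' M') {y : E} (hy : y ∈ e.target)
    (hf : ContMDiffAt 𝓘(ℝ, E) 𝓘(ℝ, E') ∞ f (e.symm y)) (hy' : f (e.symm y) ∈ e'.source)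
    (η : M' → E' [⋀^Fin p]→L[ℝ] ℝ) :
    chartForm e (pullForm f η) y =
      (chartForm e' η (rep e e' f y)).compContinuousLinearMap (fderiv ℝ (rep e e' f) y) := by
  have h := tmap_symm_fderiv_rep he he' hy hf hy'
  have h2 : e'.symm (rep e e' f y) = f (e.symm y) := e'.left_inv hy'
  ext v
  have h3 : ∀ w, tmap e'.symm (rep e e' f y) (fderiv ℝ (rep e e' f) y w) =
    tmap f (e.symm y) (tmap e.symm y w) := fun w => DFunLike.congr_fun h w
  simp only [chartForm, pullForm, ContinuousAlternatingMap.compContinuousLinearMap_apply, h2]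
  congr 1
  funext k
  exact (h3 (v k)).symm

theorem chartForm_pullForm_eventually {p : ℕ} {f : M → M'} {U : Set M} (hU : IsOpen U)
    (hf : ContMDiffOn 𝓘(ℝ, E) 𝓘(ℝ, E') ∞ f U) {e : OpenPartialHomeomorph M E} (he : e ∈ atlas E M)
    {e' : OpenPartialHomeomorph M' E'} (he' : e' ∈ atlas E' M') {y : E} (hy : y ∈ e.target)
    (hyU : e.symm y ∈ U) (hy' : f (e.symm y) ∈ e'.source) (η : M' → E' [⋀^Fin p]→L[ℝ] ℝ) :
    chartForm e (pullForm f η) =ᶠ[𝓝 y] fun y =>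
      (chartForm e' η (rep e e' f y)).compContinuousLinearMap (fderiv ℝ (rep e e' f) y) := by
  have h1 := (smoothAt_symm he hy (hf.contMDiffAt (hU.mem_nhds hyU))).continuousAt.preimage_mem_nhds
    (e'.open_source.mem_nhds hy')
  filter_upwards [h1, (e.isOpen_inter_preimage_symm hU).mem_nhds ⟨hy, hyU⟩] with z hz hzU
  exact chartForm_pullForm he he' hzU.1 (hf.contMDiffAt (hU.mem_nhds hzU.2)) hz η

theorem SmoothForm.pullForm [FiniteDimensional ℝ E] [FiniteDimensional ℝ E'] {p : ℕ}
    {η : M' → E' [⋀^Fin p]→L[ℝ] ℝ} {U' : Set M'} (hU' : IsOpen U') (hη : SmoothForm η U')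
    {f : M → M'} {U : Set M} (hU : IsOpen U) (hf : ContMDiffOn 𝓘(ℝ, E) 𝓘(ℝ, E') ∞ f U)
    (hUU' : MapsTo f U U') : SmoothForm (E := E) (pullForm f η) U := by
  refine smoothForm_of_contDiffAt fun e he y hy hyU => ?_
  set e' := chartAt E' (f (e.symm y))
  have he' : e' ∈ atlas E' M' := chart_mem_atlas _ _
  have hy' : f (e.symm y) ∈ e'.source := mem_chart_source _ _
  refine ContDiffAt.congr_of_eventuallyEq ?_
    (chartForm_pullForm_eventually hU hf he he' hy hyU hy' η)
  have hF := rep_smooth he he' hy (hf.contMDiffAt (hU.mem_nhds hyU)) hy'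
  refine contDiffWithinAt_comp (s := univ) ?_ ?_
  · refine (ContDiffAt.comp (g := chartForm e' η) y ?_ hF).contDiffWithinAt
    refine hη.contDiffAt hU' he' (e'.map_source hy') ?_
    rw [show rep e e' f y = e' (f (e.symm y)) from rfl, e'.left_inv hy']
    exact hUU' hyU
  · exact (hF.fderiv_right (m := ∞) le_rfl).contDiffWithinAt

/-- Since `extD` is computed in preferred charts, this is the naturality of `extDeriv` under the
local representative of `f`; the chain rule moves the tangent maps of the two charts to the outside.
-/
theorem extD_pullForm {p : ℕ} {η : M' → E' [⋀^Fin p]→L[ℝ] ℝ} {U' : Set M'} (hU' : IsOpen U')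
    (hη : SmoothForm η U') {f : M → M'} {U : Set M} (hU : IsOpen U)
    (hf : ContMDiffOn 𝓘(ℝ, E) 𝓘(ℝ, E') ∞ f U) {x : M} (hx : x ∈ U) (hx' : f x ∈ U') :
    extD (E := E) (pullForm f η) x = (extD η (f x)).compContinuousLinearMap (tmap f x) := by
  set e := chartAt E x
  set e' := chartAt E' (f x)
  have he : e ∈ atlas E M := chart_mem_atlas _ _
  have he' : e' ∈ atlas E' M' := chart_mem_atlas _ _
  have hxs : x ∈ e.source := mem_chart_source _ _
  have hy : e x ∈ e.target := e.map_source hxs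
  have hes : e.symm (e x) = x := e.left_inv hxs
  have hxs' : f x ∈ e'.source := mem_chart_source _ _
  have hfx := hf.contMDiffAt (hU.mem_nhds hx)
  have hF := rep_smooth (y := e x) he he' hy (by rwa [hes]) (by rwa [hes])
  have hFx : rep e e' f (e x) = e' (f x) := by rw [rep, hes]
  have h1 := chartForm_pullForm_eventually (η := η) hU hf he he' hy (by rwa [hes]) (by rwa [hes])
  have hη' : DifferentiableAt ℝ (chartForm e' η) (rep e e' f (e x)) :=
    (hη.contDiffAt hU' he' (by rw [hFx]; exact e'.map_source hxs')
      (by rw [hFx, e'.left_inv hxs']; exact hx')).differentiableAt (by simp)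
  have h2 := extDeriv_pullback (r := ∞) hη' hF minSmoothness_le_infty
  have h3 : (fderiv ℝ (rep e e' f) (e x)).comp (tmap e x : E →L[ℝ] E) =
      (tmap e' (f x) : E' →L[ℝ] E').comp (tmap f x : E →L[ℝ] E') := by
    rw [← tmap_eq_fderiv, ← tmap_comp (hF.contMDiffAt.mdiff) (chart_smoothAt he hxs).mdiff,
      ← tmap_comp (chart_smoothAt he' hxs').mdiff hfx.mdiff]
    refine tmap_congr ?_
    filter_upwards [e.open_source.mem_nhds hxs] with z hz
    rw [rep, e.left_inv hz]
  have h4 : ∀ w, fderiv ℝ (rep e e' f) (e x) (tmap e x w) = tmap e' (f x) (tmap f x w) :=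
    fun w => DFunLike.congr_fun h3 w
  change (extDeriv (chartForm e (Darboux.pullForm f η)) (e x)).compContinuousLinearMap (tmap e x) =
    ((extDeriv (chartForm e' η) (e' (f x))).compContinuousLinearMap
      (tmap e' (f x))).compContinuousLinearMap (tmap f x)
  rw [h1.extDeriv_eq, h2, hFx]
  ext v
  simp only [ContinuousAlternatingMap.compContinuousLinearMap_apply]
  congr 1
  funext k
  exact h4 (v k)

theorem extD_congr {p : ℕ} {η η' : M → E [⋀^Fin p]→L[ℝ] ℝ} {x : M} (h : η =ᶠ[𝓝 x] η') :
    extD η x = extD η' x := by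
  have hxs := mem_chart_source E x
  have hy := (chartAt E x).map_source hxs
  have : chartForm (chartAt E x) η =ᶠ[𝓝 (chartAt E x x)] chartForm (chartAt E x) η' := by
    have hc : ContinuousAt (chartAt E x).symm (chartAt E x x) :=
      (chartAt E x).continuousAt_symm hy
    have h' : ∀ᶠ y in 𝓝 ((chartAt E x).symm (chartAt E x x)), η y = η' y := by
      rwa [(chartAt E x).left_inv hxs]
    filter_upwards [hc.eventually h'] with y hy
    rw [chartForm, chartForm, hy]
  rw [extD, extD, this.extDeriv_eq]

end Forms

/-! ### The exterior derivative on a manifold -/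

section ExteriorDerivative

variable {E : Type*} [NormedAddCommGroup E] [NormedSpace ℝ E]
  {E' : Type*} [NormedAddCommGroup E'] [NormedSpace ℝ E']
  {E'' : Type*} [NormedAddCommGroup E''] [NormedSpace ℝ E'']
  {M : Type*} [TopologicalSpace M] [ChartedSpace E M]
  {M' : Type*} [TopologicalSpace M'] [ChartedSpace E' M']
  {M'' : Type*} [TopologicalSpace M''] [ChartedSpace E'' M'']

theorem chartForm_self {p : ℕ} (η : E → E [⋀^Fin p]→L[ℝ] ℝ) :
    chartForm (OpenPartialHomeomorph.refl E) η = η := by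
  funext y
  have : (tmap (OpenPartialHomeomorph.refl E).symm y : E →L[ℝ] E) =
      ContinuousLinearMap.id ℝ E := mfderiv_id
  rw [chartForm, this]
  rfl

theorem smoothForm_self {p : ℕ} {η : E → E [⋀^Fin p]→L[ℝ] ℝ} {U : Set E}
    (h : ContDiffOn ℝ ∞ η U) : SmoothForm η U := by
  intro e he
  obtain rfl := chartedSpaceSelf_atlas.1 he
  rw [chartForm_self]
  exact h.mono fun _ hx => hx.2

theorem extD_self {p : ℕ} (η : E → E [⋀^Fin p]→L[ℝ] ℝ) (x : E) : extD η x = extDeriv η x := by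
  have : (tmap (chartAt E x) x : E →L[ℝ] E) = ContinuousLinearMap.id ℝ E := mfderiv_id
  rw [extD, this, show chartAt E x = OpenPartialHomeomorph.refl E from rfl, chartForm_self]
  rfl

theorem extD_const {p : ℕ} (η : E [⋀^Fin p]→L[ℝ] ℝ) (x : E) :
    extD (M := E) (fun _ => η) x = 0 := by
  rw [extD_self, extDeriv, fderiv_fun_const]
  exact map_zero (ContinuousAlternatingMap.alternatizeUncurryFinCLM ℝ E ℝ)

theorem comp_add {p : ℕ} (η η' : E' [⋀^Fin p]→L[ℝ] ℝ) (L : E →L[ℝ] E') :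
    (η + η').compContinuousLinearMap L =
      η.compContinuousLinearMap L + η'.compContinuousLinearMap L := rfl

theorem comp_smul {p : ℕ} (c : ℝ) (η : E' [⋀^Fin p]→L[ℝ] ℝ) (L : E →L[ℝ] E') :
    (c • η).compContinuousLinearMap L = c • η.compContinuousLinearMap L := rfl

/-- The pullback of forms by a linear map, as a linear map. -/
def compL (p : ℕ) (L : E →L[ℝ] E') : (E' [⋀^Fin p]→L[ℝ] ℝ) →ₗ[ℝ] (E [⋀^Fin p]→L[ℝ] ℝ) where
  toFun η := η.compContinuousLinearMap L
  map_add' _ _ := rfl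
  map_smul' _ _ := rfl

theorem compL_apply {p : ℕ} (L : E →L[ℝ] E') (η : E' [⋀^Fin p]→L[ℝ] ℝ) :
    compL p L η = η.compContinuousLinearMap L := rfl

theorem extDeriv_sum {p : ℕ} {ι : Type*} (t : Finset ι) {η : ι → E → E [⋀^Fin p]→L[ℝ] ℝ} {x : E}
    (h : ∀ i ∈ t, DifferentiableAt ℝ (η i) x) :
    extDeriv (fun y => ∑ i ∈ t, η i y) x = ∑ i ∈ t, extDeriv (η i) x := by
  rw [extDeriv, fderiv_fun_sum h]
  exact map_sum (ContinuousAlternatingMap.alternatizeUncurryFinCLM ℝ E ℝ) _ _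

variable [IsManifold 𝓘(ℝ, E) ∞ M] [IsManifold 𝓘(ℝ, E') ∞ M']

theorem chartForm_comp {p : ℕ} {e : OpenPartialHomeomorph M E} (he : e ∈ atlas E M) {x : M}
    (hx : x ∈ e.source) (η : M → E [⋀^Fin p]→L[ℝ] ℝ) :
    (chartForm e η (e x)).compContinuousLinearMap (tmap e x) = η x := by
  have h : ∀ v, tmap e.symm (e x) (tmap e x v) = v :=
    fun v => DFunLike.congr_fun (tmap_symm_comp he hx) v
  ext v
  simp only [chartForm, ContinuousAlternatingMap.compContinuousLinearMap_apply, e.left_inv hx]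
  congr 1
  funext k
  exact h (v k)

section

variable {p : ℕ} {η η' : M → E [⋀^Fin p]→L[ℝ] ℝ} {U : Set M} {x : M}

theorem SmoothForm.differentiableAt (h : SmoothForm η U) (hU : IsOpen U) (hx : x ∈ U) :
    DifferentiableAt ℝ (chartForm (chartAt E x) η) (chartAt E x x) := by
  have hs := mem_chart_source E x
  exact (h.contDiffAt hU (chart_mem_atlas E x) ((chartAt E x).map_source hs)
    (by rwa [(chartAt E x).left_inv hs])).differentiableAt (by simp)

theorem extD_add (hU : IsOpen U) (h : SmoothForm η U) (h' : SmoothForm η' U) (hx : x ∈ U) :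
    extD (fun y => η y + η' y) x = extD η x + extD η' x := by
  rw [extD, chartForm_add,
    extDeriv_fun_add (h.differentiableAt hU hx) (h'.differentiableAt hU hx)]
  rfl

theorem extD_sum {ι : Type*} (t : Finset ι) {η : ι → M → E [⋀^Fin p]→L[ℝ] ℝ} (hU : IsOpen U)
    (h : ∀ i ∈ t, SmoothForm (η i) U) (hx : x ∈ U) :
    extD (fun y => ∑ i ∈ t, η i y) x = ∑ i ∈ t, extD (η i) x := by
  have : chartForm (chartAt E x) (fun y => ∑ i ∈ t, η i y) =
      fun y => ∑ i ∈ t, chartForm (chartAt E x) (η i) y :=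
    funext fun y => map_sum (compL p _) _ _
  rw [extD, this, extDeriv_sum t fun i hi => (h i hi).differentiableAt hU hx]
  exact map_sum (compL (p + 1) _) _ _

theorem fderiv_symm_comp {g : M → E'} (hg : MDifferentiableAt 𝓘(ℝ, E) 𝓘(ℝ, E') g x)
    {e : OpenPartialHomeomorph M E} (he : e ∈ atlas E M) (hx : x ∈ e.source) :
    (fderiv ℝ (fun y => g (e.symm y)) (e x)).comp (tmap e x : E →L[ℝ] E) = tmap g x := by
  have h0 : e.symm (e x) = x := e.left_inv hx
  rw [← tmap_eq_fderiv, tmap_comp (by rwa [h0])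
    (chart_symm_smoothAt he (e.map_source hx)).mdiff, h0, ContinuousLinearMap.comp_assoc,
    tmap_symm_comp he hx]
  rfl

theorem extD_smul {g : M → ℝ} (hU : IsOpen U) (hg : ContMDiffOn 𝓘(ℝ, E) 𝓘(ℝ, ℝ) ∞ g U)
    (h : SmoothForm η U) (hx : x ∈ U) :
    extD (fun y => g y • η y) x = wedge (tmap g x) (η x) + g x • extD η x := by
  have hs := mem_chart_source E x
  have he := chart_mem_atlas E x
  have hl := (chartAt E x).left_inv hs
  have hgx := hg.contMDiffAt (hU.mem_nhds hx)
  have hg' : ContDiffAt ℝ ∞ (fun y => g ((chartAt E x).symm y)) (chartAt E x x) :=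
    (smoothAt_symm he ((chartAt E x).map_source hs) (by rwa [hl])).contDiffAt
  rw [extD, chartForm_smul, extDeriv_mul_smul (hg'.differentiableAt (by simp))
    (h.differentiableAt hU hx), comp_add, comp_smul, wedge_comp, hl, chartForm_comp he hs,
    fderiv_symm_comp hgx.mdiff he hs]
  rfl

/-- A general Leibniz rule is avoided by expanding `α = ∑ a_k c_k` in the constant coframe `c` of
the chart. Each summand `c_k ∧ (a_k η)` has derivative `-c_k ∧ (da_k ∧ η + a_k dη)`, which lies in
an ideal as soon as `η` and `dη` do. -/
theorem extD_wedge_mem [FiniteDimensional ℝ E] {α : M → E →L[ℝ] ℝ} (hU : IsOpen U)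
    (hα : SmoothCov α U) (h : SmoothForm η U) (hx : x ∈ U)
    (K : ∀ q : ℕ, Submodule ℝ (E [⋀^Fin q]→L[ℝ] ℝ))
    (hK : ∀ (q : ℕ) (β : E →L[ℝ] ℝ), ∀ ω' ∈ K q, wedge β ω' ∈ K (q + 1))
    (h0 : η x ∈ K p) (h1 : extD η x ∈ K (p + 1)) :
    extD (fun y => wedge (α y) (η y)) x ∈ K (p + 2) := by
  have hs := mem_chart_source E x
  have he := chart_mem_atlas E x
  set e := chartAt E x with hedef
  have hl := e.left_inv hs
  have hy := e.map_source hs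
  set b := finBasis ℝ E
  set c : Fin (finrank ℝ E) → E →L[ℝ] ℝ := fun k => LinearMap.toContinuousLinearMap (b.coord k)
  have hexp : ∀ A : E →L[ℝ] ℝ, A = ∑ k, A (b k) • c k := by
    intro A
    ext v
    refine (congrArg A (b.sum_repr v)).symm.trans ?_
    rw [map_sum, sum_apply]
    refine Finset.sum_congr rfl fun k _ => ?_
    rw [map_smul, smul_apply, smul_eq_mul, smul_eq_mul, mul_comm]
    rfl
  have hxO := (e.isOpen_inter_preimage_symm hU).mem_nhds ⟨hy, by rwa [mem_preimage, hl]⟩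
  have hA : ContDiffAt ℝ ∞ (chartCov e α) (e x) := (hα e he).contDiffAt hxO
  have hH : ∀ᶠ y in 𝓝 (e x), ContDiffAt ℝ ∞ (chartForm e η) y := by
    filter_upwards [hxO] with y hy using h.contDiffAt hU he hy.1 hy.2
  have hA' : ∀ᶠ y in 𝓝 (e x), ContDiffAt ℝ ∞ (chartCov e α) y := by
    filter_upwards [(e.isOpen_inter_preimage_symm hU).mem_nhds (hxO |> mem_of_mem_nhds)] with y hy
    exact (hα e he).contDiffAt ((e.isOpen_inter_preimage_symm hU).mem_nhds hy)
  have hne : (∞ : WithTop ℕ∞) ≠ 0 := by simp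
  have hAk : ∀ k, ∀ {y}, ContDiffAt ℝ ∞ (chartCov e α) y →
      ContDiffAt ℝ ∞ (fun y => chartCov e α y (b k)) y :=
    fun k y h => h.clm_apply contDiffAt_const
  have hform : chartForm e (fun y => wedge (α y) (η y)) =
      fun y => ∑ k, wedge (fderiv ℝ (c k) y) (chartCov e α y (b k) • chartForm e η y) := by
    rw [chartForm_wedge]
    funext y
    conv_lhs => rw [hexp (chartCov e α y), sum_wedge]
    refine Finset.sum_congr rfl fun k _ => ?_
    rw [smul_wedge, wedge_smul, ContinuousLinearMap.fderiv]
  have hd : ∀ k, DifferentiableAt ℝ (fun y => wedge (fderiv ℝ (c k) y)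
      (chartCov e α y (b k) • chartForm e η y)) (e x) := by
    intro k
    simp only [ContinuousLinearMap.fderiv]
    exact (wedgeL p (c k)).differentiableAt.comp (e x)
      (((hAk k hA).smul hH.self_of_nhds).differentiableAt hne)
  change (extDeriv (chartForm e fun y => wedge (α y) (η y)) (e x)).compContinuousLinearMap
    (tmap e x) ∈ K (p + 2)
  rw [hform, extDeriv_sum _ fun k _ => hd k, ← compL_apply, map_sum]
  refine Submodule.sum_mem _ fun k _ => ?_
  rw [extDeriv_wedge_fderiv (η := fun y => chartCov e α y (b k) • chartForm e η y)
    (c k).contDiff.contDiffAt ((hAk k hA).smul hH.self_of_nhds)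
    (Filter.Eventually.of_forall fun y => (c k).differentiableAt) (by
      filter_upwards [hH, hA'] with y h1 h2 using ((hAk k h2).smul h1).differentiableAt hne),
    map_neg, compL_apply, wedge_comp]
  refine Submodule.neg_mem _ (hK _ _ _ ?_)
  rw [extDeriv_mul_smul ((hAk k hA).differentiableAt hne) (hH.self_of_nhds.differentiableAt hne),
    comp_add, comp_smul, wedge_comp, chartForm_comp he hs]
  exact Submodule.add_mem _ (hK _ _ _ h0) (Submodule.smul_mem _ _ h1)

end

theorem tmap_clm (L : E' →L[ℝ] E'') (x : E') : (tmap L x : E' →L[ℝ] E'') = L := by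
  rw [tmap_eq_fderiv, L.fderiv]

theorem tmap_clm_comp (L : E' →L[ℝ] E'') {f : M → E'} {x : M}
    (hf : MDifferentiableAt 𝓘(ℝ, E) 𝓘(ℝ, E') f x) :
    (tmap (fun y => L (f y)) x : E →L[ℝ] E'') = L.comp (tmap f x) := by
  rw [tmap_comp L.mdifferentiableAt hf, tmap_clm]

theorem tmap_prodMk {f : M → E'} {g : M → E''} {x : M}
    (hf : ContMDiffAt 𝓘(ℝ, E) 𝓘(ℝ, E') ∞ f x) (hg : ContMDiffAt 𝓘(ℝ, E) 𝓘(ℝ, E'') ∞ g x) :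
    (tmap (fun y => (f y, g y)) x : E →L[ℝ] E' × E'') = (tmap f x).prod (tmap g x) := by
  have h := (hf.prodMk_space hg).mdiff
  have h1 := tmap_clm_comp (ContinuousLinearMap.fst ℝ E' E'') h
  have h2 := tmap_clm_comp (ContinuousLinearMap.snd ℝ E' E'') h
  exact ContinuousLinearMap.ext fun v =>
    Prod.ext (DFunLike.congr_fun h1 v).symm (DFunLike.congr_fun h2 v).symm

variable [FiniteDimensional ℝ E] [FiniteDimensional ℝ E'] [FiniteDimensional ℝ E'']

theorem SmoothCov.pull {α : M' → E' →L[ℝ] ℝ} {U' : Set M'} (hU' : IsOpen U') (hα : SmoothCov α U')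
    {f : M → M'} {U : Set M} (hU : IsOpen U) (hf : ContMDiffOn 𝓘(ℝ, E) 𝓘(ℝ, E') ∞ f U)
    (hUU' : MapsTo f U U') : SmoothCov (E := E) (pull f α) U :=
  smoothCov_iff.2 (SmoothForm.pullForm hU' (smoothCov_iff.1 hα) hU hf hUU')

theorem smoothCov_comp_tmap {f : M → E'} {U : Set M} (hU : IsOpen U)
    (hf : ContMDiffOn 𝓘(ℝ, E) 𝓘(ℝ, E') ∞ f U) (c : E' →L[ℝ] ℝ) :
    SmoothCov (fun y => c.comp (tmap f y : E →L[ℝ] E')) U :=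
  SmoothCov.pull isOpen_univ (α := fun _ => c)
    (smoothCov_iff.2 (smoothForm_self contDiffOn_const)) hU hf (mapsTo_univ _ _)

theorem smoothCov_tmap {f : M → ℝ} {U : Set M} (hU : IsOpen U)
    (hf : ContMDiffOn 𝓘(ℝ, E) 𝓘(ℝ, ℝ) ∞ f U) : SmoothCov (tmap f : M → E →L[ℝ] ℝ) U :=
  smoothCov_comp_tmap hU hf (ContinuousLinearMap.id ℝ ℝ)

theorem extD_comp_tmap {p : ℕ} {f : M → E'} {U : Set M} (hU : IsOpen U)
    (hf : ContMDiffOn 𝓘(ℝ, E) 𝓘(ℝ, E') ∞ f U) (c : E' [⋀^Fin p]→L[ℝ] ℝ) {x : M} (hx : x ∈ U) :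
    extD (fun y => c.compContinuousLinearMap (tmap f y : E →L[ℝ] E')) x = 0 := by
  refine (extD_pullForm isOpen_univ (η := fun _ => c) (smoothForm_self contDiffOn_const) hU hf hx
    (mem_univ _)).trans ?_
  rw [extD_const]
  rfl

/-- `df ∧ dg` is the pullback by `(f, g)` of a constant 2-form on `ℝ × ℝ`, hence closed. -/
theorem extD_wedge_tmap {f g : M → ℝ} {U : Set M} (hU : IsOpen U)
    (hf : ContMDiffOn 𝓘(ℝ, E) 𝓘(ℝ, ℝ) ∞ f U) (hg : ContMDiffOn 𝓘(ℝ, E) 𝓘(ℝ, ℝ) ∞ g U) {x : M}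
    (hx : x ∈ U) :
    extD (fun y => wedge (tmap f y : E →L[ℝ] ℝ) (ofOne (tmap g y))) x = 0 := by
  have hfg : ContMDiffOn 𝓘(ℝ, E) 𝓘(ℝ, ℝ × ℝ) ∞ (fun y => (f y, g y)) U := hf.prodMk_space hg
  rw [← extD_comp_tmap hU hfg (wedge (ContinuousLinearMap.fst ℝ ℝ ℝ)
    (ofOne (ContinuousLinearMap.snd ℝ ℝ ℝ))) hx]
  refine extD_congr ?_
  filter_upwards [hU.mem_nhds hx] with y hy
  rw [wedge_comp, ofOne_comp, tmap_prodMk (hf.contMDiffAt (hU.mem_nhds hy))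
    (hg.contMDiffAt (hU.mem_nhds hy))]
  rfl

end ExteriorDerivative

/-! ### Smooth coefficients with respect to a local frame -/

section Expansion

variable {E : Type*} [NormedAddCommGroup E] [NormedSpace ℝ E]
  {E' : Type*} [NormedAddCommGroup E'] [NormedSpace ℝ E']
  {W : Type*} [NormedAddCommGroup W] [NormedSpace ℝ W] [FiniteDimensional ℝ W]
  {M : Type*} [TopologicalSpace M] [ChartedSpace E M]
  {M' : Type*} [TopologicalSpace M'] [ChartedSpace E' M']

/-- The coefficients of a section in a smooth frame are smooth. -/
theorem exists_smooth_coeff {ι : Type*} [Fintype ι] {D : Set E} (hD : IsOpen D)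
    {e : ι → E → W} (he : ∀ i, ContDiffOn ℝ ∞ (e i) D) {y₀ : E} (hy₀ : y₀ ∈ D)
    (hli : LinearIndependent ℝ fun i => e i y₀) {α : E → W} (hα : ContDiffOn ℝ ∞ α D)
    (hmem : ∀ y ∈ D, α y ∈ Submodule.span ℝ (range fun i => e i y)) :
    ∃ D' ⊆ D, IsOpen D' ∧ y₀ ∈ D' ∧ ∃ f : ι → E → ℝ, (∀ i, ContDiffOn ℝ ∞ (f i) D') ∧
      ∀ y ∈ D', α y = ∑ i, f i y • e i y := by
  classical
  -- `A y` sends coefficients to the combination of the frame at `y`. A fixed left inverse `R` of `A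
  -- y₀` makes `S y = R ∘ A y` the identity at `y₀`, hence invertible nearby, and the coefficients
  -- of `α` are `(S y)⁻¹ (R (α y))`.
  set A : E → (ι → ℝ) →L[ℝ] W := fun y =>
    ∑ i, (ContinuousLinearMap.proj i : (ι → ℝ) →L[ℝ] ℝ).smulRight (e i y) with hAdef
  have hA : ∀ y c, A y c = ∑ i, c i • e i y := fun y c => by simp [hAdef]
  have hAs : ContDiffOn ℝ ∞ A D := ContDiffOn.sum fun i _ =>
    ((ContinuousLinearMap.smulRightL ℝ (ι → ℝ) W
      (ContinuousLinearMap.proj i)).contDiff.comp_contDiffOn (he i))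
  have hinj : Function.Injective (A y₀).toLinearMap := by
    rw [← LinearMap.ker_eq_bot, LinearMap.ker_eq_bot']
    intro c hc
    have hc' : ∑ i, c i • e i y₀ = 0 := by rw [← hA]; exact hc
    exact funext fun i => Fintype.linearIndependent_iff.1 hli c hc' i
  obtain ⟨R, hR⟩ := LinearMap.exists_leftInverse_of_injective _ (LinearMap.ker_eq_bot.2 hinj)
  set S : E → (ι → ℝ) →L[ℝ] (ι → ℝ) := fun y => (LinearMap.toContinuousLinearMap R).comp (A y)
  have hS : ContDiffOn ℝ ∞ S D := contDiffOn_const.clm_comp hAs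
  have hS0 : S y₀ = 1 := by
    ext c : 1
    exact LinearMap.congr_fun hR c
  have hD' : IsOpen (D ∩ S ⁻¹' {T | IsUnit T}) :=
    hS.continuousOn.isOpen_inter_preimage hD Units.isOpen
  refine ⟨_, inter_subset_left, hD', ⟨hy₀, by rw [mem_preimage, hS0]; exact isUnit_one⟩,
    fun i y => Ring.inverse (S y) (R (α y)) i, ?_, ?_⟩
  · intro i y hy
    obtain ⟨u, hu⟩ := hy.2
    have h1 : ContDiffAt ℝ ∞ Ring.inverse (S y) := by
      rw [← hu]; exact contDiffAt_ringInverse ℝ u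
    have h2 : ContDiffAt ℝ ∞ S y := hS.contDiffAt (hD.mem_nhds hy.1)
    have h3 : ContDiffAt ℝ ∞ (fun y => Ring.inverse (S y) (R (α y))) y :=
      (h1.comp y h2).clm_apply ((LinearMap.toContinuousLinearMap R).contDiff.contDiffAt.comp y
        (hα.contDiffAt (hD.mem_nhds hy.1)))
    exact (contDiffAt_pi.1 h3 i).contDiffWithinAt
  · intro y hy
    obtain ⟨c, hc⟩ := (Submodule.mem_span_range_iff_exists_fun ℝ).1 (hmem y hy.1)
    rw [← hA] at hc ⊢
    have h1 : R (α y) = S y c := by rw [← hc]; rfl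
    have h2 : Ring.inverse (S y) (R (α y)) = c := by
      rw [h1, ← mul_apply_eq_comp, Ring.inverse_mul_cancel _ hy.2]
      rfl
    rw [show (fun i => Ring.inverse (S y) (R (α y)) i) = c from h2, hc]

theorem SmoothCov.mono {α : M → E →L[ℝ] W} {U U' : Set M}
    (h : SmoothCov α U) (hU : U' ⊆ U) : SmoothCov α U' :=
  fun e he => (h e he).mono fun _ hy => ⟨hy.1, hU hy.2⟩

theorem SmoothCov.add {α β : M → E →L[ℝ] ℝ} {U : Set M}
    (h : SmoothCov α U) (h' : SmoothCov β U) : SmoothCov (fun y => α y + β y) U :=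
  fun e he => (h e he).add (h' e he)

theorem SmoothForm.congr {p : ℕ} {η η' : M → E [⋀^Fin p]→L[ℝ] ℝ} {U : Set M}
    (h : SmoothForm η U) (heq : ∀ y ∈ U, η' y = η y) : SmoothForm η' U :=
  fun e he => (h e he).congr fun y hy => by rw [chartForm, chartForm, heq _ hy.2]

theorem SmoothCov.congr {α β : M → E →L[ℝ] ℝ} {U : Set M}
    (h : SmoothCov α U) (heq : ∀ y ∈ U, β y = α y) : SmoothCov β U :=
  fun e he => (h e he).congr fun y hy => by rw [chartCov, chartCov, heq _ hy.2]

variable [IsManifold 𝓘(ℝ, E) ∞ M] [IsManifold 𝓘(ℝ, E') ∞ M']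

theorem SmoothCov.smul {g : M → ℝ} {α : M → E →L[ℝ] ℝ} {U : Set M} (hU : IsOpen U)
    (h : ContMDiffOn 𝓘(ℝ, E) 𝓘(ℝ, ℝ) ∞ g U) (h' : SmoothCov α U) :
    SmoothCov (fun y => g y • α y) U := by
  rw [smoothCov_iff] at *
  exact (SmoothForm.smul hU h h').congr fun y _ => ofOne_smul _ _

theorem contMDiffOn_comp_chart {e : OpenPartialHomeomorph M E} (he : e ∈ atlas E M) {g : E → ℝ}
    {D : Set E} (hD : IsOpen D) (hg : ContDiffOn ℝ ∞ g D) :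
    ContMDiffOn 𝓘(ℝ, E) 𝓘(ℝ, ℝ) ∞ (fun x => g (e x)) (e.source ∩ e ⁻¹' D) := by
  intro x hx
  exact ((hg.contDiffAt (hD.mem_nhds hx.2)).contMDiffAt.comp x
    (chart_smoothAt he hx.1)).contMDiffWithinAt

theorem SmoothForm.exists_coeff [FiniteDimensional ℝ E] {p : ℕ} {ι : Type*} [Fintype ι]
    {U : Set M} (hU : IsOpen U) {ξ : ι → M → E [⋀^Fin p]→L[ℝ] ℝ} (hξ : ∀ i, SmoothForm (ξ i) U)
    {x : M} (hx : x ∈ U) (hli : LinearIndependent ℝ fun i => ξ i x)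
    {η : M → E [⋀^Fin p]→L[ℝ] ℝ} (hη : SmoothForm η U)
    (hmem : ∀ y ∈ U, η y ∈ Submodule.span ℝ (range fun i => ξ i y)) :
    ∃ U' ⊆ U, IsOpen U' ∧ x ∈ U' ∧ ∃ f : ι → M → ℝ,
      (∀ i, ContMDiffOn 𝓘(ℝ, E) 𝓘(ℝ, ℝ) ∞ (f i) U') ∧ ∀ y ∈ U', η y = ∑ i, f i y • ξ i y := by
  set e := chartAt E x
  have he : e ∈ atlas E M := chart_mem_atlas E x
  have hs : x ∈ e.source := mem_chart_source E x
  have hl := e.left_inv hs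
  obtain ⟨D', hD'D, hD', hxD', f, hf, hfe⟩ := exists_smooth_coeff
    (e.isOpen_inter_preimage_symm hU) (e := fun i => chartForm e (ξ i)) (fun i => hξ i e he)
    (y₀ := e x) ⟨e.map_source hs, by rwa [mem_preimage, hl]⟩ (by
      refine LinearIndependent.of_comp (compL p (tmap e x : E →L[ℝ] E)) ?_
      convert hli using 1
      funext i
      exact chartForm_comp he hs (ξ i)) (hη e he) (by
      intro y hy
      have h := Submodule.mem_map_of_mem (f := compL p (tmap e.symm y : E →L[ℝ] E))
        (hmem _ hy.2)
      rw [Submodule.map_span, ← range_comp] at h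
      exact h)
  refine ⟨e.source ∩ e ⁻¹' D', ?_, e.isOpen_inter_preimage hD', ⟨hs, hxD'⟩,
    fun i y => f i (e y), fun i => contMDiffOn_comp_chart he hD' (hf i), ?_⟩
  · rintro y ⟨hy, hy'⟩
    have := (hD'D hy').2
    rwa [mem_preimage, e.left_inv hy] at this
  · rintro y ⟨hy, hy'⟩
    rw [← chartForm_comp he hy η, hfe _ hy', ← compL_apply, map_sum]
    refine Finset.sum_congr rfl fun i _ => ?_
    rw [map_smul, compL_apply, chartForm_comp he hy]

theorem SmoothCov.exists_coeff [FiniteDimensional ℝ E] {ι : Type*} [Fintype ι]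
    {U : Set M} (hU : IsOpen U) {ξ : ι → M → E →L[ℝ] ℝ} (hξ : ∀ i, SmoothCov (ξ i) U)
    {x : M} (hx : x ∈ U) (hli : LinearIndependent ℝ fun i => ξ i x)
    {α : M → E →L[ℝ] ℝ} (hα : SmoothCov α U)
    (hmem : ∀ y ∈ U, α y ∈ Submodule.span ℝ (range fun i => ξ i y)) :
    ∃ U' ⊆ U, IsOpen U' ∧ x ∈ U' ∧ ∃ f : ι → M → ℝ,
      (∀ i, ContMDiffOn 𝓘(ℝ, E) 𝓘(ℝ, ℝ) ∞ (f i) U') ∧ ∀ y ∈ U', α y = ∑ i, f i y • ξ i y := by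
  obtain ⟨U', hU'U, hU', hxU', f, hf, hfe⟩ := SmoothForm.exists_coeff hU
    (ξ := fun i y => ofOne (ξ i y)) (fun i => smoothCov_iff.1 (hξ i)) hx
    (hli.map' (ofOneL E).toLinearEquiv.toLinearMap (LinearEquiv.ker _)) (smoothCov_iff.1 hα) (by
      intro y hy
      have h := Submodule.mem_map_of_mem (f := (ofOneL E).toLinearEquiv.toLinearMap) (hmem _ hy)
      rw [Submodule.map_span, ← range_comp] at h
      exact h)
  refine ⟨U', hU'U, hU', hxU', f, hf, fun y hy => ofOne_injective ?_⟩
  rw [hfe y hy, ofOne_sum]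
  exact Finset.sum_congr rfl fun i _ => (ofOne_smul _ _).symm

end Expansion

/-! ### Ideals generated by covectors and 2-covectors -/

section AlgIdeal

variable {E : Type*} [NormedAddCommGroup E] [NormedSpace ℝ E]
  {E' : Type*} [NormedAddCommGroup E'] [NormedSpace ℝ E']

theorem algIdeal_le {S T : ∀ p : ℕ, Set (E [⋀^Fin p]→L[ℝ] ℝ)} (h : ∀ p, S p ⊆ algIdeal T p) (p : ℕ) :
    algIdeal S p ≤ algIdeal T p := fun _ hη =>
  algIdeal_induction (algIdeal T) (fun q α η h => wedge_mem_algIdeal q α η h) h hη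

/-- Pullback commutes with the exterior product, so the preimage of an ideal is an ideal and only
generators have to be checked. -/
theorem comp_mem_algIdeal {S : ∀ p : ℕ, Set (E' [⋀^Fin p]→L[ℝ] ℝ)}
    {T : ∀ p : ℕ, Set (E [⋀^Fin p]→L[ℝ] ℝ)} (L : E →L[ℝ] E')
    (h : ∀ p, ∀ η ∈ S p, η.compContinuousLinearMap L ∈ algIdeal T p) {p : ℕ}
    {η : E' [⋀^Fin p]→L[ℝ] ℝ} (hη : η ∈ algIdeal S p) :
    η.compContinuousLinearMap L ∈ algIdeal T p := by
  refine algIdeal_induction (fun q => (algIdeal T q).comap (compL q L)) ?_ h hη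
  intro q α η hη
  rw [Submodule.mem_comap, compL_apply, wedge_comp]
  exact wedge_mem_algIdeal _ _ _ hη

theorem mem_oneForms {A : Set (E →L[ℝ] ℝ)} {α : E →L[ℝ] ℝ} (h : α ∈ A) :
    ofOne α ∈ oneForms A 1 := ⟨α, h, rfl⟩

theorem oneForms_subset {A : Set (E →L[ℝ] ℝ)} {K : ∀ p : ℕ, Submodule ℝ (E [⋀^Fin p]→L[ℝ] ℝ)}
    (h : ∀ α ∈ A, ofOne α ∈ K 1) (p : ℕ) : oneForms A p ⊆ K p := by
  match p with
  | 0 => exact empty_subset _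
  | 1 => rintro _ ⟨α, hα, rfl⟩; exact h α hα
  | _ + 2 => exact empty_subset _

theorem twoForms_subset {T : Set (E [⋀^Fin 2]→L[ℝ] ℝ)}
    {K : ∀ p : ℕ, Submodule ℝ (E [⋀^Fin p]→L[ℝ] ℝ)} (h : ∀ η ∈ T, η ∈ K 2) (p : ℕ) :
    twoForms T p ⊆ K p := by
  match p with
  | 0 => exact empty_subset _
  | 1 => exact empty_subset _
  | 2 => exact h
  | _ + 3 => exact empty_subset _

theorem wedge_ofOne_swap (α β : E →L[ℝ] ℝ) : wedge α (ofOne β) = - wedge β (ofOne α) := by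
  ext v
  rw [ContinuousAlternatingMap.neg_apply, wedge_ofOne_apply, wedge_ofOne_apply]
  ring

theorem wedge_ofOne_mem {S : ∀ p : ℕ, Set (E [⋀^Fin p]→L[ℝ] ℝ)} {α β : E →L[ℝ] ℝ}
    (h : ofOne α ∈ algIdeal S 1 ∨ ofOne β ∈ algIdeal S 1) : wedge α (ofOne β) ∈ algIdeal S 2 := by
  rcases h with h | h
  · rw [wedge_ofOne_swap]
    exact Submodule.neg_mem _ (wedge_mem_algIdeal _ _ _ h)
  · exact wedge_mem_algIdeal _ _ _ h

/-- A decomposable 2-covector that vanishes on a subspace lies in the ideal generated by the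
covectors that vanish on it. -/
theorem wedge_mem_of_vanish {S : ∀ p : ℕ, Set (E [⋀^Fin p]→L[ℝ] ℝ)} {P : Submodule ℝ E}
    (hS : ∀ γ : E →L[ℝ] ℝ, (∀ v ∈ P, γ v = 0) → ofOne γ ∈ algIdeal S 1) {α β : E →L[ℝ] ℝ}
    (h : ∀ v ∈ P, ∀ w ∈ P, α v * β w = α w * β v) : wedge α (ofOne β) ∈ algIdeal S 2 := by
  by_cases hα : ∀ v ∈ P, α v = 0
  · exact wedge_ofOne_mem (Or.inl (hS α hα))
  push Not at hα
  obtain ⟨v, hv, hne⟩ := hα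
  -- Subtracting a multiple of `α` from `β` does not change `α ∧ β`; this multiple makes the second
  -- factor vanish on `P`.
  have h1 : wedge α (ofOne β) = wedge α (ofOne (β - (β v / α v) • α)) := by
    ext u
    simp only [wedge_ofOne_apply, sub_apply, smul_apply, smul_eq_mul]
    ring
  rw [h1]
  refine wedge_ofOne_mem (Or.inr (hS _ fun w hw => ?_))
  rw [sub_apply, smul_apply, smul_eq_mul, div_mul_eq_mul_div, sub_eq_zero, eq_div_iff hne]
  linarith [h v hv w hw]

end AlgIdeal

/-! ### Spans of covectors as annihilators -/

section Span

variable {E : Type*} [NormedAddCommGroup E] [NormedSpace ℝ E]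

/-- Duality: a finite span of functionals is the annihilator of their common kernel. Membership in
Pfaffian systems is tested on vectors by means of this. -/
theorem mem_span_range_iff {ι : Type*} [Finite ι] (L : ι → E →L[ℝ] ℝ) (α : E →L[ℝ] ℝ) :
    α ∈ Submodule.span ℝ (range L) ↔ ∀ v, (∀ i, L i v = 0) → α v = 0 := by
  constructor
  · intro h v hv
    refine Submodule.span_induction (p := fun β _ => β v = 0) ?_ rfl ?_ ?_ h
    · rintro _ ⟨i, rfl⟩
      exact hv i
    · intro β γ _ _ hβ hγ
      rw [add_apply, hβ, hγ, add_zero]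
    · intro c β _ hβ
      rw [smul_apply, hβ, smul_zero]
  · intro h
    have h1 : α.toLinearMap ∈ Submodule.span ℝ (range fun i => (L i).toLinearMap) := by
      refine mem_span_of_iInf_ker_le_ker fun v hv => ?_
      rw [Submodule.mem_iInf] at hv
      exact h v hv
    have h2 : (range fun i => (L i).toLinearMap) =
        (ContinuousLinearMap.coeLM ℝ : (E →L[ℝ] ℝ) →ₗ[ℝ] E →ₗ[ℝ] ℝ) '' range L := by
      rw [← range_comp]; rfl
    rw [h2, ← Submodule.map_span] at h1
    obtain ⟨β, hβ, hβα⟩ := h1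
    rwa [← ContinuousLinearMap.coe_injective hβα]

/-- Exterior multiplication raises the degree and there are no generators of degree zero. Hence the
family that is zero in degree zero, the span in degree one and everything above is an ideal
containing the generators. -/
theorem ofOne_mem_iff {ι : Type*} (L : ι → E →L[ℝ] ℝ) (T : Set (E [⋀^Fin 2]→L[ℝ] ℝ))
    (α : E →L[ℝ] ℝ) :
    ofOne α ∈ algIdeal (fun q => oneForms (range L) q ∪ twoForms T q) 1 ↔
      α ∈ Submodule.span ℝ (range L) := by
  constructor
  · intro h
    have h1 : ofOne α ∈ (Submodule.span ℝ (range L)).map (ofOneL E).toLinearEquiv.toLinearMap := by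
      refine algIdeal_induction (fun q => match q with
        | 0 => ⊥
        | 1 => (Submodule.span ℝ (range L)).map (ofOneL E).toLinearEquiv.toLinearMap
        | _ + 2 => ⊤) ?_ ?_ h
      · intro q β η hη
        match q with
        | 0 =>
          rw [(Submodule.mem_bot ℝ).1 hη, ← wedgeL_apply, map_zero]
          exact Submodule.zero_mem _
        | _ + 1 => exact Submodule.mem_top
      · intro q
        match q with
        | 0 => simp [oneForms, twoForms]
        | 1 =>
          rintro _ (⟨β, hβ, rfl⟩ | h)
          · exact Submodule.mem_map_of_mem (Submodule.subset_span hβ)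
          · exact h.elim
        | _ + 2 => exact subset_univ _
    obtain ⟨β, hβ, hβα⟩ := h1
    rwa [← ofOne_injective hβα]
  · intro h
    refine Submodule.span_induction (p := fun β _ => ofOne β ∈ algIdeal
      (fun q => oneForms (range L) q ∪ twoForms T q) 1) ?_ ?_ ?_ ?_ h
    · exact fun β hβ => subset_algIdeal _ _ (Or.inl (mem_oneForms hβ))
    · exact Submodule.zero_mem _
    · intro β γ _ _ hβ hγ
      rw [ofOne_add]
      exact Submodule.add_mem _ hβ hγ
    · intro c β _ hβ
      rw [ofOne_smul]
      exact Submodule.smul_mem _ _ hβ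

end Span

theorem exists_frame {W : Type*} [NormedAddCommGroup W] [NormedSpace ℝ W] [FiniteDimensional ℝ W]
    (V : Submodule ℝ W) : ∃ (r : ℕ) (b : Fin r → W), LinearIndependent ℝ b ∧
      Submodule.span ℝ (range b) = V := by
  refine ⟨_, fun i => (finBasis ℝ V i : W), (finBasis ℝ V).linearIndependent.map' V.subtype
    (Submodule.ker_subtype _), ?_⟩
  have h := congrArg (Submodule.map V.subtype) (finBasis ℝ V).span_eq
  rw [Submodule.map_span, ← range_comp, Submodule.map_subtype_top] at h
  exact h

/-! ### The model ideal of a hyperbolic system, and closedness from its generators -/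

section Coframe

variable {E : Type*} [NormedAddCommGroup E] [NormedSpace ℝ E]
  {M : Type*} [TopologicalSpace M] [ChartedSpace E M] {s : ℕ} {I : FormFamily E M}

namespace AdaptedCoframe

variable {U : Set M} (κ : AdaptedCoframe s I U)

/-- The restriction of an adapted coframe. -/
def restrict {U' : Set M} (h : U' ⊆ U) : AdaptedCoframe s I U' where
  θ := κ.θ
  h := κ.h
  c := κ.c
  smooth_θ i := (κ.smooth_θ i).mono h
  smooth_h i := (κ.smooth_h i).mono h
  smooth_c i := (κ.smooth_c i).mono h
  coframe x hx := κ.coframe x (h hx)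
  generate x hx := κ.generate x (h hx)

/-- The adapted coframe in which the two pairs are interchanged. -/
def swap : AdaptedCoframe s I U where
  θ := κ.θ
  h := κ.c
  c := κ.h
  smooth_θ := κ.smooth_θ
  smooth_h := κ.smooth_c
  smooth_c := κ.smooth_h
  coframe x hx := by
    have e : (fun v : E => ((fun i => κ.θ i x v, fun i => κ.c i x v, fun i => κ.h i x v) :
        (Fin s → ℝ) × (Fin 2 → ℝ) × (Fin 2 → ℝ))) =
        (Prod.map id Prod.swap) ∘ fun v : E =>
        ((fun i => κ.θ i x v, fun i => κ.h i x v, fun i => κ.c i x v) :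
        (Fin s → ℝ) × (Fin 2 → ℝ) × (Fin 2 → ℝ)) := rfl
    rw [e]
    exact (Function.bijective_id.prodMap Prod.swap_bijective).comp (κ.coframe x hx)
  generate x hx p := by rw [κ.generate x hx, pair_comm]

/-- The first singular Pfaffian system. -/
def Vh (x : M) : Submodule ℝ (E →L[ℝ] ℝ) :=
  Submodule.span ℝ ((range fun i => κ.θ i x) ∪ (range fun i => κ.h i x))

/-- The second singular Pfaffian system. -/
def Vc (x : M) : Submodule ℝ (E →L[ℝ] ℝ) :=
  Submodule.span ℝ ((range fun i => κ.θ i x) ∪ (range fun i => κ.c i x))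

theorem mem_Vh {x : M} {α : E →L[ℝ] ℝ} :
    α ∈ κ.Vh x ↔ ∀ v, (∀ i, κ.θ i x v = 0) → (∀ i, κ.h i x v = 0) → α v = 0 := by
  have : ((range fun i => κ.θ i x) ∪ (range fun i => κ.h i x)) =
    range (Sum.elim (fun i => κ.θ i x) fun i => κ.h i x) := (Sum.elim_range _ _).symm
  rw [Vh, this, mem_span_range_iff]
  simp only [Sum.forall, Sum.elim_inl, Sum.elim_inr, and_imp]

theorem mem_Vc {x : M} {α : E →L[ℝ] ℝ} :
    α ∈ κ.Vc x ↔ ∀ v, (∀ i, κ.θ i x v = 0) → (∀ i, κ.c i x v = 0) → α v = 0 :=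
  κ.swap.mem_Vh

theorem ofOne_mem {x : M} (hx : x ∈ U) {α : E →L[ℝ] ℝ} :
    ofOne α ∈ I 1 x ↔ ∀ v, (∀ i, κ.θ i x v = 0) → α v = 0 := by
  rw [κ.generate x hx, ofOne_mem_iff, mem_span_range_iff]

theorem wedge_mem (κ : AdaptedCoframe s I U) {x : M} (hx : x ∈ U) {p : ℕ} (α : E →L[ℝ] ℝ) {η : E [⋀^Fin p]→L[ℝ] ℝ}
    (hη : η ∈ I p x) : wedge α η ∈ I (p + 1) x := by
  rw [κ.generate x hx] at hη ⊢
  exact wedge_mem_algIdeal _ _ _ hη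

end AdaptedCoframe

/-- The model of a coframe. -/
abbrev ModelSpace (s : ℕ) := (Fin s → ℝ) × (Fin 2 → ℝ) × (Fin 2 → ℝ)

/-- The coordinates of the model. -/
def modelθ (s : ℕ) (i : Fin s) : ModelSpace s →L[ℝ] ℝ :=
  (ContinuousLinearMap.proj i).comp (ContinuousLinearMap.fst ℝ _ _)

/-- The coordinates of the model. -/
def modelh (s : ℕ) (i : Fin 2) : ModelSpace s →L[ℝ] ℝ :=
  (ContinuousLinearMap.proj i).comp
    ((ContinuousLinearMap.fst ℝ _ _).comp (ContinuousLinearMap.snd ℝ _ _))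

/-- The coordinates of the model. -/
def modelc (s : ℕ) (i : Fin 2) : ModelSpace s →L[ℝ] ℝ :=
  (ContinuousLinearMap.proj i).comp
    ((ContinuousLinearMap.snd ℝ _ _).comp (ContinuousLinearMap.snd ℝ _ _))

/-- The generators of the model ideal. -/
def modelGen (s : ℕ) (q : ℕ) : Set (ModelSpace s [⋀^Fin q]→L[ℝ] ℝ) :=
  oneForms (range (modelθ s)) q ∪ twoForms {wedge (modelh s 0) (ofOne (modelh s 1)),
    wedge (modelc s 0) (ofOne (modelc s 1))} q

namespace AdaptedCoframe

variable {U : Set M} (κ : AdaptedCoframe s I U)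

theorem comp_cof_mem {x : M} (hx : x ∈ U) {p : ℕ} {b : ModelSpace s [⋀^Fin p]→L[ℝ] ℝ}
    (hb : b ∈ algIdeal (modelGen s) p) : b.compContinuousLinearMap (κ.cof x) ∈ I p x := by
  rw [κ.generate x hx]
  refine comp_mem_algIdeal (κ.cof x) ?_ hb
  rintro q η (hη | hη)
  · match q, η, hη with
    | 1, _, ⟨_, ⟨k, rfl⟩, rfl⟩ =>
      exact subset_algIdeal _ _ (Or.inl (mem_oneForms ⟨k, rfl⟩))
  · match q, η, hη with
    | 2, _, Or.inl rfl =>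
      rw [wedge_comp]
      exact subset_algIdeal _ _ (Or.inr (Or.inl rfl))
    | 2, _, Or.inr rfl =>
      rw [wedge_comp]
      exact subset_algIdeal _ _ (Or.inr (Or.inr rfl))

/-- The inverse `R` of the coframe carries the generators of `I` at `x` to those of the model, so
the pullback of `η` by `R` is the required element of the model ideal. -/
theorem exists_comp_cof [FiniteDimensional ℝ E] {x : M} (hx : x ∈ U) {p : ℕ}
    {η : E [⋀^Fin p]→L[ℝ] ℝ} (hη : η ∈ I p x) :
    ∃ b ∈ algIdeal (modelGen s) p, η = b.compContinuousLinearMap (κ.cof x) := by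
  set L : E ≃ₗ[ℝ] ModelSpace s :=
    LinearEquiv.ofBijective (κ.cof x).toLinearMap (κ.cof_bijective hx)
  have hL : ∀ v, L v = κ.cof x v := fun v => rfl
  set R : ModelSpace s →L[ℝ] E := LinearMap.toContinuousLinearMap L.symm.toLinearMap
  have hLR : (κ.cof x).comp R = ContinuousLinearMap.id ℝ _ :=
    ContinuousLinearMap.ext fun w => L.apply_symm_apply w
  have hRL : R.comp (κ.cof x) = ContinuousLinearMap.id ℝ _ :=
    ContinuousLinearMap.ext fun w => L.symm_apply_apply w
  have hcomp : ∀ β : ModelSpace s →L[ℝ] ℝ, (β.comp (κ.cof x)).comp R = β := by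
    intro β
    rw [ContinuousLinearMap.comp_assoc, hLR]
    rfl
  rw [κ.generate x hx] at hη
  refine ⟨η.compContinuousLinearMap R, comp_mem_algIdeal R ?_ hη, ?_⟩
  · rintro q η (hη | hη)
    · match q, η, hη with
      | 1, _, ⟨_, ⟨k, rfl⟩, rfl⟩ =>
        rw [ofOne_comp, show (κ.θ k x).comp R = modelθ s k from hcomp (modelθ s k)]
        exact subset_algIdeal _ _ (Or.inl (mem_oneForms ⟨k, rfl⟩))
    · match q, η, hη with
      | 2, _, Or.inl rfl =>
        rw [wedge_comp, ofOne_comp, show (κ.h 0 x).comp R = modelh s 0 from hcomp (modelh s 0),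
          show (κ.h 1 x).comp R = modelh s 1 from hcomp (modelh s 1)]
        exact subset_algIdeal _ _ (Or.inr (Or.inl rfl))
      | 2, _, Or.inr rfl =>
        rw [wedge_comp, ofOne_comp, show (κ.c 0 x).comp R = modelc s 0 from hcomp (modelc s 0),
          show (κ.c 1 x).comp R = modelc s 1 from hcomp (modelc s 1)]
        exact subset_algIdeal _ _ (Or.inr (Or.inr rfl))
  · have : (η.compContinuousLinearMap R).compContinuousLinearMap (κ.cof x) =
        η.compContinuousLinearMap (R.comp (κ.cof x)) := rfl
    rw [this, hRL]
    rfl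

variable [FiniteDimensional ℝ E]

theorem smooth_comp_cof {p : ℕ} (b : ModelSpace s [⋀^Fin p]→L[ℝ] ℝ) :
    SmoothForm (fun y => b.compContinuousLinearMap (κ.cof y)) U := fun e he y hy =>
  contDiffWithinAt_comp (f := fun _ => b) (A := chartCov e κ.cof) contDiffWithinAt_const
    (κ.smooth_cof e he y hy)

/-- The exterior derivatives of the generators of an adapted coframe lie in the ideal. -/
structure IsClosed : Prop where
  θ : ∀ x ∈ U, ∀ k, extD (fun y => ofOne (κ.θ k y)) x ∈ I 2 x
  h : ∀ x ∈ U, extD (fun y => wedge (κ.h 0 y) (ofOne (κ.h 1 y))) x ∈ I 3 x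
  c : ∀ x ∈ U, extD (fun y => wedge (κ.c 0 y) (ofOne (κ.c 1 y))) x ∈ I 3 x

variable [IsManifold 𝓘(ℝ, E) ∞ M] {κ}

/-- Forms with constant coefficients in the coframe are handled by induction over the model ideal.
The step is `extD_wedge_mem`, which leaves only the generators, whose derivatives are controlled by
hypothesis. -/
theorem IsClosed.extD_comp_cof (hκ : κ.IsClosed) (hU : IsOpen U) {p : ℕ}
    {b : ModelSpace s [⋀^Fin p]→L[ℝ] ℝ} (hb : b ∈ algIdeal (modelGen s) p) :
    ∀ x ∈ U, extD (fun y => b.compContinuousLinearMap (κ.cof y)) x ∈ I (p + 1) x := by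
  let K : ∀ q, Submodule ℝ (ModelSpace s [⋀^Fin q]→L[ℝ] ℝ) := fun q =>
    { carrier := {b | b ∈ algIdeal (modelGen s) q ∧
        ∀ x ∈ U, extD (fun y => b.compContinuousLinearMap (κ.cof y)) x ∈ I (q + 1) x}
      add_mem' := by
        rintro b b' ⟨h1, h2⟩ ⟨h1', h2'⟩
        refine ⟨Submodule.add_mem _ h1 h1', fun x hx => ?_⟩
        have := extD_add hU (κ.smooth_comp_cof b) (κ.smooth_comp_cof b') hx
        exact this ▸ Submodule.add_mem _ (h2 x hx) (h2' x hx)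
      zero_mem' := by
        refine ⟨Submodule.zero_mem _, fun x hx => ?_⟩
        have := extD_add hU (κ.smooth_comp_cof (0 : ModelSpace s [⋀^Fin q]→L[ℝ] ℝ))
          (κ.smooth_comp_cof 0) hx
        have h0 : extD (fun y => (0 : ModelSpace s [⋀^Fin q]→L[ℝ] ℝ).compContinuousLinearMap
            (κ.cof y)) x = 0 := by
          refine left_eq_add.1 (Eq.trans (extD_congr (Filter.Eventually.of_forall fun y => ?_)) this)
          rw [← comp_add, add_zero]
        rw [h0]
        exact Submodule.zero_mem _
      smul_mem' := by
        rintro c b ⟨h1, h2⟩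
        refine ⟨Submodule.smul_mem _ _ h1, fun x hx => ?_⟩
        have h3 := extD_smul (g := fun _ => c) hU contMDiffOn_const (κ.smooth_comp_cof b) hx
        have h4 : (tmap (fun _ : M => c) x : E →L[ℝ] ℝ) = 0 := mfderiv_const
        have h5 : extD (fun y => (c • b).compContinuousLinearMap (κ.cof y)) x =
            c • extD (fun y => b.compContinuousLinearMap (κ.cof y)) x := by
          refine h3.trans ?_
          rw [h4, ← wedgeL_apply, map_zero, zero_apply, zero_add]
        rw [h5]
        exact Submodule.smul_mem _ _ (h2 x hx) }
  refine (algIdeal_induction K ?_ ?_ hb).2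
  · rintro q α η ⟨h1, h2⟩
    refine ⟨wedge_mem_algIdeal _ _ _ h1, fun x hx => ?_⟩
    simp only [wedge_comp]
    exact extD_wedge_mem hU (smoothCov_iff (α := fun y => α.comp (κ.cof y)) |>.2 (κ.smooth_comp_cof (ofOne α))) (κ.smooth_comp_cof η) hx
      (fun q => I q x) (fun q β ω' h => κ.wedge_mem hx β h) (κ.comp_cof_mem hx h1) (h2 x hx)
  · intro q η hη
    refine ⟨subset_algIdeal _ _ hη, ?_⟩
    rcases hη with hη | hη
    · match q, η, hη with
      | 1, _, ⟨_, ⟨k, rfl⟩, rfl⟩ => exact fun x hx => hκ.θ x hx k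
    · match q, η, hη with
      | 2, _, Or.inl rfl =>
        intro x hx
        simp only [wedge_comp]
        exact hκ.h x hx
      | 2, _, Or.inr rfl =>
        intro x hx
        simp only [wedge_comp]
        exact hκ.c x hx

end AdaptedCoframe

variable [FiniteDimensional ℝ E] [IsManifold 𝓘(ℝ, E) ∞ M]

/-- A basis of the model ideal in degree `p`, pulled back by any adapted coframe, is a frame of `I
p`; the rank therefore depends only on `s` and `p`. An arbitrary section is expanded in this frame
with smooth coefficients, and the Leibniz rule reduces closedness to `IsClosed.extD_comp_cof`. -/
theorem isEDSOn_of_coframes {U : Set M} (hU : IsOpen U)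
    (h : ∀ x ∈ U, ∃ U' : Set M, IsOpen U' ∧ x ∈ U' ∧ ∃ κ : AdaptedCoframe s I U', κ.IsClosed) :
    IsEDSOn I U := by
  have key : ∀ x ∈ U, ∃ U' : Set M, IsOpen U' ∧ x ∈ U' ∧ U' ⊆ U ∧
      ∃ κ : AdaptedCoframe s I U', κ.IsClosed := by
    intro x hx
    obtain ⟨U', hU', hxU', κ, hκ⟩ := h x hx
    exact ⟨U ∩ U', hU.inter hU', ⟨hx, hxU'⟩, inter_subset_left, κ.restrict inter_subset_right,
      fun y hy => hκ.θ y hy.2, fun y hy => hκ.h y hy.2, fun y hy => hκ.c y hy.2⟩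
  choose r b hb hspan using fun p => exists_frame (algIdeal (modelGen s) p)
  have hbmem : ∀ p i, b p i ∈ algIdeal (modelGen s) p := fun p i => by
    rw [← hspan]; exact Submodule.subset_span ⟨i, rfl⟩
  have frame : ∀ p, ∀ U' : Set M, ∀ κ : AdaptedCoframe s I U', ∀ y ∈ U',
      LinearIndependent ℝ (fun i => (b p i).compContinuousLinearMap (κ.cof y)) ∧
      I p y = Submodule.span ℝ (range fun i => (b p i).compContinuousLinearMap (κ.cof y)) := by
    intro p U' κ y hy
    have hinj : Function.Injective (compL p (κ.cof y)) := by
      intro η η' h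
      ext v
      choose w hw using fun k => (κ.cof_bijective hy).2 (v k)
      have := DFunLike.congr_fun h w
      rw [compL_apply, compL_apply, ContinuousAlternatingMap.compContinuousLinearMap_apply,
        ContinuousAlternatingMap.compContinuousLinearMap_apply] at this
      have e : (⇑(κ.cof y) ∘ w) = v := funext hw
      rwa [e] at this
    refine ⟨(hb p).map' (compL p (κ.cof y)) (LinearMap.ker_eq_bot.2 hinj), ?_⟩
    have h1 : I p y = (algIdeal (modelGen s) p).map (compL p (κ.cof y)) := by
      refine le_antisymm (fun η hη => ?_) ?_
      · obtain ⟨c, hc, rfl⟩ := κ.exists_comp_cof hy hη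
        exact Submodule.mem_map_of_mem hc
      · rintro _ ⟨c, hc, rfl⟩
        exact κ.comp_cof_mem hy hc
    rw [h1, ← hspan, Submodule.map_span, ← range_comp]
    rfl
  refine ⟨fun p => ⟨r p, fun x hx => ?_⟩, fun x hx p α η hη => ?_,
    fun p U₁ hU₁ hU₁U η hη hmem x hx => ?_⟩
  · obtain ⟨U', hU', hxU', hU'U, κ, hκ⟩ := key x hx
    exact ⟨U', hU', hxU', hU'U, _, fun i => κ.smooth_comp_cof _, frame p U' κ⟩
  · obtain ⟨U', -, hxU', -, κ, -⟩ := key x hx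
    exact κ.wedge_mem hxU' α hη
  · obtain ⟨U', hU', hxU', -, κ, hκ⟩ := key x (hU₁U hx)
    obtain ⟨U₂, hU₂, hU₂', hxU₂, f, hf, hfe⟩ := SmoothForm.exists_coeff (hU₁.inter hU')
      (ξ := fun i y => (b p i).compContinuousLinearMap (κ.cof y))
      (fun i => (κ.smooth_comp_cof _).mono inter_subset_right) ⟨hx, hxU'⟩
      (frame p U' κ x hxU').1 (hη.mono inter_subset_left)
      (fun y hy => by rw [← (frame p U' κ y hy.2).2]; exact hmem y hy.1)
    have hs : ∀ i, SmoothForm (fun y => (b p i).compContinuousLinearMap (κ.cof y)) U₂ :=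
      fun i => (κ.smooth_comp_cof _).mono (hU₂.trans inter_subset_right)
    rw [extD_congr (Filter.eventuallyEq_of_mem (hU₂'.mem_nhds hxU₂) hfe),
      extD_sum _ hU₂' (fun i _ => SmoothForm.smul hU₂' (hf i) (hs i)) hxU₂]
    refine Submodule.sum_mem _ fun i _ => ?_
    rw [extD_smul hU₂' (hf i) (hs i) hxU₂]
    exact Submodule.add_mem _ (κ.wedge_mem hxU' _ (κ.comp_cof_mem hxU' (hbmem p i)))
      (Submodule.smul_mem _ _ (hκ.extD_comp_cof hU' (hbmem p i) x hxU'))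

end Coframe

/-! ### Uniqueness of the singular systems up to interchange -/

section Uniqueness

variable {E : Type*} [NormedAddCommGroup E] [NormedSpace ℝ E]
  {M : Type*} [TopologicalSpace M] [ChartedSpace E M] {s : ℕ} {I : FormFamily E M}

theorem linearIndependent_of_dual {ι : Type*} [Finite ι] {L : ι → E →L[ℝ] ℝ}
    (h : ∀ i, ∃ v, L i v = 1 ∧ ∀ k, k ≠ i → L k v = 0) : LinearIndependent ℝ L := by
  have := Fintype.ofFinite ι
  rw [Fintype.linearIndependent_iff]
  intro g hg i
  obtain ⟨v, hv, hv'⟩ := h i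
  have h1 := DFunLike.congr_fun hg v
  rw [sum_apply, Finset.sum_eq_single i] at h1
  · simpa [hv] using h1
  · intro k _ hk
    rw [smul_apply, hv' k hk, smul_zero]
  · intro hi
    exact absurd (Finset.mem_univ i) hi

namespace AdaptedCoframe

variable {U U' : Set M} (κ : AdaptedCoframe s I U) (κ' : AdaptedCoframe s I U')

theorem exists_cof_eq {x : M} (hx : x ∈ U) (a : Fin s → ℝ) (b c : Fin 2 → ℝ) :
    ∃ v, (∀ k, κ.θ k x v = a k) ∧ (∀ k, κ.h k x v = b k) ∧ ∀ k, κ.c k x v = c k := by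
  obtain ⟨v, hv⟩ := (κ.coframe x hx).2 (a, b, c)
  simp only [Prod.mk.injEq, funext_iff] at hv
  exact ⟨v, hv⟩

theorem eq_zero {x : M} (hx : x ∈ U) {v : E} (h1 : ∀ k, κ.θ k x v = 0) (h2 : ∀ k, κ.h k x v = 0)
    (h3 : ∀ k, κ.c k x v = 0) : v = 0 := by
  refine (κ.coframe x hx).1 ?_
  simp only [h1, h2, h3, map_zero]

theorem finrank_Vh {x : M} (hx : x ∈ U) : finrank ℝ (κ.Vh x) = s + 2 := by
  have h1 : ((range fun i => κ.θ i x) ∪ (range fun i => κ.h i x)) =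
    range (Sum.elim (fun i => κ.θ i x) fun i => κ.h i x) := (Sum.elim_range _ _).symm
  rw [Vh, h1, finrank_span_eq_card]
  · simp
  refine linearIndependent_of_dual ?_
  rintro (i | i)
  · obtain ⟨v, h1, h2, -⟩ := κ.exists_cof_eq hx (Pi.single i 1) 0 0
    refine ⟨v, by simp [h1], ?_⟩
    rintro (k | k) hk
    · have : k ≠ i := fun h => hk (by rw [h])
      simp [h1, this]
    · simp [h2]
  · obtain ⟨v, h1, h2, -⟩ := κ.exists_cof_eq hx 0 (Pi.single i 1) 0
    refine ⟨v, by simp [h2], ?_⟩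
    rintro (k | k) hk
    · simp [h1]
    · have : k ≠ i := fun h => hk (by rw [h])
      simp [h2, this]

theorem finrank_Vc {x : M} (hx : x ∈ U) : finrank ℝ (κ.Vc x) = s + 2 := κ.swap.finrank_Vh hx

/-- On the kernel of the forms `θ`, the 2-forms of the ideal are combinations of the two
decomposable generators. -/
theorem two_form_eq {x : M} (hx : x ∈ U) {η : E [⋀^Fin 2]→L[ℝ] ℝ} (hη : η ∈ I 2 x) :
    ∃ r t : ℝ, ∀ v w : E, (∀ k, κ.θ k x v = 0) → (∀ k, κ.θ k x w = 0) →
      η ![v, w] = r * (κ.h 0 x v * κ.h 1 x w - κ.h 0 x w * κ.h 1 x v) +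
        t * (κ.c 0 x v * κ.c 1 x w - κ.c 0 x w * κ.c 1 x v) := by
  set A : Submodule ℝ E := annih (Submodule.span ℝ (range fun k => κ.θ k x)) with hA
  have hAm : ∀ v, (∀ k, κ.θ k x v = 0) → v ∈ A := by
    intro v hv α hα
    exact (mem_span_range_iff _ _).1 hα v hv
  have hAm' : ∀ v ∈ A, ∀ k, κ.θ k x v = 0 :=
    fun v hv k => hv _ (Submodule.subset_span ⟨k, rfl⟩)
  set T : Set (E [⋀^Fin 2]→L[ℝ] ℝ) :=
    {wedge (κ.h 0 x) (ofOne (κ.h 1 x)), wedge (κ.c 0 x) (ofOne (κ.c 1 x))} with hT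
  have h1 : η ∈ vanishOn A 2 ⊔ Submodule.span ℝ T := by
    rw [κ.generate x hx] at hη
    -- In degree two the ideal is spanned by the two decomposable generators modulo forms that
    -- vanish on the kernel `A` of the `θ`. The family is closed under exterior multiplication
    -- because its degree-one members vanish on `A`, and so do their multiples.
    refine algIdeal_induction (fun q => match q with
        | 0 => ⊥
        | 1 => vanishOn A 1
        | 2 => vanishOn A 2 ⊔ Submodule.span ℝ T
        | _ + 3 => ⊤) ?_ ?_ hη
    · intro q β η hη
      match q with
      | 0 =>
        rw [(Submodule.mem_bot ℝ).1 hη, ← wedgeL_apply, map_zero]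
        exact Submodule.zero_mem _
      | 1 => exact Submodule.mem_sup_left (wedge_mem_vanishOn _ _ _ _ hη)
      | _ + 2 => exact Submodule.mem_top
    · intro q
      match q with
      | 0 => simp [oneForms, twoForms]
      | 1 =>
        rintro _ (⟨_, ⟨k, rfl⟩, rfl⟩ | h)
        · exact fun v hv => hAm' _ (hv 0) k
        · exact h.elim
      | 2 =>
        rintro η (h | h)
        · exact h.elim
        · exact Submodule.mem_sup_right (Submodule.subset_span h)
      | _ + 3 => exact subset_univ _
  obtain ⟨η₁, h1, η₂, h2, rfl⟩ := Submodule.mem_sup.1 h1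
  obtain ⟨r, t, rfl⟩ := Submodule.mem_span_pair.1 h2
  refine ⟨r, t, fun v w hv hw => ?_⟩
  have h0 : η₁ ![v, w] = 0 := by
    refine (show η₁ ∈ vanishOn A 2 from by assumption) _ fun k => ?_
    fin_cases k
    exacts [hAm v hv, hAm w hw]
  simp [h0, wedge_ofOne_apply]

/-- The Pfaffian system of one coframe is one of the two of another one. -/
theorem Vh_eq_or {x : M} (hx : x ∈ U) (hx' : x ∈ U') : κ'.Vh x = κ.Vh x ∨ κ'.Vh x = κ.Vc x := by
  have hθ : ∀ v, (∀ k, κ.θ k x v = 0) ↔ ∀ k, κ'.θ k x v = 0 := fun v =>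
    ⟨fun h k => (κ.ofOne_mem hx).1 (κ'.mem_theta hx' k) v h,
      fun h k => (κ'.ofOne_mem hx').1 (κ.mem_theta hx k) v h⟩
  obtain ⟨r, t, hrt⟩ := κ.two_form_eq hx (κ'.mem_h hx')
  have hw : ∀ v w, (∀ k, κ.θ k x v = 0) → (∀ k, κ.θ k x w = 0) →
      κ'.h 0 x v * κ'.h 1 x w - κ'.h 0 x w * κ'.h 1 x v =
        r * (κ.h 0 x v * κ.h 1 x w - κ.h 0 x w * κ.h 1 x v) +
        t * (κ.c 0 x v * κ.c 1 x w - κ.c 0 x w * κ.c 1 x v) := by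
    intro v w hv hw
    rw [← hrt v w hv hw, wedge_ofOne_apply]
    rfl
  -- Pairing with vectors dual to `κ'.h` shows that the radical of `κ'.h 0 ∧ κ'.h 1` on the kernel
  -- of `θ` is the common kernel of the two factors.
  have key : ∀ u, (∀ k, κ.θ k x u = 0) → (∀ v, (∀ k, κ.θ k x v = 0) →
      κ'.h 0 x v * κ'.h 1 x u - κ'.h 0 x u * κ'.h 1 x v = 0) → ∀ k, κ'.h k x u = 0 := by
    intro u hu huv
    obtain ⟨v, h1, h2, -⟩ := κ'.exists_cof_eq hx' 0 ![1, 0] 0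
    obtain ⟨w, h3, h4, -⟩ := κ'.exists_cof_eq hx' 0 ![0, 1] 0
    have e1 := huv v ((hθ v).2 h1)
    have e2 := huv w ((hθ w).2 h3)
    simp [h2, h4] at e1 e2
    intro k
    fin_cases k
    exacts [e2, e1]
  -- The 2-form is decomposable, so it satisfies the Plücker relation. On the dual vectors `v, w,
  -- v', w'` its mixed values vanish, and the relation becomes `r * t = 0`.
  have hr : r = 0 ∨ t = 0 := by
    obtain ⟨v, h1, h2, h3⟩ := κ.exists_cof_eq hx 0 ![1, 0] 0
    obtain ⟨w, k1, k2, k3⟩ := κ.exists_cof_eq hx 0 ![0, 1] 0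
    obtain ⟨v', h1', h2', h3'⟩ := κ.exists_cof_eq hx 0 0 ![1, 0]
    obtain ⟨w', k1', k2', k3'⟩ := κ.exists_cof_eq hx 0 0 ![0, 1]
    have e1 := hw v w h1 k1
    have e2 := hw v' w' h1' k1'
    have e3 := hw v v' h1 h1'
    have e4 := hw w w' k1 k1'
    have e5 := hw v w' h1 k1'
    have e6 := hw w v' k1 h1'
    simp [h2, h3, k2, k3, h2', h3', k2', k3'] at e1 e2 e3 e4 e5 e6
    rw [← mul_eq_zero, ← e1, ← e2]
    linear_combination (κ'.h 0 x w * κ'.h 1 x w' - κ'.h 0 x w' * κ'.h 1 x w) * e3 -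
      (κ'.h 0 x w * κ'.h 1 x v' - κ'.h 0 x v' * κ'.h 1 x w) * e5
  have : FiniteDimensional ℝ (κ.Vh x) :=
    FiniteDimensional.of_finrank_eq_succ (n := s + 1) (κ.finrank_Vh hx)
  have : FiniteDimensional ℝ (κ.Vc x) :=
    FiniteDimensional.of_finrank_eq_succ (n := s + 1) (κ.finrank_Vc hx)
  rcases hr with rfl | rfl
  · right
    refine Submodule.eq_of_le_of_finrank_eq (fun α hα => κ.mem_Vc.2 fun u h1 h2 => ?_)
      (by rw [κ.finrank_Vc hx, κ'.finrank_Vh hx'])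
    refine κ'.mem_Vh.1 hα u ((hθ u).1 h1) (key u h1 fun v hv => ?_)
    rw [hw v u hv h1, h2, h2]
    ring
  · left
    refine Submodule.eq_of_le_of_finrank_eq (fun α hα => κ.mem_Vh.2 fun u h1 h2 => ?_)
      (by rw [κ.finrank_Vh hx, κ'.finrank_Vh hx'])
    refine κ'.mem_Vh.1 hα u ((hθ u).1 h1) (key u h1 fun v hv => ?_)
    rw [hw v u hv h1, h2, h2]
    ring

theorem Vh_ne_Vc {x : M} (hx : x ∈ U) : κ.Vh x ≠ κ.Vc x := by
  intro h
  obtain ⟨v, h1, h2, h3⟩ := κ.exists_cof_eq hx 0 ![1, 0] 0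
  have h4 : κ.h 0 x ∈ κ.Vc x := by
    rw [← h]
    exact κ.mem_Vh.2 fun v _ hv => hv 0
  have := κ.mem_Vc.1 h4 v (by simpa using h1) (by simpa using h3)
  rw [h2] at this
  simp at this

/-- The pair of singular Pfaffian systems is unique up to interchange. -/
theorem eq_or_swap {x : M} (hx : x ∈ U) (hx' : x ∈ U') :
    (κ'.Vh x = κ.Vh x ∧ κ'.Vc x = κ.Vc x) ∨ (κ'.Vh x = κ.Vc x ∧ κ'.Vc x = κ.Vh x) := by
  have h1 := κ'.Vh_ne_Vc hx'
  have h2 : κ'.Vc x = κ.Vh x ∨ κ'.Vc x = κ.Vc x := κ.Vh_eq_or κ'.swap hx hx'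
  rcases κ.Vh_eq_or κ' hx hx' with h | h <;> rcases h2 with h' | h'
  · exact absurd (h.trans h'.symm) h1
  · exact Or.inl ⟨h, h'⟩
  · exact Or.inr ⟨h, h'⟩
  · exact absurd (h.trans h'.symm) h1

variable [FiniteDimensional ℝ E] [IsManifold 𝓘(ℝ, E) ∞ M]

/-- The value of a smooth field of covectors on a vector with constant components in a coframe
depends continuously on the point. -/
theorem eventually_ne (hU : IsOpen U) (hU' : IsOpen U') {x : M} (hx : x ∈ U) (hx' : x ∈ U')
    {α : M → E →L[ℝ] ℝ} (hα : SmoothCov α U') {v₀ : E} (hne : α x v₀ ≠ 0) :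
    ∀ᶠ y in 𝓝 x, ∀ v, κ.cof y v = κ.cof x v₀ → α y v ≠ 0 := by
  set φ := chartAt E x
  have hφ : φ ∈ atlas E M := chart_mem_atlas E x
  have hs : x ∈ φ.source := mem_chart_source E x
  set w := κ.cof x v₀
  have hc : ContinuousAt (fun y => chartCov φ α y (κ.vec φ y w)) (φ x) := by
    have h1 : ContinuousAt (chartCov φ α) (φ x) := ((hα φ hφ).contDiffAt
      ((φ.isOpen_inter_preimage_symm hU').mem_nhds ⟨φ.map_source hs, by
        rwa [mem_preimage, φ.left_inv hs]⟩)).continuousAt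
    have h2 : ContinuousAt (fun y => ContinuousLinearMap.inverse (chartCov φ κ.cof y)) (φ x) :=
      ((κ.vec_smooth hφ).contDiffAt ((φ.isOpen_inter_preimage_symm hU).mem_nhds
        ⟨φ.map_source hs, by rwa [mem_preimage, φ.left_inv hs]⟩)).continuousAt
    exact h1.clm_apply (h2.clm_apply continuousAt_const)
  have huniq : ∀ y ∈ φ.source, y ∈ U → ∀ v, κ.cof y v = w →
      chartCov φ α (φ y) (κ.vec φ (φ y) w) = α y v := by
    intro y hy hyU v hv
    have h1 := κ.cof_vec hφ (φ.map_source hy) (by rwa [φ.left_inv hy]) w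
    rw [← hv] at h1
    have h2 := (κ.cof_bijective (by rwa [φ.left_inv hy])).1
      (h1.trans (by rw [φ.left_inv hy]))
    rw [chartCov, ContinuousLinearMap.comp_apply, ← hv, h2, φ.left_inv hy]
  have h0 : chartCov φ α (φ x) (κ.vec φ (φ x) w) ≠ 0 := by
    rw [huniq x hs hx v₀ rfl]
    exact hne
  have h3 := (φ.continuousAt hs).eventually (hc.eventually_ne h0)
  filter_upwards [h3, φ.open_source.mem_nhds hs, hU.mem_nhds hx] with y hy hys hyU v hv
  rw [← huniq y hys hyU v hv]
  exact hy

/-- An interchange would make every `κ'.h i` vanish on the kernel of `θ` and `c`. At `x` some vector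
in this kernel shows the contrary, and by `eventually_ne` the vector with the same components does
so at nearby points; this decides the alternative `eq_or_swap` there. -/
theorem eventually_eq (hU : IsOpen U) (hU' : IsOpen U') {x : M} (hx : x ∈ U) (hx' : x ∈ U')
    (h : κ'.Vh x = κ.Vh x) : ∀ᶠ y in 𝓝 x, κ'.Vh y = κ.Vh y ∧ κ'.Vc y = κ.Vc y := by
  have h0 : ∃ v, (∀ k, κ.θ k x v = 0) ∧ (∀ k, κ.c k x v = 0) ∧ ∃ i, κ'.h i x v ≠ 0 := by
    by_contra! hcon
    have h1 : κ'.Vh x = κ.Vc x := by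
      have : FiniteDimensional ℝ (κ.Vc x) :=
        FiniteDimensional.of_finrank_eq_succ (n := s + 1) (κ.finrank_Vc hx)
      refine Submodule.eq_of_le_of_finrank_eq (fun α hα => κ.mem_Vc.2 fun u h1 h2 => ?_)
        (by rw [κ.finrank_Vc hx, κ'.finrank_Vh hx'])
      exact κ'.mem_Vh.1 hα u
        (fun k => (κ.ofOne_mem hx).1 (κ'.mem_theta hx' k) u h1) (hcon u h1 h2)
    exact κ.Vh_ne_Vc hx (h.symm.trans h1)
  obtain ⟨v, h1, h2, i, h3⟩ := h0
  filter_upwards [κ.eventually_ne hU hU' hx hx' (κ'.smooth_h i) h3, hU.mem_nhds hx,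
    hU'.mem_nhds hx'] with y hy hyU hyU'
  refine (κ.eq_or_swap κ' hyU hyU').resolve_right fun hcon => ?_
  obtain ⟨w, hw⟩ := (κ.cof_bijective hyU).2 (κ.cof x v)
  refine hy w hw ?_
  have h4 : κ'.h i y ∈ κ.Vc y := by
    rw [← hcon.1]
    exact κ'.mem_Vh.2 fun v _ hv => hv i
  refine κ.mem_Vc.1 h4 w (fun k => ?_) fun k => ?_
  · exact (congrFun (congrArg Prod.fst hw) k).trans (h1 k)
  · exact (congrFun (congrArg (fun q => q.2.2) hw) k).trans (h2 k)

/-- The pair of singular Pfaffian systems is locally unique up to interchange. -/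
theorem eventually_eq_or_swap (hU : IsOpen U) (hU' : IsOpen U') {x : M} (hx : x ∈ U)
    (hx' : x ∈ U') : (∀ᶠ y in 𝓝 x, κ'.Vh y = κ.Vh y ∧ κ'.Vc y = κ.Vc y) ∨
      ∀ᶠ y in 𝓝 x, κ'.Vh y = κ.Vc y ∧ κ'.Vc y = κ.Vh y := by
  rcases κ.Vh_eq_or κ' hx hx' with h | h
  · exact Or.inl (κ.eventually_eq κ' hU hU' hx hx' h)
  · exact Or.inr (κ.swap.eventually_eq κ' hU hU' hx hx' h)

end AdaptedCoframe
end Uniqueness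

/-! ### Adapted coframes of extensions with one-dimensional fibres -/

section Extension

variable {E : Type*} [NormedAddCommGroup E] [NormedSpace ℝ E] [FiniteDimensional ℝ E]
  {E' : Type*} [NormedAddCommGroup E'] [NormedSpace ℝ E'] [FiniteDimensional ℝ E']
  {M : Type*} [TopologicalSpace M] [ChartedSpace E M]
  {M' : Type*} [TopologicalSpace M'] [ChartedSpace E' M']
  {p : M → M'} {B : FormFamily E M} {I : FormFamily E' M'}
  {J : M → Submodule ℝ (E →L[ℝ] ℝ)} {U : Set M} {x : M}

theorem mem_pullCov {V : Submodule ℝ (E' →L[ℝ] ℝ)} {α : E →L[ℝ] ℝ} :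
    α ∈ pullCov p x V ↔ ∃ β ∈ V, α = β.comp (tmap p x : E →L[ℝ] E') := by
  have h : pullCov p x V = V.map (ContinuousLinearMap.precomp ℝ (tmap p x : E →L[ℝ] E')).toLinearMap := by
    rw [pullCov, ← Submodule.span_eq (p := V.map _)]
    rfl
  rw [h, Submodule.mem_map]
  exact exists_congr fun β => and_congr_right fun _ => eq_comm

theorem finrank_vertical (hs : Function.Surjective (tmap p x : E →L[ℝ] E'))
    (hd : finrank ℝ E = finrank ℝ E' + 1) : finrank ℝ (vertical E' p x : Submodule ℝ E) = 1 := by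
  have h := LinearMap.finrank_range_add_finrank_ker (tmap p x : E →L[ℝ] E').toLinearMap
  rw [LinearMap.range_eq_top.2 hs, finrank_top] at h
  change finrank ℝ E' + finrank ℝ (vertical E' p x : Submodule ℝ E) = finrank ℝ E at h
  omega

/-- A vector that spans the vertical line. -/
theorem exists_vertical (hs : Function.Surjective (tmap p x : E →L[ℝ] E'))
    (hd : finrank ℝ E = finrank ℝ E' + 1) : ∃ v : E, (tmap p x : E →L[ℝ] E') v = 0 ∧ v ≠ 0 ∧
      ∀ w : E, (tmap p x : E →L[ℝ] E') w = 0 → ∃ c : ℝ, w = c • v := by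
  obtain ⟨v, hv, h⟩ := finrank_eq_one_iff'.1 (finrank_vertical hs hd)
  refine ⟨v, v.2, fun h0 => hv (Subtype.ext h0), fun w hw => ?_⟩
  obtain ⟨c, hc⟩ := h ⟨w, hw⟩
  exact ⟨c, (congrArg Subtype.val hc).symm⟩

theorem IsAdmissibleOn.eq_zero (h : IsAdmissibleOn p B I J U) (hx : x ∈ U) {v : E}
    (h1 : ∀ α ∈ J x, α v = 0) (h2 : (tmap p x : E →L[ℝ] E') v = 0) : v = 0 :=
  (h.transverse x hx).disjoint.le_bot ⟨h1, h2⟩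

/-- A covector of `J` that is semibasic vanishes. -/
theorem IsAdmissibleOn.semibasic_eq_zero (h : IsAdmissibleOn p B I J U) (hx : x ∈ U)
    {α : E →L[ℝ] ℝ} (h1 : α ∈ J x) (h2 : α ∈ semibasic E' p x) : α = 0 := by
  ext v
  have hv : v ∈ annih (J x) ⊔ vertical E' p x := by
    rw [(h.transverse x hx).codisjoint.eq_top]
    trivial
  obtain ⟨a, ha, b, hb, rfl⟩ := Submodule.mem_sup.1 hv
  rw [map_add, ha α h1, h2 b hb, zero_add]
  rfl

theorem pullCov_le_semibasic (V : Submodule ℝ (E' →L[ℝ] ℝ)) : (pullCov p x V : Submodule ℝ (E →L[ℝ] ℝ)) ≤ semibasic E' p x := by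
  intro α hα v hv
  obtain ⟨β, -, rfl⟩ := mem_pullCov.1 hα
  rw [ContinuousLinearMap.comp_apply, hv, map_zero]

theorem IsAdmissibleOn.disjoint (h : IsAdmissibleOn p B I J U) (hx : x ∈ U)
    (V : Submodule ℝ (E' →L[ℝ] ℝ)) : Disjoint (J x) (pullCov p x V) :=
  Submodule.disjoint_def.2 fun _ h1 h2 => h.semibasic_eq_zero hx h1 (pullCov_le_semibasic V h2)

/-- Pullbacks are semibasic and `J` contains no semibasic covector except zero, so the `J`-component
has to vanish. This is what allows first integrals to descend. -/
theorem IsAdmissibleOn.sup_inf_semibasic (h : IsAdmissibleOn p B I J U) (hx : x ∈ U)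
    (V : Submodule ℝ (E' →L[ℝ] ℝ)) :
    (J x ⊔ pullCov p x V) ⊓ semibasic E' p x ≤ pullCov p x V := by
  rintro α ⟨h1, h2⟩
  obtain ⟨β, hβ, γ, hγ, rfl⟩ := Submodule.mem_sup.1 h1
  have h3 : β ∈ semibasic E' p x := by
    have := Submodule.sub_mem _ h2 (pullCov_le_semibasic V hγ)
    rwa [add_sub_cancel_right] at this
  rw [h.semibasic_eq_zero hx hβ h3, zero_add]
  exact hγ

/-- `J` has rank one if the fibres are one-dimensional. -/
theorem IsAdmissibleOn.exists_frame (h : IsAdmissibleOn p B I J U)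
    (hs : ∀ y ∈ U, Function.Surjective (tmap p y : E →L[ℝ] E'))
    (hd : finrank ℝ E = finrank ℝ E' + 1) (hx : x ∈ U) :
    ∃ W : Set M, IsOpen W ∧ x ∈ W ∧ W ⊆ U ∧ ∃ ϑ : M → E →L[ℝ] ℝ, SmoothCov ϑ W ∧
      ∀ y ∈ W, J y = Submodule.span ℝ {ϑ y} := by
  obtain ⟨r, hr⟩ := h.subbundle
  obtain ⟨W, hW, hxW, hWU, α, hα, hspan⟩ := hr x hx
  obtain ⟨v, hv, hv0, hv1⟩ := exists_vertical (hs x hx) hd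
  have h1 : ∀ β ∈ J x, β v = 0 → β = 0 := by
    intro β hβ hβv
    refine h.semibasic_eq_zero hx hβ fun w hw => ?_
    obtain ⟨c, rfl⟩ := hv1 w hw
    rw [map_smul, hβv, smul_zero]
  -- Evaluation at the vertical vector `v` is injective on `J x`, so the rank is at most one. Rank
  -- zero would put `v` into the annihilator of `J x`, against transversality.
  have hr1 : r ≤ 1 := by
    have h2 : LinearIndependent ℝ fun i => α i x v := by
      rw [Fintype.linearIndependent_iff]
      intro g hg
      refine Fintype.linearIndependent_iff.1 (hspan x hxW).1 g (h1 _ ?_ ?_)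
      · rw [(hspan x hxW).2]
        exact Submodule.sum_mem _ fun i _ => Submodule.smul_mem _ _ (Submodule.subset_span ⟨i, rfl⟩)
      · rw [sum_apply]
        exact hg
    simpa using h2.fintype_card_le_finrank
  have hr0 : r ≠ 0 := by
    rintro rfl
    refine hv0 (h.eq_zero hx (fun β hβ => ?_) hv)
    rw [(hspan x hxW).2, range_eq_empty, Submodule.span_empty] at hβ
    rw [(Submodule.mem_bot ℝ).1 hβ]
    rfl
  obtain rfl : r = 1 := by omega
  refine ⟨W, hW, hxW, hWU, α 0, hα 0, fun y hy => ?_⟩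
  rw [(hspan y hy).2, range_unique]
  rfl

variable [IsManifold 𝓘(ℝ, E) ∞ M] [IsManifold 𝓘(ℝ, E') ∞ M'] {s : ℕ} {U' : Set M'}

/-- The coframe of an integrable extension that is adapted to a coframe downstairs. -/
def extCoframe (h : IsAdmissibleOn p B I J U) (hd : finrank ℝ E = finrank ℝ E' + 1)
    (hU' : IsOpen U') (κ : AdaptedCoframe s I U') {W : Set M} (hW : IsOpen W) (hWU : W ⊆ U)
    (hWU' : MapsTo p W U') (hp : ContMDiffOn 𝓘(ℝ, E) 𝓘(ℝ, E') ∞ p W) {ϑ : M → E →L[ℝ] ℝ}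
    (hϑ : SmoothCov ϑ W) (hJ : ∀ y ∈ W, J y = Submodule.span ℝ {ϑ y}) :
    AdaptedCoframe (s + 1) B W where
  θ := Fin.cons ϑ fun k => pull p (κ.θ k)
  h k := pull p (κ.h k)
  c k := pull p (κ.c k)
  smooth_θ i := by
    refine Fin.cases hϑ (fun k => ?_) i
    exact (κ.smooth_θ k).pull hU' hW hp hWU'
  smooth_h k := (κ.smooth_h k).pull hU' hW hp hWU'
  smooth_c k := (κ.smooth_c k).pull hU' hW hp hWU'
  -- A common zero of `ϑ` and of the pulled-back coframe is vertical and annihilated by `J`, hence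
  -- zero; bijectivity then follows from the dimension count `hd`.
  coframe y hy := by
    set L : E →L[ℝ] ModelSpace (s + 1) :=
      (ContinuousLinearMap.pi fun i => (Fin.cons ϑ fun k => pull p (κ.θ k) :
        Fin (s + 1) → M → E →L[ℝ] ℝ) i y).prod
      ((ContinuousLinearMap.pi fun i => pull p (κ.h i) y).prod
        (ContinuousLinearMap.pi fun i => pull p (κ.c i) y)) with hL
    change Function.Bijective L.toLinearMap
    have hinj : Function.Injective L.toLinearMap := by
      rw [← LinearMap.ker_eq_bot, LinearMap.ker_eq_bot']
      intro v hv
      have h1 : ∀ i, (Fin.cons ϑ fun k => pull p (κ.θ k) : Fin (s + 1) → M → E →L[ℝ] ℝ) i y v = 0 :=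
        fun i => congrFun (congrArg Prod.fst hv) i
      have h2 : ∀ i, κ.h i (p y) ((tmap p y : E →L[ℝ] E') v) = 0 :=
        fun i => congrFun (congrArg (fun q : ModelSpace (s + 1) => q.2.1) hv) i
      have h3 : ∀ i, κ.c i (p y) ((tmap p y : E →L[ℝ] E') v) = 0 :=
        fun i => congrFun (congrArg (fun q : ModelSpace (s + 1) => q.2.2) hv) i
      refine h.eq_zero (hWU hy) (fun α hα => ?_) (κ.eq_zero (hWU' hy) (fun k => h1 k.succ) h2 h3)
      rw [hJ y hy] at hα
      obtain ⟨c, rfl⟩ := Submodule.mem_span_singleton.1 hα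
      have : ϑ y v = 0 := h1 0
      rw [smul_apply, this, smul_zero]
    refine ⟨hinj, (LinearMap.injective_iff_surjective_of_finrank_eq_finrank ?_).1 hinj⟩
    have h1 := (LinearEquiv.ofBijective (κ.cof (p y)).toLinearMap
      (κ.cof_bijective (hWU' hy))).finrank_eq
    rw [hd, h1]
    simp
  generate y hy q := by
    rw [h.generate y (hWU hy)]
    refine le_antisymm (algIdeal_le ?_ q) (algIdeal_le ?_ q)
    · rintro k η (hη | ⟨η, hη, rfl⟩)
      · refine oneForms_subset (fun α hα => ?_) k hη
        rw [hJ y hy] at hα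
        obtain ⟨c, rfl⟩ := Submodule.mem_span_singleton.1 hα
        rw [ofOne_smul]
        exact Submodule.smul_mem _ _ (subset_algIdeal _ _ (Or.inl (mem_oneForms ⟨0, rfl⟩)))
      · rw [SetLike.mem_coe, κ.generate _ (hWU' hy)] at hη
        refine comp_mem_algIdeal _ ?_ hη
        rintro q η (hη | hη)
        · match q, η, hη with
          | 1, _, ⟨_, ⟨k, rfl⟩, rfl⟩ =>
            exact subset_algIdeal _ _ (Or.inl ⟨_, ⟨k.succ, rfl⟩, rfl⟩)
        · match q, η, hη with
          | 2, _, Or.inl rfl =>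
            rw [wedge_comp]
            exact subset_algIdeal _ _ (Or.inr (Or.inl rfl))
          | 2, _, Or.inr rfl =>
            rw [wedge_comp]
            exact subset_algIdeal _ _ (Or.inr (Or.inr rfl))
    · rintro k η (hη | hη)
      · refine oneForms_subset ?_ k hη
        rintro _ ⟨i, rfl⟩
        rcases Fin.eq_zero_or_eq_succ i with rfl | ⟨k, rfl⟩
        · refine subset_algIdeal _ 1 (Or.inl (mem_oneForms ?_))
          rw [hJ y hy]
          exact Submodule.mem_span_singleton_self (ϑ y)
        · exact subset_algIdeal _ 1 (Or.inr ⟨_, κ.mem_theta (hWU' hy) k, rfl⟩)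
      · refine twoForms_subset (fun η hη => subset_algIdeal _ _ (Or.inr ?_)) k hη
        rcases hη with rfl | rfl
        · exact ⟨_, κ.mem_h (hWU' hy), wedge_comp _ _ _⟩
        · exact ⟨_, κ.mem_c (hWU' hy), wedge_comp _ _ _⟩

section

variable (h : IsAdmissibleOn p B I J U) (hd : finrank ℝ E = finrank ℝ E' + 1)
    (hU' : IsOpen U') (κ : AdaptedCoframe s I U') {W : Set M} (hW : IsOpen W) (hWU : W ⊆ U)
    (hWU' : MapsTo p W U') (hp : ContMDiffOn 𝓘(ℝ, E) 𝓘(ℝ, E') ∞ p W) {ϑ : M → E →L[ℝ] ℝ}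
    (hϑ : SmoothCov ϑ W) (hJ : ∀ y ∈ W, J y = Submodule.span ℝ {ϑ y})

theorem extCoframe_Vh {y : M} (hy : y ∈ W) :
    (extCoframe h hd hU' κ hW hWU hWU' hp hϑ hJ).Vh y = J y ⊔ pullCov p y (κ.Vh (p y)) := by
  have h1 : (pullCov p y (κ.Vh (p y)) : Submodule ℝ (E →L[ℝ] ℝ)) = Submodule.span ℝ
      ((range fun k => pull p (κ.θ k) y) ∪ range fun k => pull p (κ.h k) y) := by
    refine le_antisymm (fun α hα => ?_) (Submodule.span_le.2 ?_)
    · obtain ⟨β, hβ, rfl⟩ := mem_pullCov.1 hα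
      have := Submodule.mem_map_of_mem
        (f := (ContinuousLinearMap.precomp ℝ (tmap p y : E →L[ℝ] E')).toLinearMap) hβ
      rw [AdaptedCoframe.Vh, Submodule.map_span, image_union, ← range_comp, ← range_comp] at this
      exact this
    · rintro _ (⟨k, rfl⟩ | ⟨k, rfl⟩)
      · exact mem_pullCov.2 ⟨_, Submodule.subset_span (Or.inl ⟨k, rfl⟩), rfl⟩
      · exact mem_pullCov.2 ⟨_, Submodule.subset_span (Or.inr ⟨k, rfl⟩), rfl⟩
  rw [h1, hJ y hy, ← Submodule.span_union, AdaptedCoframe.Vh]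
  congr 1
  rw [← union_assoc]
  congr 1
  ext α
  constructor
  · rintro ⟨i, rfl⟩
    revert i
    refine Fin.cases (Or.inl rfl) fun k => Or.inr ⟨k, rfl⟩
  · rintro (rfl | ⟨k, rfl⟩)
    · exact ⟨0, rfl⟩
    · exact ⟨k.succ, rfl⟩

theorem extCoframe_Vc {y : M} (hy : y ∈ W) :
    (extCoframe h hd hU' κ hW hWU hWU' hp hϑ hJ).Vc y = J y ⊔ pullCov p y (κ.Vc (p y)) :=
  extCoframe_Vh h hd hU' κ.swap hW hWU hWU' hp hϑ hJ hy

/-- Pullback commutes with `d` and carries `I` into `B`, so the pulled-back generators inherit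
closedness. Only `ϑ`, which does not come from below, needs a hypothesis. -/
theorem extCoframe_isClosed (hκ : κ.IsClosed) (hdϑ : ∀ y ∈ W, extD (fun y => ofOne (ϑ y)) y ∈ B 2 y) :
    (extCoframe h hd hU' κ hW hWU hWU' hp hϑ hJ).IsClosed := by
  have hB : ∀ y ∈ W, ∀ q, ∀ η ∈ I q (p y), η.compContinuousLinearMap (tmap p y) ∈ B q y := by
    intro y hy q η hη
    rw [h.generate y (hWU hy)]
    exact subset_algIdeal _ _ (Or.inr ⟨η, hη, rfl⟩)
  have key : ∀ y ∈ W, ∀ q (η : M' → E' [⋀^Fin q]→L[ℝ] ℝ), SmoothForm η U' →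
      extD η (p y) ∈ I (q + 1) (p y) → extD (E := E) (pullForm p η) y ∈ B (q + 1) y := by
    intro y hy q η hη hmem
    rw [extD_pullForm hU' hη hW hp hy (hWU' hy)]
    exact hB y hy _ _ hmem
  have hw : ∀ σ : Fin 2 → M' → E' →L[ℝ] ℝ, (∀ k, SmoothCov (σ k) U') →
      (∀ y ∈ U', extD (fun y => wedge (σ 0 y) (ofOne (σ 1 y))) y ∈ I 3 y) → ∀ y ∈ W,
      extD (fun y => wedge (pull p (σ 0) y : E →L[ℝ] ℝ) (ofOne (pull p (σ 1) y))) y ∈ B 3 y := by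
    intro σ hσ hdσ y hy
    have h1 : SmoothForm (fun y => wedge (σ 0 y) (ofOne (σ 1 y))) U' :=
      SmoothForm.wedge (hσ 0) (smoothCov_iff.1 (hσ 1))
    have h2 := key y hy 2 _ h1 (hdσ _ (hWU' hy))
    have h3 : pullForm (E := E) p (fun y => wedge (σ 0 y) (ofOne (σ 1 y))) =
        fun y => wedge (pull p (σ 0) y : E →L[ℝ] ℝ) (ofOne (pull p (σ 1) y)) :=
      funext fun y => wedge_comp _ _ _
    rwa [h3] at h2
  refine ⟨fun y hy k => ?_, fun y hy => ?_, fun y hy => ?_⟩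
  · rcases Fin.eq_zero_or_eq_succ k with rfl | ⟨k, rfl⟩
    · exact hdϑ y hy
    · exact key y hy 1 (fun y => ofOne (κ.θ k y)) (smoothCov_iff.1 (κ.smooth_θ k))
        (hκ.θ _ (hWU' hy) k)
  · exact hw κ.h κ.smooth_h hκ.h y hy
  · exact hw κ.c κ.smooth_c hκ.c y hy

end

/-- The coframe `κ'` of an integrable extension lifts the coframe `κ`. -/
structure AdaptedCoframe.IsLift {W : Set M} (κ' : AdaptedCoframe (s + 1) B W)
    (κ : AdaptedCoframe s I U') (p : M → M') (J : M → Submodule ℝ (E →L[ℝ] ℝ)) : Prop where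
  mapsTo : MapsTo p W U'
  θ_zero : ∀ y ∈ W, κ'.θ 0 y ∈ J y
  θ_succ : ∀ y ∈ W, ∀ k, κ'.θ (Fin.succ k) y = (κ.θ k (p y)).comp (tmap p y : E →L[ℝ] E')
  h : ∀ y ∈ W, ∀ k, κ'.h k y = (κ.h k (p y)).comp (tmap p y : E →L[ℝ] E')
  c : ∀ y ∈ W, ∀ k, κ'.c k y = (κ.c k (p y)).comp (tmap p y : E →L[ℝ] E')
  Vh : ∀ y ∈ W, κ'.Vh y = J y ⊔ pullCov p y (κ.Vh (p y))
  Vc : ∀ y ∈ W, κ'.Vc y = J y ⊔ pullCov p y (κ.Vc (p y))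

theorem AdaptedCoframe.IsLift.swap {W : Set M} {κ' : AdaptedCoframe (s + 1) B W}
    {κ : AdaptedCoframe s I U'} (h : κ'.IsLift κ p J) : κ'.swap.IsLift κ.swap p J :=
  ⟨h.mapsTo, h.θ_zero, h.θ_succ, h.c, h.h, h.Vc, h.Vh⟩

/-- The local form of `extCoframe`. Closedness is a conditional conclusion because it serves where
`B` is not yet known to be an exterior differential system; elsewhere only the lift is used. -/
theorem IsAdmissibleOn.exists_coframe (h : IsAdmissibleOn p B I J U)
    (hs : ∀ y ∈ U, Function.Surjective (tmap p y : E →L[ℝ] E'))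
    (hd : finrank ℝ E = finrank ℝ E' + 1) (hp : ContMDiffOn 𝓘(ℝ, E) 𝓘(ℝ, E') ∞ p U)
    (hU' : IsOpen U') (κ : AdaptedCoframe s I U') (hx : x ∈ U) (hx' : p x ∈ U') :
    ∃ W : Set M, IsOpen W ∧ x ∈ W ∧ W ⊆ U ∧ ∃ κ' : AdaptedCoframe (s + 1) B W,
      κ'.IsLift κ p J ∧
      (κ.IsClosed → (∀ (α : M → E →L[ℝ] ℝ) (W' : Set M), IsOpen W' → W' ⊆ U → SmoothCov α W' →
        (∀ y ∈ W', α y ∈ J y) → ∀ y ∈ W', extD (fun y => ofOne (α y)) y ∈ B 2 y) →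
        κ'.IsClosed) := by
  obtain ⟨W₀, hW₀, hxW₀, hW₀U, ϑ, hϑ, hJ⟩ := h.exists_frame hs hd hx
  have hW : IsOpen (W₀ ∩ p ⁻¹' U') := (hp.continuousOn.mono hW₀U).isOpen_inter_preimage hW₀ hU'
  have hWU : W₀ ∩ p ⁻¹' U' ⊆ U := inter_subset_left.trans hW₀U
  have hm : MapsTo p (W₀ ∩ p ⁻¹' U') U' := fun y hy => hy.2
  have hJ' : ∀ y ∈ W₀ ∩ p ⁻¹' U', J y = Submodule.span ℝ {ϑ y} := fun y hy => hJ y hy.1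
  have hmem : ∀ y ∈ W₀ ∩ p ⁻¹' U', ϑ y ∈ J y := fun y hy => by
    rw [hJ' y hy]
    exact Submodule.mem_span_singleton_self _
  refine ⟨_, hW, ⟨hxW₀, hx'⟩, hWU, extCoframe h hd hU' κ hW hWU hm (hp.mono hWU)
    (hϑ.mono inter_subset_left) hJ', ⟨hm, hmem, fun _ _ _ => rfl, fun _ _ _ => rfl,
    fun _ _ _ => rfl, fun y hy => extCoframe_Vh h hd hU' κ hW hWU hm _ _ hJ' hy,
    fun y hy => extCoframe_Vc h hd hU' κ hW hWU hm _ _ hJ' hy⟩, fun hκ hd' => ?_⟩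
  exact extCoframe_isClosed h hd hU' κ hW hWU hm _ _ hJ' hκ
    (hd' ϑ _ hW hWU (hϑ.mono inter_subset_left) hmem)

end Extension

/-! ### Points and slopes as coordinates on the space of integral elements -/

section ProlongationSpace

variable {E : Type*} [NormedAddCommGroup E] [NormedSpace ℝ E] [FiniteDimensional ℝ E]
  {M : Type*} [TopologicalSpace M] [ChartedSpace E M] [IsManifold 𝓘(ℝ, E) ∞ M]
  {s : ℕ} {I : FormFamily E M}

/-- The tangent map of the projection of an integral element to its point. -/
abbrev dpt (z : IntegralElement s I) : (E × ℝ × ℝ) →L[ℝ] E :=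
  tmap (fun z : IntegralElement s I => z.pt) z

namespace AdaptedCoframe

variable {U : Set M} (κ : AdaptedCoframe s I U)

/-- The integral elements on which `σ̂^i` and `σ̌^j` do not vanish. -/
def dom (i j : Fin 2) : Set (IntegralElement s I) :=
  {z | z.pt ∈ U ∧ (∃ v ∈ z.plane, κ.h i z.pt v ≠ 0) ∧ ∃ v ∈ z.plane, κ.c j z.pt v ≠ 0}

/-- The slope of an integral element with respect to the first pair. -/
def sh (i : Fin 2) (z : IntegralElement s I) : ℝ := slope (κ.h i z.pt) (κ.h (i + 1) z.pt) z.plane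

/-- The slope of an integral element with respect to the second pair. -/
def sc (j : Fin 2) (z : IntegralElement s I) : ℝ := slope (κ.c j z.pt) (κ.c (j + 1) z.pt) z.plane

theorem exists_dom {z : IntegralElement s I} (hz : z.pt ∈ U) : ∃ i j, z ∈ κ.dom i j := by
  obtain ⟨i, hi⟩ := κ.exists_h_ne hz
  obtain ⟨j, hj⟩ := κ.exists_c_ne hz
  exact ⟨i, j, hz, hi, hj⟩

/-- The chart given by an adapted coframe, as an open partial homeomorphism. -/
def pchart (hU : IsOpen U) (z₀ : IntegralElement s I) {φ : OpenPartialHomeomorph M E}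
    (hφ : φ ∈ atlas E M) (i j : Fin 2) :
    OpenPartialHomeomorph (IntegralElement s I) (E × ℝ × ℝ) :=
  (IntegralElement.core s I).openPartialHomeomorph (κ.chart hU z₀ φ i j)
    ⟨U, hU, κ, z₀, φ, hφ, i, j, rfl⟩

section

variable (hU : IsOpen U) (z₀ : IntegralElement s I) {φ : OpenPartialHomeomorph M E}
    (hφ : φ ∈ atlas E M) (i j : Fin 2)

theorem pchart_mem :
    κ.pchart hU z₀ hφ i j ∈ atlas (E × ℝ × ℝ) (IntegralElement s I) := by
  change κ.pchart hU z₀ hφ i j ∈ ⋃ (f : _) (hf : f ∈ (IntegralElement.core s I).atlas),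
      {(IntegralElement.core s I).openPartialHomeomorph f hf}
  simp only [mem_iUnion, mem_singleton_iff]
  exact ⟨κ.chart hU z₀ φ i j, ⟨U, hU, κ, z₀, φ, hφ, i, j, rfl⟩, rfl⟩

theorem pchart_symm_apply {q : E × ℝ × ℝ} (hq : q ∈ (κ.pchart hU z₀ hφ i j).target) :
    (κ.pchart hU z₀ hφ i j).symm q = κ.elem hU hq.2 i j q.2.1 q.2.2 := dif_pos hq.2

end

variable {κ} {i j : Fin 2} {z : IntegralElement s I}

theorem isOpen_dom (hU : IsOpen U) : IsOpen (κ.dom i j) := by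
  rw [isOpen_iff_mem_nhds]
  intro z hz
  refine Filter.mem_of_superset ((κ.pchart hU z (chart_mem_atlas E z.pt) i j).open_source.mem_nhds
    (show z ∈ _ from ⟨mem_chart_source E z.pt, hz⟩)) fun y hy => hy.2

theorem smoothAt_pt (hU : IsOpen U) (hz : z ∈ κ.dom i j) :
    ContMDiffAt 𝓘(ℝ, E × ℝ × ℝ) 𝓘(ℝ, E) ∞ (fun z : IntegralElement s I => z.pt) z := by
  set φ := chartAt E z.pt
  have hφ : φ ∈ atlas E M := chart_mem_atlas E z.pt
  set e := κ.pchart hU z hφ i j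
  have hs : z ∈ e.source := ⟨mem_chart_source E z.pt, hz⟩
  have h1 := chart_smoothAt (κ.pchart_mem hU z hφ i j) hs
  have h2 : ContMDiffAt 𝓘(ℝ, E × ℝ × ℝ) 𝓘(ℝ, E) ∞ (fun y => φ.symm (e y).1) z :=
    (chart_symm_smoothAt hφ (y := (e z).1) (e.map_source hs).1).comp z
      ((contDiff_fst.contMDiff.contMDiffAt (x := e z)).comp z h1)
  refine h2.congr_of_eventuallyEq ?_
  filter_upwards [e.open_source.mem_nhds hs] with y hy
  exact (φ.left_inv hy.1).symm

theorem smoothAt_sh (hU : IsOpen U) (hz : z ∈ κ.dom i j) :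
    ContMDiffAt 𝓘(ℝ, E × ℝ × ℝ) 𝓘(ℝ, ℝ) ∞ (κ.sh i) z := by
  have h1 := chart_smoothAt (κ.pchart_mem hU z (chart_mem_atlas E z.pt) i j)
    (show z ∈ _ from ⟨mem_chart_source E z.pt, hz⟩)
  exact ((contDiff_fst.comp contDiff_snd).contMDiff.contMDiffAt (x := κ.pchart hU z
    (chart_mem_atlas E z.pt) i j z)).comp z h1

theorem smoothAt_sc (hU : IsOpen U) (hz : z ∈ κ.dom i j) :
    ContMDiffAt 𝓘(ℝ, E × ℝ × ℝ) 𝓘(ℝ, ℝ) ∞ (κ.sc j) z := by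
  have h1 := chart_smoothAt (κ.pchart_mem hU z (chart_mem_atlas E z.pt) i j)
    (show z ∈ _ from ⟨mem_chart_source E z.pt, hz⟩)
  exact ((contDiff_snd.comp contDiff_snd).contMDiff.contMDiffAt (x := κ.pchart hU z
    (chart_mem_atlas E z.pt) i j z)).comp z h1

/-- The coordinates of the chart are by definition `φ` of the point and the two slopes, so its
tangent map splits accordingly. -/
theorem tmap_pchart (hU : IsOpen U) (z₀ : IntegralElement s I) {φ : OpenPartialHomeomorph M E}
    (hφ : φ ∈ atlas E M) (hs : z.pt ∈ φ.source) (hz : z ∈ κ.dom i j) :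
    (tmap (κ.pchart hU z₀ hφ i j) z : (E × ℝ × ℝ) →L[ℝ] E × ℝ × ℝ) =
      ((tmap φ z.pt : E →L[ℝ] E).comp (dpt z)).prod
        ((tmap (κ.sh i) z : (E × ℝ × ℝ) →L[ℝ] ℝ).prod (tmap (κ.sc j) z)) := by
  have hφpt := (chart_smoothAt hφ hs).comp z (smoothAt_pt hU hz)
  have h2 := tmap_prodMk hφpt ((smoothAt_sh hU hz).prodMk_space (smoothAt_sc hU hz))
  rw [tmap_prodMk (smoothAt_sh hU hz) (smoothAt_sc hU hz)] at h2
  refine Eq.trans ?_ (h2.trans ?_)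
  · rfl
  · congr 1
    exact tmap_comp (chart_smoothAt hφ hs).mdiff (smoothAt_pt hU hz).mdiff

/-- The coordinates of a tangent vector of the space of integral elements. -/
theorem bijective_tmap (hU : IsOpen U) (hz : z ∈ κ.dom i j) :
    Function.Bijective fun v : E × ℝ × ℝ =>
      ((dpt z v, (tmap (κ.sh i) z : (E × ℝ × ℝ) →L[ℝ] ℝ) v,
        (tmap (κ.sc j) z : (E × ℝ × ℝ) →L[ℝ] ℝ) v) : E × ℝ × ℝ) := by
  set φ := chartAt E z.pt
  have hφ : φ ∈ atlas E M := chart_mem_atlas E z.pt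
  have hs : z ∈ (κ.pchart hU z hφ i j).source := ⟨mem_chart_source E z.pt, hz⟩
  have hmem := κ.pchart_mem hU z hφ i j
  have h1 := tmap_pchart hU z hφ (mem_chart_source E z.pt) hz
  have hb : Function.Bijective (tmap (κ.pchart hU z hφ i j) z : (E × ℝ × ℝ) →L[ℝ] E × ℝ × ℝ) := by
    refine Function.bijective_iff_has_inverse.2 ⟨tmap (κ.pchart hU z hφ i j).symm
      (κ.pchart hU z hφ i j z), fun v => ?_, fun v => ?_⟩
    · exact DFunLike.congr_fun (tmap_symm_comp hmem hs) v
    · have := DFunLike.congr_fun (tmap_comp_symm hmem ((κ.pchart hU z hφ i j).map_source hs)) v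
      rwa [(κ.pchart hU z hφ i j).left_inv hs] at this
  have hb' : Function.Bijective (tmap φ z.pt : E →L[ℝ] E) := by
    refine Function.bijective_iff_has_inverse.2 ⟨tmap φ.symm (φ z.pt), fun v => ?_, fun v => ?_⟩
    · exact DFunLike.congr_fun (tmap_symm_comp hφ (mem_chart_source E z.pt)) v
    · have := DFunLike.congr_fun (tmap_comp_symm hφ (φ.map_source (mem_chart_source E z.pt))) v
      rwa [φ.left_inv (mem_chart_source E z.pt)] at this
  rw [h1] at hb
  refine ⟨fun v w h => hb.1 ?_, fun q => ?_⟩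
  · simp only [Prod.mk.injEq] at h
    exact Prod.ext (congrArg (tmap φ z.pt : E →L[ℝ] E) h.1) (Prod.ext h.2.1 h.2.2)
  · obtain ⟨v, hv⟩ := hb.2 ((tmap φ z.pt : E →L[ℝ] E) q.1, q.2)
    exact ⟨v, Prod.ext (hb'.1 (congrArg Prod.fst hv)) (Prod.ext_iff.1 hv).2⟩

theorem eq_zero_of_tmap (hU : IsOpen U) (hz : z ∈ κ.dom i j) {v : E × ℝ × ℝ} (h1 : dpt z v = 0)
    (h2 : (tmap (κ.sh i) z : (E × ℝ × ℝ) →L[ℝ] ℝ) v = 0)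
    (h3 : (tmap (κ.sc j) z : (E × ℝ × ℝ) →L[ℝ] ℝ) v = 0) : v = 0 := by
  refine (bijective_tmap hU hz).1 ?_
  simp only [h1, h2, h3, map_zero]

theorem exists_tmap_eq (hU : IsOpen U) (hz : z ∈ κ.dom i j) (u : E) (r t : ℝ) :
    ∃ v : E × ℝ × ℝ, dpt z v = u ∧ (tmap (κ.sh i) z : (E × ℝ × ℝ) →L[ℝ] ℝ) v = r ∧
      (tmap (κ.sc j) z : (E × ℝ × ℝ) →L[ℝ] ℝ) v = t := by
  obtain ⟨v, hv⟩ := (bijective_tmap hU hz).2 (u, r, t)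
  simp only [Prod.mk.injEq] at hv
  exact ⟨v, hv⟩

theorem mem_plane_iff (hz : z ∈ κ.dom i j) {v : E} : v ∈ z.plane ↔ (∀ k, κ.θ k z.pt v = 0) ∧
    κ.h (i + 1) z.pt v = κ.sh i z * κ.h i z.pt v ∧ κ.c (j + 1) z.pt v = κ.sc j z * κ.c j z.pt v := by
  conv_lhs => rw [← κ.plane_eq hz.1 hz.2.1 hz.2.2]
  rfl

end AdaptedCoframe

namespace IntegralElement

theorem smoothAt_pt (z : IntegralElement s I) :
    ContMDiffAt 𝓘(ℝ, E × ℝ × ℝ) 𝓘(ℝ, E) ∞ (fun z : IntegralElement s I => z.pt) z := by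
  obtain ⟨U, hU, hz, ⟨κ⟩⟩ := z.hyperbolic_at
  obtain ⟨i, j, hij⟩ := κ.exists_dom hz
  exact κ.smoothAt_pt hU hij

theorem smooth_pt (T : Set (IntegralElement s I)) :
    ContMDiffOn 𝓘(ℝ, E × ℝ × ℝ) 𝓘(ℝ, E) ∞ (fun z : IntegralElement s I => z.pt) T :=
  fun z _ => z.smoothAt_pt.contMDiffWithinAt

theorem continuous_pt : Continuous (fun z : IntegralElement s I => z.pt) :=
  continuous_iff_continuousAt.2 fun z => z.smoothAt_pt.continuousAt

theorem surjective_dpt (z : IntegralElement s I) : Function.Surjective (dpt z) := by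
  obtain ⟨U, hU, hz, ⟨κ⟩⟩ := z.hyperbolic_at
  obtain ⟨i, j, hij⟩ := κ.exists_dom hz
  intro u
  obtain ⟨v, hv, -⟩ := κ.exists_tmap_eq hU hij u 0 0
  exact ⟨v, hv⟩

end IntegralElement

end ProlongationSpace

/-! ### Pfaffian systems in terms of a local frame -/

section Pfaffian

variable {E : Type*} [NormedAddCommGroup E] [NormedSpace ℝ E] [FiniteDimensional ℝ E]
  {E' : Type*} [NormedAddCommGroup E'] [NormedSpace ℝ E']
  {M : Type*} [TopologicalSpace M] [ChartedSpace E M] [IsManifold 𝓘(ℝ, E) ∞ M]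

/-- A covector that vanishes on the kernel of a surjection is a pullback. -/
theorem exists_eq_comp [FiniteDimensional ℝ E'] {L : E →L[ℝ] E'} (hL : Function.Surjective L)
    {α : E →L[ℝ] ℝ} (h : ∀ v, L v = 0 → α v = 0) : ∃ β : E' →L[ℝ] ℝ, α = β.comp L := by
  obtain ⟨R, hR⟩ := L.toLinearMap.exists_rightInverse_of_surjective (LinearMap.range_eq_top.2 hL)
  refine ⟨α.comp (LinearMap.toContinuousLinearMap R), ContinuousLinearMap.ext fun v => ?_⟩
  have h1 : L (v - R (L v)) = 0 := by
    rw [map_sub, sub_eq_zero]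
    exact (LinearMap.congr_fun hR (L v)).symm
  have h2 := h _ h1
  rw [map_sub, sub_eq_zero] at h2
  exact h2

theorem ofOne_mem_of_span {A : Set (E →L[ℝ] ℝ)} {K : Submodule ℝ (E [⋀^Fin 1]→L[ℝ] ℝ)}
    (h : ∀ α ∈ A, ofOne α ∈ K) {α : E →L[ℝ] ℝ} (hα : α ∈ Submodule.span ℝ A) : ofOne α ∈ K := by
  have : Submodule.span ℝ A ≤ K.comap (ofOneL E).toLinearEquiv.toLinearMap :=
    Submodule.span_le.2 h
  exact this hα

/-- A Pfaffian system is generated by a local frame and the exterior derivatives of its members. -/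
theorem pfaffian_eq {ι : Type*} [Finite ι] {V : M → Submodule ℝ (E →L[ℝ] ℝ)} {W : Set M}
    (hW : IsOpen W) {ξ : ι → M → E →L[ℝ] ℝ} (hξ : ∀ i, SmoothCov (ξ i) W) {x : M} (hx : x ∈ W)
    (hli : LinearIndependent ℝ fun i => ξ i x)
    (hV : ∀ y ∈ W, V y = Submodule.span ℝ (range fun i => ξ i y)) (p : ℕ) :
    pfaffian V p x = algIdeal (fun q => oneForms (range fun i => ξ i x) q ∪
      twoForms (range fun i => extD (fun y => ofOne (ξ i y)) x) q) p := by
  have := Fintype.ofFinite ι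
  set T : ∀ q, Set (E [⋀^Fin q]→L[ℝ] ℝ) := fun q => oneForms (range fun i => ξ i x) q ∪
      twoForms (range fun i => extD (fun y => ofOne (ξ i y)) x) q with hT
  refine le_antisymm (algIdeal_le ?_ p) (algIdeal_le ?_ p)
  · rintro q η (hη | hη)
    · refine oneForms_subset (fun α hα => ?_) q hη
      rw [SetLike.mem_coe, hV x hx] at hα
      refine ofOne_mem_of_span ?_ hα
      exact fun α hα => subset_algIdeal _ 1 (Or.inl (mem_oneForms hα))
    · refine twoForms_subset ?_ q hη
      rintro _ ⟨α, U, hU, hxU, hα, hαV, rfl⟩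
      obtain ⟨U', hU'U, hU', hxU', f, hf, hfe⟩ := SmoothCov.exists_coeff (hW.inter hU)
        (fun i => (hξ i).mono inter_subset_left) ⟨hx, hxU⟩ hli (hα.mono inter_subset_right)
        (fun y hy => by rw [← hV y hy.1]; exact hαV y hy.2)
      have hs : ∀ i, SmoothForm (fun y => ofOne (ξ i y)) U' := fun i =>
        smoothCov_iff.1 ((hξ i).mono (hU'U.trans inter_subset_left))
      have h1 : extD (fun y => ofOne (α y)) x = ∑ i, extD (fun y => f i y • ofOne (ξ i y)) x := by
        rw [← extD_sum Finset.univ hU' (fun i _ => SmoothForm.smul hU' (hf i) (hs i)) hxU']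
        refine extD_congr (Filter.eventuallyEq_of_mem (hU'.mem_nhds hxU') fun y hy => ?_)
        simp only [hfe y hy, ofOne_sum, ofOne_smul]
      rw [h1]
      refine Submodule.sum_mem _ fun i _ => ?_
      -- By the Leibniz rule the derivative of `f_i ξ_i` is `df_i ∧ ξ_i + f_i dξ_i`; the first term
      -- is in the ideal of the frame, so the `dξ_i` suffice.
      rw [extD_smul hU' (hf i) (hs i) hxU']
      refine Submodule.add_mem _ (wedge_mem_algIdeal _ _ _ ?_) (Submodule.smul_mem _ _ ?_)
      · exact subset_algIdeal _ 1 (Or.inl (mem_oneForms ⟨i, rfl⟩))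
      · exact subset_algIdeal _ 2 (Or.inr ⟨i, rfl⟩)
  · rintro q η (hη | hη)
    · refine oneForms_subset ?_ q hη
      rintro _ ⟨i, rfl⟩
      refine subset_algIdeal _ 1 (Or.inl (mem_oneForms ?_))
      rw [hV x hx]
      exact Submodule.subset_span ⟨i, rfl⟩
    · refine twoForms_subset ?_ q hη
      rintro _ ⟨i, rfl⟩
      refine subset_algIdeal _ 2 (Or.inr ⟨ξ i, W, hW, hx, hξ i, fun y hy => ?_, rfl⟩)
      rw [hV y hy]
      exact Submodule.subset_span ⟨i, rfl⟩

end Pfaffian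

/-! ### The contact system of the prolongation -/

section Contact

variable {E : Type*} [NormedAddCommGroup E] [NormedSpace ℝ E] [FiniteDimensional ℝ E]
  {M : Type*} [TopologicalSpace M] [ChartedSpace E M] [IsManifold 𝓘(ℝ, E) ∞ M]
  {s : ℕ} {I : FormFamily E M}

/-- A covector that vanishes on the preimage of the plane vanishes in particular on the kernel of
the projection to the base, so it is a pullback, and the covector below vanishes on the plane. -/
theorem mem_contactSystem {z : IntegralElement s I} {α : (E × ℝ × ℝ) →L[ℝ] ℝ} :
    α ∈ contactSystem s I z ↔ ∀ v, dpt z v ∈ z.plane → α v = 0 := by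
  constructor
  · intro h v hv
    refine Submodule.span_induction (p := fun β _ => β v = 0) ?_ rfl ?_ ?_ h
    · rintro _ ⟨β, hβ, rfl⟩
      exact hβ _ hv
    · intro β γ _ _ hβ hγ
      rw [add_apply, hβ, hγ, add_zero]
    · intro c β _ hβ
      rw [smul_apply, hβ, smul_zero]
  · intro h
    obtain ⟨β, rfl⟩ := exists_eq_comp z.surjective_dpt (α := α)
      (fun v hv => h v (by rw [hv]; exact zero_mem _))
    refine Submodule.subset_span ⟨β, fun v hv => ?_, rfl⟩
    obtain ⟨w, rfl⟩ := z.surjective_dpt v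
    exact h w hv

theorem comp_dpt_mem {z : IntegralElement s I} {α : E →L[ℝ] ℝ} (h : ∀ v ∈ z.plane, α v = 0) :
    α.comp (dpt z) ∈ contactSystem s I z := Submodule.subset_span ⟨α, h, rfl⟩

theorem ofOne_mem_prolong {z : IntegralElement s I} {α : (E × ℝ × ℝ) →L[ℝ] ℝ}
    (h : α ∈ contactSystem s I z) : ofOne α ∈ prolong s I 1 z :=
  subset_algIdeal _ 1 (Or.inl (mem_oneForms h))

/-- The pullback of a system to its integral elements is contained in every ideal that contains the
contact system. -/
theorem comp_dpt_mem_algIdeal {z : IntegralElement s I}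
    {T : ∀ q : ℕ, Set ((E × ℝ × ℝ) [⋀^Fin q]→L[ℝ] ℝ)}
    (hT : ∀ γ ∈ contactSystem s I z, ofOne γ ∈ algIdeal T 1) {q : ℕ} {η : E [⋀^Fin q]→L[ℝ] ℝ}
    (hη : η ∈ I q z.pt) : η.compContinuousLinearMap (dpt z) ∈ algIdeal T q := by
  obtain ⟨U, hU, hz, ⟨κ⟩⟩ := z.hyperbolic_at
  rw [κ.generate _ hz] at hη
  -- The 2-form generators are decomposable and vanish on the integral element, so
  -- `wedge_mem_of_vanish` puts their pullbacks into the ideal of the contact forms.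
  have hP : ∀ γ : (E × ℝ × ℝ) →L[ℝ] ℝ, (∀ v ∈ z.plane.comap (dpt z).toLinearMap, γ v = 0) →
      ofOne γ ∈ algIdeal T 1 := fun γ hγ => hT γ (mem_contactSystem.2 hγ)
  refine comp_mem_algIdeal _ ?_ hη
  rintro q η (hη | hη)
  · match q, η, hη with
    | 1, _, ⟨_, ⟨k, rfl⟩, rfl⟩ =>
      exact hT _ (comp_dpt_mem fun v hv => κ.theta_eq_zero hz hv k)
  · match q, η, hη with
    | 2, _, Or.inl rfl =>
      rw [wedge_comp, ofOne_comp]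
      exact wedge_mem_of_vanish hP fun v hv w hw => κ.h_symm hz 0 _ hv _ hw
    | 2, _, Or.inr rfl =>
      rw [wedge_comp, ofOne_comp]
      exact wedge_mem_of_vanish hP fun v hv w hw => κ.c_symm hz 0 _ hv _ hw

/-- The pullback of a system to its integral elements is contained in its prolongation. -/
theorem comp_dpt_mem_prolong {z : IntegralElement s I} {q : ℕ} {η : E [⋀^Fin q]→L[ℝ] ℝ}
    (hη : η ∈ I q z.pt) : η.compContinuousLinearMap (dpt z) ∈ prolong s I q z :=
  comp_dpt_mem_algIdeal (fun _ => ofOne_mem_prolong) hη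

namespace AdaptedCoframe

variable {U : Set M} (κ : AdaptedCoframe s I U) {i j : Fin 2} {z : IntegralElement s I}

/-- The contact forms of the space of integral elements. -/
def contact (i j : Fin 2) : Fin s ⊕ Fin 2 → IntegralElement s I → (E × ℝ × ℝ) →L[ℝ] ℝ :=
  Sum.elim (fun k z => (κ.θ k z.pt).comp (dpt z))
    ![fun z => (κ.h (i + 1) z.pt - κ.sh i z • κ.h i z.pt).comp (dpt z),
      fun z => (κ.c (j + 1) z.pt - κ.sc j z • κ.c j z.pt).comp (dpt z)]

theorem smoothCov_comp_dpt (hU : IsOpen U) {α : M → E →L[ℝ] ℝ} (hα : SmoothCov α U) :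
    SmoothCov (fun z : IntegralElement s I => (α z.pt).comp (dpt z)) (κ.dom i j) :=
  hα.pull hU (isOpen_dom hU) (IntegralElement.smooth_pt _) fun _ hz => hz.1

theorem smooth_contact (hU : IsOpen U) (k : Fin s ⊕ Fin 2) :
    SmoothCov (κ.contact i j k) (κ.dom i j) := by
  have hO : IsOpen (κ.dom i j) := isOpen_dom hU
  rcases k with k | k
  · exact κ.smoothCov_comp_dpt hU (κ.smooth_θ k)
  · fin_cases k
    · refine ((κ.smoothCov_comp_dpt hU (κ.smooth_h (i + 1))).add (SmoothCov.smul
        (g := fun z => - κ.sh i z) hO (fun z hz => (smoothAt_sh hU hz).neg.contMDiffWithinAt)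
        (κ.smoothCov_comp_dpt hU (κ.smooth_h i)))).congr fun z _ => ?_
      ext v <;> simp [contact, sub_eq_add_neg]
    · refine ((κ.smoothCov_comp_dpt hU (κ.smooth_c (j + 1))).add (SmoothCov.smul
        (g := fun z => - κ.sc j z) hO (fun z hz => (smoothAt_sc hU hz).neg.contMDiffWithinAt)
        (κ.smoothCov_comp_dpt hU (κ.smooth_c j)))).congr fun z _ => ?_
      ext v <;> simp [contact, sub_eq_add_neg]

variable {κ}

theorem contact_eq_zero_iff (hz : z ∈ κ.dom i j) {v : E × ℝ × ℝ} :
    (∀ k, κ.contact i j k z v = 0) ↔ dpt z v ∈ z.plane := by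
  rw [mem_plane_iff hz]
  simp [contact, Sum.forall, Fin.forall_fin_two, sub_eq_zero]

theorem contact_span (hz : z ∈ κ.dom i j) : contactSystem s I z =
    Submodule.span ℝ (range fun k => κ.contact i j k z) := by
  ext α
  rw [mem_contactSystem, mem_span_range_iff]
  exact forall_congr' fun v => by rw [contact_eq_zero_iff hz]

theorem linearIndependent_contact (hz : z ∈ κ.dom i j) :
    LinearIndependent ℝ fun k => κ.contact i j k z := by
  refine linearIndependent_of_dual ?_
  have key : ∀ (a : Fin s → ℝ) (b c : Fin 2 → ℝ), ∃ v : E × ℝ × ℝ, (∀ k, κ.θ k z.pt (dpt z v) = a k) ∧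
      (∀ k, κ.h k z.pt (dpt z v) = b k) ∧ ∀ k, κ.c k z.pt (dpt z v) = c k := by
    intro a b c
    obtain ⟨u, hu⟩ := κ.exists_cof_eq hz.1 a b c
    obtain ⟨v, rfl⟩ := z.surjective_dpt u
    exact ⟨v, hu⟩
  have hne := fin2_ne
  have hne' : ∀ i : Fin 2, i ≠ i + 1 := fun i => (fin2_ne i).symm
  rintro (k | k)
  · obtain ⟨v, h1, h2, h3⟩ := key (Pi.single k 1) 0 0
    refine ⟨v, by simp [contact, h1], ?_⟩
    rintro (l | l) hl
    · have : l ≠ k := fun h => hl (by rw [h])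
      simp [contact, h1, this]
    · fin_cases l <;> simp [contact, h2, h3]
  · fin_cases k
    · obtain ⟨v, h1, h2, h3⟩ := key 0 (Pi.single (i + 1) 1) 0
      refine ⟨v, by simp [contact, h2, hne'], ?_⟩
      rintro (l | l) hl
      · simp [contact, h1]
      · fin_cases l
        · exact absurd rfl hl
        · simp [contact, h3]
    · obtain ⟨v, h1, h2, h3⟩ := key 0 0 (Pi.single (j + 1) 1)
      refine ⟨v, by simp [contact, h3, hne'], ?_⟩
      rintro (l | l) hl
      · simp [contact, h1]
      · fin_cases l
        · simp [contact, h2]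
        · exact absurd rfl hl

theorem prolong_eq (hU : IsOpen U) (hz : z ∈ κ.dom i j) (p : ℕ) :
    prolong s I p z = algIdeal (fun q => oneForms (range fun k => κ.contact i j k z) q ∪
      twoForms (range fun k => extD (fun y => ofOne (κ.contact i j k y)) z) q) p :=
  pfaffian_eq (isOpen_dom hU) (κ.smooth_contact hU) hz (linearIndependent_contact hz)
    (fun _ hy => contact_span hy) p

end AdaptedCoframe

end Contact

/-! ### The prolongation of an extension -/

section ProlongedMap

variable {E : Type*} [NormedAddCommGroup E] [NormedSpace ℝ E] [FiniteDimensional ℝ E]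
  {E' : Type*} [NormedAddCommGroup E'] [NormedSpace ℝ E'] [FiniteDimensional ℝ E']
  {M : Type*} [TopologicalSpace M] [ChartedSpace E M] [IsManifold 𝓘(ℝ, E) ∞ M]
  {M' : Type*} [TopologicalSpace M'] [ChartedSpace E' M'] [IsManifold 𝓘(ℝ, E') ∞ M']
  {p : M → M'} {s : ℕ} {B : FormFamily E M} {I : FormFamily E' M'}
  {J : M → Submodule ℝ (E →L[ℝ] ℝ)}
  (hI : IsHyperbolicOn s I univ) (hp : IsIntegrableExtensionOn p B I univ)

section Lift

variable {W : Set M} {U' : Set M'} {κ' : AdaptedCoframe (s + 1) B W} {κ : AdaptedCoframe s I U'}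
  (hκ : κ'.IsLift κ p J) {i j : Fin 2} {z : IntegralElement (s + 1) B}

include hκ in
theorem mem_dom_iff (hz : z.pt ∈ W) : z ∈ κ'.dom i j ↔ prolongMap hI hp z ∈ κ.dom i j := by
  have key : ∀ α : E' →L[ℝ] ℝ, (∃ v ∈ z.plane, (α.comp (tmap p z.pt : E →L[ℝ] E')) v ≠ 0) ↔
      ∃ v ∈ (prolongMap hI hp z).plane, α v ≠ 0 := by
    intro α
    constructor
    · rintro ⟨v, hv, h⟩
      exact ⟨_, Submodule.mem_map_of_mem hv, h⟩
    · rintro ⟨_, ⟨v, hv, rfl⟩, h⟩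
      exact ⟨v, hv, h⟩
  simp only [AdaptedCoframe.dom, mem_ofPred_eq, hκ.h z.pt hz, hκ.c z.pt hz, key]
  exact and_congr_left fun _ => ⟨fun _ => hκ.mapsTo hz, fun _ => hz⟩

include hκ in
-- A slope is a ratio of values of characteristic forms, and those of a lift are pullbacks. In
-- matching charts the prolonged map is therefore `p` on points and the identity on slopes.
theorem sh_eq (hz : z ∈ κ'.dom i j) : κ'.sh i z = κ.sh i (prolongMap hI hp z) := by
  obtain ⟨v, hv, h⟩ := hz.2.1
  have h' : κ.h i (prolongMap hI hp z).pt ((tmap p z.pt : E →L[ℝ] E') v) ≠ 0 := by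
    rw [hκ.h z.pt hz.1] at h
    exact h
  rw [AdaptedCoframe.sh, AdaptedCoframe.sh, slope_eq (κ'.h_symm hz.1 i) hv h,
    slope_eq (κ.h_symm (hκ.mapsTo hz.1) i) (Submodule.mem_map_of_mem hv) h', hκ.h z.pt hz.1,
    hκ.h z.pt hz.1]
  rfl

include hκ in
theorem sc_eq (hz : z ∈ κ'.dom i j) : κ'.sc j z = κ.sc j (prolongMap hI hp z) :=
  sh_eq hI hp hκ.swap (i := j) (j := i) ⟨hz.1, hz.2.2, hz.2.1⟩

end Lift

variable (hJ : IsAdmissibleOn p B I J univ) (hd : finrank ℝ E = finrank ℝ E' + 1)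

include hI hp hJ hd in
theorem exists_lift (z : IntegralElement (s + 1) B) : ∃ (W : Set M) (U' : Set M')
    (κ' : AdaptedCoframe (s + 1) B W) (κ : AdaptedCoframe s I U') (i j : Fin 2), IsOpen W ∧
      IsOpen U' ∧ z ∈ κ'.dom i j ∧ κ'.IsLift κ p J := by
  obtain ⟨U', hU', hx', ⟨κ⟩⟩ := hI (p z.pt) (mem_univ _)
  obtain ⟨W, hW, hxW, -, κ', hκ, -⟩ := hJ.exists_coframe hp.submersion hd hp.smooth hU' κ
    (mem_univ z.pt) hx'
  obtain ⟨i, j, hij⟩ := κ'.exists_dom hxW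
  exact ⟨W, U', κ', κ, i, j, hW, hU', hij, hκ⟩

include hd in
theorem smoothAt_prolongMap (z : IntegralElement (s + 1) B) :
    ContMDiffAt 𝓘(ℝ, E × ℝ × ℝ) 𝓘(ℝ, E' × ℝ × ℝ) ∞ (prolongMap hI hp) z := by
  obtain ⟨J, hJ⟩ := hp.admissible
  obtain ⟨W, U', κ', κ, i, j, hW, hU', hz, hκ⟩ := exists_lift hI hp hJ hd z
  set z' := prolongMap hI hp z with hz'
  set φ := chartAt E' z'.pt
  have hφ : φ ∈ atlas E' M' := chart_mem_atlas E' z'.pt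
  set e := κ.pchart hU' z' hφ i j
  have hdom' : z' ∈ κ.dom i j := (mem_dom_iff hI hp hκ hz.1).1 hz
  have hs : z' ∈ e.source := ⟨mem_chart_source E' z'.pt, hdom'⟩
  have hpz : ContMDiffAt 𝓘(ℝ, E) 𝓘(ℝ, E') ∞ p z.pt :=
    (hp.smooth z.pt (mem_univ _)).contMDiffAt Filter.univ_mem
  have hppt : ContMDiffAt 𝓘(ℝ, E × ℝ × ℝ) 𝓘(ℝ, E') ∞
      (fun y : IntegralElement (s + 1) B => p y.pt) z := hpz.comp z z.smoothAt_pt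
  have h1 : ContMDiffAt 𝓘(ℝ, E × ℝ × ℝ) 𝓘(ℝ, E' × ℝ × ℝ) ∞
      (fun y : IntegralElement (s + 1) B => (φ (p y.pt), κ'.sh i y, κ'.sc j y)) z :=
    ((chart_smoothAt hφ (mem_chart_source E' z'.pt)).comp z hppt).prodMk_space
      ((AdaptedCoframe.smoothAt_sh hW hz).prodMk_space (AdaptedCoframe.smoothAt_sc hW hz))
  have heq : ∀ y ∈ κ'.dom i j, e (prolongMap hI hp y) = (φ (p y.pt), κ'.sh i y, κ'.sc j y) := by
    intro y hy
    rw [sh_eq hI hp hκ hy, sc_eq hI hp hκ hy]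
    rfl
  have h2 : ContMDiffAt 𝓘(ℝ, E × ℝ × ℝ) 𝓘(ℝ, E' × ℝ × ℝ) ∞
      (fun y : IntegralElement (s + 1) B => e.symm (φ (p y.pt), κ'.sh i y, κ'.sc j y)) z := by
    refine ContMDiffAt.comp z (g := e.symm) ?_ h1
    rw [← heq z hz]
    exact chart_symm_smoothAt (κ.pchart_mem hU' z' hφ i j) (e.map_source hs)
  refine h2.congr_of_eventuallyEq ?_
  filter_upwards [(AdaptedCoframe.isOpen_dom hW).mem_nhds hz,
    hppt.continuousAt.preimage_mem_nhds (φ.open_source.mem_nhds (mem_chart_source E' z'.pt))]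
    with y hy hy'
  rw [← heq y hy]
  exact (e.left_inv (show prolongMap hI hp y ∈ e.source from
    ⟨hy', (mem_dom_iff hI hp hκ hy.1).1 hy⟩)).symm

include hd in
theorem dpt_tmap_prolongMap (z : IntegralElement (s + 1) B) :
    (dpt (prolongMap hI hp z)).comp
      (tmap (prolongMap hI hp) z : (E × ℝ × ℝ) →L[ℝ] E' × ℝ × ℝ) =
    (tmap p z.pt : E →L[ℝ] E').comp (dpt z) := by
  have hpz : ContMDiffAt 𝓘(ℝ, E) 𝓘(ℝ, E') ∞ p z.pt :=
    (hp.smooth z.pt (mem_univ _)).contMDiffAt Filter.univ_mem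
  have h1 := tmap_comp (prolongMap hI hp z).smoothAt_pt.mdiff
    (smoothAt_prolongMap hI hp hd z).mdiff
  have h2 := tmap_comp hpz.mdiff z.smoothAt_pt.mdiff
  exact h1.symm.trans h2

section Lift

variable {W : Set M} {U' : Set M'} {κ' : AdaptedCoframe (s + 1) B W} {κ : AdaptedCoframe s I U'}
  (hW : IsOpen W) (hU' : IsOpen U')
  (hκ : κ'.IsLift κ p J) {i j : Fin 2} {z : IntegralElement (s + 1) B}

include hW hU' hκ hd in
theorem tmap_sh_eq (hz : z ∈ κ'.dom i j) :
    (tmap (κ'.sh i) z : (E × ℝ × ℝ) →L[ℝ] ℝ) =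
    (tmap (κ.sh i) (prolongMap hI hp z) : (E' × ℝ × ℝ) →L[ℝ] ℝ).comp
      (tmap (prolongMap hI hp) z : (E × ℝ × ℝ) →L[ℝ] E' × ℝ × ℝ) := by
  have hz' : prolongMap hI hp z ∈ κ.dom i j := (mem_dom_iff hI hp hκ hz.1).1 hz
  rw [← tmap_comp (AdaptedCoframe.smoothAt_sh hU' hz').mdiff
    (smoothAt_prolongMap hI hp hd z).mdiff]
  refine tmap_congr ?_
  filter_upwards [(AdaptedCoframe.isOpen_dom hW).mem_nhds hz] with y hy
  exact sh_eq hI hp hκ hy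

include hW hU' hκ hd in
theorem tmap_sc_eq (hz : z ∈ κ'.dom i j) :
    (tmap (κ'.sc j) z : (E × ℝ × ℝ) →L[ℝ] ℝ) =
    (tmap (κ.sc j) (prolongMap hI hp z) : (E' × ℝ × ℝ) →L[ℝ] ℝ).comp
      (tmap (prolongMap hI hp) z : (E × ℝ × ℝ) →L[ℝ] E' × ℝ × ℝ) :=
  tmap_sh_eq hI hp hd hW hU' hκ.swap (i := j) (j := i) ⟨hz.1, hz.2.2, hz.2.1⟩

include hW hU' hκ hd in
/-- The vertical vectors of the prolonged map. -/
theorem tmap_prolongMap_eq_zero_iff (hz : z ∈ κ'.dom i j) {v : E × ℝ × ℝ} :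
    (tmap (prolongMap hI hp) z : (E × ℝ × ℝ) →L[ℝ] E' × ℝ × ℝ) v = 0 ↔
      (tmap p z.pt : E →L[ℝ] E') (dpt z v) = 0 ∧
      (tmap (κ'.sh i) z : (E × ℝ × ℝ) →L[ℝ] ℝ) v = 0 ∧
      (tmap (κ'.sc j) z : (E × ℝ × ℝ) →L[ℝ] ℝ) v = 0 := by
  have hz' : prolongMap hI hp z ∈ κ.dom i j := (mem_dom_iff hI hp hκ hz.1).1 hz
  have h1 := DFunLike.congr_fun (dpt_tmap_prolongMap hI hp hd z) v
  rw [ContinuousLinearMap.comp_apply, ContinuousLinearMap.comp_apply] at h1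
  rw [tmap_sh_eq hI hp hd hW hU' hκ hz, tmap_sc_eq hI hp hd hW hU' hκ hz, ← h1]
  constructor
  · intro h
    simp only [ContinuousLinearMap.comp_apply, h, map_zero, and_self]
  · rintro ⟨h2, h3, h4⟩
    exact AdaptedCoframe.eq_zero_of_tmap hU' hz' h2 h3 h4

include hW hU' hκ hd in
theorem contact_succ (hz : z ∈ κ'.dom i j) (k : Fin s) :
    κ'.contact i j (Sum.inl k.succ) z =
    (κ.contact i j (Sum.inl k) (prolongMap hI hp z)).comp (tmap (prolongMap hI hp) z) := by
  change (κ'.θ k.succ z.pt).comp (dpt z) = ((κ.θ k (p z.pt)).comp (dpt (prolongMap hI hp z))).comp _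
  rw [hκ.θ_succ z.pt hz.1, ContinuousLinearMap.comp_assoc, ContinuousLinearMap.comp_assoc,
    dpt_tmap_prolongMap hI hp hd]

include hW hU' hκ hd in
theorem contact_inr (hz : z ∈ κ'.dom i j) (k : Fin 2) :
    κ'.contact i j (Sum.inr k) z =
    (κ.contact i j (Sum.inr k) (prolongMap hI hp z)).comp (tmap (prolongMap hI hp) z) := by
  fin_cases k
  · change (κ'.h (i + 1) z.pt - κ'.sh i z • κ'.h i z.pt).comp (dpt z) =
      ((κ.h (i + 1) (p z.pt) - κ.sh i (prolongMap hI hp z) • κ.h i (p z.pt)).comp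
        (dpt (prolongMap hI hp z))).comp _
    rw [ContinuousLinearMap.comp_assoc, dpt_tmap_prolongMap hI hp hd, hκ.h z.pt hz.1,
      hκ.h z.pt hz.1, sh_eq hI hp hκ hz]
    rfl
  · change (κ'.c (j + 1) z.pt - κ'.sc j z • κ'.c j z.pt).comp (dpt z) =
      ((κ.c (j + 1) (p z.pt) - κ.sc j (prolongMap hI hp z) • κ.c j (p z.pt)).comp
        (dpt (prolongMap hI hp z))).comp _
    rw [ContinuousLinearMap.comp_assoc, dpt_tmap_prolongMap hI hp hd, hκ.c z.pt hz.1,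
      hκ.c z.pt hz.1, sc_eq hI hp hκ hz]
    rfl

end Lift

include hd in
-- The base component is lifted by the submersion `p`, and the components along the slopes can be
-- prescribed freely.
theorem surjective_tmap_prolongMap (z : IntegralElement (s + 1) B) :
    Function.Surjective (tmap (prolongMap hI hp) z : (E × ℝ × ℝ) →L[ℝ] E' × ℝ × ℝ) := by
  obtain ⟨J, hJ⟩ := hp.admissible
  obtain ⟨W, U', κ', κ, i, j, hW, hU', hz, hκ⟩ := exists_lift hI hp hJ hd z
  have hz' : prolongMap hI hp z ∈ κ.dom i j := (mem_dom_iff hI hp hκ hz.1).1 hz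
  intro w
  obtain ⟨u, hu⟩ := hp.submersion z.pt (mem_univ _) (dpt (prolongMap hI hp z) w)
  obtain ⟨v, h1, h2, h3⟩ := AdaptedCoframe.exists_tmap_eq hW hz u
    ((tmap (κ.sh i) (prolongMap hI hp z) : (E' × ℝ × ℝ) →L[ℝ] ℝ) w)
    ((tmap (κ.sc j) (prolongMap hI hp z) : (E' × ℝ × ℝ) →L[ℝ] ℝ) w)
  refine ⟨v, (AdaptedCoframe.bijective_tmap hU' hz').1 (Prod.ext ?_ (Prod.ext ?_ ?_))⟩
  · have h := DFunLike.congr_fun (dpt_tmap_prolongMap hI hp hd z) v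
    rw [ContinuousLinearMap.comp_apply, ContinuousLinearMap.comp_apply, h1, hu] at h
    exact h
  · rw [tmap_sh_eq hI hp hd hW hU' hκ hz] at h2
    exact h2
  · rw [tmap_sc_eq hI hp hd hW hU' hκ hz] at h3
    exact h3

/-- The pullback to the space of integral elements of an admissible subbundle. -/
abbrev liftJ (s : ℕ) (B : FormFamily E M) (J : M → Submodule ℝ (E →L[ℝ] ℝ)) (z : IntegralElement s B) :
    Submodule ℝ ((E × ℝ × ℝ) →L[ℝ] ℝ) :=
  pullCov (fun z : IntegralElement s B => z.pt) z (J z.pt)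

include hJ in
theorem liftJ_le (z : IntegralElement (s + 1) B) : liftJ (s + 1) B J z ≤ contactSystem (s + 1) B z := by
  intro α hα
  obtain ⟨β, hβ, rfl⟩ := mem_pullCov.1 hα
  refine comp_dpt_mem fun v hv => ?_
  refine z.integral 1 (ofOne β) ?_ (fun _ => v) fun _ => hv
  rw [hJ.generate z.pt (mem_univ _)]
  exact subset_algIdeal _ 1 (Or.inl ⟨β, hβ, rfl⟩)

include hd in
-- The contact forms upstairs are one form coming from `J` and the pullbacks of the contact forms
-- downstairs. Derivatives of pullbacks are pullbacks of derivatives, and only the derivative of the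
-- form from `J` needs the closedness of `B`.
theorem prolong_generate (hJ : IsAdmissibleOn p B I J univ) (z : IntegralElement (s + 1) B) (q : ℕ) :
    prolong (s + 1) B q z = algIdeal (fun k =>
      oneForms (liftJ (s + 1) B J z : Set ((E × ℝ × ℝ) →L[ℝ] ℝ)) k ∪
      (fun η : (E' × ℝ × ℝ) [⋀^Fin k]→L[ℝ] ℝ => η.compContinuousLinearMap
        (tmap (prolongMap hI hp) z)) '' (prolong s I k (prolongMap hI hp z))) q := by
  obtain ⟨W, U', κ', κ, i, j, hW, hU', hz, hκ⟩ := exists_lift hI hp hJ hd z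
  have hz' : prolongMap hI hp z ∈ κ.dom i j := (mem_dom_iff hI hp hκ hz.1).1 hz
  have hO := AdaptedCoframe.isOpen_dom hW (κ := κ') (i := i) (j := j)
  have hO' := AdaptedCoframe.isOpen_dom hU' (κ := κ) (i := i) (j := j)
  have hsm : ContMDiffOn 𝓘(ℝ, E × ℝ × ℝ) 𝓘(ℝ, E' × ℝ × ℝ) ∞ (prolongMap hI hp) (κ'.dom i j) :=
    fun y _ => (smoothAt_prolongMap hI hp hd y).contMDiffWithinAt
  have hmaps : MapsTo (prolongMap hI hp) (κ'.dom i j) (κ.dom i j) := fun y hy =>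
    (mem_dom_iff hI hp hκ hy.1).1 hy
  have hpull : ∀ k, SmoothCov (E := E × ℝ × ℝ) (pull (prolongMap hI hp) (κ.contact i j k))
      (κ'.dom i j) := fun k => (κ.smooth_contact hU' k).pull hO' hO hsm hmaps
  have hext : ∀ k, extD (fun y => ofOne (pull (E := E × ℝ × ℝ) (prolongMap hI hp)
      (κ.contact i j k) y)) z = (extD (fun y => ofOne (κ.contact i j k y))
        (prolongMap hI hp z)).compContinuousLinearMap (tmap (prolongMap hI hp) z) := fun k =>
    extD_pullForm hO' (smoothCov_iff.1 (κ.smooth_contact hU' k)) hO hsm hz hz'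
  refine le_antisymm ?_ (algIdeal_le ?_ q)
  · set T : ∀ k, Set ((E × ℝ × ℝ) [⋀^Fin k]→L[ℝ] ℝ) := fun k =>
      oneForms (liftJ (s + 1) B J z : Set ((E × ℝ × ℝ) →L[ℝ] ℝ)) k ∪
      (fun η : (E' × ℝ × ℝ) [⋀^Fin k]→L[ℝ] ℝ => η.compContinuousLinearMap
        (tmap (prolongMap hI hp) z)) '' (prolong s I k (prolongMap hI hp z)) with hT
    have hpb : ∀ k (η : (E' × ℝ × ℝ) [⋀^Fin k]→L[ℝ] ℝ), η ∈ prolong s I k (prolongMap hI hp z) →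
        η.compContinuousLinearMap (tmap (prolongMap hI hp) z) ∈ algIdeal T k :=
      fun k η hη => subset_algIdeal _ _ (Or.inr ⟨η, hη, rfl⟩)
    have h1 : ∀ k, ofOne (κ.contact i j k (prolongMap hI hp z)) ∈
        prolong s I 1 (prolongMap hI hp z) := fun k => by
      rw [AdaptedCoframe.prolong_eq hU' hz']
      exact subset_algIdeal _ 1 (Or.inl (mem_oneForms ⟨k, rfl⟩))
    have h2 : ∀ k, extD (fun y => ofOne (κ.contact i j k y)) (prolongMap hI hp z) ∈
        prolong s I 2 (prolongMap hI hp z) := fun k => by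
      rw [AdaptedCoframe.prolong_eq hU' hz']
      exact subset_algIdeal _ 2 (Or.inr ⟨k, rfl⟩)
    have key : ∀ l k, (∀ y ∈ κ'.dom i j, κ'.contact i j l y =
        (κ.contact i j k (prolongMap hI hp y)).comp (tmap (prolongMap hI hp) y)) →
        ofOne (κ'.contact i j l z) ∈ algIdeal T 1 ∧
        extD (fun y => ofOne (κ'.contact i j l y)) z ∈ algIdeal T 2 := by
      intro l k hlk
      refine ⟨?_, ?_⟩
      · rw [hlk z hz]
        exact hpb 1 _ (h1 k)
      · rw [extD_congr (Filter.eventuallyEq_of_mem (hO.mem_nhds hz) fun y hy =>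
          congrArg ofOne (hlk y hy))]
        exact (hext k).symm ▸ hpb 2 _ (h2 k)
    have hϑ : ofOne (κ'.contact i j (Sum.inl 0) z) ∈ algIdeal T 1 ∧
        extD (fun y => ofOne (κ'.contact i j (Sum.inl 0) y)) z ∈ algIdeal T 2 := by
      refine ⟨subset_algIdeal _ 1 (Or.inl (mem_oneForms
        (mem_pullCov.2 ⟨_, hκ.θ_zero z.pt hz.1, rfl⟩))), ?_⟩
      have h3 : extD (fun y => ofOne (κ'.contact i j (Sum.inl 0) y)) z =
          (extD (fun y => ofOne (κ'.θ 0 y)) z.pt).compContinuousLinearMap (dpt z) :=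
        extD_pullForm hW (smoothCov_iff.1 (κ'.smooth_θ 0)) hO
          (IntegralElement.smooth_pt _) hz hz.1
      -- `B` is differentially closed, so the derivative of the section of `J` lies in `⟨J, p^*I⟩`.
      -- On integral elements `J` becomes the lifted `J`, and `p^*I` becomes a pullback from the
      -- prolongation of `I`, which contains the pullback of `I`.
      have h4 := hp.eds_top.closed 1 W hW (subset_univ _) _ (smoothCov_iff.1 (κ'.smooth_θ 0))
        (fun y hy => κ'.mem_theta hy 0) z.pt hz.1
      rw [h3]
      rw [hJ.generate z.pt (mem_univ _)] at h4
      refine comp_mem_algIdeal _ ?_ h4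
      rintro k η (hη | ⟨η, hη, rfl⟩)
      · match k, η, hη with
        | 1, _, ⟨β, hβ, rfl⟩ =>
          exact subset_algIdeal _ 1 (Or.inl (mem_oneForms (mem_pullCov.2 ⟨β, hβ, rfl⟩)))
      · have h5 : (η.compContinuousLinearMap (tmap p z.pt : E →L[ℝ] E')).compContinuousLinearMap
            (dpt z) = (η.compContinuousLinearMap (dpt (prolongMap hI hp z))).compContinuousLinearMap
              (tmap (prolongMap hI hp) z) := by
          change η.compContinuousLinearMap ((tmap p z.pt : E →L[ℝ] E').comp (dpt z)) =
            η.compContinuousLinearMap ((dpt (prolongMap hI hp z)).comp _)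
          rw [dpt_tmap_prolongMap hI hp hd]
        exact h5 ▸ hpb k _ (comp_dpt_mem_prolong hη)
    have hall : ∀ l, ofOne (κ'.contact i j l z) ∈ algIdeal T 1 ∧
        extD (fun y => ofOne (κ'.contact i j l y)) z ∈ algIdeal T 2 := by
      rintro (l | l)
      · rcases Fin.eq_zero_or_eq_succ l with rfl | ⟨k, rfl⟩
        · exact hϑ
        · exact key _ (Sum.inl k) fun y hy => contact_succ hI hp hd hW hU' hκ hy k
      · exact key _ (Sum.inr l) fun y hy => contact_inr hI hp hd hW hU' hκ hy l
    rw [AdaptedCoframe.prolong_eq hW hz]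
    refine algIdeal_le ?_ q
    rintro k η (hη | hη)
    · refine oneForms_subset ?_ k hη
      rintro _ ⟨l, rfl⟩
      exact (hall l).1
    · refine twoForms_subset ?_ k hη
      rintro _ ⟨l, rfl⟩
      exact (hall l).2
  -- Conversely, the plane downstairs is the image of the plane upstairs, so contact forms pull back
  -- to contact forms.
  · have hcon : ∀ y ∈ κ'.dom i j, ∀ k, pull (E := E × ℝ × ℝ) (prolongMap hI hp)
        (κ.contact i j k) y ∈ contactSystem (s + 1) B y := by
      intro y hy k
      refine mem_contactSystem.2 fun v hv => ?_
      refine (AdaptedCoframe.contact_eq_zero_iff (hmaps hy)).2 ?_ k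
      have h := DFunLike.congr_fun (dpt_tmap_prolongMap hI hp hd y) v
      rw [ContinuousLinearMap.comp_apply, ContinuousLinearMap.comp_apply] at h
      have h' : dpt (prolongMap hI hp y)
          ((tmap (prolongMap hI hp) y : (E × ℝ × ℝ) →L[ℝ] E' × ℝ × ℝ) v) ∈
            (prolongMap hI hp y).plane := by
        rw [h]
        exact Submodule.mem_map_of_mem hv
      exact h'
    rintro k η (hη | ⟨η, hη, rfl⟩)
    · exact oneForms_subset (fun α hα => ofOne_mem_prolong (liftJ_le hJ z hα)) k hη
    · rw [SetLike.mem_coe, AdaptedCoframe.prolong_eq hU' hz'] at hη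
      refine comp_mem_algIdeal _ ?_ hη
      rintro q η (hη | hη)
      · match q, η, hη with
        | 1, _, ⟨_, ⟨k, rfl⟩, rfl⟩ => exact ofOne_mem_prolong (hcon z hz k)
      · match q, η, hη with
        | 2, _, ⟨k, rfl⟩ =>
          refine subset_algIdeal _ 2 (Or.inr ⟨_, κ'.dom i j, hO, hz, hpull k,
            fun y hy => hcon y hy k, (hext k).symm⟩)

include hd in
/-- The prolongation of an integrable extension is an integrable extension. -/
theorem prolong_admissible (hJ : IsAdmissibleOn p B I J univ) :
    IsAdmissibleOn (prolongMap hI hp) (prolong (s + 1) B) (prolong s I) (liftJ (s + 1) B J) univ where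
  subbundle := by
    obtain ⟨r, hr⟩ := hJ.subbundle
    refine ⟨r, fun z _ => ?_⟩
    obtain ⟨W, hW, hxW, -, α, hα, h⟩ := hr z.pt (mem_univ _)
    have hO : IsOpen ((fun z : IntegralElement (s + 1) B => z.pt) ⁻¹' W) :=
      hW.preimage IntegralElement.continuous_pt
    refine ⟨_, hO, hxW, subset_univ _, fun i => pull (fun z : IntegralElement (s + 1) B => z.pt) (α i),
      fun i => (hα i).pull hW hO (IntegralElement.smooth_pt _) (fun _ h => h), fun y hy => ⟨?_, ?_⟩⟩
    · rw [Fintype.linearIndependent_iff]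
      intro g hg
      refine Fintype.linearIndependent_iff.1 (h y.pt hy).1 g (ContinuousLinearMap.ext fun v => ?_)
      obtain ⟨w, rfl⟩ := y.surjective_dpt v
      have := DFunLike.congr_fun hg w
      simp only [sum_apply, smul_apply] at this ⊢
      exact this
    · rw [liftJ, pullCov, (h y.pt hy).2]
      refine le_antisymm (Submodule.span_le.2 ?_) (Submodule.span_le.2 ?_)
      · rintro _ ⟨β, hβ, rfl⟩
        have := Submodule.mem_map_of_mem (f := (ContinuousLinearMap.precomp ℝ (dpt y)).toLinearMap) hβ
        rw [Submodule.map_span, ← range_comp] at this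
        exact this
      · rintro _ ⟨i, rfl⟩
        exact Submodule.subset_span ⟨_, Submodule.subset_span ⟨i, rfl⟩, rfl⟩
  -- The vertical vectors of the prolonged map lie over vertical vectors of `p` and keep both slopes
  -- fixed, while the annihilator of the lifted `J` is the preimage of that of `J`. A vertical
  -- component is lifted with zero slope components.
  transverse z _ := by
    obtain ⟨W, U', κ', κ, i, j, hW, hU', hz, hκ⟩ := exists_lift hI hp hJ hd z
    have hann : ∀ v : E × ℝ × ℝ, v ∈ annih (liftJ (s + 1) B J z) ↔ dpt z v ∈ annih (J z.pt) := by
      intro v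
      constructor
      · exact fun h β hβ => h _ (mem_pullCov.2 ⟨β, hβ, rfl⟩)
      · intro h α hα
        obtain ⟨β, hβ, rfl⟩ := mem_pullCov.1 hα
        exact h β hβ
    have hver : ∀ v : E × ℝ × ℝ, v ∈ (vertical (E' × ℝ × ℝ) (prolongMap hI hp) z :
        Submodule ℝ (E × ℝ × ℝ)) ↔ (tmap p z.pt : E →L[ℝ] E') (dpt z v) = 0 ∧
      (tmap (κ'.sh i) z : (E × ℝ × ℝ) →L[ℝ] ℝ) v = 0 ∧
      (tmap (κ'.sc j) z : (E × ℝ × ℝ) →L[ℝ] ℝ) v = 0 := fun v =>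
      tmap_prolongMap_eq_zero_iff hI hp hd hW hU' hκ hz
    constructor
    · rw [Submodule.disjoint_def]
      intro v h1 h2
      obtain ⟨h3, h4, h5⟩ := (hver v).1 h2
      exact AdaptedCoframe.eq_zero_of_tmap hW hz
        (hJ.eq_zero (mem_univ _) ((hann v).1 h1) h3) h4 h5
    · rw [codisjoint_iff, eq_top_iff]
      intro v _
      have hv : dpt z v ∈ annih (J z.pt) ⊔ vertical E' p z.pt := by
        rw [(hJ.transverse z.pt (mem_univ _)).codisjoint.eq_top]
        trivial
      obtain ⟨a, ha, b, hb, hab⟩ := Submodule.mem_sup.1 hv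
      obtain ⟨w, h1, h2, h3⟩ := AdaptedCoframe.exists_tmap_eq hW hz b 0 0
      refine Submodule.mem_sup.2 ⟨v - w, (hann _).2 ?_, w, (hver w).2 ⟨?_, h2, h3⟩, sub_add_cancel _ _⟩
      · rw [map_sub, h1, ← hab, add_sub_cancel_right]
        exact ha
      · rw [h1]
        exact hb
  generate z _ q := prolong_generate hI hp hd hJ z q

end ProlongedMap

/-! ### A smooth local inverse -/

section InverseFunction

variable {E : Type*} [NormedAddCommGroup E] [NormedSpace ℝ E] [FiniteDimensional ℝ E]
  {G : Type*} [NormedAddCommGroup G] [NormedSpace ℝ G] [FiniteDimensional ℝ G]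

/-- The local inverse is restricted to the open set where the derivative stays invertible, which
makes it smooth on its whole domain and not only at the image of `y₀`. -/
theorem exists_smooth_inverse {D : Set E} (hD : IsOpen D) {Φ : E → G} (hΦ : ContDiffOn ℝ ∞ Φ D)
    {y₀ : E} (hy₀ : y₀ ∈ D) (hb : Function.Bijective (fderiv ℝ Φ y₀)) :
    ∃ e : OpenPartialHomeomorph E G, y₀ ∈ e.source ∧ e.source ⊆ D ∧ ⇑e = Φ ∧
      ContDiffOn ℝ ∞ e.symm e.target := by
  have : CompleteSpace E := FiniteDimensional.complete ℝ E
  have hat : ∀ y ∈ D, ContDiffAt ℝ ∞ Φ y := fun y hy => hΦ.contDiffAt (hD.mem_nhds hy)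
  have hder : ∀ y ∈ D, HasFDerivAt Φ (fderiv ℝ Φ y) y := fun y hy =>
    ((hat y hy).differentiableAt (by simp)).hasFDerivAt
  set L : E ≃L[ℝ] G :=
    (LinearEquiv.ofBijective (fderiv ℝ Φ y₀).toLinearMap hb).toContinuousLinearEquiv
  have hL : (L : E →L[ℝ] G) = fderiv ℝ Φ y₀ := by ext v; rfl
  have hd₀ : HasFDerivAt Φ (L : E →L[ℝ] G) y₀ := by rw [hL]; exact hder y₀ hy₀
  set e := (hat y₀ hy₀).toOpenPartialHomeomorph Φ hd₀ (by simp) with he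
  have hO : IsOpen (D ∩ fderiv ℝ Φ ⁻¹' range ((↑) : (E ≃L[ℝ] G) → E →L[ℝ] G)) :=
    (hΦ.continuousOn_fderiv_of_isOpen hD (by simp)).isOpen_inter_preimage hD
      (ContinuousLinearEquiv.isOpen)
  refine ⟨e.restrOpen _ hO, ⟨(hat y₀ hy₀).mem_toOpenPartialHomeomorph_source hd₀ (by simp), hy₀, L, hL⟩,
    fun y hy => hy.2.1, rfl, fun q hq => ?_⟩
  obtain ⟨hq1, hq2, L', hL'⟩ := hq
  refine ContDiffAt.contDiffWithinAt (e.contDiffAt_symm (f₀' := L') hq1 ?_ (hat _ hq2))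
  rw [hL']
  exact hder _ hq2

end InverseFunction

/-! ### Level sets as local sections, and the count of first integrals -/

section Slice

variable {E : Type*} [NormedAddCommGroup E] [NormedSpace ℝ E] [FiniteDimensional ℝ E]
  {E' : Type*} [NormedAddCommGroup E'] [NormedSpace ℝ E'] [FiniteDimensional ℝ E']
  {M : Type*} [TopologicalSpace M] [ChartedSpace E M] [IsManifold 𝓘(ℝ, E) ∞ M]
  {M' : Type*} [TopologicalSpace M'] [ChartedSpace E' M'] [IsManifold 𝓘(ℝ, E') ∞ M']
  {p : M → M'} {U : Set M} {x₀ : M}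

theorem tmap_chart_bijective {φ : OpenPartialHomeomorph M E} (hφ : φ ∈ atlas E M) {x : M}
    (hx : x ∈ φ.source) : Function.Bijective (tmap φ x : E →L[ℝ] E) := by
  refine Function.bijective_iff_has_inverse.2 ⟨tmap φ.symm (φ x), fun v => ?_, fun v => ?_⟩
  · exact DFunLike.congr_fun (tmap_symm_comp hφ hx) v
  · have := DFunLike.congr_fun (tmap_comp_symm hφ (φ.map_source hx)) v
    rwa [φ.left_inv hx] at this

theorem rep_prod {φ : OpenPartialHomeomorph M E} (hφ : φ ∈ atlas E M)
    {φ' : OpenPartialHomeomorph M' E'} (hφ' : φ' ∈ atlas E' M') {F₀ : M → ℝ} {y : E}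
    (hy : y ∈ φ.target) (hp : ContMDiffAt 𝓘(ℝ, E) 𝓘(ℝ, E') ∞ p (φ.symm y))
    (hF : ContMDiffAt 𝓘(ℝ, E) 𝓘(ℝ, ℝ) ∞ F₀ (φ.symm y)) (hy' : p (φ.symm y) ∈ φ'.source) :
    ContDiffAt ℝ ∞ (fun y => (φ' (p (φ.symm y)), F₀ (φ.symm y))) y ∧
    (Function.Bijective (fderiv ℝ (fun y => (φ' (p (φ.symm y)), F₀ (φ.symm y))) y) ↔
      Function.Bijective fun v : E => (((tmap p (φ.symm y) : E →L[ℝ] E') v,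
        (tmap F₀ (φ.symm y) : E →L[ℝ] ℝ) v) : E' × ℝ)) := by
  have hφy := chart_symm_smoothAt hφ hy
  have hpy : ContMDiffAt 𝓘(ℝ, E) 𝓘(ℝ, E') ∞ (fun y => φ' (p (φ.symm y))) y :=
    (chart_smoothAt hφ' hy').comp y (hp.comp y hφy)
  have hFy : ContMDiffAt 𝓘(ℝ, E) 𝓘(ℝ, ℝ) ∞ (fun y => F₀ (φ.symm y)) y := hF.comp y hφy
  refine ⟨(hpy.prodMk_space hFy).contDiffAt, ?_⟩
  have h1 : fderiv ℝ (fun y => (φ' (p (φ.symm y)), F₀ (φ.symm y))) y =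
      ((tmap φ' (p (φ.symm y)) : E' →L[ℝ] E').comp ((tmap p (φ.symm y) : E →L[ℝ] E').comp
        (tmap φ.symm y : E →L[ℝ] E))).prod
        ((tmap F₀ (φ.symm y) : E →L[ℝ] ℝ).comp (tmap φ.symm y : E →L[ℝ] E)) := by
    rw [← tmap_eq_fderiv, tmap_prodMk hpy hFy, tmap_comp hF.mdiff hφy.mdiff,
      tmap_comp (f := fun y => p (φ.symm y)) (chart_smoothAt hφ' hy').mdiff (hp.comp y hφy).mdiff,
      tmap_comp hp.mdiff hφy.mdiff]
  have h2 : ⇑(fderiv ℝ (fun y => (φ' (p (φ.symm y)), F₀ (φ.symm y))) y) =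
      Prod.map (tmap φ' (p (φ.symm y)) : E' →L[ℝ] E') id ∘
      (fun v : E => (((tmap p (φ.symm y) : E →L[ℝ] E') v,
        (tmap F₀ (φ.symm y) : E →L[ℝ] ℝ) v) : E' × ℝ)) ∘ (tmap φ.symm y : E →L[ℝ] E) := by
    rw [h1]; rfl
  rw [h2, Function.Bijective.of_comp_iff' ((tmap_chart_bijective hφ' hy').prodMap
    Function.bijective_id), Function.Bijective.of_comp_iff _
    (AdaptedCoframe.tmap_symm_bijective hφ hy)]

theorem eventually_bijective (hU : IsOpen U) (hp : ContMDiffOn 𝓘(ℝ, E) 𝓘(ℝ, E') ∞ p U) {F₀ : M → ℝ}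
    (hF : ContMDiffOn 𝓘(ℝ, E) 𝓘(ℝ, ℝ) ∞ F₀ U) (hx₀ : x₀ ∈ U)
    (hb : Function.Bijective fun v : E => (((tmap p x₀ : E →L[ℝ] E') v,
      (tmap F₀ x₀ : E →L[ℝ] ℝ) v) : E' × ℝ)) :
    ∀ᶠ x in 𝓝 x₀, Function.Bijective fun v : E => (((tmap p x : E →L[ℝ] E') v,
      (tmap F₀ x : E →L[ℝ] ℝ) v) : E' × ℝ) := by
  have : CompleteSpace E := FiniteDimensional.complete ℝ E
  set φ := chartAt E x₀
  have hφ : φ ∈ atlas E M := chart_mem_atlas E x₀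
  have hs : x₀ ∈ φ.source := mem_chart_source E x₀
  set φ' := chartAt E' (p x₀)
  have hφ' : φ' ∈ atlas E' M' := chart_mem_atlas E' (p x₀)
  have hs' : p x₀ ∈ φ'.source := mem_chart_source E' (p x₀)
  have hU₁ : IsOpen (U ∩ p ⁻¹' φ'.source) :=
    hp.continuousOn.isOpen_inter_preimage hU φ'.open_source
  have key : ∀ x ∈ φ.source ∩ (U ∩ p ⁻¹' φ'.source), ContDiffAt ℝ ∞
      (fun y => (φ' (p (φ.symm y)), F₀ (φ.symm y))) (φ x) ∧
      (Function.Bijective (fderiv ℝ (fun y => (φ' (p (φ.symm y)), F₀ (φ.symm y))) (φ x)) ↔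
      Function.Bijective fun v : E => (((tmap p x : E →L[ℝ] E') v,
        (tmap F₀ x : E →L[ℝ] ℝ) v) : E' × ℝ)) := by
    rintro x ⟨hx, hxU, hx'⟩
    have := rep_prod (p := p) (F₀ := F₀) hφ hφ' (φ.map_source hx)
      (by rw [φ.left_inv hx]; exact hp.contMDiffAt (hU.mem_nhds hxU))
      (by rw [φ.left_inv hx]; exact hF.contMDiffAt (hU.mem_nhds hxU))
      (by rw [φ.left_inv hx]; exact hx')
    rwa [φ.left_inv hx] at this
  obtain ⟨h1, h2⟩ := key x₀ ⟨hs, hx₀, hs'⟩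
  have hb₀ := h2.2 hb
  have h3 := (h1.continuousAt_fderiv (by simp)).eventually
    ((ContinuousLinearEquiv.isOpen (𝕜 := ℝ) (E := E) (F := E' × ℝ)).mem_nhds
    ⟨(LinearEquiv.ofBijective (fderiv ℝ _ (φ x₀)).toLinearMap hb₀).toContinuousLinearEquiv,
      by ext v <;> rfl⟩)
  filter_upwards [(φ.continuousAt hs).eventually h3, φ.open_source.mem_nhds hs,
    hU₁.mem_nhds ⟨hx₀, hs'⟩] with x hx hxs hxU
  refine (key x ⟨hxs, hxU⟩).2.1 ?_
  obtain ⟨L, hL⟩ := hx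
  rw [← hL]
  exact L.bijective

/-- A local section of a map with one-dimensional fibres, with values in a level set. -/
theorem exists_section (hU : IsOpen U) (hp : ContMDiffOn 𝓘(ℝ, E) 𝓘(ℝ, E') ∞ p U) {F₀ : M → ℝ}
    (hF : ContMDiffOn 𝓘(ℝ, E) 𝓘(ℝ, ℝ) ∞ F₀ U) (hx₀ : x₀ ∈ U)
    (hb : Function.Bijective fun v : E => (((tmap p x₀ : E →L[ℝ] E') v,
      (tmap F₀ x₀ : E →L[ℝ] ℝ) v) : E' × ℝ)) :
    ∃ (S : M' → M) (V' : Set M'), IsOpen V' ∧ p x₀ ∈ V' ∧ ContMDiffOn 𝓘(ℝ, E') 𝓘(ℝ, E) ∞ S V' ∧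
      S (p x₀) = x₀ ∧ MapsTo S V' U ∧ (∀ m ∈ V', p (S m) = m) ∧ ∀ m ∈ V', F₀ (S m) = F₀ x₀ := by
  set φ := chartAt E x₀
  have hφ : φ ∈ atlas E M := chart_mem_atlas E x₀
  have hs : x₀ ∈ φ.source := mem_chart_source E x₀
  set φ' := chartAt E' (p x₀)
  have hφ' : φ' ∈ atlas E' M' := chart_mem_atlas E' (p x₀)
  have hs' : p x₀ ∈ φ'.source := mem_chart_source E' (p x₀)
  set Φ : E → E' × ℝ := fun y => (φ' (p (φ.symm y)), F₀ (φ.symm y)) with hΦdef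
  set U₁ := U ∩ p ⁻¹' φ'.source
  have hU₁ : IsOpen U₁ := hp.continuousOn.isOpen_inter_preimage hU φ'.open_source
  set D := φ.target ∩ φ.symm ⁻¹' U₁
  have hD : IsOpen D := φ.isOpen_inter_preimage_symm hU₁
  have hy₀ : φ x₀ ∈ D := ⟨φ.map_source hs, by rw [mem_preimage, φ.left_inv hs]; exact ⟨hx₀, hs'⟩⟩
  have key := fun y (hy : y ∈ D) => rep_prod (p := p) (F₀ := F₀) hφ hφ' hy.1
    (hp.contMDiffAt (hU.mem_nhds hy.2.1)) (hF.contMDiffAt (hU.mem_nhds hy.2.1)) hy.2.2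
  have hΦ : ContDiffOn ℝ ∞ Φ D := fun y hy => (key y hy).1.contDiffWithinAt
  have hbΦ : Function.Bijective (fderiv ℝ Φ (φ x₀)) := by
    refine (key _ hy₀).2.2 ?_
    rwa [φ.left_inv hs]
  obtain ⟨e, he0, heD, heΦ, hes⟩ := exists_smooth_inverse hD hΦ hy₀ hbΦ
  -- The section sends `m` to the point that `(p, F₀)`, read in charts, takes to `(φ' m, F₀ x₀)`; it
  -- lies over `m` and in the level set of `x₀`.
  set V' := φ'.source ∩ (fun m => (φ' m, F₀ x₀)) ⁻¹' e.target
  have hcont : ContinuousOn (fun m => ((φ' m, F₀ x₀) : E' × ℝ)) φ'.source :=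
    φ'.continuousOn.prodMk continuousOn_const
  have hq₀ : e (φ x₀) = (φ' (p x₀), F₀ x₀) := by
    rw [heΦ]
    simp only [hΦdef, φ.left_inv hs]
  have hmem : ∀ m ∈ V', e.symm (φ' m, F₀ x₀) ∈ D := fun m hm => heD (e.map_target hm.2)
  have heq : ∀ m ∈ V', φ' (p (φ.symm (e.symm (φ' m, F₀ x₀)))) = φ' m ∧
      F₀ (φ.symm (e.symm (φ' m, F₀ x₀))) = F₀ x₀ := by
    intro m hm
    have h1 := e.right_inv hm.2
    rw [heΦ] at h1
    exact Prod.mk.injEq _ _ _ _ ▸ h1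
  refine ⟨fun m => φ.symm (e.symm (φ' m, F₀ x₀)), V', hcont.isOpen_inter_preimage φ'.open_source
    e.open_target, ⟨hs', ?_⟩, fun m hm => ?_, ?_, fun m hm => (hmem m hm).2.1, fun m hm => ?_,
    fun m hm => (heq m hm).2⟩
  · rw [mem_preimage, ← hq₀]
    exact e.map_source he0
  · refine ContMDiffAt.contMDiffWithinAt ?_
    refine (chart_symm_smoothAt hφ (hmem m hm).1).comp m ?_
    have h1 : ContMDiffAt 𝓘(ℝ, E') 𝓘(ℝ, E' × ℝ) ∞ (fun m => ((φ' m, F₀ x₀) : E' × ℝ)) m :=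
      (chart_smoothAt hφ' hm.1).prodMk_space contMDiffAt_const
    exact (hes.contDiffAt (e.open_target.mem_nhds hm.2)).contMDiffAt.comp m h1
  · simp only [← hq₀, e.left_inv he0, φ.left_inv hs]
  · exact φ'.injOn (hmem m hm).2.2 hm.1 (heq m hm).1

/-- Functions on the total space whose differentials are, up to multiples of `dF₀`, pulled back from
`V`, restrict to first integrals of `V` on a level set of `F₀`. -/
theorem le_finrank_of_level (hU : IsOpen U) (hp : ContMDiffOn 𝓘(ℝ, E) 𝓘(ℝ, E') ∞ p U) {F₀ : M → ℝ}
    (hF : ContMDiffOn 𝓘(ℝ, E) 𝓘(ℝ, ℝ) ∞ F₀ U) (hx₀ : x₀ ∈ U)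
    (hb : Function.Bijective fun v : E => (((tmap p x₀ : E →L[ℝ] E') v,
      (tmap F₀ x₀ : E →L[ℝ] ℝ) v) : E' × ℝ)) {V : M' → Submodule ℝ (E' →L[ℝ] ℝ)} {k : ℕ}
    {f : Fin k → M → ℝ} (hf : ∀ i, ContMDiffOn 𝓘(ℝ, E) 𝓘(ℝ, ℝ) ∞ (f i) U)
    (hfV : ∀ x ∈ U, ∀ i, ∃ c : ℝ, (tmap (f i) x : E →L[ℝ] ℝ) - c • (tmap F₀ x : E →L[ℝ] ℝ) ∈
      pullCov p x (V (p x)))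
    (hli : ∀ (g : Fin k → ℝ) (c : ℝ), ∑ i, g i • (tmap (f i) x₀ : E →L[ℝ] ℝ) =
      c • (tmap F₀ x₀ : E →L[ℝ] ℝ) → g = 0) :
    k ≤ finrank ℝ (firstIntegrals V (p x₀)) := by
  obtain ⟨S, V', hV', hxV', hS, hS0, hSU, hpS, hFS⟩ := exists_section hU hp hF hx₀ hb
  have hSd : ∀ m ∈ V', MDifferentiableAt 𝓘(ℝ, E') 𝓘(ℝ, E) S m := fun m hm =>
    (hS.contMDiffAt (hV'.mem_nhds hm)).mdiff
  have hgd : ∀ m ∈ V', ∀ {g : M → ℝ}, ContMDiffOn 𝓘(ℝ, E) 𝓘(ℝ, ℝ) ∞ g U →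
      (tmap (fun m => g (S m)) m : E' →L[ℝ] ℝ) =
        (tmap g (S m) : E →L[ℝ] ℝ).comp (tmap S m : E' →L[ℝ] E) := fun m hm g hg =>
    tmap_comp (hg.contMDiffAt (hU.mem_nhds (hSU hm))).mdiff (hSd m hm)
  have hpS' : ∀ m ∈ V', (tmap p (S m) : E →L[ℝ] E').comp (tmap S m : E' →L[ℝ] E) =
      ContinuousLinearMap.id ℝ E' := by
    intro m hm
    rw [← tmap_comp (hp.contMDiffAt (hU.mem_nhds (hSU hm))).mdiff (hSd m hm), ← tmap_id m]
    exact tmap_congr (Filter.eventuallyEq_of_mem (hV'.mem_nhds hm) hpS)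
  have hFS' : ∀ m ∈ V', (tmap F₀ (S m) : E →L[ℝ] ℝ).comp (tmap S m : E' →L[ℝ] E) = 0 := by
    intro m hm
    rw [← hgd m hm hF]
    have h1 : (tmap (fun _ : M' => F₀ x₀) m : E' →L[ℝ] ℝ) = 0 := mfderiv_const
    rw [← h1]
    exact tmap_congr (Filter.eventuallyEq_of_mem (hV'.mem_nhds hm) hFS)
  -- `dF₀` restricts to zero on the level set, so the correction `c • dF₀` disappears and only the
  -- covector pulled back from `V` remains.
  have hgV : ∀ i, ∀ m ∈ V', (tmap (fun m => f i (S m)) m : E' →L[ℝ] ℝ) ∈ V m := by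
    intro i m hm
    obtain ⟨c, hc⟩ := hfV (S m) (hSU hm) i
    obtain ⟨β, hβ, hβe⟩ := mem_pullCov.1 hc
    rw [hpS m hm] at hβ
    rw [sub_eq_iff_eq_add] at hβe
    rw [hgd m hm (hf i), hβe, ContinuousLinearMap.add_comp, ContinuousLinearMap.smul_comp,
      hFS' m hm, smul_zero, add_zero, ContinuousLinearMap.comp_assoc, hpS' m hm]
    exact hβ
  have hmem : ∀ i, (tmap (fun m => f i (S m)) (p x₀) : E' →L[ℝ] ℝ) ∈ firstIntegrals V (p x₀) :=
    fun i => Submodule.subset_span ⟨_, V', hV', hxV', fun m hm =>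
      ((hf i).contMDiffAt (hU.mem_nhds (hSU hm))).comp_contMDiffWithinAt m (hS m hm), hgV i, rfl⟩
  have hind : LinearIndependent ℝ fun i => (tmap (fun m => f i (S m)) (p x₀) : E' →L[ℝ] ℝ) := by
    rw [Fintype.linearIndependent_iff]
    intro g hg
    have h1 : (∑ i, g i • (tmap (f i) x₀ : E →L[ℝ] ℝ)).comp (tmap S (p x₀) : E' →L[ℝ] E) = 0 := by
      rw [← hg]
      ext v
      simp only [hgd _ hxV' (hf _), hS0, sum_apply, smul_apply, ContinuousLinearMap.comp_apply]
    obtain ⟨v, hv⟩ := hb.2 (0, 1)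
    simp only [Prod.mk.injEq] at hv
    refine congrFun (hli g ((∑ i, g i • (tmap (f i) x₀ : E →L[ℝ] ℝ)) v) ?_)
    ext w
    -- With `v` vertical and `dF₀ v = 1`, the map `S_* p_*` is the projection along `v` onto the
    -- tangent space of the level set. A combination of the `df i` killed by `S` is therefore a
    -- multiple of `dF₀`, which `hli` excludes unless it is trivial.
    have h2 : (tmap S (p x₀) : E' →L[ℝ] E) ((tmap p x₀ : E →L[ℝ] E') w) =
        w - (tmap F₀ x₀ : E →L[ℝ] ℝ) w • v := by
      refine hb.1 (Prod.ext ?_ ?_)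
      · have := DFunLike.congr_fun (hpS' _ hxV') ((tmap p x₀ : E →L[ℝ] E') w)
        rw [hS0] at this
        simp only [map_sub, map_smul, hv.1, smul_zero, sub_zero]
        exact this
      · have := DFunLike.congr_fun (hFS' _ hxV') ((tmap p x₀ : E →L[ℝ] E') w)
        rw [hS0] at this
        simp only [map_sub, map_smul, hv.2, smul_eq_mul, mul_one, sub_self]
        exact this
    have h3 := DFunLike.congr_fun h1 ((tmap p x₀ : E →L[ℝ] E') w)
    rw [ContinuousLinearMap.comp_apply, h2, map_sub, map_smul, zero_apply,
      sub_eq_zero] at h3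
    rw [h3, smul_apply, smul_eq_mul, smul_eq_mul, mul_comm]
  have h1 := finrank_span_eq_card hind
  rw [Fintype.card_fin] at h1
  rw [← h1]
  refine Submodule.finrank_mono (Submodule.span_le.2 ?_)
  rintro _ ⟨i, rfl⟩
  exact hmem i

/-- `α` does not vanish on the vertical line, so the map is injective, and the dimensions agree. -/
theorem bijective_prod_of_not_semibasic (hs : Function.Surjective (tmap p x₀ : E →L[ℝ] E'))
    (hd : finrank ℝ E = finrank ℝ E' + 1) {α : E →L[ℝ] ℝ} (hα : α ∉ semibasic E' p x₀) :
    Function.Bijective fun v : E => (((tmap p x₀ : E →L[ℝ] E') v, α v) : E' × ℝ) := by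
  set L : E →ₗ[ℝ] E' × ℝ := (tmap p x₀ : E →L[ℝ] E').toLinearMap.prod α.toLinearMap
  change Function.Bijective L
  obtain ⟨v, hv, hv0, hv1⟩ := exists_vertical hs hd
  have hinj : Function.Injective L := by
    rw [← LinearMap.ker_eq_bot, LinearMap.ker_eq_bot']
    intro w hw
    obtain ⟨c, rfl⟩ := hv1 w (congrArg Prod.fst hw)
    have h1 : α (c • v) = 0 := congrArg Prod.snd hw
    have h2 : α v ≠ 0 := by
      intro h
      refine hα fun w hw => ?_
      obtain ⟨d, rfl⟩ := hv1 w hw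
      rw [map_smul, h, smul_zero]
    rw [map_smul, smul_eq_mul, mul_eq_zero, or_iff_left h2] at h1
    rw [h1, zero_smul]
  exact ⟨hinj, (LinearMap.injective_iff_surjective_of_finrank_eq_finrank
    (by rw [hd, finrank_prod, finrank_self])).1 hinj⟩

/-- There is a function that is not constant along a given line. -/
theorem exists_smooth_ne (x₀ : M) {v : E} (hv : v ≠ 0) : ∃ (F : M → ℝ) (U : Set M), IsOpen U ∧
    x₀ ∈ U ∧ ContMDiffOn 𝓘(ℝ, E) 𝓘(ℝ, ℝ) ∞ F U ∧ (tmap F x₀ : E →L[ℝ] ℝ) v ≠ 0 := by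
  set φ := chartAt E x₀
  have hφ : φ ∈ atlas E M := chart_mem_atlas E x₀
  have hs : x₀ ∈ φ.source := mem_chart_source E x₀
  have h0 : (tmap φ x₀ : E →L[ℝ] E) v ≠ 0 := by
    intro h
    have := DFunLike.congr_fun (tmap_symm_comp hφ hs) v
    rw [ContinuousLinearMap.comp_apply, h, map_zero] at this
    exact hv this.symm
  obtain ⟨L, hL⟩ := SeparatingDual.exists_ne_zero (R := ℝ) h0
  have hc := chart_smoothAt hφ hs
  refine ⟨fun x => L (φ x), φ.source, φ.open_source, hs, fun x hx =>
    (L.contDiff.contMDiff.contMDiffAt.comp x (chart_smoothAt hφ hx)).contMDiffWithinAt, ?_⟩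
  rw [tmap_clm_comp L hc.mdiff]
  exact hL

/-- Functions with semibasic differentials in the pullback of `V` come from first integrals. -/
theorem le_finrank_of_pullCov (hU : IsOpen U) (hp : ContMDiffOn 𝓘(ℝ, E) 𝓘(ℝ, E') ∞ p U)
    (hx₀ : x₀ ∈ U) (hs : Function.Surjective (tmap p x₀ : E →L[ℝ] E'))
    (hd : finrank ℝ E = finrank ℝ E' + 1) {V : M' → Submodule ℝ (E' →L[ℝ] ℝ)} {k : ℕ}
    {f : Fin k → M → ℝ} (hf : ∀ i, ContMDiffOn 𝓘(ℝ, E) 𝓘(ℝ, ℝ) ∞ (f i) U)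
    (hfV : ∀ x ∈ U, ∀ i, (tmap (f i) x : E →L[ℝ] ℝ) ∈ pullCov p x (V (p x)))
    (hli : LinearIndependent ℝ fun i => (tmap (f i) x₀ : E →L[ℝ] ℝ)) :
    k ≤ finrank ℝ (firstIntegrals V (p x₀)) := by
  obtain ⟨v, hv, hv0, -⟩ := exists_vertical hs hd
  -- Any function that is not constant along the fibre provides a section. As the given
  -- differentials are semibasic, they need no correction by `dF₀`.
  obtain ⟨F₀, U₀, hU₀, hxU₀, hF₀, hne⟩ := exists_smooth_ne (M := M) x₀ hv0
  refine le_finrank_of_level (hU.inter hU₀) (hp.mono inter_subset_left)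
    (hF₀.mono inter_subset_right) ⟨hx₀, hxU₀⟩ (bijective_prod_of_not_semibasic hs hd
    (α := tmap F₀ x₀) fun h => hne (h v hv)) (fun i => (hf i).mono inter_subset_left)
    (fun x hx i => ⟨0, by rw [zero_smul, sub_zero]; exact hfV x hx.1 i⟩) fun g c hg => ?_
  have h1 := DFunLike.congr_fun hg v
  have h2 : ∀ i, (tmap (f i) x₀ : E →L[ℝ] ℝ) v = 0 := fun i =>
    pullCov_le_semibasic _ (hfV x₀ hx₀ i) v hv
  simp only [sum_apply, smul_apply, h2, smul_eq_mul, mul_zero, Finset.sum_const_zero] at h1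
  have hc : c = 0 := by
    rcases mul_eq_zero.1 h1.symm with h | h
    · exact h
    · exact absurd h hne
  rw [hc, zero_smul] at hg
  exact funext (Fintype.linearIndependent_iff.1 hli g hg)

/-- In a chart the covectors vary continuously in one fixed vector space, where linear independence
is an open condition. -/
theorem eventually_linearIndependent {ι : Type*} [Finite ι] (hU : IsOpen U)
    {α : ι → M → E →L[ℝ] ℝ} (hα : ∀ i, SmoothCov (α i) U) (hx₀ : x₀ ∈ U)
    (hli : LinearIndependent ℝ fun i => α i x₀) :
    ∀ᶠ x in 𝓝 x₀, LinearIndependent ℝ fun i => α i x := by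
  set φ := chartAt E x₀
  have hφ : φ ∈ atlas E M := chart_mem_atlas E x₀
  have hs : x₀ ∈ φ.source := mem_chart_source E x₀
  have key : ∀ x ∈ φ.source, (LinearIndependent ℝ fun i => chartCov φ (α i) (φ x)) ↔
      LinearIndependent ℝ fun i => α i x := by
    intro x hx
    have hb : Function.Surjective (tmap φ.symm (φ x) : E →L[ℝ] E) :=
      (AdaptedCoframe.tmap_symm_bijective hφ (φ.map_source hx)).2
    have hinj : Function.Injective
        (ContinuousLinearMap.precomp ℝ (tmap φ.symm (φ x) : E →L[ℝ] E) :
          (E →L[ℝ] ℝ) →L[ℝ] E →L[ℝ] ℝ).toLinearMap := by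
      intro β γ h
      ext v
      obtain ⟨w, rfl⟩ := hb v
      exact DFunLike.congr_fun h w
    have h1 := LinearMap.linearIndependent_iff (v := fun i => α i x) _ (LinearMap.ker_eq_bot.2 hinj)
    rw [← h1]
    have h2 : (fun i => chartCov φ (α i) (φ x)) = (ContinuousLinearMap.precomp ℝ
        (tmap φ.symm (φ x) : E →L[ℝ] E) : (E →L[ℝ] ℝ) →L[ℝ] E →L[ℝ] ℝ).toLinearMap ∘
        fun i => α i x := by
      funext i
      simp only [chartCov, φ.left_inv hx]
      rfl
    rw [h2]
  have hc : ContinuousAt (fun y => fun i => chartCov φ (α i) y) (φ x₀) := continuousAt_pi.2 fun i =>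
    (((hα i) φ hφ).contDiffAt ((φ.isOpen_inter_preimage_symm hU).mem_nhds ⟨φ.map_source hs, by
      rwa [mem_preimage, φ.left_inv hs]⟩)).continuousAt
  have h1 := (φ.continuousAt hs).eventually
    (hc.eventually (LinearIndependent.eventually ((key x₀ hs).2 hli)))
  filter_upwards [h1, φ.open_source.mem_nhds hs] with x hx hxs
  exact (key x hxs).1 hx

/-- A bound for the number of first integrals of a system upstairs whose semibasic part is pulled
back from `V`. -/
theorem exists_le_finrank (hU : IsOpen U) (hp : ContMDiffOn 𝓘(ℝ, E) 𝓘(ℝ, E') ∞ p U)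
    (hx₀ : x₀ ∈ U) (hs : ∀ x ∈ U, Function.Surjective (tmap p x : E →L[ℝ] E'))
    (hd : finrank ℝ E = finrank ℝ E' + 1) {V : M' → Submodule ℝ (E' →L[ℝ] ℝ)}
    {W : M → Submodule ℝ (E →L[ℝ] ℝ)}
    (hW : ∀ x ∈ U, W x ⊓ semibasic E' p x ≤ pullCov p x (V (p x))) {k : ℕ}
    {f : Fin (k + 1) → M → ℝ} (hf : ∀ i, ContMDiffOn 𝓘(ℝ, E) 𝓘(ℝ, ℝ) ∞ (f i) U)
    (hfW : ∀ x ∈ U, ∀ i, (tmap (f i) x : E →L[ℝ] ℝ) ∈ W x)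
    (hli : LinearIndependent ℝ fun i => (tmap (f i) x₀ : E →L[ℝ] ℝ)) :
    ∃ x ∈ U, k ≤ finrank ℝ (firstIntegrals V (p x)) := by
  -- If all differentials are semibasic near `x₀`, all `k + 1` functions descend. Otherwise, at some
  -- nearby point, one function is transverse to the fibre; the other `k` descend along its level
  -- set.
  by_cases hall : ∀ᶠ x in 𝓝 x₀, ∀ i, (tmap (f i) x : E →L[ℝ] ℝ) ∈ semibasic E' p x
  · obtain ⟨U₁, hU₁, hU₁o, hxU₁⟩ := eventually_nhds_iff.1 hall
    refine ⟨x₀, hx₀, (Nat.le_succ k).trans ?_⟩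
    exact le_finrank_of_pullCov (hU.inter hU₁o) (hp.mono inter_subset_left) ⟨hx₀, hxU₁⟩ (hs x₀ hx₀)
      hd (fun i => (hf i).mono inter_subset_left)
      (fun x hx i => hW x hx.1 ⟨hfW x hx.1 i, hU₁ x hx.2 i⟩) hli
  · have h1 := (eventually_linearIndependent hU (fun i => smoothCov_tmap hU (hf i)) hx₀ hli).and
      (hU.mem_nhds hx₀)
    obtain ⟨x, hx, hxli, hxU⟩ := (Filter.not_eventually.1 hall).and_eventually h1 |>.exists
    push Not at hx
    obtain ⟨i₀, hi₀⟩ := hx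
    refine ⟨x, hxU, ?_⟩
    have hb := bijective_prod_of_not_semibasic (hs x hxU) hd hi₀
    have hne : ∀ᶠ y in 𝓝 x, (tmap (f i₀) y : E →L[ℝ] ℝ) ∉ semibasic E' p y := by
      filter_upwards [eventually_bijective hU hp (hf i₀) hxU hb, hU.mem_nhds hxU] with y hy hyU h
      obtain ⟨v, hv, hv0, -⟩ := exists_vertical (hs y hyU) hd
      refine hv0 (hy.1 (Prod.ext ?_ ?_))
      · simp only [hv, map_zero]
      · simp only [h v hv, map_zero]
    obtain ⟨U₁, hU₁, hU₁o, hxU₁⟩ := eventually_nhds_iff.1 hne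
    refine le_finrank_of_level (hU.inter hU₁o) (hp.mono inter_subset_left)
      ((hf i₀).mono inter_subset_left) ⟨hxU, hxU₁⟩ hb (f := fun i => f (i₀.succAbove i))
      (fun i => (hf _).mono inter_subset_left) (fun y hy i => ?_) fun g c hg => ?_
    · obtain ⟨v, hv, hv0, hv1⟩ := exists_vertical (hs y hy.1) hd
      have hne : (tmap (f i₀) y : E →L[ℝ] ℝ) v ≠ 0 := by
        intro h
        refine hU₁ y hy.2 fun w hw => ?_
        obtain ⟨c, rfl⟩ := hv1 w hw
        rw [map_smul, h, smul_zero]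
      -- This multiple of the differential of `f i₀` cancels the value on the vertical line; the
      -- difference is semibasic and still in `W`, hence pulled back from `V`.
      refine ⟨(tmap (f (i₀.succAbove i)) y : E →L[ℝ] ℝ) v / (tmap (f i₀) y : E →L[ℝ] ℝ) v,
        hW y hy.1 ⟨Submodule.sub_mem _ (hfW y hy.1 _) (Submodule.smul_mem _ _ (hfW y hy.1 _)),
          fun w hw => ?_⟩⟩
      obtain ⟨c, rfl⟩ := hv1 w hw
      rw [map_smul, sub_apply, smul_apply, smul_eq_mul, smul_eq_mul, div_mul_cancel₀ _ hne, sub_self, mul_zero]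
    · have h2 := Fintype.linearIndependent_iff.1 hxli (i₀.insertNth (-c) g) (by
        rw [Fin.sum_univ_succAbove _ i₀]
        simp only [Fin.insertNth_apply_same, Fin.insertNth_apply_succAbove]
        rw [hg, neg_smul, neg_add_cancel])
      funext i
      have := h2 (i₀.succAbove i)
      rwa [Fin.insertNth_apply_succAbove] at this

end Slice

/-! ### Descent of first integrals from integral elements to points -/

section Descent

variable {E : Type*} [NormedAddCommGroup E] [NormedSpace ℝ E] [FiniteDimensional ℝ E]
  {M : Type*} [TopologicalSpace M] [ChartedSpace E M] [IsManifold 𝓘(ℝ, E) ∞ M]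
  {s : ℕ} {I : FormFamily E M} {U : Set M} {κ : AdaptedCoframe s I U} {i j : Fin 2}

/-- A function with no dependence on the last variable on a product of balls. -/
theorem eq_of_fderiv_last_eq_zero {f : E × ℝ × ℝ → ℝ} {q₀ : E × ℝ × ℝ} {ε : ℝ}
    (hf : DifferentiableOn ℝ f (Metric.ball q₀ ε))
    (h : ∀ q ∈ Metric.ball q₀ ε, fderiv ℝ f q (0, 0, 1) = 0) {y : E} (hy : y ∈ Metric.ball q₀.1 ε)
    {b : ℝ} (hb : b ∈ Metric.ball q₀.2.2 ε) : f (y, q₀.2.1, b) = f (y, q₀.2.1, q₀.2.2) := by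
  have hε : 0 < ε := Metric.pos_of_mem_ball hy
  have hmem : ∀ t ∈ Metric.ball q₀.2.2 ε, (y, q₀.2.1, t) ∈ Metric.ball q₀ ε := by
    intro t ht
    rw [Metric.mem_ball] at *
    simp only [Prod.dist_eq, dist_self]
    exact max_lt hy (max_lt hε ht)
  have hd : ∀ t ∈ Metric.ball q₀.2.2 ε, HasDerivAt (fun t => f (y, q₀.2.1, t)) 0 t := by
    intro t ht
    have h1 := (hf.differentiableAt (Metric.isOpen_ball.mem_nhds (hmem t ht))).hasFDerivAt
    have h2 : HasDerivAt (fun t : ℝ => (y, q₀.2.1, t)) (0, 0, 1) t :=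
      (hasDerivAt_const t y).prodMk ((hasDerivAt_const t q₀.2.1).prodMk (hasDerivAt_id t))
    have h3 := h1.comp_hasDerivAt t h2
    rwa [h (y, q₀.2.1, t) (hmem t ht)] at h3
  exact Metric.isOpen_ball.is_const_of_deriv_eq_zero (convex_ball _ _).isPreconnected
    (fun t ht => (hd t ht).differentiableAt.differentiableWithinAt) (fun t ht => (hd t ht).deriv) hb
    (Metric.mem_ball_self hε)

/-- A function on the space of integral elements whose differential vanishes on the characteristic
vectors of the first pair descends, at a fixed value of the first slope, to a first integral. -/
theorem exists_descent (hU : IsOpen U) {z₀ : IntegralElement s I} (hz₀ : z₀ ∈ κ.dom i j)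
    {f : IntegralElement s I → ℝ} {O : Set (IntegralElement s I)} (hO : IsOpen O) (hzO : z₀ ∈ O)
    (hf : ContMDiffOn 𝓘(ℝ, E × ℝ × ℝ) 𝓘(ℝ, ℝ) ∞ f O)
    (hker : ∀ z ∈ O, z ∈ κ.dom i j → ∀ v : E × ℝ × ℝ, dpt z v ∈ z.plane →
      (∀ k, κ.h k z.pt (dpt z v) = 0) → (tmap (κ.sh i) z : (E × ℝ × ℝ) →L[ℝ] ℝ) v = 0 →
      (tmap f z : (E × ℝ × ℝ) →L[ℝ] ℝ) v = 0) :
    ∃ (F : M → ℝ) (U' : Set M), IsOpen U' ∧ z₀.pt ∈ U' ∧ U' ⊆ U ∧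
      ContMDiffOn 𝓘(ℝ, E) 𝓘(ℝ, ℝ) ∞ F U' ∧ (∀ y ∈ U', (tmap F y : E →L[ℝ] ℝ) ∈ κ.Vh y) ∧
      ∃ c : ℝ, (tmap f z₀ : (E × ℝ × ℝ) →L[ℝ] ℝ) =
        (tmap F z₀.pt : E →L[ℝ] ℝ).comp (dpt z₀) + c • (tmap (κ.sh i) z₀ : (E × ℝ × ℝ) →L[ℝ] ℝ) := by
  set φ := chartAt E z₀.pt
  have hφ : φ ∈ atlas E M := chart_mem_atlas E z₀.pt
  have hs : z₀.pt ∈ φ.source := mem_chart_source E z₀.pt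
  set e := κ.pchart hU z₀ hφ i j with he
  have hmem : e ∈ atlas (E × ℝ × ℝ) (IntegralElement s I) := κ.pchart_mem hU z₀ hφ i j
  have hes : z₀ ∈ e.source := ⟨hs, hz₀⟩
  set g : E × ℝ × ℝ → ℝ := fun q => f (e.symm q) with hg
  set T := e.target ∩ e.symm ⁻¹' O
  have hT : IsOpen T := e.isOpen_inter_preimage_symm hO
  have hgs : ContDiffOn ℝ ∞ g T := fun q hq => by
    have := ((hf.contMDiffAt (hO.mem_nhds hq.2)).comp q (chart_symm_smoothAt hmem hq.1))
    exact this.contDiffAt.contDiffWithinAt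
  have hq₀ : e z₀ ∈ T := ⟨e.map_source hes, by rwa [mem_preimage, e.left_inv hes]⟩
  obtain ⟨ε, hε, hball⟩ := Metric.isOpen_iff.1 hT _ hq₀
  have hgd : DifferentiableOn ℝ g (Metric.ball (e z₀) ε) :=
    (hgs.mono hball).differentiableOn (by simp)
  have hder : ∀ z ∈ e.source, z ∈ O → ∀ v : E × ℝ × ℝ,
      fderiv ℝ g (e z) ((tmap φ z.pt : E →L[ℝ] E) (dpt z v),
        (tmap (κ.sh i) z : (E × ℝ × ℝ) →L[ℝ] ℝ) v, (tmap (κ.sc j) z : (E × ℝ × ℝ) →L[ℝ] ℝ) v) =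
      (tmap f z : (E × ℝ × ℝ) →L[ℝ] ℝ) v := by
    intro z hz hzO v
    have h1 := DFunLike.congr_fun (fderiv_symm_comp (hf.contMDiffAt (hO.mem_nhds hzO)).mdiff hmem hz) v
    rw [ContinuousLinearMap.comp_apply, he, AdaptedCoframe.tmap_pchart hU z₀ hφ hz.1 hz.2] at h1
    exact h1
  have key : ∀ z ∈ e.source, z ∈ O → ∀ (w : E) (t : ℝ), w ∈ z.plane → (∀ k, κ.h k z.pt w = 0) →
      fderiv ℝ g (e z) ((tmap φ z.pt : E →L[ℝ] E) w, 0, t) = 0 := by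
    intro z hz hzO w t hw hwh
    obtain ⟨v, rfl, h2, h3⟩ := AdaptedCoframe.exists_tmap_eq hU hz.2 w 0 t
    have h4 := hder z hz hzO v
    rw [h2, h3] at h4
    rw [h4]
    exact hker z hzO hz.2 v hw hwh h2
  -- A zero base component and a pure change of the second slope is an allowed direction, so `f`
  -- does not depend on the second slope.
  have hlast : ∀ q ∈ Metric.ball (e z₀) ε, fderiv ℝ g q (0, 0, 1) = 0 := by
    intro q hq
    have h1 := key (e.symm q) (e.map_target (hball hq).1) (hball hq).2 0 1 (zero_mem _)
      (fun k => map_zero _)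
    rwa [e.right_inv (hball hq).1, map_zero] at h1
  set a₀ := (e z₀).2.1 with ha₀
  set b₀ := (e z₀).2.2 with hb₀
  have hbm : ∀ y ∈ Metric.ball (e z₀).1 ε, ∀ b ∈ Metric.ball b₀ ε, (y, a₀, b) ∈ Metric.ball (e z₀) ε := by
    intro y hy b hb
    rw [Metric.mem_ball] at *
    simp only [Prod.dist_eq]
    exact max_lt hy (max_lt (by rwa [ha₀, dist_self]) hb)
  -- Both slopes are frozen at their values at `z₀`. As the second is immaterial, the derivative of
  -- `G` can be read off at every `b` near `b₀`, which is the content of `hGd`.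
  set G : E → ℝ := fun y => g (y, a₀, b₀) with hG
  have hb₀m : b₀ ∈ Metric.ball b₀ ε := Metric.mem_ball_self hε
  have hGs : ContDiffOn ℝ ∞ G (Metric.ball (e z₀).1 ε) :=
    (hgs.mono hball).comp (contDiff_id.prodMk contDiff_const).contDiffOn
      fun y hy => hbm y hy b₀ hb₀m
  have hGd : ∀ y ∈ Metric.ball (e z₀).1 ε, ∀ b ∈ Metric.ball b₀ ε, ∀ u : E,
      fderiv ℝ G y u = fderiv ℝ g (y, a₀, b) (u, 0, 0) := by
    intro y hy b hb u
    have h1 : G =ᶠ[𝓝 y] fun y => g (y, a₀, b) :=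
      Filter.eventuallyEq_of_mem (Metric.isOpen_ball.mem_nhds hy) fun x hx =>
        (eq_of_fderiv_last_eq_zero hgd hlast hx hb).symm
    have h2 := (hgd.differentiableAt (Metric.isOpen_ball.mem_nhds (hbm y hy b hb))).hasFDerivAt
    have h3 : HasFDerivAt (fun y : E => (y, a₀, b))
        ((ContinuousLinearMap.id ℝ E).prod 0) y :=
      (hasFDerivAt_id y).prodMk (hasFDerivAt_const (a₀, b) y)
    have h4 : HasFDerivAt (fun y => g (y, a₀, b)) _ y :=
      HasFDerivAt.comp (g := g) (f := fun y : E => (y, a₀, b)) y h2 h3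
    rw [h1.fderiv_eq, h4.fderiv]
    rfl
  have hU₁ : IsOpen (φ.source ∩ φ ⁻¹' Metric.ball (e z₀).1 ε) :=
    φ.isOpen_inter_preimage Metric.isOpen_ball
  have hxU₁ : z₀.pt ∈ φ.source ∩ φ ⁻¹' Metric.ball (e z₀).1 ε :=
    ⟨hs, Metric.mem_ball_self hε⟩
  have hFd : ∀ m ∈ φ.source ∩ φ ⁻¹' Metric.ball (e z₀).1 ε, ∀ w : E,
      (tmap (fun m => G (φ m)) m : E →L[ℝ] ℝ) w = fderiv ℝ G (φ m) ((tmap φ m : E →L[ℝ] E) w) := by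
    intro m hm w
    have h1 : ContDiffAt ℝ ∞ G (φ m) := hGs.contDiffAt (Metric.isOpen_ball.mem_nhds hm.2)
    rw [tmap_comp h1.contMDiffAt.mdiff (chart_smoothAt hφ hm.1).mdiff, tmap_eq_fderiv]
    rfl
  refine ⟨fun m => G (φ m), _, hU₁, hxU₁, ?_, contMDiffOn_comp_chart hφ Metric.isOpen_ball hGs,
    ?_, ?_⟩
  · rintro m ⟨hm, hm'⟩
    have := (hball (hbm _ hm' b₀ hb₀m)).1.2
    rwa [φ.left_inv hm] at this
  · rintro m ⟨hm, hm'⟩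
    have hmU : m ∈ U := by
      have := (hball (hbm _ hm' b₀ hb₀m)).1.2
      rwa [φ.left_inv hm] at this
    have hchar : ∀ b ∈ Metric.ball b₀ ε, ∀ w : E, (∀ k, κ.θ k m w = 0) → (∀ k, κ.h k m w = 0) →
        κ.c (j + 1) m w = b * κ.c j m w → fderiv ℝ G (φ m) ((tmap φ m : E →L[ℝ] E) w) = 0 := by
      intro b hb w h1 h2 h3
      have hq := hball (hbm _ hm' b hb)
      have hz : e.symm (φ m, a₀, b) = κ.elem hU hq.1.2 i j a₀ b := κ.pchart_symm_apply hU z₀ hφ i j hq.1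
      have hpt : (e.symm (φ m, a₀, b)).pt = m := by
        rw [hz]; exact φ.left_inv hm
      have hpl : w ∈ (e.symm (φ m, a₀, b)).plane := by
        rw [hz]
        change w ∈ κ.plane (φ.symm (φ m)) i j a₀ b
        rw [φ.left_inv hm]
        exact ⟨h1, by rw [h2, h2, mul_zero], h3⟩
      have h4 := key _ (e.map_target hq.1) hq.2 w 0 hpl (by rw [hpt]; exact h2)
      rw [e.right_inv hq.1, hpt] at h4
      rw [hGd _ hm' b hb]
      exact h4
    refine κ.mem_Vh.2 fun w h1 h2 => ?_
    rw [hFd m ⟨hm, hm'⟩]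
    -- The second slopes `b₀` and `b₀ + ε / 2` give two distinct characteristic lines. They span the
    -- plane on which `θ` and the first pair vanish, so the differential of `G ∘ φ` kills this plane
    -- and belongs to `κ.Vh`.
    obtain ⟨u₁, k1, k2, k3⟩ := κ.exists_cof_eq hmU 0 0 (Pi.single j 1 + b₀ • Pi.single (j + 1) 1)
    obtain ⟨u₂, l1, l2, l3⟩ := κ.exists_cof_eq hmU 0 0
      (Pi.single j 1 + (b₀ + ε / 2) • Pi.single (j + 1) 1)
    have hne : j ≠ j + 1 := (AdaptedCoframe.fin2_ne j).symm
    have e1 := hchar b₀ hb₀m u₁ k1 k2 (by simp [k3, hne, hne.symm])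
    have e2 := hchar (b₀ + ε / 2) (by simp [abs_of_pos hε, hε]) u₂ l1 l2
      (by simp [l3, hne, hne.symm])
    have hdec : w = (κ.c j m w - (κ.c (j + 1) m w - b₀ * κ.c j m w) / (ε / 2)) • u₁ +
        ((κ.c (j + 1) m w - b₀ * κ.c j m w) / (ε / 2)) • u₂ := by
      refine sub_eq_zero.1 (κ.eq_zero hmU (fun k => ?_) (fun k => ?_) fun k => ?_)
      · simp [h1, k1, l1]
      · simp [h2, k2, l2]
      · rcases fin2_cases j k with rfl | rfl
        · simp [k3, l3, hne]
        · simp [k3, l3, hne.symm]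
          field_simp
          ring
    rw [hdec, map_add, map_add, map_smul, map_smul, map_smul, map_smul, e1, e2, smul_zero,
      smul_zero, add_zero]
  -- What `F` does not see of `f` is its derivative along the first slope.
  · refine ⟨fderiv ℝ g (e z₀) (0, 1, 0), ?_⟩
    refine ContinuousLinearMap.ext fun v => ?_
    rw [← hder z₀ hes hzO v, add_apply, smul_apply, ContinuousLinearMap.comp_apply, hFd _ hxU₁,
      hGd _ hxU₁.2 b₀ hb₀m]
    have hlast₀ := hlast (e z₀) (Metric.mem_ball_self hε)
    set u := (tmap φ z₀.pt : E →L[ℝ] E) (dpt z₀ v)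
    set r := (tmap (κ.sh i) z₀ : (E × ℝ × ℝ) →L[ℝ] ℝ) v
    set t := (tmap (κ.sc j) z₀ : (E × ℝ × ℝ) →L[ℝ] ℝ) v
    have h1 : ((u, r, t) : E × ℝ × ℝ) = (u, 0, 0) + r • (0, 1, 0) + t • (0, 0, 1) := by
      ext <;> simp
    rw [h1, map_add, map_add, map_smul, map_smul, hlast₀, smul_zero, add_zero, smul_eq_mul,
      smul_eq_mul, mul_comm r]
    rfl

end Descent

/-! ### Prolongation of a coframe with exact characteristic forms -/

section ExactCoframe

variable {E : Type*} [NormedAddCommGroup E] [NormedSpace ℝ E] [FiniteDimensional ℝ E]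
  {M : Type*} [TopologicalSpace M] [ChartedSpace E M] [IsManifold 𝓘(ℝ, E) ∞ M]
  {s : ℕ} {I : FormFamily E M} {U : Set M} {i j : Fin 2} {z : IntegralElement s I}

/-- An adapted coframe whose characteristic 1-forms are the differentials of `H` and `C`. -/
structure AdaptedCoframe.IsExact (κ : AdaptedCoframe s I U) (H C : Fin 2 → M → ℝ) : Prop where
  smooth_H : ∀ k, ContMDiffOn 𝓘(ℝ, E) 𝓘(ℝ, ℝ) ∞ (H k) U
  smooth_C : ∀ k, ContMDiffOn 𝓘(ℝ, E) 𝓘(ℝ, ℝ) ∞ (C k) U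
  h_eq : ∀ k, ∀ x ∈ U, κ.h k x = tmap (H k) x
  c_eq : ∀ k, ∀ x ∈ U, κ.c k x = tmap (C k) x
  closed : ∀ x ∈ U, ∀ k, extD (fun y => ofOne (κ.θ k y)) x ∈ I 2 x

namespace AdaptedCoframe

variable (κ : AdaptedCoframe s I U) {H C : Fin 2 → M → ℝ}

variable {κ} in
theorem IsExact.swap (hκ : κ.IsExact H C) : κ.swap.IsExact C H :=
  ⟨hκ.smooth_C, hκ.smooth_H, hκ.c_eq, hκ.h_eq, hκ.closed⟩

/-- The first singular system of the prolongation. -/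
def charSys (z : IntegralElement s I) : Submodule ℝ ((E × ℝ × ℝ) →L[ℝ] ℝ) where
  carrier := {α | ∀ v : E × ℝ × ℝ, dpt z v ∈ z.plane → (∀ k, κ.h k z.pt (dpt z v) = 0) →
    (∀ i, (∃ w ∈ z.plane, κ.h i z.pt w ≠ 0) → (tmap (κ.sh i) z : (E × ℝ × ℝ) →L[ℝ] ℝ) v = 0) →
    α v = 0}
  add_mem' := by
    intro α β hα hβ v h1 h2 h3
    rw [add_apply, hα v h1 h2 h3, hβ v h1 h2 h3, add_zero]
  zero_mem' := fun _ _ _ _ => rfl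
  smul_mem' := by
    intro c α hα v h1 h2 h3
    rw [smul_apply, hα v h1 h2 h3, smul_zero]

/-- The first integrals of the first singular system of the prolongation. -/
def charFun (H : Fin 2 → M → ℝ) (i : Fin 2) : Fin 3 → IntegralElement s I → ℝ :=
  ![fun z => H 0 z.pt, fun z => H 1 z.pt, κ.sh i]

variable {κ}

theorem mem_dom_swap : z ∈ κ.swap.dom j i ↔ z ∈ κ.dom i j :=
  ⟨fun h => ⟨h.1, h.2.2, h.2.1⟩, fun h => ⟨h.1, h.2.2, h.2.1⟩⟩

/-- Where both slopes of a pair are defined they are reciprocal to each other, so their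
differentials have the same kernel. Thus `charSys` does not depend on the chart, and by
`mem_charSys` one slope suffices to describe it. -/
theorem tmap_sh_eq_zero (hU : IsOpen U) (hz : z ∈ κ.dom i j) {i' : Fin 2}
    (hi' : ∃ w ∈ z.plane, κ.h i' z.pt w ≠ 0) {v : E × ℝ × ℝ}
    (hv : (tmap (κ.sh i) z : (E × ℝ × ℝ) →L[ℝ] ℝ) v = 0) :
    (tmap (κ.sh i') z : (E × ℝ × ℝ) →L[ℝ] ℝ) v = 0 := by
  rcases fin2_cases i i' with rfl | rfl
  · exact hv
  have hz' : z ∈ κ.dom (i + 1) j := ⟨hz.1, hi', hz.2.2⟩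
  have hii : ∀ i : Fin 2, i + 1 + 1 = i := by decide
  have key : ∀ y, y ∈ κ.dom i j → y ∈ κ.dom (i + 1) j → κ.sh i y ≠ 0 ∧
      κ.sh (i + 1) y = (κ.sh i y)⁻¹ := by
    intro y hy hy'
    obtain ⟨w, hw, hne⟩ := hy'.2.1
    have h1 := ((mem_plane_iff hy).1 hw).2.1
    have h2 := ((mem_plane_iff hy').1 hw).2.1
    rw [hii i] at h2
    have h3 : κ.sh i y ≠ 0 := fun h => hne (by rw [h1, h, zero_mul])
    refine ⟨h3, ?_⟩
    have h4 : κ.h i y.pt w ≠ 0 := fun h => hne (by rw [h1, h, mul_zero])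
    rw [h1] at h2
    field_simp
    have : κ.h i y.pt w * 1 = κ.h i y.pt w * (κ.sh (i + 1) y * κ.sh i y) := by linarith
    exact (mul_left_cancel₀ h4 this).symm
  have h1 : (tmap (κ.sh (i + 1)) z : (E × ℝ × ℝ) →L[ℝ] ℝ) = tmap (fun y => (κ.sh i y)⁻¹) z := by
    refine tmap_congr ?_
    filter_upwards [(isOpen_dom hU).mem_nhds hz, (isOpen_dom hU).mem_nhds hz'] with y h2 h3
    exact (key y h2 h3).2
  have h2 : ContMDiffAt 𝓘(ℝ, ℝ) 𝓘(ℝ, ℝ) ∞ (fun t : ℝ => t⁻¹) (κ.sh i z) :=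
    (contDiffAt_inv ℝ (key z hz hz').1).contMDiffAt
  rw [h1, tmap_comp h2.mdiff (smoothAt_sh hU hz).mdiff, ContinuousLinearMap.comp_apply, hv, map_zero]

theorem h_eq_zero_iff (hz : z ∈ κ.dom i j) {v : E × ℝ × ℝ} (hv : dpt z v ∈ z.plane) :
    (∀ k, κ.h k z.pt (dpt z v) = 0) ↔ κ.h i z.pt (dpt z v) = 0 := by
  refine ⟨fun h => h i, fun h k => ?_⟩
  rcases fin2_cases i k with rfl | rfl
  · exact h
  · rw [((mem_plane_iff hz).1 hv).2.1, h, mul_zero]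

theorem mem_charSys (hU : IsOpen U) (hz : z ∈ κ.dom i j) {α : (E × ℝ × ℝ) →L[ℝ] ℝ} :
    α ∈ κ.charSys z ↔ ∀ v : E × ℝ × ℝ, dpt z v ∈ z.plane → κ.h i z.pt (dpt z v) = 0 →
      (tmap (κ.sh i) z : (E × ℝ × ℝ) →L[ℝ] ℝ) v = 0 → α v = 0 := by
  refine forall_congr' fun v => forall_congr' fun hv => ?_
  rw [h_eq_zero_iff hz hv]
  refine forall_congr' fun h => ⟨fun h1 h2 => h1 fun i' hi' => tmap_sh_eq_zero hU hz hi' h2,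
    fun h1 h2 => h1 (h2 i hz.2.1)⟩

theorem smooth_comp_pt {f : M → ℝ} (hf : ContMDiffOn 𝓘(ℝ, E) 𝓘(ℝ, ℝ) ∞ f U) :
    ContMDiffOn 𝓘(ℝ, E × ℝ × ℝ) 𝓘(ℝ, ℝ) ∞ (fun z : IntegralElement s I => f z.pt) (κ.dom i j) :=
  hf.comp (IntegralElement.smooth_pt _) fun _ h => h.1

theorem tmap_comp_pt {f : M → ℝ} (hU : IsOpen U) (hf : ContMDiffOn 𝓘(ℝ, E) 𝓘(ℝ, ℝ) ∞ f U)
    (hz : z.pt ∈ U) : (tmap (fun z : IntegralElement s I => f z.pt) z : (E × ℝ × ℝ) →L[ℝ] ℝ) =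
      (tmap f z.pt : E →L[ℝ] ℝ).comp (dpt z) :=
  tmap_comp (hf.contMDiffAt (hU.mem_nhds hz)).mdiff z.smoothAt_pt.mdiff

namespace IsExact

variable (hκ : κ.IsExact H C) (hU : IsOpen U)

include hκ hU in
theorem tmap_H (k : Fin 2) (hz : z.pt ∈ U) :
    (tmap (fun z : IntegralElement s I => H k z.pt) z : (E × ℝ × ℝ) →L[ℝ] ℝ) =
      (κ.h k z.pt).comp (dpt z) := by
  rw [tmap_comp_pt hU (hκ.smooth_H k) hz, hκ.h_eq k _ hz]

include hκ hU in
theorem smooth_charFun (k : Fin 3) :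
    ContMDiffOn 𝓘(ℝ, E × ℝ × ℝ) 𝓘(ℝ, ℝ) ∞ (κ.charFun H i k) (κ.dom i j) := by
  fin_cases k
  · exact smooth_comp_pt (hκ.smooth_H 0)
  · exact smooth_comp_pt (hκ.smooth_H 1)
  · exact fun y hy => (smoothAt_sh hU hy).contMDiffWithinAt

include hκ hU in
theorem tmap_charFun_eq_zero_iff (hz : z ∈ κ.dom i j) {v : E × ℝ × ℝ} :
    (∀ k, (tmap (κ.charFun H i k) z : (E × ℝ × ℝ) →L[ℝ] ℝ) v = 0) ↔
      (∀ k, κ.h k z.pt (dpt z v) = 0) ∧ (tmap (κ.sh i) z : (E × ℝ × ℝ) →L[ℝ] ℝ) v = 0 := by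
  have h0 := DFunLike.congr_fun (hκ.tmap_H hU 0 hz.1) v
  have h1 := DFunLike.congr_fun (hκ.tmap_H hU 1 hz.1) v
  rw [Fin.forall_fin_succ, Fin.forall_fin_two, Fin.forall_fin_two, and_assoc]
  change (tmap (fun z : IntegralElement s I => H 0 z.pt) z : (E × ℝ × ℝ) →L[ℝ] ℝ) v = 0 ∧
    (tmap (fun z : IntegralElement s I => H 1 z.pt) z : (E × ℝ × ℝ) →L[ℝ] ℝ) v = 0 ∧ _ ↔ _
  rw [h0, h1]
  rfl

include hκ hU in
theorem tmap_charFun_mem (hz : z ∈ κ.dom i j) (k : Fin 3) :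
    (tmap (κ.charFun H i k) z : (E × ℝ × ℝ) →L[ℝ] ℝ) ∈ κ.charSys z :=
  (mem_charSys hU hz).2 fun _ h1 h2 h3 =>
    (hκ.tmap_charFun_eq_zero_iff hU hz).2 ⟨(h_eq_zero_iff hz h1).2 h2, h3⟩ k

include hκ hU in
theorem linearIndependent_charFun (hz : z ∈ κ.dom i j) :
    LinearIndependent ℝ fun k => (tmap (κ.charFun H i k) z : (E × ℝ × ℝ) →L[ℝ] ℝ) := by
  refine linearIndependent_of_dual ?_
  have h0 := fun v => DFunLike.congr_fun (hκ.tmap_H hU 0 hz.1) v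
  have h1 := fun v => DFunLike.congr_fun (hκ.tmap_H hU 1 hz.1) v
  have key : ∀ a : Fin 3 → ℝ, ∃ v, ∀ k,
      (tmap (κ.charFun H i k) z : (E × ℝ × ℝ) →L[ℝ] ℝ) v = a k := by
    intro a
    obtain ⟨u, -, h2, -⟩ := κ.exists_cof_eq hz.1 0 ![a 0, a 1] 0
    obtain ⟨v, rfl, h3, -⟩ := exists_tmap_eq hU hz u (a 2) 0
    refine ⟨v, fun k => ?_⟩
    fin_cases k
    · exact (h0 v).trans (h2 0)
    · exact (h1 v).trans (h2 1)
    · exact h3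
  intro k
  obtain ⟨v, hv⟩ := key (Pi.single k 1)
  exact ⟨v, by simp [hv], fun l hl => by simp [hv, hl]⟩

include hκ hU in
-- Given `v`, choose `w` with the second characteristic components of `v` and vanishing first ones.
-- A covector in both spans kills `w` on account of the first and `v - w` on account of the second.
theorem inf_charFun (hz : z ∈ κ.dom i j) :
    Submodule.span ℝ (range fun k => (tmap (κ.charFun H i k) z : (E × ℝ × ℝ) →L[ℝ] ℝ)) ⊓
      Submodule.span ℝ (range fun k => (tmap (κ.swap.charFun C j k) z : (E × ℝ × ℝ) →L[ℝ] ℝ)) =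
      ⊥ := by
  rw [eq_bot_iff]
  rintro α ⟨h1, h2⟩
  rw [SetLike.mem_coe, mem_span_range_iff] at h1 h2
  refine (Submodule.mem_bot ℝ).2 (ContinuousLinearMap.ext fun v => ?_)
  obtain ⟨u, -, k2, k3⟩ := κ.exists_cof_eq hz.1 0 0 (fun k => κ.c k z.pt (dpt z v))
  obtain ⟨w, rfl, l1, l2⟩ := exists_tmap_eq hU hz u 0 ((tmap (κ.sc j) z : (E × ℝ × ℝ) →L[ℝ] ℝ) v)
  have e1 : α w = 0 := h1 w ((hκ.tmap_charFun_eq_zero_iff hU hz).2 ⟨k2, l1⟩)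
  have e2 : α (v - w) = 0 := by
    refine h2 _ ((hκ.swap.tmap_charFun_eq_zero_iff hU (mem_dom_swap.2 hz)).2 ⟨fun k => ?_, ?_⟩)
    · change κ.c k z.pt _ = 0
      rw [map_sub, map_sub, k3, sub_self]
    · change (tmap (κ.sc j) z : (E × ℝ × ℝ) →L[ℝ] ℝ) _ = 0
      rw [map_sub, l2, sub_self]
  rw [map_sub, e1, sub_zero] at e2
  exact e2

/-- The exterior derivatives of the contact forms that come from the characteristic pairs. -/
theorem extD_contact_inr_zero (hκ : κ.IsExact H C) (hU : IsOpen U) (hz : z ∈ κ.dom i j) :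
    extD (fun y => ofOne (κ.contact i j (Sum.inr 0) y)) z =
      wedge (tmap (fun z : IntegralElement s I => H i z.pt) z : (E × ℝ × ℝ) →L[ℝ] ℝ)
        (ofOne (tmap (κ.sh i) z)) := by
  have hO : IsOpen (κ.dom i j) := isOpen_dom hU
  have hH : ∀ k, ContMDiffOn 𝓘(ℝ, E × ℝ × ℝ) 𝓘(ℝ, ℝ) ∞
      (fun z : IntegralElement s I => H k z.pt) (κ.dom i j) := fun k => smooth_comp_pt (hκ.smooth_H k)
  have hsm : ∀ k, SmoothForm (fun y => ofOne (tmap (fun z : IntegralElement s I => H k z.pt) y :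
      (E × ℝ × ℝ) →L[ℝ] ℝ)) (κ.dom i j) := fun k => smoothCov_iff.1 (smoothCov_tmap hO (hH k))
  have hsh : ContMDiffOn 𝓘(ℝ, E × ℝ × ℝ) 𝓘(ℝ, ℝ) ∞ (fun z => - κ.sh i z) (κ.dom i j) :=
    fun y hy => (smoothAt_sh hU hy).neg.contMDiffWithinAt
  have h0 : ∀ k, extD (fun y => ofOne (tmap (fun z : IntegralElement s I => H k z.pt) y :
      (E × ℝ × ℝ) →L[ℝ] ℝ)) z = 0 := fun k =>
    extD_comp_tmap hO (hH k) (ofOne (ContinuousLinearMap.id ℝ ℝ)) hz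
  have h1 : ∀ y ∈ κ.dom i j, ofOne (κ.contact i j (Sum.inr 0) y) =
      ofOne (tmap (fun z : IntegralElement s I => H (i + 1) z.pt) y : (E × ℝ × ℝ) →L[ℝ] ℝ) +
      (- κ.sh i y) • ofOne (tmap (fun z : IntegralElement s I => H i z.pt) y) := by
    intro y hy
    rw [hκ.tmap_H hU _ hy.1, hκ.tmap_H hU _ hy.1, ← ofOne_smul, ← ofOne_add]
    congr 1
    refine ContinuousLinearMap.ext fun v => ?_
    simp [contact, sub_eq_add_neg]
  have h2 : (tmap (fun z => - κ.sh i z) z : (E × ℝ × ℝ) →L[ℝ] ℝ) = - tmap (κ.sh i) z := by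
    refine (tmap_clm_comp (-ContinuousLinearMap.id ℝ ℝ) (smoothAt_sh hU hz).mdiff).trans ?_
    refine ContinuousLinearMap.ext fun v => ?_
    rfl
  -- The contact form is `dH_{i+1} - sh dH_i`, with derivative `-d(sh) ∧ dH_i = dH_i ∧ d(sh)`.
  rw [extD_congr (Filter.eventuallyEq_of_mem (hO.mem_nhds hz) h1),
    extD_add hO (hsm _) (SmoothForm.smul hO hsh (hsm _)) hz, extD_smul hO hsh (hsm _) hz, h0, h0,
    zero_add, smul_zero, add_zero, h2, wedge_ofOne_swap]
  refine ContinuousAlternatingMap.ext fun v => ?_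
  rw [ContinuousAlternatingMap.neg_apply, wedge_ofOne_apply, wedge_ofOne_apply]
  simp
  ring

/-- The adapted coframe of the prolongation. -/
def prolongCoframe (hκ : κ.IsExact H C) (hU : IsOpen U) (i j : Fin 2) :
    AdaptedCoframe (s + 2) (prolong s I) (κ.dom i j) where
  θ k := κ.contact i j (finSumFinEquiv.symm k)
  h := ![tmap fun z => H i z.pt, tmap (κ.sh i)]
  c := ![tmap fun z => C j z.pt, tmap (κ.sc j)]
  smooth_θ k := κ.smooth_contact hU _
  smooth_h k := by
    fin_cases k
    · exact smoothCov_tmap (isOpen_dom hU) (smooth_comp_pt (hκ.smooth_H i))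
    · exact smoothCov_tmap (isOpen_dom hU) fun y hy => (smoothAt_sh hU hy).contMDiffWithinAt
  smooth_c k := by
    fin_cases k
    · exact smoothCov_tmap (isOpen_dom hU) (smooth_comp_pt (hκ.smooth_C j))
    · exact smoothCov_tmap (isOpen_dom hU) fun y hy => (smoothAt_sc hU hy).contMDiffWithinAt
  coframe z hz := by
    have hH := fun v => DFunLike.congr_fun (hκ.tmap_H hU i hz.1) v
    have hC := fun v => DFunLike.congr_fun (hκ.swap.tmap_H hU j hz.1) v
    set L : (E × ℝ × ℝ) →ₗ[ℝ] ModelSpace (s + 2) :=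
      (LinearMap.pi fun k => (κ.contact i j (finSumFinEquiv.symm k) z).toLinearMap).prod
        ((LinearMap.pi fun k => ((![tmap fun z => H i z.pt, tmap (κ.sh i)] : Fin 2 → _) k z :
          (E × ℝ × ℝ) →L[ℝ] ℝ).toLinearMap).prod
          (LinearMap.pi fun k => ((![tmap fun z => C j z.pt, tmap (κ.sc j)] : Fin 2 → _) k z :
            (E × ℝ × ℝ) →L[ℝ] ℝ).toLinearMap))
    change Function.Bijective L
    constructor
    · rw [← LinearMap.ker_eq_bot, LinearMap.ker_eq_bot']
      intro v hv
      have h1 : ∀ k, κ.contact i j k z v = 0 := fun k => by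
        have := congrFun (congrArg Prod.fst hv) (finSumFinEquiv k)
        change κ.contact i j (finSumFinEquiv.symm (finSumFinEquiv k)) z v = 0 at this
        rwa [Equiv.symm_apply_apply] at this
      have h2 : ∀ k, _ = (0 : ℝ) := congrFun (congrArg (fun q => q.2.1) hv)
      have h3 : ∀ k, _ = (0 : ℝ) := congrFun (congrArg (fun q => q.2.2) hv)
      rw [contact_eq_zero_iff hz] at h1
      have k1 := (h_eq_zero_iff hz h1).2 ((hH v).symm.trans (h2 0))
      have k2 := (h_eq_zero_iff (mem_dom_swap.2 hz) h1).2 ((hC v).symm.trans (h3 0))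
      exact eq_zero_of_tmap hU hz (κ.eq_zero hz.1 ((mem_plane_iff hz).1 h1).1 k1 k2) (h2 1) (h3 1)
    · rintro ⟨r, f, g⟩
      -- The component along `h i` is the prescribed `f 0`; the one along `h (i + 1)` is then forced
      -- by the prescribed value of the contact form `h (i + 1) - sh h i`. The second pair is
      -- treated alike.
      obtain ⟨u, k1, k2, k3⟩ := κ.exists_cof_eq hz.1 (fun k => r (finSumFinEquiv (Sum.inl k)))
        (f 0 • Pi.single i 1 + (r (finSumFinEquiv (Sum.inr 0)) + κ.sh i z * f 0) • Pi.single (i + 1) 1)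
        (g 0 • Pi.single j 1 + (r (finSumFinEquiv (Sum.inr 1)) + κ.sc j z * g 0) • Pi.single (j + 1) 1)
      obtain ⟨v, rfl, l1, l2⟩ := exists_tmap_eq hU hz u (f 1) (g 1)
      have hne : ∀ i : Fin 2, i ≠ i + 1 := fun i => (fin2_ne i).symm
      refine ⟨v, Prod.ext (funext fun k => ?_) (Prod.ext (funext fun k => ?_) (funext fun k => ?_))⟩
      · obtain ⟨k, rfl⟩ := finSumFinEquiv.surjective k
        change κ.contact i j (finSumFinEquiv.symm (finSumFinEquiv k)) z v = _
        rw [Equiv.symm_apply_apply]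
        rcases k with k | k
        · exact k1 k
        · fin_cases k
          · simp [contact, k2, hne]
          · simp [contact, k3, hne]
      · fin_cases k
        · exact (hH v).trans (by simp [k2, hne])
        · exact l1
      · fin_cases k
        · exact (hC v).trans ((k3 j).trans (by simp [hne]))
        · exact l2
  generate z hz p := by
    have hr : (range fun k => κ.contact i j (finSumFinEquiv.symm k) z) =
        range fun k => κ.contact i j k z :=
      finSumFinEquiv.symm.surjective.range_comp fun k => κ.contact i j k z
    rw [prolong_eq hU hz]
    refine le_antisymm (algIdeal_le ?_ p) (algIdeal_le ?_ p)
    · rintro q η (hη | hη)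
      · rw [← hr] at hη
        exact subset_algIdeal _ q (Or.inl hη)
      · refine twoForms_subset ?_ q hη
        rintro _ ⟨k, rfl⟩
        rcases k with k | k
        · have h3 : extD (fun y => ofOne (κ.contact i j (Sum.inl k) y)) z =
              (extD (fun y => ofOne (κ.θ k y)) z.pt).compContinuousLinearMap (dpt z) :=
            extD_pullForm hU (smoothCov_iff.1 (κ.smooth_θ k)) (isOpen_dom hU)
              (IntegralElement.smooth_pt _) hz hz.1
          beta_reduce
          rw [h3]
          -- `dθ` lies in `I`, and on integral elements all of `I` falls into the ideal of the
          -- contact forms, so these derivatives contribute no new generators.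
          refine comp_dpt_mem_algIdeal (fun γ hγ => ?_) (hκ.closed _ hz.1 k)
          rw [contact_span hz, ← hr] at hγ
          refine ofOne_mem_of_span (fun α hα => ?_) hγ
          exact subset_algIdeal _ 1 (Or.inl (mem_oneForms hα))
        · fin_cases k
          · refine subset_algIdeal _ 2 (Or.inr (Or.inl ?_))
            exact hκ.extD_contact_inr_zero hU hz
          · refine subset_algIdeal _ 2 (Or.inr (Or.inr ?_))
            exact hκ.swap.extD_contact_inr_zero hU (mem_dom_swap.2 hz)
    · rintro q η (hη | hη)
      · rw [hr] at hη
        exact subset_algIdeal _ q (Or.inl hη)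
      · refine twoForms_subset ?_ q hη
        rintro _ (rfl | rfl)
        · refine subset_algIdeal _ 2 (Or.inr ⟨Sum.inr 0, ?_⟩)
          exact hκ.extD_contact_inr_zero hU hz
        · refine subset_algIdeal _ 2 (Or.inr ⟨Sum.inr 1, ?_⟩)
          exact hκ.swap.extD_contact_inr_zero hU (mem_dom_swap.2 hz)

/-- The derivatives of the contact forms are among the generators of the Pfaffian system, and the
two 2-forms are products of exact differentials, hence closed. -/
theorem isClosed_prolongCoframe : (hκ.prolongCoframe hU i j).IsClosed where
  θ z hz k := by
    rw [prolong_eq hU hz]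
    exact subset_algIdeal _ 2 (Or.inr ⟨finSumFinEquiv.symm k, rfl⟩)
  h z hz := by
    have : extD (fun y => wedge ((hκ.prolongCoframe hU i j).h 0 y)
        (ofOne ((hκ.prolongCoframe hU i j).h 1 y))) z = 0 :=
      extD_wedge_tmap (isOpen_dom hU) (smooth_comp_pt (hκ.smooth_H i))
        (fun y hy => (smoothAt_sh hU hy).contMDiffWithinAt) hz
    exact this.symm ▸ Submodule.zero_mem _
  c z hz := by
    have : extD (fun y => wedge ((hκ.prolongCoframe hU i j).c 0 y)
        (ofOne ((hκ.prolongCoframe hU i j).c 1 y))) z = 0 :=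
      extD_wedge_tmap (isOpen_dom hU) (smooth_comp_pt (hκ.smooth_C j))
        (fun y hy => (smoothAt_sc hU hy).contMDiffWithinAt) hz
    exact this.symm ▸ Submodule.zero_mem _

theorem Vh_prolongCoframe (hz : z ∈ κ.dom i j) :
    (hκ.prolongCoframe hU i j).Vh z = κ.charSys z := by
  ext α
  rw [AdaptedCoframe.mem_Vh, mem_charSys hU hz]
  refine forall_congr' fun v => ?_
  have h1 : (∀ k, (hκ.prolongCoframe hU i j).θ k z v = 0) ↔ dpt z v ∈ z.plane := by
    rw [← contact_eq_zero_iff hz]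
    exact finSumFinEquiv.symm.forall_congr_left.trans (by simp [prolongCoframe])
  have h2 := DFunLike.congr_fun (hκ.tmap_H hU i hz.1) v
  rw [h1, Fin.forall_fin_two]
  change _ → ((tmap (fun z : IntegralElement s I => H i z.pt) z : (E × ℝ × ℝ) →L[ℝ] ℝ) v = 0 ∧
    (tmap (κ.sh i) z : (E × ℝ × ℝ) →L[ℝ] ℝ) v = 0 → _) ↔ _
  rw [h2, and_imp]
  rfl

theorem Vc_prolongCoframe (hz : z ∈ κ.dom i j) :
    (hκ.prolongCoframe hU i j).Vc z = κ.swap.charSys z := by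
  ext α
  rw [AdaptedCoframe.mem_Vc, mem_charSys hU (mem_dom_swap.2 hz)]
  refine forall_congr' fun v => ?_
  have h1 : (∀ k, (hκ.prolongCoframe hU i j).θ k z v = 0) ↔ dpt z v ∈ z.plane := by
    rw [← contact_eq_zero_iff hz]
    exact finSumFinEquiv.symm.forall_congr_left.trans (by simp [prolongCoframe])
  have h2 := DFunLike.congr_fun (hκ.swap.tmap_H hU j hz.1) v
  rw [h1, Fin.forall_fin_two]
  change _ → ((tmap (fun z : IntegralElement s I => C j z.pt) z : (E × ℝ × ℝ) →L[ℝ] ℝ) v = 0 ∧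
    (tmap (κ.sc j) z : (E × ℝ × ℝ) →L[ℝ] ℝ) v = 0 → _) ↔ _
  rw [h2, and_imp]
  rfl

include hκ hU in
-- The contact forms and the first pair of `prolongCoframe` span `charSys`; the second pair consists
-- of the differentials of `C j` and of the second slope, which are in the other span.
theorem charSys_sup (hz : z ∈ κ.dom i j) : κ.charSys z ⊔ Submodule.span ℝ
    (range fun k => (tmap (κ.swap.charFun C j k) z : (E × ℝ × ℝ) →L[ℝ] ℝ)) = ⊤ := by
  rw [eq_top_iff]
  rintro α -
  set L := hκ.prolongCoframe hU i j
  have h1 : α ∈ Submodule.span ℝ (range (Sum.elim (fun k => L.θ k z)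
      (Sum.elim (fun k => L.h k z) fun k => L.c k z))) := by
    rw [mem_span_range_iff]
    intro v hv
    simp only [Sum.forall, Sum.elim_inl, Sum.elim_inr] at hv
    rw [L.eq_zero hz hv.1 hv.2.1 hv.2.2, map_zero]
  refine (Submodule.span_le.2 ?_) h1
  have hV : L.Vh z ≤ κ.charSys z ⊔ Submodule.span ℝ
      (range fun k => (tmap (κ.swap.charFun C j k) z : (E × ℝ × ℝ) →L[ℝ] ℝ)) := by
    rw [hκ.Vh_prolongCoframe hU hz]
    exact le_sup_left
  rintro _ ⟨k | k | k, rfl⟩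
  · exact hV (Submodule.subset_span (Or.inl ⟨k, rfl⟩))
  · exact hV (Submodule.subset_span (Or.inr ⟨k, rfl⟩))
  · refine (le_sup_right : _ ≤ κ.charSys z ⊔ _) ?_
    fin_cases k
    · fin_cases j
      · exact Submodule.subset_span ⟨0, rfl⟩
      · exact Submodule.subset_span ⟨1, rfl⟩
    · exact Submodule.subset_span ⟨2, rfl⟩

end IsExact

end AdaptedCoframe

end ExactCoframe

/-! ### Exactness of the coframe of the wave equation -/

section Wave

/-- The first integrals of the singular systems of the wave equation. -/
def waveH (k : Fin 2) (m : J1) : ℝ := dc (![3, 0] k) m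

/-- The first integrals of the singular systems of the wave equation. -/
def waveC (k : Fin 2) (m : J1) : ℝ := dc (![4, 1] k) m

/-- `d(du - u_x dx - u_y dy) = -du_x ∧ dx - du_y ∧ dy`, a combination of the two generators. -/
theorem extD_waveContact (m : J1) : extD (fun y => ofOne (waveContact y)) m ∈ wave 2 m := by
  have hc : ∀ k : Fin 5, ContMDiffOn 𝓘(ℝ, J1) 𝓘(ℝ, ℝ) ∞ (fun y : J1 => (-dc k) y) univ :=
    fun k => (-dc k).contDiff.contMDiff.contMDiffOn
  have hs : ∀ k : Fin 5, SmoothForm (fun _ : J1 => ofOne (dc k)) univ := fun k =>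
    smoothCov_iff.1 (smoothCov_self contDiff_const univ)
  have hsm : ∀ k l : Fin 5, SmoothForm (fun y : J1 => (-dc k) y • ofOne (dc l)) univ := fun k l =>
    SmoothForm.smul isOpen_univ (hc k) (hs l)
  have h1 : (fun y => ofOne (waveContact y)) =
      fun y => ofOne (dc 2) + ((-dc 3) y • ofOne (dc 0) + (-dc 4) y • ofOne (dc 1)) := by
    funext y
    rw [← ofOne_smul, ← ofOne_smul, ← ofOne_add, ← ofOne_add]
    congr 1
    refine ContinuousLinearMap.ext fun v => ?_
    change dc 2 v - dc 3 y * dc 0 v - dc 4 y * dc 1 v =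
      dc 2 v + (-dc 3 y * dc 0 v + -dc 4 y * dc 1 v)
    ring
  have h2 : ∀ k l : Fin 5, extD (fun y : J1 => (-dc k) y • ofOne (dc l)) m =
      wedge (-dc k) (ofOne (dc l)) := by
    intro k l
    rw [extD_smul isOpen_univ (hc k) (hs l) (mem_univ m), extD_const, smul_zero, add_zero, tmap_clm]
  rw [h1, extD_add isOpen_univ (hs 2) (SmoothForm.add (hsm 3 0) (hsm 4 1)) (mem_univ m), extD_const,
    zero_add, extD_add isOpen_univ (hsm 3 0) (hsm 4 1) (mem_univ m), h2, h2]
  have h3 : ∀ k l : Fin 5, wedge (-dc k) (ofOne (dc l)) = -wedge (dc k) (ofOne (dc l)) := by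
    intro k l
    refine ContinuousAlternatingMap.ext fun v => ?_
    rw [ContinuousAlternatingMap.neg_apply, wedge_ofOne_apply, wedge_ofOne_apply, neg_apply, neg_apply]
    ring
  rw [h3, h3]
  refine Submodule.add_mem _ (Submodule.neg_mem _ ?_) (Submodule.neg_mem _ ?_)
  · exact subset_algIdeal _ 2 (Or.inr (Or.inl rfl))
  · exact subset_algIdeal _ 2 (Or.inr (Or.inr rfl))

/-- The characteristic forms are coordinate differentials. In the ordering `du_x, dx`, the slope
with index `1` is `u_xx` where `dx` does not vanish, and the slope with index `0` is `dx / du_x`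
where `du_x` does not vanish. -/
theorem isExact_waveCoframe : waveCoframe.IsExact waveH waveC where
  smooth_H k := (dc (![3, 0] k)).contDiff.contMDiff.contMDiffOn
  smooth_C k := (dc (![4, 1] k)).contDiff.contMDiff.contMDiffOn
  h_eq k x _ := (tmap_clm (dc (![3, 0] k)) x).symm
  c_eq k x _ := (tmap_clm (dc (![4, 1] k)) x).symm
  closed x _ _ := extD_waveContact x

end Wave

/-! ### The exact space of first integrals of the prolonged extension -/

section Rank

variable {E : Type*} [NormedAddCommGroup E] [NormedSpace ℝ E] [FiniteDimensional ℝ E]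
  {E' : Type*} [NormedAddCommGroup E'] [NormedSpace ℝ E'] [FiniteDimensional ℝ E']
  {M : Type*} [TopologicalSpace M] [ChartedSpace E M] [IsManifold 𝓘(ℝ, E) ∞ M]
  {M' : Type*} [TopologicalSpace M'] [ChartedSpace E' M'] [IsManifold 𝓘(ℝ, E') ∞ M']
  {p : M → M'} {s : ℕ} {B : FormFamily E M} {I : FormFamily E' M'}
  {J : M → Submodule ℝ (E →L[ℝ] ℝ)}

theorem firstIntegrals_le {V : M → Submodule ℝ (E →L[ℝ] ℝ)} {x : M} : firstIntegrals V x ≤ V x := by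
  refine Submodule.span_le.2 ?_
  rintro _ ⟨f, U, hU, hx, -, hf, rfl⟩
  exact hf x hx

theorem mem_firstIntegrals {V : M → Submodule ℝ (E →L[ℝ] ℝ)} {x : M} {f : M → ℝ} {U : Set M}
    (hU : IsOpen U) (hx : x ∈ U) (hf : ContMDiffOn 𝓘(ℝ, E) 𝓘(ℝ, ℝ) ∞ f U)
    (hV : ∀ y ∈ U, (tmap f y : E →L[ℝ] ℝ) ∈ V y) : (tmap f x : E →L[ℝ] ℝ) ∈ firstIntegrals V x :=
  Submodule.subset_span ⟨f, U, hU, hx, hf, hV, rfl⟩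

theorem pullCov_mono {x : M} {V V' : Submodule ℝ (E' →L[ℝ] ℝ)} (h : V ≤ V') :
    (pullCov p x V : Submodule ℝ (E →L[ℝ] ℝ)) ≤ pullCov p x V' :=
  Submodule.span_mono (image_mono h)

theorem comp_mem_pullCov {x : M} {V : Submodule ℝ (E' →L[ℝ] ℝ)} {β : E' →L[ℝ] ℝ} (h : β ∈ V) :
    β.comp (tmap p x : E →L[ℝ] E') ∈ (pullCov p x V : Submodule ℝ (E →L[ℝ] ℝ)) :=
  mem_pullCov.2 ⟨β, h, rfl⟩

theorem comp_tmap_injective {x : M} (hs : Function.Surjective (tmap p x : E →L[ℝ] E'))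
    {β γ : E' →L[ℝ] ℝ} (h : β.comp (tmap p x : E →L[ℝ] E') = γ.comp (tmap p x)) : β = γ := by
  refine ContinuousLinearMap.ext fun w => ?_
  obtain ⟨v, rfl⟩ := hs w
  exact DFunLike.congr_fun h v

theorem le_of_pullCov_le {x : M} (hs : Function.Surjective (tmap p x : E →L[ℝ] E'))
    {V V' : Submodule ℝ (E' →L[ℝ] ℝ)}
    (h : (pullCov p x V : Submodule ℝ (E →L[ℝ] ℝ)) ≤ pullCov p x V') : V ≤ V' := by
  intro β hβ
  obtain ⟨γ, hγ, h1⟩ := mem_pullCov.1 (h (comp_mem_pullCov hβ))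
  rwa [comp_tmap_injective hs h1]

theorem pullCov_inf_le {x : M} (hs : Function.Surjective (tmap p x : E →L[ℝ] E'))
    {V V' : Submodule ℝ (E' →L[ℝ] ℝ)} : (pullCov p x V ⊓ pullCov p x V' :
      Submodule ℝ (E →L[ℝ] ℝ)) ≤ pullCov p x (V ⊓ V') := by
  rintro α ⟨h, h'⟩
  obtain ⟨β, hβ, rfl⟩ := mem_pullCov.1 h
  obtain ⟨γ, hγ, h1⟩ := mem_pullCov.1 h'
  obtain rfl := comp_tmap_injective hs h1
  exact comp_mem_pullCov ⟨hβ, hγ⟩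

theorem pullCov_span_range {ι : Type*} {x : M} (L : ι → E' →L[ℝ] ℝ) :
    (pullCov p x (Submodule.span ℝ (range L)) : Submodule ℝ (E →L[ℝ] ℝ)) =
      Submodule.span ℝ (range fun k => (L k).comp (tmap p x : E →L[ℝ] E')) := by
  refine le_antisymm (Submodule.span_le.2 ?_) (Submodule.span_le.2 ?_)
  · rintro _ ⟨β, hβ, rfl⟩
    have := Submodule.mem_map_of_mem
      (f := (ContinuousLinearMap.precomp ℝ (tmap p x : E →L[ℝ] E')).toLinearMap) hβ
    rw [Submodule.map_span, ← range_comp] at this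
    exact this
  · rintro _ ⟨i, rfl⟩
    exact comp_mem_pullCov (Submodule.subset_span ⟨i, rfl⟩)

theorem pullCov_firstIntegrals_le {V : M' → Submodule ℝ (E' →L[ℝ] ℝ)}
    {W : M → Submodule ℝ (E →L[ℝ] ℝ)} {U : Set M} (hU : IsOpen U) {x : M} (hx : x ∈ U)
    (hp : ContMDiffOn 𝓘(ℝ, E) 𝓘(ℝ, E') ∞ p U) (hW : ∀ y ∈ U, pullCov p y (V (p y)) ≤ W y) :
    pullCov p x (firstIntegrals V (p x)) ≤ firstIntegrals W x := by
  intro α hα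
  obtain ⟨β, hβ, rfl⟩ := mem_pullCov.1 hα
  refine Submodule.span_induction (p := fun β _ => β.comp (tmap p x : E →L[ℝ] E') ∈
    firstIntegrals W x) ?_ ?_ ?_ ?_ hβ
  · rintro _ ⟨f, O, hO, hxO, hf, hfV, rfl⟩
    have hpx : ∀ y ∈ U, ContMDiffAt 𝓘(ℝ, E) 𝓘(ℝ, E') ∞ p y := fun y hy =>
      hp.contMDiffAt (hU.mem_nhds hy)
    have hO' : IsOpen (U ∩ p ⁻¹' O) := hp.continuousOn.isOpen_inter_preimage hU hO
    have h1 : ∀ y ∈ U ∩ p ⁻¹' O, (tmap (fun y => f (p y)) y : E →L[ℝ] ℝ) =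
        (tmap f (p y) : E' →L[ℝ] ℝ).comp (tmap p y) := fun y hy =>
      tmap_comp (hf.contMDiffAt (hO.mem_nhds hy.2)).mdiff (hpx y hy.1).mdiff
    have := mem_firstIntegrals hO' ⟨hx, hxO⟩ (f := fun y => f (p y)) (V := W)
      (hf.comp (hp.mono inter_subset_left) fun y hy => hy.2) fun y hy => by
        rw [h1 y hy]
        exact hW y hy.1 (comp_mem_pullCov (hfV _ hy.2))
    rwa [h1 x ⟨hx, hxO⟩] at this
  · exact Submodule.zero_mem _
  · intro β γ _ _ h1 h2
    exact Submodule.add_mem _ h1 h2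
  · intro c β _ h1
    exact Submodule.smul_mem _ c h1

/-- The number of independent first integrals of a singular system of an extension exceeds that of
the base by at most one. -/
theorem not_linearIndependent_firstIntegrals (hJ : IsAdmissibleOn p B I J univ)
    (hs : ∀ y, Function.Surjective (tmap p y : E →L[ℝ] E'))
    (hd : finrank ℝ E = finrank ℝ E' + 1) (hp : ContMDiffOn 𝓘(ℝ, E) 𝓘(ℝ, E') ∞ p univ)
    {Vh Vc : M' → Submodule ℝ (E' →L[ℝ] ℝ)} (hV : IsSingularPairOn s I Vh Vc univ) {r : ℕ}
    (hrh : ∀ x, finrank ℝ (firstIntegrals Vh x) = r) (hrc : ∀ x, finrank ℝ (firstIntegrals Vc x) = r)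
    {W : Set M} (hW : IsOpen W) (κ' : AdaptedCoframe (s + 1) B W) {x : M} (hx : x ∈ W)
    {f : Fin (r + 1 + 1) → M → ℝ} {U : Set M} (hU : IsOpen U) (hxU : x ∈ U)
    (hf : ∀ i, ContMDiffOn 𝓘(ℝ, E) 𝓘(ℝ, ℝ) ∞ (f i) U)
    (hfV : ∀ y ∈ U, ∀ i, (tmap (f i) y : E →L[ℝ] ℝ) ∈ κ'.Vh y) :
    ¬ LinearIndependent ℝ fun i => (tmap (f i) x : E →L[ℝ] ℝ) := by
  intro hli
  obtain ⟨U₂, hU₂, hxU₂, κ₂, hκ₂⟩ := hV (p x) (mem_univ _)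
  obtain ⟨W₂, hW₂, hxW₂, -, κ₂', hl, -⟩ := hJ.exists_coframe (fun y _ => hs y) hd hp hU₂ κ₂
    (mem_univ x) hxU₂
  -- Near `x` the system `κ'.Vh` lies over one of the two singular systems downstairs. Whichever it
  -- is, `r + 2` independent functions would yield a nearby point with `r + 1` independent first
  -- integrals of that system.
  have key : ∀ V : M' → Submodule ℝ (E' →L[ℝ] ℝ), (∀ x, finrank ℝ (firstIntegrals V x) = r) →
      (∀ᶠ y in 𝓝 x, κ'.Vh y = J y ⊔ pullCov p y (V (p y))) → False := by
    intro V hr h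
    obtain ⟨O, hOV, hO, hxO⟩ := mem_nhds_iff.1 h
    obtain ⟨y, -, hy⟩ := exists_le_finrank (hU.inter hO)
      (hp.mono (subset_univ _)) ⟨hxU, hxO⟩ (fun y _ => hs y) hd
      (V := V) (W := κ'.Vh) (k := r + 1) (fun y hy => by
        rw [(hOV hy.2 : κ'.Vh y = J y ⊔ pullCov p y (V (p y)))]
        exact hJ.sup_inf_semibasic (mem_univ _) _)
      (fun i => (hf i).mono inter_subset_left) (fun y hy => hfV y hy.1) hli
    rw [hr] at hy
    omega
  rcases κ₂'.eventually_eq_or_swap κ' hW₂ hW hxW₂ hx with h | h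
  · refine key Vh hrh ?_
    filter_upwards [h, hW₂.mem_nhds hxW₂] with y hy hyW
    rw [hy.1, hl.Vh y hyW, (hκ₂ _ (hl.mapsTo hyW)).1]
    rfl
  · refine key Vc hrc ?_
    filter_upwards [h, hW₂.mem_nhds hxW₂] with y hy hyW
    rw [hy.1, hl.Vc y hyW, (hκ₂ _ (hl.mapsTo hyW)).2]
    rfl

variable (hI : IsHyperbolicOn s I univ) (hp : IsIntegrableExtensionOn p B I univ)
  (hJ : IsAdmissibleOn p B I J univ) (hd : finrank ℝ E = finrank ℝ E' + 1)
  {U' : Set M'} {κ : AdaptedCoframe s I U'} {H C : Fin 2 → M' → ℝ} {i j : Fin 2}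

include hd in
theorem smooth_prolongMap (O : Set (IntegralElement (s + 1) B)) :
    ContMDiffOn 𝓘(ℝ, E × ℝ × ℝ) 𝓘(ℝ, E' × ℝ × ℝ) ∞ (prolongMap hI hp) O :=
  fun z _ => (smoothAt_prolongMap hI hp hd z).contMDiffWithinAt

include hd in
theorem continuous_prolongMap : Continuous (prolongMap (sB := s + 1) hI hp) :=
  continuous_iff_continuousAt.2 fun z => (smoothAt_prolongMap hI hp hd z).continuousAt

include hJ hd in
/-- The first integrals of a singular system of the prolongation of an extension of a system with
exact characteristic forms. -/
theorem firstIntegrals_eq (hU' : IsOpen U') (hκ : κ.IsExact H C) {z : IntegralElement (s + 1) B}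
    (hz : prolongMap hI hp z ∈ κ.dom i j)
    {V : IntegralElement (s + 1) B → Submodule ℝ ((E × ℝ × ℝ) →L[ℝ] ℝ)}
    (hV : ∀ᶠ y in 𝓝 z, V y = liftJ (s + 1) B J y ⊔
      pullCov (prolongMap hI hp) y (κ.charSys (prolongMap hI hp y)))
    (hN : ∀ (W : Set M) (κ' : AdaptedCoframe (s + 1) B W), IsOpen W → z.pt ∈ W → κ'.IsLift κ p J →
      ∀ f : Fin 3 → M → ℝ, (∀ i, ContMDiffOn 𝓘(ℝ, E) 𝓘(ℝ, ℝ) ∞ (f i) W) →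
      (∀ y ∈ W, ∀ i, (tmap (f i) y : E →L[ℝ] ℝ) ∈ κ'.Vh y) →
      ¬ LinearIndependent ℝ fun i => (tmap (f i) z.pt : E →L[ℝ] ℝ)) :
    firstIntegrals V z = pullCov (prolongMap hI hp) z (Submodule.span ℝ (range fun k =>
      (tmap (κ.charFun H i k) (prolongMap hI hp z) : (E' × ℝ × ℝ) →L[ℝ] ℝ))) := by
  obtain ⟨W, hW, hzW, -, κ', hl, -⟩ := hJ.exists_coframe hp.submersion hd hp.smooth hU' κ
    (mem_univ z.pt) hz.1
  obtain ⟨O, hOV, hO, hzO⟩ := mem_nhds_iff.1 hV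
  have hz' : z ∈ κ'.dom i j := (mem_dom_iff hI hp hl hzW).2 hz
  have hdom : IsOpen (κ.dom i j) := AdaptedCoframe.isOpen_dom hU'
  refine le_antisymm (Submodule.span_le.2 ?_) ?_
  · rintro _ ⟨f, O', hO', hzO', hf, hfV, rfl⟩
    -- To descend, the differential must kill characteristic vectors. Its component in the lifted
    -- `J` does so because the lifted `J` is part of the contact system, and its pulled-back
    -- component because the prolonged map preserves characteristic vectors.
    obtain ⟨F, U, hU, hzU, hUW, hF, hFV, c, hc⟩ := exists_descent hW hz' (hO'.inter hO)
      ⟨hzO', hzO⟩ (hf.mono inter_subset_left) fun y hy hyd v h1 h2 h3 => by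
        have hm := hfV y hy.1
        rw [(hOV hy.2 : V y = _)] at hm
        obtain ⟨β, hβ, δ, hδ, hsum⟩ := Submodule.mem_sup.1 hm
        obtain ⟨γ, hγ, rfl⟩ := mem_pullCov.1 hδ
        have hd1 := DFunLike.congr_fun (dpt_tmap_prolongMap hI hp hd y) v
        rw [ContinuousLinearMap.comp_apply, ContinuousLinearMap.comp_apply] at hd1
        have hyd' : prolongMap hI hp y ∈ κ.dom i j := (mem_dom_iff hI hp hl hyd.1).1 hyd
        have e1 : β v = 0 := mem_contactSystem.1 (liftJ_le hJ y hβ) v h1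
        have e2 : γ ((tmap (prolongMap hI hp) y : (E × ℝ × ℝ) →L[ℝ] E' × ℝ × ℝ) v) = 0 := by
          refine (AdaptedCoframe.mem_charSys hU' hyd').1 hγ _ ?_ ?_ ?_
          · rw [hd1]
            exact Submodule.mem_map_of_mem h1
          · rw [hd1]
            have := h2 i
            rwa [hl.h y.pt hyd.1] at this
          · rw [tmap_sh_eq hI hp hd hW hU' hl hyd] at h3
            exact h3
        rw [← hsum, add_apply, e1, zero_add]
        exact e2
    have hsmp : ∀ y, ContMDiffAt 𝓘(ℝ, E) 𝓘(ℝ, E') ∞ p y := fun y =>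
      (hp.smooth y (mem_univ _)).contMDiffAt Filter.univ_mem
    have htg : ∀ y ∈ W, ∀ k, (tmap (fun m => H k (p m)) y : E →L[ℝ] ℝ) = κ'.h k y := by
      intro y hy k
      rw [hl.h y hy, hκ.h_eq k _ (hl.mapsTo hy)]
      exact tmap_comp ((hκ.smooth_H k).contMDiffAt (hU'.mem_nhds (hl.mapsTo hy))).mdiff
        (hsmp y).mdiff
    -- `F` and the two functions `H k ∘ p` are three first integrals of the same singular system,
    -- hence dependent at this point by `hN`. The last two have independent differentials, so `dF`
    -- is a combination of them.
    have hFz : (tmap F z.pt : E →L[ℝ] ℝ) ∈ Submodule.span ℝ (range fun k => κ'.h k z.pt) := by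
      have hlr : (κ'.restrict hUW).IsLift κ p J :=
        ⟨fun y hy => hl.mapsTo (hUW hy), fun y hy => hl.θ_zero y (hUW hy),
          fun y hy => hl.θ_succ y (hUW hy), fun y hy => hl.h y (hUW hy),
          fun y hy => hl.c y (hUW hy), fun y hy => hl.Vh y (hUW hy), fun y hy => hl.Vc y (hUW hy)⟩
      have h1 := hN U (κ'.restrict hUW) hU hzU hlr
        (Fin.cons F fun (k : Fin 2) m => H k (p m)) (fun k => by
          rcases Fin.eq_zero_or_eq_succ k with rfl | ⟨k, rfl⟩
          · exact hF
          · exact (hκ.smooth_H k).comp (hp.smooth.mono (subset_univ _))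
              fun y hy => hl.mapsTo (hUW hy)) (fun y hy k => by
          rcases Fin.eq_zero_or_eq_succ k with rfl | ⟨k, rfl⟩
          · exact hFV y hy
          · refine Submodule.subset_span (Or.inr ⟨k, ?_⟩)
            exact (htg y (hUW hy) k).symm)
      have h2 : (fun k : Fin 3 => (tmap ((Fin.cons F fun (k : Fin 2) m => H k (p m) :
          Fin 3 → M → ℝ) k) z.pt : E →L[ℝ] ℝ)) =
          Fin.cons (tmap F z.pt : E →L[ℝ] ℝ) fun k => κ'.h k z.pt := by
        funext k
        rcases Fin.eq_zero_or_eq_succ k with rfl | ⟨k, rfl⟩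
        · rfl
        · exact htg _ hzW k
      rw [h2, linearIndependent_finCons, not_and_not_right] at h1
      refine h1 (linearIndependent_of_dual fun k => ?_)
      obtain ⟨v, -, h3, -⟩ := κ'.exists_cof_eq hzW 0 (Pi.single k 1) 0
      exact ⟨v, by simp [h3], fun l hl => by simp [h3, hl]⟩
    rw [SetLike.mem_coe, pullCov_span_range, mem_span_range_iff]
    intro v hv
    have hd1 := DFunLike.congr_fun (dpt_tmap_prolongMap hI hp hd z) v
    rw [ContinuousLinearMap.comp_apply, ContinuousLinearMap.comp_apply] at hd1
    obtain ⟨h1, h2⟩ := (hκ.tmap_charFun_eq_zero_iff hU' hz).1 hv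
    rw [mem_span_range_iff] at hFz
    have h3 : (tmap (κ'.sh i) z : (E × ℝ × ℝ) →L[ℝ] ℝ) v = 0 := by
      rw [tmap_sh_eq hI hp hd hW hU' hl hz']
      exact h2
    rw [hc, add_apply, smul_apply, h3, smul_zero, add_zero]
    refine hFz _ fun k => ?_
    rw [hl.h z.pt hzW]
    exact (congrArg _ hd1).symm.trans (h1 k)
  · rw [pullCov_span_range]
    refine Submodule.span_le.2 ?_
    rintro _ ⟨k, rfl⟩
    have hP := continuous_prolongMap hI hp hd
    have hO' : IsOpen (O ∩ prolongMap hI hp ⁻¹' κ.dom i j) := hO.inter (hdom.preimage hP)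
    have h1 : ∀ y ∈ O ∩ prolongMap hI hp ⁻¹' κ.dom i j,
        (tmap (fun y => κ.charFun H i k (prolongMap hI hp y)) y : (E × ℝ × ℝ) →L[ℝ] ℝ) =
        (tmap (κ.charFun H i k) (prolongMap hI hp y) : (E' × ℝ × ℝ) →L[ℝ] ℝ).comp
          (tmap (prolongMap hI hp) y) := fun y hy =>
      tmap_comp ((hκ.smooth_charFun hU' k).contMDiffAt (hdom.mem_nhds hy.2)).mdiff
        (smoothAt_prolongMap hI hp hd y).mdiff
    have := mem_firstIntegrals hO' ⟨hzO, hz⟩ (V := V)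
      (f := fun y => κ.charFun H i k (prolongMap hI hp y))
      ((hκ.smooth_charFun hU' k).comp (smooth_prolongMap hI hp hd _) fun y hy => hy.2)
      fun y hy => by
        rw [h1 y hy, (hOV hy.1 : V y = _)]
        exact Submodule.mem_sup_right (comp_mem_pullCov (hκ.tmap_charFun_mem hU' hy.2 k))
    rwa [h1 z ⟨hzO, hz⟩] at this

end Rank

/-! ### Restriction to open sets, and linear algebra of semibasic covectors -/

section Restriction

variable {E : Type*} [NormedAddCommGroup E] [NormedSpace ℝ E]
  {E' : Type*} [NormedAddCommGroup E'] [NormedSpace ℝ E']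
  {M : Type*} [TopologicalSpace M] [ChartedSpace E M]
  {M' : Type*} [TopologicalSpace M'] [ChartedSpace E' M']
  {p : M → M'} {s : ℕ} {B : FormFamily E M} {I : FormFamily E' M'}
  {J : M → Submodule ℝ (E →L[ℝ] ℝ)} {U U' : Set M}

theorem IsEDSOn.mono (h : IsEDSOn B U) (hU' : IsOpen U') (hUU : U' ⊆ U) : IsEDSOn B U' where
  subbundle q := by
    obtain ⟨r, hr⟩ := h.subbundle q
    refine ⟨r, fun x hx => ?_⟩
    obtain ⟨O, hO, hxO, -, η, hη, h1⟩ := hr x (hUU hx)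
    exact ⟨O ∩ U', hO.inter hU', ⟨hxO, hx⟩, inter_subset_right, η,
      fun i => (hη i).mono inter_subset_left, fun y hy => h1 y hy.1⟩
  ideal x hx := h.ideal x (hUU hx)
  closed q O hO hOU := h.closed q O hO (hOU.trans hUU)

theorem IsSubbundleOn.mono (h : IsSubbundleOn J U) (hU' : IsOpen U') (hUU : U' ⊆ U) :
    IsSubbundleOn J U' := by
  obtain ⟨r, hr⟩ := h
  refine ⟨r, fun x hx => ?_⟩
  obtain ⟨O, hO, hxO, -, η, hη, h1⟩ := hr x (hUU hx)
  exact ⟨O ∩ U', hO.inter hU', ⟨hxO, hx⟩, inter_subset_right, η,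
    fun i => (hη i).mono inter_subset_left, fun y hy => h1 y hy.1⟩

theorem IsAdmissibleOn.mono (h : IsAdmissibleOn p B I J U) (hU' : IsOpen U') (hUU : U' ⊆ U) :
    IsAdmissibleOn p B I J U' :=
  ⟨h.subbundle.mono hU' hUU, fun x hx => h.transverse x (hUU hx), fun x hx => h.generate x (hUU hx)⟩

theorem DarbouxIntegrableOn.mono {Vh Vc : M → Submodule ℝ (E →L[ℝ] ℝ)}
    (h : DarbouxIntegrableOn s B Vh Vc U) (hU' : IsOpen U') (hUU : U' ⊆ U) :
    DarbouxIntegrableOn s B Vh Vc U' where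
  eds := h.eds.mono hU' hUU
  singular x hx := h.singular x (hUU hx)
  rank_h := h.rank_h.imp fun _ hr x hx => hr x (hUU hx)
  rank_c := h.rank_c.imp fun _ hr x hx => hr x (hUU hx)
  sup_h x hx := h.sup_h x (hUU hx)
  sup_c x hx := h.sup_c x (hUU hx)
  inf x hx := h.inf x (hUU hx)

variable [FiniteDimensional ℝ E] [FiniteDimensional ℝ E'] [IsManifold 𝓘(ℝ, E) ∞ M]
  [IsManifold 𝓘(ℝ, E') ∞ M'] {x : M}

/-- A submersion with one-dimensional fibres is open. -/
theorem isOpen_image_of_surjective (hd : finrank ℝ E = finrank ℝ E' + 1) (hU : IsOpen U)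
    (hp : ContMDiffOn 𝓘(ℝ, E) 𝓘(ℝ, E') ∞ p U)
    (hs : ∀ x ∈ U, Function.Surjective (tmap p x : E →L[ℝ] E')) : IsOpen (p '' U) := by
  rw [isOpen_iff_mem_nhds]
  rintro _ ⟨x, hx, rfl⟩
  obtain ⟨v, hv, hv0, -⟩ := exists_vertical (hs x hx) hd
  obtain ⟨F, O, hO, hxO, hF, hne⟩ := exists_smooth_ne (M := M) x hv0
  obtain ⟨S, V, hV, hxV, -, -, hSU, hpS, -⟩ := exists_section (hU.inter hO)
    (hp.mono inter_subset_left) (hF.mono inter_subset_right) ⟨hx, hxO⟩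
    (bijective_prod_of_not_semibasic (hs x hx) hd fun h => hne (h v hv))
  exact Filter.mem_of_superset (hV.mem_nhds hxV) fun m hm => ⟨S m, (hSU hm).1, hpS m hm⟩

theorem IsIntegrableExtensionOn.mono (hd : finrank ℝ E = finrank ℝ E' + 1)
    (h : IsIntegrableExtensionOn p B I U) (hU' : IsOpen U') (hUU : U' ⊆ U) :
    IsIntegrableExtensionOn p B I U' where
  eds_top := h.eds_top.mono hU' hUU
  eds_base := h.eds_base.mono (isOpen_image_of_surjective hd hU' (h.smooth.mono hUU)
    fun x hx => h.submersion x (hUU hx)) (image_mono hUU)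
  smooth := h.smooth.mono hUU
  submersion x hx := h.submersion x (hUU hx)
  admissible := h.admissible.imp fun _ hJ => hJ.mono hU' hUU

theorem IsDarbouxExtensionOn.mono (hd : finrank ℝ E = finrank ℝ E' + 1) {sB sI : ℕ}
    {Zh Zc : M → Submodule ℝ (E →L[ℝ] ℝ)} {Vh Vc : M' → Submodule ℝ (E' →L[ℝ] ℝ)}
    (h : IsDarbouxExtensionOn sB sI p B I Zh Zc Vh Vc U) (hU' : IsOpen U') (hUU : U' ⊆ U) :
    IsDarbouxExtensionOn sB sI p B I Zh Zc Vh Vc U' where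
  extension := h.extension.mono hd hU' hUU
  darboux_top := h.darboux_top.mono hU' hUU
  darboux_base := h.darboux_base.mono (isOpen_image_of_surjective hd hU'
    (h.extension.smooth.mono hUU) fun x hx => h.extension.submersion x (hUU hx)) (image_mono hUU)
  singular := by
    obtain ⟨J, hJ, h1⟩ := h.singular
    exact ⟨J, hJ.mono hU' hUU, fun x hx => h1 x (hUU hx)⟩

/-- The singular systems of an integrable extension. -/
theorem IsAdmissibleOn.isSingularPairOn (hJ : IsAdmissibleOn p B I J U)
    (hs : ∀ y ∈ U, Function.Surjective (tmap p y : E →L[ℝ] E'))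
    (hd : finrank ℝ E = finrank ℝ E' + 1) (hp : ContMDiffOn 𝓘(ℝ, E) 𝓘(ℝ, E') ∞ p U)
    {Vh Vc : M' → Submodule ℝ (E' →L[ℝ] ℝ)} {T : Set M'} (hV : IsSingularPairOn s I Vh Vc T)
    (hm : MapsTo p U T) : IsSingularPairOn (s + 1) B (fun y => J y ⊔ pullCov p y (Vh (p y)))
      (fun y => J y ⊔ pullCov p y (Vc (p y))) U := by
  intro x hx
  obtain ⟨T', hT', hxT', κ, hκ⟩ := hV (p x) (hm hx)
  obtain ⟨W, hW, hxW, -, κ', hl, -⟩ := hJ.exists_coframe hs hd hp hT' κ hx hxT'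
  refine ⟨W, hW, hxW, κ', fun y hy => ⟨?_, ?_⟩⟩
  · beta_reduce
    rw [(hκ _ (hl.mapsTo hy)).1]
    exact (hl.Vh y hy).symm
  · beta_reduce
    rw [(hκ _ (hl.mapsTo hy)).2]
    exact (hl.Vc y hy).symm

theorem mem_semibasic_iff {v : E} (hv : (tmap p x : E →L[ℝ] E') v = 0)
    (hv' : ∀ w : E, (tmap p x : E →L[ℝ] E') w = 0 → ∃ c : ℝ, w = c • v) {α : E →L[ℝ] ℝ} :
    α ∈ semibasic E' p x ↔ α v = 0 := by
  refine ⟨fun h => h v hv, fun h w hw => ?_⟩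
  obtain ⟨c, rfl⟩ := hv' w hw
  rw [map_smul, h, smul_zero]

/-- The semibasic covectors form a hyperplane. -/
theorem finrank_inf_semibasic (hs : Function.Surjective (tmap p x : E →L[ℝ] E'))
    (hd : finrank ℝ E = finrank ℝ E' + 1) {A : Submodule ℝ (E →L[ℝ] ℝ)}
    (hA : ¬ A ≤ semibasic E' p x) :
    finrank ℝ (A ⊓ semibasic E' p x : Submodule ℝ (E →L[ℝ] ℝ)) + 1 = finrank ℝ A := by
  obtain ⟨v, hv, -, hv'⟩ := exists_vertical hs hd
  set ℓ : (E →L[ℝ] ℝ) →ₗ[ℝ] ℝ := (ContinuousLinearMap.apply ℝ ℝ v).toLinearMap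
  have hk : semibasic E' p x = LinearMap.ker ℓ := by
    ext α
    exact mem_semibasic_iff hv hv'
  have h1 := LinearMap.finrank_range_add_finrank_ker (K := ℝ) (V := A) (V₂ := ℝ) (ℓ.domRestrict A)
  have h2 : finrank ℝ (LinearMap.ker (ℓ.domRestrict A)) =
      finrank ℝ (A ⊓ semibasic E' p x : Submodule ℝ (E →L[ℝ] ℝ)) := by
    rw [hk, LinearMap.ker_domRestrict, ← Submodule.map_comap_subtype,
      Submodule.finrank_map_subtype_eq]
  have h3 : LinearMap.range (ℓ.domRestrict A) = ⊤ := by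
    obtain ⟨α, hα, hne⟩ := SetLike.not_le_iff_exists.1 hA
    refine LinearMap.range_eq_top.2 (LinearMap.surjective fun h => hne ?_)
    exact (mem_semibasic_iff hv hv').2 (LinearMap.congr_fun h ⟨α, hα⟩)
  rw [h3, finrank_top, finrank_self, h2] at h1
  omega

/-- The vertical space is a line, so it meets the annihilator of `A` trivially exactly when some
covector of `A` does not vanish on it. Condition [i] thus becomes a statement about semibasic
covectors. -/
theorem vertical_inf_annih (hs : Function.Surjective (tmap p x : E →L[ℝ] E'))
    (hd : finrank ℝ E = finrank ℝ E' + 1) {A : Submodule ℝ (E →L[ℝ] ℝ)} :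
    (vertical E' p x : Submodule ℝ E) ⊓ annih A = ⊥ ↔ ¬ A ≤ semibasic E' p x := by
  obtain ⟨v, hv, hv0, hv'⟩ := exists_vertical hs hd
  constructor
  · intro h hA
    refine hv0 ((Submodule.mem_bot ℝ).1 (h ▸ ⟨hv, fun α hα => hA hα v hv⟩))
  · intro hA
    obtain ⟨α, hα, hne⟩ := SetLike.not_le_iff_exists.1 hA
    rw [mem_semibasic_iff hv hv'] at hne
    rw [eq_bot_iff]
    rintro w ⟨hw, hw'⟩
    obtain ⟨c, rfl⟩ := hv' w hw
    have h1 := hw' α hα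
    rw [map_smul, smul_eq_mul, mul_eq_zero, or_iff_left hne] at h1
    rw [h1, zero_smul]
    exact zero_mem _

/-- `J` contains a covector that does not vanish on the vertical line. Subtracting a multiple of it
makes any covector semibasic, that is, a pullback. -/
theorem IsAdmissibleOn.sup_semibasic (h : IsAdmissibleOn p B I J U) (hx : x ∈ U)
    (hs : Function.Surjective (tmap p x : E →L[ℝ] E')) (hd : finrank ℝ E = finrank ℝ E' + 1) :
    J x ⊔ pullCov p x (⊤ : Submodule ℝ (E' →L[ℝ] ℝ)) = ⊤ := by
  obtain ⟨v, hv, hv0, hv'⟩ := exists_vertical hs hd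
  obtain ⟨α, hα, hne⟩ : ∃ α ∈ J x, α v ≠ 0 := by
    by_contra hc
    push Not at hc
    exact hv0 (h.eq_zero hx hc hv)
  rw [eq_top_iff]
  rintro β -
  have h1 : β - (β v / α v) • α ∈ semibasic E' p x := by
    rw [mem_semibasic_iff hv hv', sub_apply, smul_apply, smul_eq_mul, div_mul_cancel₀ _ hne, sub_self]
  obtain ⟨γ, hγ⟩ := exists_eq_comp hs h1
  refine Submodule.mem_sup.2 ⟨(β v / α v) • α, Submodule.smul_mem _ _ hα, γ.comp (tmap p x),
    comp_mem_pullCov Submodule.mem_top, ?_⟩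
  rw [← hγ, add_sub_cancel]

theorem pullCov_sup {V V' : Submodule ℝ (E' →L[ℝ] ℝ)} :
    (pullCov p x (V ⊔ V') : Submodule ℝ (E →L[ℝ] ℝ)) = pullCov p x V ⊔ pullCov p x V' := by
  refine le_antisymm ?_ (sup_le (pullCov_mono le_sup_left) (pullCov_mono le_sup_right))
  intro α hα
  obtain ⟨β, hβ, rfl⟩ := mem_pullCov.1 hα
  obtain ⟨γ, hγ, δ, hδ, rfl⟩ := Submodule.mem_sup.1 hβ
  exact Submodule.add_mem_sup (comp_mem_pullCov hγ) (comp_mem_pullCov hδ)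

end Restriction

/-! ### Darboux integrability of the prolongations -/

section Frames

variable {E : Type*} [NormedAddCommGroup E] [NormedSpace ℝ E] [FiniteDimensional ℝ E]
  {E' : Type*} [NormedAddCommGroup E'] [NormedSpace ℝ E'] [FiniteDimensional ℝ E']
  {M : Type*} [TopologicalSpace M] [ChartedSpace E M] [IsManifold 𝓘(ℝ, E) ∞ M]
  {M' : Type*} [TopologicalSpace M'] [ChartedSpace E' M'] [IsManifold 𝓘(ℝ, E') ∞ M']
  {p : M → M'} {s : ℕ} {B : FormFamily E M} {I : FormFamily E' M'}
  {J : M → Submodule ℝ (E →L[ℝ] ℝ)}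

/-- The differentials of the functions `G` form a frame of the first integrals of `V`. -/
structure IsIntegralFrameOn (V : M → Submodule ℝ (E →L[ℝ] ℝ)) {r : ℕ} (G : Fin r → M → ℝ)
    (U : Set M) : Prop where
  smooth : ∀ k, ContMDiffOn 𝓘(ℝ, E) 𝓘(ℝ, ℝ) ∞ (G k) U
  li : ∀ x ∈ U, LinearIndependent ℝ fun k => (tmap (G k) x : E →L[ℝ] ℝ)
  eq : ∀ x ∈ U, firstIntegrals V x = Submodule.span ℝ (range fun k => (tmap (G k) x : E →L[ℝ] ℝ))

theorem IsIntegralFrameOn.finrank_eq {V : M → Submodule ℝ (E →L[ℝ] ℝ)} {r : ℕ}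
    {G : Fin r → M → ℝ} {U : Set M} (h : IsIntegralFrameOn V G U) {x : M} (hx : x ∈ U) :
    finrank ℝ (firstIntegrals V x) = r := by
  rw [h.eq x hx, finrank_span_eq_card (h.li x hx), Fintype.card_fin]

/-- The first integrals of the singular systems of `B` are pulled back by `p`. -/
structure IsPulledBackAt (p : M → M') (Wh Wc : M → Submodule ℝ (E →L[ℝ] ℝ)) (x : M) : Prop where
  semibasic_h : firstIntegrals Wh x ≤ semibasic E' p x
  semibasic_c : firstIntegrals Wc x ≤ semibasic E' p x
  sup_h : Wh x ⊔ firstIntegrals Wc x = ⊤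
  sup_c : Wc x ⊔ firstIntegrals Wh x = ⊤
  inf : firstIntegrals Wh x ⊓ firstIntegrals Wc x = ⊥

variable (hI : IsHyperbolicOn s I univ) (hp : IsIntegrableExtensionOn p B I univ)
  (hJ : IsAdmissibleOn p B I J univ) (hd : finrank ℝ E = finrank ℝ E' + 1)
  {κ : AdaptedCoframe s I univ} {H C : Fin 2 → M' → ℝ} {i j : Fin 2}

include hd in
theorem finrank_prod_eq : finrank ℝ (E × ℝ × ℝ) = finrank ℝ (E' × ℝ × ℝ) + 1 := by
  rw [finrank_prod, finrank_prod (R := ℝ) (M := E'), hd]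
  omega

/-- The bound on the number of first integrals of the singular systems of `B`. -/
def AtMostTwoIntegrals (s : ℕ) (B : FormFamily E M) : Prop :=
  ∀ (x : M) (W : Set M) (κ' : AdaptedCoframe s B W), IsOpen W → x ∈ W →
    ∀ f : Fin 3 → M → ℝ, (∀ i, ContMDiffOn 𝓘(ℝ, E) 𝓘(ℝ, ℝ) ∞ (f i) W) →
      (∀ y ∈ W, ∀ i, (tmap (f i) y : E →L[ℝ] ℝ) ∈ κ'.Vh y) →
      ¬ LinearIndependent ℝ fun i => (tmap (f i) x : E →L[ℝ] ℝ)

include hJ hd in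
-- `firstIntegrals_eq` is applied to `κ` and to `κ.swap` at all points near `z`, so the functions
-- `charFun` composed with the prolonged map are frames. The spanning conditions hold because they
-- hold for the base, up to the summand `J`; the trivial intersection holds because pullback by a
-- submersion is injective.
theorem exists_frames_of_eq (hN : AtMostTwoIntegrals (s + 1) B) (hκ : κ.IsExact H C)
    {z : IntegralElement (s + 1) B} (hz : prolongMap hI hp z ∈ κ.dom i j)
    {Wh Wc : IntegralElement (s + 1) B → Submodule ℝ ((E × ℝ × ℝ) →L[ℝ] ℝ)}
    (hh : ∀ᶠ y in 𝓝 z, Wh y = liftJ (s + 1) B J y ⊔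
      pullCov (prolongMap hI hp) y (κ.charSys (prolongMap hI hp y)))
    (hc : ∀ᶠ y in 𝓝 z, Wc y = liftJ (s + 1) B J y ⊔
      pullCov (prolongMap hI hp) y (κ.swap.charSys (prolongMap hI hp y))) :
    ∃ (O : Set (IntegralElement (s + 1) B)) (G G' : Fin 3 → IntegralElement (s + 1) B → ℝ),
      IsOpen O ∧ z ∈ O ∧ IsIntegralFrameOn Wh G O ∧ IsIntegralFrameOn Wc G' O ∧
      ∀ y ∈ O, IsPulledBackAt (E' := E' × ℝ × ℝ) (prolongMap hI hp) Wh Wc y := by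
  set P : IntegralElement (s + 1) B → IntegralElement s I := prolongMap hI hp with hP
  have hsurj : ∀ y, Function.Surjective (tmap P y : (E × ℝ × ℝ) →L[ℝ] E' × ℝ × ℝ) := fun y =>
    surjective_tmap_prolongMap hI hp hd y
  have hdom : IsOpen (κ.dom i j) := AdaptedCoframe.isOpen_dom isOpen_univ
  have hdom' : IsOpen (κ.swap.dom j i) := AdaptedCoframe.isOpen_dom isOpen_univ
  obtain ⟨O₁, h1, hO₁, hzO₁⟩ := mem_nhds_iff.1 (hh.and hc)
  have hO : IsOpen (O₁ ∩ P ⁻¹' κ.dom i j) :=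
    hO₁.inter (hdom.preimage (continuous_prolongMap hI hp hd))
  have heh : ∀ y ∈ O₁ ∩ P ⁻¹' κ.dom i j, firstIntegrals Wh y = pullCov P y (Submodule.span ℝ
      (range fun k => (tmap (κ.charFun H i k) (P y) : (E' × ℝ × ℝ) →L[ℝ] ℝ))) := fun y hy =>
    firstIntegrals_eq hI hp hJ hd isOpen_univ hκ hy.2
      (Filter.eventually_of_mem (hO₁.mem_nhds hy.1) fun x hx => (h1 hx).1)
      fun W κ' hW hyW _ => hN y.pt W κ' hW hyW
  have hec : ∀ y ∈ O₁ ∩ P ⁻¹' κ.dom i j, firstIntegrals Wc y = pullCov P y (Submodule.span ℝ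
      (range fun k => (tmap (κ.swap.charFun C j k) (P y) : (E' × ℝ × ℝ) →L[ℝ] ℝ))) := fun y hy =>
    firstIntegrals_eq hI hp hJ hd isOpen_univ hκ.swap (AdaptedCoframe.mem_dom_swap.2 hy.2)
      (Filter.eventually_of_mem (hO₁.mem_nhds hy.1) fun x hx => (h1 hx).2)
      fun W κ' hW hyW _ => hN y.pt W κ' hW hyW
  have frame : ∀ (V : IntegralElement (s + 1) B → Submodule ℝ ((E × ℝ × ℝ) →L[ℝ] ℝ))
      (g : Fin 3 → IntegralElement s I → ℝ),
      (∀ k, ContMDiffOn 𝓘(ℝ, E' × ℝ × ℝ) 𝓘(ℝ, ℝ) ∞ (g k) (κ.dom i j)) →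
      (∀ y ∈ κ.dom i j, LinearIndependent ℝ fun k => (tmap (g k) y : (E' × ℝ × ℝ) →L[ℝ] ℝ)) →
      (∀ y ∈ O₁ ∩ P ⁻¹' κ.dom i j, firstIntegrals V y = pullCov P y (Submodule.span ℝ
        (range fun k => (tmap (g k) (P y) : (E' × ℝ × ℝ) →L[ℝ] ℝ)))) →
      IsIntegralFrameOn V (fun k y => g k (P y)) (O₁ ∩ P ⁻¹' κ.dom i j) := by
    intro V g hg hli he
    have ht : ∀ y ∈ O₁ ∩ P ⁻¹' κ.dom i j, ∀ k, (tmap (fun y => g k (P y)) y :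
        (E × ℝ × ℝ) →L[ℝ] ℝ) = (tmap (g k) (P y) : (E' × ℝ × ℝ) →L[ℝ] ℝ).comp (tmap P y) :=
      fun y hy k => tmap_comp ((hg k).contMDiffAt (hdom.mem_nhds hy.2)).mdiff
        (smoothAt_prolongMap hI hp hd y).mdiff
    refine ⟨fun k => (hg k).comp (smooth_prolongMap hI hp hd _) fun y hy => hy.2,
      fun y hy => ?_, fun y hy => ?_⟩
    · simp only [ht y hy]
      rw [Fintype.linearIndependent_iff]
      intro a ha
      refine Fintype.linearIndependent_iff.1 (hli _ hy.2) a (ContinuousLinearMap.ext fun v => ?_)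
      obtain ⟨w, rfl⟩ := hsurj y v
      have := DFunLike.congr_fun ha w
      simp only [sum_apply, smul_apply] at this ⊢
      exact this
    · simp only [ht y hy]
      rw [he y hy, pullCov_span_range]
  refine ⟨_, _, _, hO, ⟨hzO₁, hz⟩,
    frame Wh _ (hκ.smooth_charFun isOpen_univ)
      (fun y hy => hκ.linearIndependent_charFun isOpen_univ hy) heh,
    frame Wc _ (fun k => (hκ.swap.smooth_charFun (j := i) isOpen_univ k).mono
      fun y hy => AdaptedCoframe.mem_dom_swap.2 hy)
      (fun y hy => hκ.swap.linearIndependent_charFun isOpen_univ (AdaptedCoframe.mem_dom_swap.2 hy))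
      hec, fun y hy => ⟨?_, ?_, ?_, ?_, ?_⟩⟩
  · rw [heh y hy]
    exact pullCov_le_semibasic _
  · rw [hec y hy]
    exact pullCov_le_semibasic _
  · rw [hec y hy, (h1 hy.1).1, sup_assoc, ← pullCov_sup, hκ.charSys_sup isOpen_univ hy.2]
    exact (prolong_admissible hI hp hd hJ).sup_semibasic (mem_univ _) (hsurj y) (finrank_prod_eq hd)
  · have h2 := hκ.swap.charSys_sup isOpen_univ (AdaptedCoframe.mem_dom_swap.2 hy.2)
    rw [heh y hy, (h1 hy.1).2, sup_assoc, ← pullCov_sup]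
    refine Eq.trans (congrArg _ (congrArg _ h2)) ?_
    exact (prolong_admissible hI hp hd hJ).sup_semibasic (mem_univ _) (hsurj y) (finrank_prod_eq hd)
  · rw [heh y hy, hec y hy, eq_bot_iff]
    refine (pullCov_inf_le (hsurj y)).trans ?_
    rw [hκ.inf_charFun isOpen_univ hy.2]
    intro α hα
    obtain ⟨β, hβ, rfl⟩ := mem_pullCov.1 hα
    rw [(Submodule.mem_bot ℝ).1 hβ]
    exact Submodule.zero_mem _

include hJ hd in
/-- The first integrals of the singular systems of the prolongation of an extension. -/
theorem exists_frames (hN : AtMostTwoIntegrals (s + 1) B) (hκ : κ.IsExact H C)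
    {Wh Wc : IntegralElement (s + 1) B → Submodule ℝ ((E × ℝ × ℝ) →L[ℝ] ℝ)}
    {O : Set (IntegralElement (s + 1) B)}
    (hW : IsSingularPairOn (s + 2 + 1) (prolong (s + 1) B) Wh Wc O)
    {z : IntegralElement (s + 1) B} (hz : z ∈ O) :
    ∃ (O : Set (IntegralElement (s + 1) B)) (G G' : Fin 3 → IntegralElement (s + 1) B → ℝ),
      IsOpen O ∧ z ∈ O ∧ IsIntegralFrameOn Wh G O ∧ IsIntegralFrameOn Wc G' O ∧
      ∀ y ∈ O, IsPulledBackAt (E' := E' × ℝ × ℝ) (prolongMap hI hp) Wh Wc y := by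
  obtain ⟨i, j, hij⟩ := κ.exists_dom (z := prolongMap hI hp z) (mem_univ _)
  obtain ⟨T, hT, hzT, κT, hκT⟩ := hW z hz
  have hdom : IsOpen (κ.dom i j) := AdaptedCoframe.isOpen_dom isOpen_univ
  obtain ⟨V, hV, hzV, -, κV, hl, -⟩ := (prolong_admissible hI hp hd hJ).exists_coframe
    (fun y _ => surjective_tmap_prolongMap hI hp hd y) (finrank_prod_eq hd)
    (smooth_prolongMap hI hp hd _) hdom (hκ.prolongCoframe isOpen_univ i j) (mem_univ z) hij
  -- The given pair agrees near `z` with the lifted pair in one of the two orders; the interchange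
  -- is absorbed by passing to `κ.swap`.
  rcases κV.eventually_eq_or_swap κT hV hT hzV hzT with h | h
  · refine exists_frames_of_eq hI hp hJ hd hN hκ hij ?_ ?_
    · filter_upwards [h, hT.mem_nhds hzT, hV.mem_nhds hzV] with y h1 h2 h3
      rw [(hκT y h2).1, ← hκ.Vh_prolongCoframe isOpen_univ (hl.mapsTo h3), ← hl.Vh y h3]
      exact h1.1
    · filter_upwards [h, hT.mem_nhds hzT, hV.mem_nhds hzV] with y h1 h2 h3
      rw [(hκT y h2).2, ← hκ.Vc_prolongCoframe isOpen_univ (hl.mapsTo h3), ← hl.Vc y h3]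
      exact h1.2
  · refine exists_frames_of_eq hI hp hJ hd hN hκ.swap (AdaptedCoframe.mem_dom_swap.2 hij) ?_ ?_
    · filter_upwards [h, hT.mem_nhds hzT, hV.mem_nhds hzV] with y h1 h2 h3
      rw [(hκT y h2).1, ← hκ.Vc_prolongCoframe isOpen_univ (hl.mapsTo h3), ← hl.Vc y h3]
      exact h1.1
    · filter_upwards [h, hT.mem_nhds hzT, hV.mem_nhds hzV] with y h1 h2 h3
      change Wc y = liftJ (s + 1) B J y ⊔ pullCov _ y (κ.charSys _)
      rw [(hκT y h2).2, ← hκ.Vh_prolongCoframe isOpen_univ (hl.mapsTo h3), ← hl.Vh y h3]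
      exact h1.2

theorem isEDSOn_prolong (hκ : κ.IsExact H C) : IsEDSOn (prolong s I) univ := by
  refine isEDSOn_of_coframes (s := s + 2) isOpen_univ fun z _ => ?_
  obtain ⟨i, j, hij⟩ := κ.exists_dom (z := z) (mem_univ _)
  exact ⟨_, AdaptedCoframe.isOpen_dom isOpen_univ, hij, hκ.prolongCoframe isOpen_univ i j,
    hκ.isClosed_prolongCoframe isOpen_univ⟩

include hI hp hJ hd in
-- The lifted coframe is closed: the pulled-back generators are closed downstairs, and the
-- derivative of a section of the lifted `J` belongs to the Pfaffian system by definition.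
theorem isEDSOn_prolong_extension (hκ : κ.IsExact H C) : IsEDSOn (prolong (s + 1) B) univ := by
  refine isEDSOn_of_coframes (s := s + 2 + 1) isOpen_univ fun z _ => ?_
  obtain ⟨i, j, hij⟩ := κ.exists_dom (z := prolongMap hI hp z) (mem_univ _)
  obtain ⟨V, hV, hzV, -, κV, -, hcl⟩ := (prolong_admissible hI hp hd hJ).exists_coframe
    (fun y _ => surjective_tmap_prolongMap hI hp hd y) (finrank_prod_eq hd)
    (smooth_prolongMap hI hp hd _) (AdaptedCoframe.isOpen_dom isOpen_univ)
    (hκ.prolongCoframe isOpen_univ i j) (mem_univ z) hij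
  refine ⟨V, hV, hzV, κV, hcl (hκ.isClosed_prolongCoframe isOpen_univ) ?_⟩
  intro α W hW _ hα hαJ y hy
  exact subset_algIdeal _ 2 (Or.inr ⟨α, W, hW, hy, hα, fun x hx => liftJ_le hJ x (hαJ x hx), rfl⟩)

theorem isSingularPairOn_prolong (hκ : κ.IsExact H C) :
    IsSingularPairOn (s + 2) (prolong s I) κ.charSys κ.swap.charSys univ := by
  intro z _
  obtain ⟨i, j, hij⟩ := κ.exists_dom (z := z) (mem_univ _)
  exact ⟨_, AdaptedCoframe.isOpen_dom isOpen_univ, hij, hκ.prolongCoframe isOpen_univ i j,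
    fun y hy => ⟨(hκ.Vh_prolongCoframe isOpen_univ hy).symm,
      (hκ.Vc_prolongCoframe isOpen_univ hy).symm⟩⟩

include hJ hd in
-- The count is made upstairs. A first integral downstairs pulls back to one upstairs, where
-- `firstIntegrals_eq` identifies it, and pullback by a submersion is injective on covectors.
theorem firstIntegrals_charSys (hN : AtMostTwoIntegrals (s + 1) B) (hκ : κ.IsExact H C)
    {z : IntegralElement (s + 1) B} (hz : prolongMap hI hp z ∈ κ.dom i j) :
    firstIntegrals κ.charSys (prolongMap hI hp z) = Submodule.span ℝ (range fun k =>
      (tmap (κ.charFun H i k) (prolongMap hI hp z) : (E' × ℝ × ℝ) →L[ℝ] ℝ)) := by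
  refine le_antisymm ?_ (Submodule.span_le.2 ?_)
  · refine le_of_pullCov_le (surjective_tmap_prolongMap hI hp hd z) ?_
    rw [← firstIntegrals_eq hI hp hJ hd isOpen_univ hκ hz
      (V := fun y => liftJ (s + 1) B J y ⊔ pullCov (prolongMap hI hp) y
        (κ.charSys (prolongMap hI hp y))) (Filter.Eventually.of_forall fun _ => rfl)
      fun W κ' hW hyW _ => hN z.pt W κ' hW hyW]
    exact pullCov_firstIntegrals_le isOpen_univ (mem_univ z) (smooth_prolongMap hI hp hd _)
      fun y _ => le_sup_right
  · rintro _ ⟨k, rfl⟩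
    exact mem_firstIntegrals (AdaptedCoframe.isOpen_dom isOpen_univ) hz
      (hκ.smooth_charFun isOpen_univ k) fun y hy => hκ.tmap_charFun_mem isOpen_univ hy k

include hJ hd in
-- Only the image of `R` is considered, because the count in `firstIntegrals_charSys` uses a point
-- upstairs.
theorem darbouxIntegrableOn_base (hN : AtMostTwoIntegrals (s + 1) B) (hκ : κ.IsExact H C)
    {R : Set (IntegralElement (s + 1) B)} (hR : IsOpen R) :
    DarbouxIntegrableOn (s + 2) (prolong s I) κ.charSys κ.swap.charSys (prolongMap hI hp '' R) := by
  have hdom : ∀ z : IntegralElement (s + 1) B, ∃ i j, prolongMap hI hp z ∈ κ.dom i j := fun z => κ.exists_dom (mem_univ _)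
  have hf : ∀ (z : IntegralElement (s + 1) B) (i j : Fin 2), prolongMap hI hp z ∈ κ.dom i j →
      firstIntegrals κ.swap.charSys (prolongMap hI hp z) = Submodule.span ℝ (range fun k =>
        (tmap (κ.swap.charFun C j k) (prolongMap hI hp z) : (E' × ℝ × ℝ) →L[ℝ] ℝ)) :=
    fun z i j hz => firstIntegrals_charSys hI hp hJ hd hN hκ.swap (AdaptedCoframe.mem_dom_swap.2 hz)
  refine ⟨(isEDSOn_prolong hκ).mono (isOpen_image_of_surjective (finrank_prod_eq hd) hR
    (smooth_prolongMap hI hp hd _) fun z _ => surjective_tmap_prolongMap hI hp hd z)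
    (subset_univ _), fun z _ => isSingularPairOn_prolong hκ z (mem_univ _), ⟨3, ?_⟩, ⟨3, ?_⟩,
    ?_, ?_, ?_⟩
  all_goals
    rintro _ ⟨z, -, rfl⟩
    obtain ⟨i, j, hz⟩ := hdom z
  · rw [firstIntegrals_charSys hI hp hJ hd hN hκ hz,
      finrank_span_eq_card (hκ.linearIndependent_charFun isOpen_univ hz), Fintype.card_fin]
  · rw [hf z i j hz, finrank_span_eq_card (hκ.swap.linearIndependent_charFun isOpen_univ
      (AdaptedCoframe.mem_dom_swap.2 hz)), Fintype.card_fin]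
  · rw [hf z i j hz]
    exact hκ.charSys_sup isOpen_univ hz
  · rw [firstIntegrals_charSys hI hp hJ hd hN hκ hz]
    exact hκ.swap.charSys_sup isOpen_univ (AdaptedCoframe.mem_dom_swap.2 hz)
  · rw [firstIntegrals_charSys hI hp hJ hd hN hκ hz, hf z i j hz]
    exact hκ.inf_charFun isOpen_univ hz

include hI hp hJ hd in
/-- Every pair of singular systems of the prolongation of an extension is Darboux integrable. -/
theorem darbouxIntegrableOn_top (hN : AtMostTwoIntegrals (s + 1) B) (hκ : κ.IsExact H C)
    {Wh Wc : IntegralElement (s + 1) B → Submodule ℝ ((E × ℝ × ℝ) →L[ℝ] ℝ)}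
    {R : Set (IntegralElement (s + 1) B)} (hR : IsOpen R)
    (hW : IsSingularPairOn (s + 2 + 1) (prolong (s + 1) B) Wh Wc R) :
    DarbouxIntegrableOn (s + 2 + 1) (prolong (s + 1) B) Wh Wc R := by
  have key : ∀ z ∈ R, finrank ℝ (firstIntegrals Wh z) = 3 ∧ finrank ℝ (firstIntegrals Wc z) = 3 ∧
      IsPulledBackAt (E' := E' × ℝ × ℝ) (prolongMap hI hp) Wh Wc z := by
    intro z hz
    obtain ⟨O, G, G', -, hzO, h1, h2, h3⟩ := exists_frames hI hp hJ hd hN hκ hW hz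
    exact ⟨h1.finrank_eq hzO, h2.finrank_eq hzO, h3 z hzO⟩
  exact ⟨(isEDSOn_prolong_extension hI hp hJ hd hκ).mono hR (subset_univ _), hW,
    ⟨3, fun z hz => (key z hz).1⟩, ⟨3, fun z hz => (key z hz).2.1⟩,
    fun z hz => (key z hz).2.2.sup_h, fun z hz => (key z hz).2.2.sup_c,
    fun z hz => (key z hz).2.2.inf⟩

end Frames

/-! ### The open dense set of maximal compatibility -/

section Compatibility

variable {E : Type*} [NormedAddCommGroup E] [NormedSpace ℝ E] [FiniteDimensional ℝ E]
  {E' : Type*} [NormedAddCommGroup E'] [NormedSpace ℝ E'] [FiniteDimensional ℝ E']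
  {M : Type*} [TopologicalSpace M] [ChartedSpace E M] [IsManifold 𝓘(ℝ, E) ∞ M]
  {M' : Type*} [TopologicalSpace M'] [ChartedSpace E' M'] [IsManifold 𝓘(ℝ, E') ∞ M']
  {p : M → M'} {B : FormFamily E M} {I : FormFamily E' M'} {R : Set M}

/-- At such a point some function of the frame is transverse to the fibre, and it stays so nearby by
`eventually_bijective`. -/
theorem isOpen_not_semibasic (hd : finrank ℝ E = finrank ℝ E' + 1) (hR : IsOpen R)
    (hp : ContMDiffOn 𝓘(ℝ, E) 𝓘(ℝ, E') ∞ p R)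
    (hs : ∀ x ∈ R, Function.Surjective (tmap p x : E →L[ℝ] E'))
    {Z : M → Submodule ℝ (E →L[ℝ] ℝ)} {r : ℕ}
    (hF : ∀ z ∈ R, ∃ (O : Set M) (G : Fin r → M → ℝ), IsOpen O ∧ z ∈ O ∧ IsIntegralFrameOn Z G O) :
    IsOpen {z | z ∈ R ∧ ¬ firstIntegrals Z z ≤ semibasic E' p z} := by
  rw [isOpen_iff_mem_nhds]
  rintro z ⟨hz, hne⟩
  obtain ⟨O, G, hO, hzO, hG⟩ := hF z hz
  have hex : ∃ k, (tmap (G k) z : E →L[ℝ] ℝ) ∉ semibasic E' p z := by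
    by_contra hc
    push Not at hc
    refine hne ?_
    rw [hG.eq z hzO, Submodule.span_le]
    rintro _ ⟨k, rfl⟩
    exact hc k
  obtain ⟨k, hk⟩ := hex
  filter_upwards [eventually_bijective (hR.inter hO) (hp.mono inter_subset_left)
    ((hG.smooth k).mono inter_subset_right) ⟨hz, hzO⟩
    (bijective_prod_of_not_semibasic (hs z hz) hd hk), hR.mem_nhds hz, hO.mem_nhds hzO]
    with y hy hyR hyO
  refine ⟨hyR, fun hle => ?_⟩
  obtain ⟨v, hv, hv0, -⟩ := exists_vertical (hs y hyR) hd
  have h1 : (tmap (G k) y : E →L[ℝ] ℝ) ∈ semibasic E' p y := by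
    refine hle ?_
    rw [hG.eq y hyO]
    exact Submodule.subset_span ⟨k, rfl⟩
  refine hv0 (hy.1 ?_)
  simp only [hv, h1 v hv, map_zero]

/-- If all first integrals were semibasic on an open set, `sup_inf_semibasic` would place the frame
in the pullback of `V`. Its `r` functions would descend to `r` independent first integrals of `V`,
more than there are. -/
theorem exists_not_semibasic (hd : finrank ℝ E = finrank ℝ E' + 1) (hR : IsOpen R)
    (hp : ContMDiffOn 𝓘(ℝ, E) 𝓘(ℝ, E') ∞ p R)
    (hs : ∀ x ∈ R, Function.Surjective (tmap p x : E →L[ℝ] E'))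
    {J : M → Submodule ℝ (E →L[ℝ] ℝ)} (hJ : IsAdmissibleOn p B I J R)
    {V : M' → Submodule ℝ (E' →L[ℝ] ℝ)} {Z : M → Submodule ℝ (E →L[ℝ] ℝ)}
    (hZ : ∀ z ∈ R, Z z = J z ⊔ pullCov p z (V (p z))) {r : ℕ}
    (hr : ∀ z ∈ R, finrank ℝ (firstIntegrals V (p z)) < r)
    (hF : ∀ z ∈ R, ∃ (O : Set M) (G : Fin r → M → ℝ), IsOpen O ∧ z ∈ O ∧ IsIntegralFrameOn Z G O)
    {z : M} (hz : z ∈ R) {T : Set M} (hT : IsOpen T) (hzT : z ∈ T) :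
    ∃ y ∈ T, y ∈ R ∧ ¬ firstIntegrals Z y ≤ semibasic E' p y := by
  by_contra hc
  push Not at hc
  obtain ⟨O, G, hO, hzO, hG⟩ := hF z hz
  have hle := le_finrank_of_pullCov (V := V) (f := G) ((hR.inter hT).inter hO)
    (hp.mono fun y hy => hy.1.1) ⟨⟨hz, hzT⟩, hzO⟩ (hs z hz) hd
    (fun k => (hG.smooth k).mono inter_subset_right) (fun y hy k => by
      have h1 : (tmap (G k) y : E →L[ℝ] ℝ) ∈ firstIntegrals Z y := by
        rw [hG.eq y hy.2]
        exact Submodule.subset_span ⟨k, rfl⟩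
      refine hJ.sup_inf_semibasic hy.1.1 _ ⟨?_, hc y hy.1.2 hy.1.1 h1⟩
      rw [← hZ y hy.1.1]
      exact firstIntegrals_le h1) (hG.li z hzO)
  exact absurd (hr z hz) (not_lt.2 hle)

/-- An extension for which the first integrals of both singular systems have rank three over a base
with ranks two is maximally compatible on an open dense subset. -/
theorem IsDarbouxExtensionOn.maximallyCompatible (hd : finrank ℝ E = finrank ℝ E' + 1)
    (hR : IsOpen R) {sB sI : ℕ} {Zh Zc : M → Submodule ℝ (E →L[ℝ] ℝ)}
    {Vh Vc : M' → Submodule ℝ (E' →L[ℝ] ℝ)}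
    (h : IsDarbouxExtensionOn sB sI p B I Zh Zc Vh Vc R)
    (hFh : ∀ z ∈ R, ∃ (O : Set M) (G : Fin 3 → M → ℝ), IsOpen O ∧ z ∈ O ∧ IsIntegralFrameOn Zh G O)
    (hFc : ∀ z ∈ R, ∃ (O : Set M) (G : Fin 3 → M → ℝ), IsOpen O ∧ z ∈ O ∧ IsIntegralFrameOn Zc G O)
    (hrh : ∀ z ∈ R, finrank ℝ (firstIntegrals Vh (p z)) = 2)
    (hrc : ∀ z ∈ R, finrank ℝ (firstIntegrals Vc (p z)) = 2) :
    IsOpen (semibasicRankTwo E' p Zh Zc R) ∧ R ⊆ closure (semibasicRankTwo E' p Zh Zc R) ∧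
      MaximallyCompatibleOn sB sI p B I Zh Zc Vh Vc (semibasicRankTwo E' p Zh Zc R) := by
  have hp := h.extension.smooth
  have hs := h.extension.submersion
  obtain ⟨J, hJ, hZ⟩ := h.singular
  have h3 : ∀ Z : M → Submodule ℝ (E →L[ℝ] ℝ), (∀ z ∈ R, ∃ (O : Set M) (G : Fin 3 → M → ℝ),
      IsOpen O ∧ z ∈ O ∧ IsIntegralFrameOn Z G O) → ∀ z ∈ R,
        finrank ℝ (firstIntegrals Z z) = 3 := by
    intro Z hF z hz
    obtain ⟨O, G, -, hzO, hG⟩ := hF z hz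
    exact hG.finrank_eq hzO
  -- The semibasic covectors form a hyperplane, so they meet a space of dimension three in dimension
  -- two, or else contain it.
  have hiff : ∀ Z : M → Submodule ℝ (E →L[ℝ] ℝ), (∀ z ∈ R, finrank ℝ (firstIntegrals Z z) = 3) →
      ∀ z ∈ R, (finrank ℝ (firstIntegrals Z z ⊓ semibasic E' p z : Submodule ℝ (E →L[ℝ] ℝ)) = 2 ↔
        ¬ firstIntegrals Z z ≤ semibasic E' p z) := by
    intro Z hZ z hz
    constructor
    · intro h2 hle
      rw [inf_eq_left.2 hle, hZ z hz] at h2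
      omega
    · intro hne
      have := finrank_inf_semibasic (hs z hz) hd hne
      rw [hZ z hz] at this
      omega
  have hset : semibasicRankTwo E' p Zh Zc R =
      {z | z ∈ R ∧ ¬ firstIntegrals Zh z ≤ semibasic E' p z} ∩
      {z | z ∈ R ∧ ¬ firstIntegrals Zc z ≤ semibasic E' p z} := by
    ext z
    constructor
    · rintro ⟨hz, h1, h2⟩
      exact ⟨⟨hz, (hiff Zh (h3 Zh hFh) z hz).1 h1⟩, hz, (hiff Zc (h3 Zc hFc) z hz).1 h2⟩
    · rintro ⟨⟨hz, h1⟩, -, h2⟩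
      exact ⟨hz, (hiff Zh (h3 Zh hFh) z hz).2 h1, (hiff Zc (h3 Zc hFc) z hz).2 h2⟩
  have hoh := isOpen_not_semibasic hd hR hp hs hFh
  have hoc := isOpen_not_semibasic hd hR hp hs hFc
  have hopen : IsOpen (semibasicRankTwo E' p Zh Zc R) := hset ▸ hoh.inter hoc
  have hsub : semibasicRankTwo E' p Zh Zc R ⊆ R := fun z hz => hz.1
  have hns : ∀ z ∈ semibasicRankTwo E' p Zh Zc R, ¬ firstIntegrals Zh z ≤ semibasic E' p z ∧
      ¬ firstIntegrals Zc z ≤ semibasic E' p z := fun z hz => by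
    rw [hset] at hz
    exact ⟨hz.1.2, hz.2.2⟩
  refine ⟨hopen, fun z hz => mem_closure_iff.2 fun T hT hzT => ?_,
    ⟨h.mono hd hopen hsub, fun z hz => ?_, fun z hz => ?_, fun z hz => ?_, fun z hz => ?_⟩⟩
  -- Density of the intersection: a point good for `Zh` is found in `T`; as this condition is open,
  -- a point good for `Zc` can be found without leaving it.
  · obtain ⟨y, hyT, hy⟩ := exists_not_semibasic hd hR hp hs hJ (V := Vh) (fun z hz => (hZ z hz).2.1)
      (fun z hz => by rw [hrh z hz]; omega) hFh hz hT hzT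
    obtain ⟨w, hw, hw'⟩ := exists_not_semibasic hd hR hp hs hJ (V := Vc)
      (fun z hz => (hZ z hz).2.2.2) (fun z hz => by rw [hrc z hz]; omega) hFc hy.1
      (hT.inter hoh) ⟨hyT, hy⟩
    exact ⟨w, hw.1, hset ▸ ⟨hw.2, hw'⟩⟩
  · exact (vertical_inf_annih (hs z (hsub hz)) hd).2 (hns z hz).1
  · exact (vertical_inf_annih (hs z (hsub hz)) hd).2 (hns z hz).2
  · rw [h3 Zh hFh z (hsub hz), finrank_vertical (hs z (hsub hz)) hd, hrh z (hsub hz)]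
  · rw [h3 Zc hFc z (hsub hz), finrank_vertical (hs z (hsub hz)) hd, hrc z (hsub hz)]

end Compatibility

/-! ### Extensions of Darboux integrable systems by prolongation -/

section ProlongedExtension

variable {E : Type*} [NormedAddCommGroup E] [NormedSpace ℝ E] [FiniteDimensional ℝ E]
  {E' : Type*} [NormedAddCommGroup E'] [NormedSpace ℝ E'] [FiniteDimensional ℝ E']
  {M : Type*} [TopologicalSpace M] [ChartedSpace E M] [IsManifold 𝓘(ℝ, E) ∞ M]
  {M' : Type*} [TopologicalSpace M'] [ChartedSpace E' M'] [IsManifold 𝓘(ℝ, E') ∞ M']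
  {p : M → M'} {s : ℕ} {B : FormFamily E M} {I : FormFamily E' M'}

/-- The prolongation of an extension is an extension of Darboux integrable systems as soon as its
total space and its base are Darboux integrable. -/
theorem exists_isDarbouxExtensionOn (hI : IsHyperbolicOn s I univ)
    (hp : IsIntegrableExtensionOn p B I univ) (hd : finrank ℝ E = finrank ℝ E' + 1)
    {R : Set (IntegralElement (s + 1) B)} (hR : IsOpen R)
    {Vh Vc : IntegralElement s I → Submodule ℝ ((E' × ℝ × ℝ) →L[ℝ] ℝ)}
    (hV : DarbouxIntegrableOn (s + 2) (prolong s I) Vh Vc (prolongMap hI hp '' R))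
    (hW : ∀ Wh Wc, IsSingularPairOn (s + 2 + 1) (prolong (s + 1) B) Wh Wc R →
      DarbouxIntegrableOn (s + 2 + 1) (prolong (s + 1) B) Wh Wc R) :
    ∃ Wh Wc, IsDarbouxExtensionOn (s + 2 + 1) (s + 2) (prolongMap hI hp) (prolong (s + 1) B)
      (prolong s I) Wh Wc Vh Vc R := by
  obtain ⟨J, hJ⟩ := hp.admissible
  have hJ' := (prolong_admissible hI hp hd hJ).mono hR (subset_univ R)
  have hs : ∀ z ∈ R, Function.Surjective
      (tmap (prolongMap hI hp) z : (E × ℝ × ℝ) →L[ℝ] E' × ℝ × ℝ) :=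
    fun z _ => surjective_tmap_prolongMap hI hp hd z
  have htop := hW _ _ (hJ'.isSingularPairOn hs (finrank_prod_eq hd) (smooth_prolongMap hI hp hd R)
    hV.singular (mapsTo_image _ _))
  exact ⟨_, _, ⟨htop.eds, hV.eds, smooth_prolongMap hI hp hd R, hs, _, hJ'⟩, htop, hV, _, hJ',
    fun z hz => ⟨hJ'.disjoint hz _, rfl, hJ'.disjoint hz _, rfl⟩⟩

end ProlongedExtension

end

end Darboux

/-! ### The theorem -/

theorem mainTheorem3
    {N N₂ : Type*}
    -- a 6-manifold `N` and a 5-manifold `N₂`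
    [TopologicalSpace N] [T2Space N] [SecondCountableTopology N]
    [ChartedSpace (EuclideanSpace ℝ (Fin 6)) N] [IsManifold 𝓘(ℝ, EuclideanSpace ℝ (Fin 6)) ∞ N]
    [TopologicalSpace N₂] [T2Space N₂] [SecondCountableTopology N₂]
    [ChartedSpace (EuclideanSpace ℝ (Fin 5)) N₂] [IsManifold 𝓘(ℝ, EuclideanSpace ℝ (Fin 5)) ∞ N₂]
    (B : FormFamily (EuclideanSpace ℝ (Fin 6)) N) (I₂ : FormFamily (EuclideanSpace ℝ (Fin 5)) N₂)
    -- `I₂` is a hyperbolic Monge-Ampère system with singular systems `V₂h`, `V₂c`, each with one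
    -- independent first integral
    (hI₂ : IsHyperbolicMongeAmpere I₂)
    (V₂h V₂c : N₂ → Submodule ℝ (EuclideanSpace ℝ (Fin 5) →L[ℝ] ℝ))
    (hV₂ : IsSingularPairOn 1 I₂ V₂h V₂c univ)
    (hrank₂h : ∀ x, finrank ℝ (firstIntegrals V₂h x) = 1)
    (hrank₂c : ∀ x, finrank ℝ (firstIntegrals V₂c x) = 1)
    -- `B` is a Bäcklund transformation between the wave equation and `I₂`
    (p₁ : N → J1) (p₂ : N → N₂)
    (hp₁ : IsIntegrableExtensionOn p₁ B wave univ) (hp₂ : IsIntegrableExtensionOn p₂ B I₂ univ)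
    -- the space `N₂^[1]` of regular integral elements of `I₂`, on which the prolongation `I₂^[1]` is
    -- Darboux integrable with singular systems `V₂h'`, `V₂c'`, each with two independent integrals
    (R₂ : Set (IntegralElement 1 I₂)) (hR₂ : IsOpen R₂)
    (V₂h' V₂c' : IntegralElement 1 I₂ →
      Submodule ℝ ((EuclideanSpace ℝ (Fin 5) × ℝ × ℝ) →L[ℝ] ℝ))
    (hI₂' : DarbouxIntegrableOn 3 (prolong 1 I₂) V₂h' V₂c' R₂)
    (hrank₂h' : ∀ z ∈ R₂, finrank ℝ (firstIntegrals V₂h' z) = 2)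
    (hrank₂c' : ∀ z ∈ R₂, finrank ℝ (firstIntegrals V₂c' z) = 2)
    -- the space `N^[1]` of regular integral elements of `B`
    (R : Set (IntegralElement 2 B)) (hR : IsOpen R)
    (hRR₂ : MapsTo (prolongMap hI₂.hyperbolic hp₂) R R₂) :
    -- `B` is hyperbolic of class two
    IsHyperbolicOn 2 B univ ∧
    -- `p₂^[1] : (B^[1], N^[1]) → (I₂^[1], N₂^[1])` is an integrable extension of Darboux integrable
    -- systems
    (∃ Wh Wc, IsDarbouxExtensionOn 4 3 (prolongMap hI₂.hyperbolic hp₂) (prolong 2 B) (prolong 1 I₂)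
      Wh Wc V₂h' V₂c' R) ∧
    -- the set `Ñ` is open and dense in `N^[1]`, and over it the extension is maximally compatible
    (∀ Wh Wc, IsDarbouxExtensionOn 4 3 (prolongMap hI₂.hyperbolic hp₂) (prolong 2 B) (prolong 1 I₂)
        Wh Wc V₂h' V₂c' R →
      IsOpen (semibasicRankTwo (EuclideanSpace ℝ (Fin 5) × ℝ × ℝ)
        (prolongMap hI₂.hyperbolic hp₂) Wh Wc R) ∧
      R ⊆ closure (semibasicRankTwo (EuclideanSpace ℝ (Fin 5) × ℝ × ℝ)
        (prolongMap hI₂.hyperbolic hp₂) Wh Wc R) ∧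
      MaximallyCompatibleOn 4 3 (prolongMap hI₂.hyperbolic hp₂) (prolong 2 B) (prolong 1 I₂)
        Wh Wc V₂h' V₂c' (semibasicRankTwo (EuclideanSpace ℝ (Fin 5) × ℝ × ℝ)
          (prolongMap hI₂.hyperbolic hp₂) Wh Wc R)) ∧
    -- `p₁^[1] : (B^[1], N^[1]) → (I₁^[1], N₁^[1])` is an integrable extension of Darboux integrable
    -- systems, but over no non-empty open subset of `N^[1]` is it maximally compatible
    (∃ Wh Wc V₁h V₁c, IsDarbouxExtensionOn 4 3 (prolongMap wave_hyperbolic hp₁) (prolong 2 B)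
      (prolong 1 wave) Wh Wc V₁h V₁c R) ∧
    (∀ Wh Wc V₁h V₁c, ∀ U ⊆ R, IsOpen U → U.Nonempty →
      ¬ MaximallyCompatibleOn 4 3 (prolongMap wave_hyperbolic hp₁) (prolong 2 B)
        (prolong 1 wave) Wh Wc V₁h V₁c U) := by
  have hd₁ : finrank ℝ (EuclideanSpace ℝ (Fin 6)) = finrank ℝ J1 + 1 := by simp
  have hd₂ : finrank ℝ (EuclideanSpace ℝ (Fin 6)) = finrank ℝ (EuclideanSpace ℝ (Fin 5)) + 1 := by
    simp
  obtain ⟨J₁, hJ₁⟩ := hp₁.admissible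
  obtain ⟨J₂, hJ₂⟩ := hp₂.admissible
  have hκ := isExact_waveCoframe
  -- The upper bound comes from the extension `p₂`: one first integral below and one more for the
  -- fibre. All that follows about first integrals of the prolonged `B` combines it with the exact
  -- coframe supplied by `p₁`.
  have hN : AtMostTwoIntegrals (1 + 1) B := fun x W κ' hW hx f hf hfV =>
    not_linearIndependent_firstIntegrals hJ₂ (fun y => hp₂.submersion y (mem_univ y)) hd₂ hp₂.smooth
      hV₂ hrank₂h hrank₂c hW κ' hx hW hx hf hfV
  have htop : ∀ Wh Wc, ∀ U : Set (IntegralElement 2 B), IsOpen U →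
      IsSingularPairOn 4 (prolong 2 B) Wh Wc U → DarbouxIntegrableOn 4 (prolong 2 B) Wh Wc U :=
    fun _ _ _ hU hW => darbouxIntegrableOn_top wave_hyperbolic hp₁ hJ₁ hd₁ hN hκ hU hW
  refine ⟨fun x hx => ?_, ?_, fun Wh Wc h => ?_, ?_, fun Wh Wc V₁h V₁c U _ hU hne h => ?_⟩
  · obtain ⟨W, hW, hxW, -, κ', -⟩ := hJ₁.exists_coframe hp₁.submersion hd₁ hp₁.smooth isOpen_univ
      waveCoframe hx (mem_univ _)
    exact ⟨W, hW, hxW, ⟨κ'⟩⟩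
  · exact exists_isDarbouxExtensionOn hI₂.hyperbolic hp₂ hd₂ hR
      (hI₂'.mono (isOpen_image_of_surjective (finrank_prod_eq hd₂) hR
        (smooth_prolongMap hI₂.hyperbolic hp₂ hd₂ R)
        fun z _ => surjective_tmap_prolongMap hI₂.hyperbolic hp₂ hd₂ z) hRR₂.image_subset)
      fun Wh Wc => htop Wh Wc R hR
  -- The frames of three first integrals are built with `p₁`, but they concern only the prolonged
  -- `B` and its singular pair, so they apply to the extension over `I₂`.
  · have hF := fun z (hz : z ∈ R) =>
      exists_frames wave_hyperbolic hp₁ hJ₁ hd₁ hN hκ h.darboux_top.singular hz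
    refine h.maximallyCompatible (finrank_prod_eq hd₂) hR (fun z hz => ?_) (fun z hz => ?_)
      (fun z hz => hrank₂h' _ (hRR₂ hz)) fun z hz => hrank₂c' _ (hRR₂ hz)
    · obtain ⟨O, G, -, hO, hzO, hG, -⟩ := hF z hz
      exact ⟨O, G, hO, hzO, hG⟩
    · obtain ⟨O, -, G, hO, hzO, -, hG, -⟩ := hF z hz
      exact ⟨O, G, hO, hzO, hG⟩
  · obtain ⟨Wh, Wc, h⟩ := exists_isDarbouxExtensionOn wave_hyperbolic hp₁ hd₁ hR
      (darbouxIntegrableOn_base wave_hyperbolic hp₁ hJ₁ hd₁ hN hκ hR) fun Wh Wc => htop Wh Wc R hR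
    exact ⟨Wh, Wc, _, _, h⟩
  -- Every first integral is pulled back by the prolongation of `p₁`, hence semibasic, and this
  -- contradicts [i] already for the first singular system at a single point.
  · obtain ⟨z, hz⟩ := hne
    obtain ⟨O, -, -, -, hzO, -, -, hpb⟩ := exists_frames wave_hyperbolic hp₁ hJ₁ hd₁ hN hκ
      h.darboux.darboux_top.singular hz
    exact (vertical_inf_annih (surjective_tmap_prolongMap wave_hyperbolic hp₁ hd₁ z)
      (finrank_prod_eq hd₁)).1 (h.transverse_h z hz) (hpb z hzO).semibasic_h
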